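/- Let $\mathbb K$ be a field of characteristic zero and $n\ge 1$. \emph{Graphs.} An internally connected graph has external vertices $1,\dots,n$, finitely many unlabelled internal vertices and linearly ordered edges, without double edges or simple loops; every internal vertex is at least trivalent and connected by a path to an external one, and after cutting the graph at the external vertices it is nonempty and connected. Let $\mathsf{ICG}(n)$ be the space of formal (possibly infinite) linear combinations of such graphs modulo $\Gamma^\sigma=\mathrm{sgn}(\sigma)\Gamma$ for permutations $\sigma$ of the edge order, graded by $\deg\Gamma=1-\#\text{edges}+2\#\text{internal vertices}$, with the differential $d=d_0+d_1+\cdots$ given by the sum over all admissible vertex splittings (an external vertex splits into an external and an internal one, an internal vertex into two unlabelled internal ones; the new edge is placed last), where $d_i$ creates exactly $i$ new internal loops (loops through no external vertex). Let $\mathcal F^p$ be the filtration by at least $p$ internal loops and $E_1^{p,q}=H^{p+q}(\mathrm{gr}^p\,\mathsf{ICG}(n),d_0)$. For $r\ge1$ let $Z_r=\{x\in \mathsf{ICG}(n):\deg x=0,\ dx\in\mathcal F^r\}$ and $$E_r^{0,0}=Z_r/\bigl(\{dy:\deg y=-1\}+Z_r\cap\mathcal F^1\bigr),\qquad i_r:E_r^{0,0}\to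 E_1^{0,0},\quad \overline{x_0+x_1+\cdots}\mapsto\overline{x_0},$$ where $x_p$ is the part of $x$ with exactly $p$ internal loops. Put $\mathfrak{krv}_n^{(k)}=i_{k+1}(E_{k+1}^{0,0})\subset E_1^{0,0}$. For tree series $x,y$ of degree $0$ let $[x,y]_0$ be obtained by gluing graphs at the external vertices (edges of $x$ first), splitting vertices (new edge last), and keeping the internally connected graphs without internal loops. \emph{Derivations.} Let $\mathrm{Ass}_n=\mathbb K\langle\langle x_1,\dots,x_n\rangle\rangle$, let $\mathfrak{lie}_n\subset \mathrm{Ass}_n$ be the completed free Lie algebra, and $\mathfrak{tr}_n=\mathrm{Ass}_n^+/\langle ab-ba\rangle$ with projection $\mathrm{tr}$. Let $\mathfrak{sder}_n$ be the space of tuples $u=(a_1,\dots,a_n)\in\mathfrak{lie}_n^n$ such that $a_k$ has no linear term in $x_k$ and $\sum_i[x_i,a_i]=0$; the tuple stands for the derivation $u(x_i)=[x_i,a_i]$, and the bracket is $[u,v]_k=u(b_k)-v(a_k)+[a_k,b_k]$ for $v=(b_1,\dots,b_n)$. Write $a=a_0+\sum_k(\partial_ka)x_k$, let $\mathrm{div}(a_1,\dots,a_n)=\sum_k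 \mathrm{tr}(x_k\,\partial_ka_k)$ and $\mathfrak{krv}_n=\ker(\mathrm{div}:\mathfrak{sder}_n\to\mathfrak{tr}_n)$. \emph{Statement.} There is a linear isomorphism $\Psi:E_1^{0,0}\to\mathfrak{sder}_n$ with the following properties. (1) $\Psi$ is the standard map: for a class represented by a series of internally trivalent trees, the $j$-th component of $\Psi$ is the sum, over the trees $\Gamma$ and the edges of $\Gamma$ at the external vertex $j$, of the Lie word of the binary tree obtained by rooting $\Gamma$ at that edge, with the sign comparing the given edge order with the order (root edge, left subtree, right subtree). (2) $[x,y]_0$ represents a class in $E_1^{0,0}$ and $\Psi(\overline{[x,y]_0})=[\Psi(\overline x),\Psi(\overline y)]$ for all tree series $x,y$ of degree $0$. (3) There is an injective linear map $j:E_1^{1,0}\to\mathfrak{tr}_n$ such that $d_1z$ represents a class in $E_1^{1,0}$ and $j(\overline{d_1z})=\mathrm{div}(\Psi(\overline z))$ for every cocycle $z$ representing a class in $E_1^{0,0}$, and such that $j$ sends the class of the one-loop graph with internal vertices $v_1,\dots,v_k$ and edges ordered as $v_1w_1,v_1v_2,v_2w_2,v_2v_3,\dots,v_kw_k,v_kv_1$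 ($w_i$ external) to $(-1)^k\mathrm{tr}(x_{w_k}\cdots x_{w_1})-\mathrm{tr}(x_{w_1}\cdots x_{w_k})$. (4) $\Psi(\mathfrak{krv}_n^{(1)})=\mathfrak{krv}_n$. In particular $\mathfrak{krv}_n^{(1)}\cong\mathfrak{krv}_n$ as Lie algebras. -/

import Mathlib

open Finset

noncomputable section

namespace KV

/-! ### Graphs with ordered edges -/

/-- Vertices: `n` external ones (`Sum.inl`) and `m` internal ones (`Sum.inr`). -/
abbrev Vtx (n m : ℕ) := Fin n ⊕ Fin m

/-- The list of the `e` edges, in their linear order, of an undirected graph. -/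
abbrev EdgeSeq (n m e : ℕ) := Fin e → Sym2 (Vtx n m)

variable {n m e : ℕ}

/-- The number of edges incident to `v` (there will be no simple loops). -/
def valence (Γ : EdgeSeq n m e) (v : Vtx n m) : ℕ :=
  (univ.filter fun i => v ∈ Γ i).card

/-- Admissible and internally connected graphs. -/
structure IsICG (Γ : EdgeSeq n m e) : Prop where
  /-- there are no double edges -/
  simple : Function.Injective Γ
  /-- there are no simple loops -/
  loopless : ∀ i, ¬ (Γ i).IsDiag
  /-- internal vertices are at least trivalent -/
  trivalent : ∀ v : Fin m, 3 ≤ valence Γ (Sum.inr v)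
  /-- internal vertices are connected by a path with some external vertex -/
  anchored : ∀ v : Fin m, ∃ j : Fin n,
    (SimpleGraph.fromEdgeSet (Set.range Γ)).Reachable (Sum.inr v) (Sum.inl j)
  /-- after cutting at the external vertices the graph is connected (and nonempty): any two edges
  are joined by a chain of edges, consecutive ones sharing an internal vertex -/
  connected : (SimpleGraph.fromRel fun i k : Fin e =>
    ∃ v : Fin m, Sum.inr v ∈ Γ i ∧ Sum.inr v ∈ Γ k).Connected

variable (n m e) in
/-- Internally connected graphs with `n` external vertices, `m` labelled internal vertices and
`e` linearly ordered edges. -/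
abbrev Gph := {Γ : EdgeSeq n m e // IsICG Γ}

/-- The number of internal loops, i.e. the first Betti number of the (connected) graph obtained by
cutting at the external vertices. That graph has `e` edges, and its vertices are the `m` internal
ones and one univalent end for each half-edge at an external vertex. -/
def loops (Γ : EdgeSeq n m e) : ℕ := e + 1 - (m + ∑ j : Fin n, valence Γ (Sum.inl j))

/-- The vertex bijection induced by a relabelling of the internal vertices. -/
def vtxEquiv (n : ℕ) {m : ℕ} (τ : Equiv.Perm (Fin m)) : Vtx n m ≃ Vtx n m :=
  Equiv.sumCongr (Equiv.refl _) τ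

/-- `Γ'` arises from `Γ` by the permutation `σ` of the order of the edges and the relabelling `τ`
of the internal vertices. -/
def IsRelabel (σ : Equiv.Perm (Fin e)) (τ : Equiv.Perm (Fin m)) (Γ Γ' : EdgeSeq n m e) : Prop :=
  ∀ i, Γ' i = (Γ (σ i)).map (vtxEquiv n τ)

/-! ### The space `ICG(n)` -/

variable (K : Type*) [Field K]

variable (n m e) in
/-- The relations: internal vertices are unlabelled, and `Γ^σ = sgn(σ) Γ`. -/
def Rel : Submodule K (Gph n m e →₀ K) :=
  Submodule.span K {z | ∃ (σ : Equiv.Perm (Fin e)) (τ : Equiv.Perm (Fin m)) (Γ Γ' : Gph n m e),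
    IsRelabel σ τ Γ.1 Γ'.1 ∧
    z = Finsupp.single Γ' 1 - ((Equiv.Perm.sign σ : ℤ) : K) • Finsupp.single Γ 1}

variable (n m e) in
/-- The part of `ICG(n)` with `m` internal vertices and `e` edges. -/
abbrev Piece := (Gph n m e →₀ K) ⧸ Rel n m e K

variable (n) in
/-- The (completed) space of internally connected graphs: the direct product of the spaces of
graphs with `m` internal vertices and `e` edges. -/
def ICG := (m e : ℕ) → Piece n m e K

instance : AddCommGroup (ICG n K) := inferInstanceAs (AddCommGroup ((m e : ℕ) → Piece n m e K))

instance : Module K (ICG n K) := inferInstanceAs (Module K ((m e : ℕ) → Piece n m e K))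

@[simp] theorem ICG.add_apply (x y : ICG n K) (m e : ℕ) : (x + y) m e = x m e + y m e := rfl

@[simp] theorem ICG.zero_apply (m e : ℕ) : (0 : ICG n K) m e = 0 := rfl

@[simp] theorem ICG.smul_apply (c : K) (x : ICG n K) (m e : ℕ) : (c • x) m e = c • x m e := rfl

variable (n) in
/-- Formal series of graphs, before dividing out the relations. -/
abbrev FormalSum := (m e : ℕ) → (Gph n m e →₀ K)

variable (n) in
/-- The class of a formal series of graphs in `ICG(n)`. -/
def toICG (c : FormalSum n K) : ICG n K := fun m e => (Rel n m e K).mkQ (c m e)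

variable (n) in
/-- The homogeneous part of degree `q`, where `deg Γ = 1 - #edges + 2 #(internal vertices)`. -/
def degPart (q : ℤ) : Submodule K (ICG n K) where
  carrier := {x | ∀ m e : ℕ, 1 - (e : ℤ) + 2 * (m : ℤ) ≠ q → x m e = 0}
  add_mem' := by
    intro a b ha hb m e h
    simp [ha m e h, hb m e h]
  zero_mem' := by
    intro m e _
    rfl
  smul_mem' := by
    intro c a ha m e h
    simp [ha m e h]

variable (n) in
/-- Series of graphs whose numbers of internal loops satisfy `P`. -/
def loopSpan (P : ℕ → Prop) : Submodule K (ICG n K) where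
  carrier := {x | ∀ m e : ℕ, x m e ∈ Submodule.span K
    {y | ∃ Γ : Gph n m e, P (loops Γ.1) ∧ y = (Rel n m e K).mkQ (Finsupp.single Γ 1)}}
  add_mem' := fun ha hb m e => Submodule.add_mem _ (ha m e) (hb m e)
  zero_mem' := fun _ _ => Submodule.zero_mem _
  smul_mem' := fun c _ ha m e => Submodule.smul_mem _ c (ha m e)

variable (n) in
/-- The filtration by internal loops: at least `p` internal loops. -/
abbrev Fil (p : ℕ) : Submodule K (ICG n K) := loopSpan n K (p ≤ ·)

variable (n) in
/-- The `p`-th piece of the associated graded: exactly `p` internal loops. -/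
abbrev Gr (p : ℕ) : Submodule K (ICG n K) := loopSpan n K (· = p)

/-! ### Vertex splitting -/

/-- Vertices of a graph, seen as vertices of a graph with one more internal vertex. -/
def up : Vtx n m → Vtx n (m + 1) := Sum.map id Fin.castSucc

/-- The new internal vertex. -/
def newV : Vtx n (m + 1) := Sum.inr (Fin.last m)

/-- Split `v` into `v` and a new internal vertex, connected by an edge which is placed last in the
order; the edges in `S` (a set of edges at `v`) are reconnected from `v` to the new vertex. -/
def split (Γ : EdgeSeq n m e) (v : Vtx n m) (S : Finset (Fin e)) : EdgeSeq n (m + 1) (e + 1) :=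
  Fin.snoc (α := fun _ => Sym2 (Vtx n (m + 1)))
    (fun i => if i ∈ S then (Γ i).map (fun u => if u = v then newV else up u) else (Γ i).map up)
    s(up v, newV)

/-- The term of the vertex splitting differential given by splitting `v` along `S`. Only internally
connected admissible graphs satisfying `P` are kept. -/
def splitTerm (P : EdgeSeq n (m + 1) (e + 1) → Prop) (Γ : EdgeSeq n m e) (v : Vtx n m)
    (S : Finset (Fin e)) : Gph n (m + 1) (e + 1) →₀ K := by
  classical exact
    if h : IsICG (split Γ v S) ∧ (∀ i ∈ S, v ∈ Γ i) ∧ P (split Γ v S) then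
      Finsupp.single ⟨split Γ v S, h.1⟩ 1
    else 0

/-- The sum over all splittings of the vertices of `Γ`. For an internal vertex the two new
vertices are unlabelled, so that `S` and its complement describe the same splitting, hence
the factor `1/2`. -/
def splitSum (P : EdgeSeq n (m + 1) (e + 1) → Prop) (Γ : EdgeSeq n m e) :
    Gph n (m + 1) (e + 1) →₀ K :=
  (∑ j : Fin n, ∑ S : Finset (Fin e), splitTerm K P Γ (Sum.inl j) S) +
    (2⁻¹ : K) • ∑ v : Fin m, ∑ S : Finset (Fin e), splitTerm K P Γ (Sum.inr v) S

/-! #### Vertex splitting is compatible with the relations -/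

theorem IsRelabel.symm {σ : Equiv.Perm (Fin e)} {τ : Equiv.Perm (Fin m)} {Γ Γ' : EdgeSeq n m e}
    (h : IsRelabel σ τ Γ Γ') : IsRelabel σ⁻¹ τ⁻¹ Γ' Γ := by
  intro i
  rw [h, Sym2.map_map]
  have : (vtxEquiv n τ⁻¹ : Vtx n m → Vtx n m) ∘ (vtxEquiv n τ) = id := by
    funext u
    rcases u with u | u <;> simp [vtxEquiv]
  rw [this]
  simp

theorem IsRelabel.mem_iff {σ : Equiv.Perm (Fin e)} {τ : Equiv.Perm (Fin m)}
    {Γ Γ' : EdgeSeq n m e} (h : IsRelabel σ τ Γ Γ') (v : Vtx n m) (i : Fin e) :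
    vtxEquiv n τ v ∈ Γ' i ↔ v ∈ Γ (σ i) := by
  rw [h, Sym2.mem_map]
  constructor
  · rintro ⟨a, ha, hav⟩
    rwa [← (vtxEquiv n τ).injective hav]
  · intro hv
    exact ⟨v, hv, rfl⟩

theorem IsRelabel.valence_eq {σ : Equiv.Perm (Fin e)} {τ : Equiv.Perm (Fin m)}
    {Γ Γ' : EdgeSeq n m e} (h : IsRelabel σ τ Γ Γ') (v : Vtx n m) :
    valence Γ' (vtxEquiv n τ v) = valence Γ v := by
  classical
  unfold valence
  refine Finset.card_bij (fun i _ => σ i) ?_ ?_ ?_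
  · intro i hi
    simpa [h.mem_iff] using hi
  · intro a _ b _ hab
    exact σ.injective hab
  · intro b hb
    refine ⟨σ⁻¹ b, ?_, by simp⟩
    simpa [h.mem_iff] using hb

theorem IsRelabel.loops_eq {σ : Equiv.Perm (Fin e)} {τ : Equiv.Perm (Fin m)}
    {Γ Γ' : EdgeSeq n m e} (h : IsRelabel σ τ Γ Γ') : loops Γ' = loops Γ := by
  unfold loops
  have : ∀ j : Fin n, valence Γ' (Sum.inl j) = valence Γ (Sum.inl j) := fun j =>
    h.valence_eq (Sum.inl j)
  simp [this]

theorem IsRelabel.isICG {σ : Equiv.Perm (Fin e)} {τ : Equiv.Perm (Fin m)}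
    {Γ Γ' : EdgeSeq n m e} (h : IsRelabel σ τ Γ Γ') (hΓ : IsICG Γ) : IsICG Γ' where
  simple := by
    intro a b hab
    rw [h, h] at hab
    exact σ.injective (hΓ.simple (Sym2.map.injective (vtxEquiv n τ).injective hab))
  loopless := by
    intro i hi
    rw [h, Sym2.isDiag_map (vtxEquiv n τ).injective] at hi
    exact hΓ.loopless _ hi
  trivalent := by
    intro v
    have h1 := h.valence_eq (Sum.inr (τ⁻¹ v))
    have h2 : vtxEquiv n τ (Sum.inr (τ⁻¹ v)) = Sum.inr v := by simp [vtxEquiv]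
    rw [h2] at h1
    rw [h1]
    exact hΓ.trivalent _
  anchored := by
    intro v
    obtain ⟨j, hj⟩ := hΓ.anchored (τ⁻¹ v)
    refine ⟨j, ?_⟩
    let f : SimpleGraph.fromEdgeSet (Set.range Γ) →g SimpleGraph.fromEdgeSet (Set.range Γ') :=
      { toFun := vtxEquiv n τ
        map_rel' := by
          intro a b hab
          rw [SimpleGraph.fromEdgeSet_adj] at hab ⊢
          obtain ⟨⟨i, hi⟩, hne⟩ := hab
          refine ⟨⟨σ⁻¹ i, ?_⟩, fun hc => hne ((vtxEquiv n τ).injective hc)⟩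
          rw [h]
          simp [hi] }
    have := hj.map f
    simpa [f, vtxEquiv] using this
  connected := by
    let f : (SimpleGraph.fromRel fun i k : Fin e =>
          ∃ v : Fin m, Sum.inr v ∈ Γ i ∧ Sum.inr v ∈ Γ k) →g
        (SimpleGraph.fromRel fun i k : Fin e =>
          ∃ v : Fin m, Sum.inr v ∈ Γ' i ∧ Sum.inr v ∈ Γ' k) :=
      { toFun := fun i => σ⁻¹ i
        map_rel' := by
          intro a b hab
          have key : ∀ a b : Fin e, (∃ v : Fin m, Sum.inr v ∈ Γ a ∧ Sum.inr v ∈ Γ b) →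
              ∃ v : Fin m, Sum.inr v ∈ Γ' (σ⁻¹ a) ∧ Sum.inr v ∈ Γ' (σ⁻¹ b) := by
            rintro a b ⟨v, h1, h2⟩
            have e1 := (h.mem_iff (Sum.inr v) (σ⁻¹ a)).2 (by simpa using h1)
            have e2 := (h.mem_iff (Sum.inr v) (σ⁻¹ b)).2 (by simpa using h2)
            exact ⟨τ v, e1, e2⟩
          rw [SimpleGraph.fromRel_adj] at hab ⊢
          refine ⟨fun hc => hab.1 (σ⁻¹.injective hc), ?_⟩
          rcases hab.2 with h1 | h1
          · exact Or.inl (key _ _ h1)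
          · exact Or.inr (key _ _ h1) }
    have hsurj : Function.Surjective f := fun i => ⟨σ i, by simp [f]⟩
    exact hΓ.connected.map f hsurj

/-- The extension of a permutation of `Fin k` to `Fin (k + 1)` fixing the last element. -/
def permSnoc {k : ℕ} (σ : Equiv.Perm (Fin k)) : Equiv.Perm (Fin (k + 1)) :=
  finSuccEquivLast.symm.permCongr (Equiv.optionCongr σ)

@[simp] theorem permSnoc_castSucc {k : ℕ} (σ : Equiv.Perm (Fin k)) (i : Fin k) :
    permSnoc σ i.castSucc = (σ i).castSucc := by
  simp [permSnoc, Equiv.permCongr_apply]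

@[simp] theorem permSnoc_last {k : ℕ} (σ : Equiv.Perm (Fin k)) :
    permSnoc σ (Fin.last k) = Fin.last k := by
  simp [permSnoc, Equiv.permCongr_apply]

theorem sign_permSnoc {k : ℕ} (σ : Equiv.Perm (Fin k)) :
    Equiv.Perm.sign (permSnoc σ) = Equiv.Perm.sign σ := by
  simp [permSnoc]

theorem vtxEquiv_up (τ : Equiv.Perm (Fin m)) (u : Vtx n m) :
    vtxEquiv n (permSnoc τ) (up u) = up (vtxEquiv n τ u) := by
  rcases u with u | u <;> simp [vtxEquiv, up]

theorem vtxEquiv_newV (τ : Equiv.Perm (Fin m)) :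
    vtxEquiv n (permSnoc τ) (newV : Vtx n (m + 1)) = newV := by
  simp [vtxEquiv, newV]

theorem IsRelabel.split {σ : Equiv.Perm (Fin e)} {τ : Equiv.Perm (Fin m)}
    {Γ Γ' : EdgeSeq n m e} (h : IsRelabel σ τ Γ Γ') (v : Vtx n m) (S : Finset (Fin e)) :
    IsRelabel (permSnoc σ) (permSnoc τ) (split Γ v S)
      (split Γ' (vtxEquiv n τ v) (σ⁻¹.finsetCongr S)) := by
  intro i
  refine Fin.lastCases ?_ (fun i => ?_) i
  · simp [KV.split, vtxEquiv_up, vtxEquiv_newV]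
  · have hmem : i ∈ σ⁻¹.finsetCongr S ↔ σ i ∈ S := by
      simp only [Equiv.finsetCongr_apply, Finset.mem_map, Equiv.coe_toEmbedding]
      constructor
      · rintro ⟨a, ha, rfl⟩
        simpa using ha
      · intro hi
        exact ⟨σ i, hi, by simp⟩
    simp only [KV.split, Fin.snoc_castSucc, permSnoc_castSucc, hmem]
    split_ifs with hS
    · rw [h, Sym2.map_map, Sym2.map_map]
      congr 1
      funext u
      simp only [Function.comp_apply, (vtxEquiv n τ).injective.eq_iff]
      split_ifs
      · rw [vtxEquiv_newV]
      · rw [vtxEquiv_up]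
    · rw [h, Sym2.map_map, Sym2.map_map]
      congr 1
      funext u
      simp only [Function.comp_apply]
      rw [vtxEquiv_up]

theorem splitTerm_relabel {P P' : EdgeSeq n (m + 1) (e + 1) → Prop}
    {σ : Equiv.Perm (Fin e)} {τ : Equiv.Perm (Fin m)} {Γ Γ' : EdgeSeq n m e}
    (hP : ∀ (σ : Equiv.Perm (Fin (e + 1))) (τ : Equiv.Perm (Fin (m + 1))) Δ Δ',
      IsRelabel σ τ Δ Δ' → (P' Δ' ↔ P Δ))
    (h : IsRelabel σ τ Γ Γ') (v : Vtx n m) (S : Finset (Fin e)) :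
    splitTerm K P' Γ' (vtxEquiv n τ v) (σ⁻¹.finsetCongr S) -
      ((Equiv.Perm.sign σ : ℤ) : K) • splitTerm K P Γ v S ∈ Rel n (m + 1) (e + 1) K := by
  have hs := h.split v S
  have hiff : (IsICG (split Γ' (vtxEquiv n τ v) (σ⁻¹.finsetCongr S)) ∧
      (∀ i ∈ σ⁻¹.finsetCongr S, vtxEquiv n τ v ∈ Γ' i) ∧
      P' (split Γ' (vtxEquiv n τ v) (σ⁻¹.finsetCongr S))) ↔
      (IsICG (split Γ v S) ∧ (∀ i ∈ S, v ∈ Γ i) ∧ P (split Γ v S)) := by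
    refine and_congr ⟨fun H => hs.symm.isICG H, fun H => hs.isICG H⟩
      (and_congr ?_ (hP _ _ _ _ hs))
    simp only [Equiv.finsetCongr_apply, Finset.mem_map, Equiv.coe_toEmbedding]
    constructor
    · intro H i hi
      have := H (σ⁻¹ i) ⟨i, hi, rfl⟩
      rw [h.mem_iff] at this
      simpa using this
    · rintro H _ ⟨i, hi, rfl⟩
      rw [h.mem_iff]
      simpa using H i hi
  unfold splitTerm
  by_cases hc : IsICG (split Γ v S) ∧ (∀ i ∈ S, v ∈ Γ i) ∧ P (split Γ v S)
  · rw [dif_pos (hiff.2 hc), dif_pos hc]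
    refine Submodule.subset_span ⟨permSnoc σ, permSnoc τ, ⟨_, hc.1⟩, ⟨_, (hiff.2 hc).1⟩, hs, ?_⟩
    rw [sign_permSnoc]
  · rw [dif_neg (fun H => hc (hiff.1 H)), dif_neg hc]
    simp

theorem splitSum_relabel {P P' : EdgeSeq n (m + 1) (e + 1) → Prop}
    {σ : Equiv.Perm (Fin e)} {τ : Equiv.Perm (Fin m)} {Γ Γ' : EdgeSeq n m e}
    (hP : ∀ (σ : Equiv.Perm (Fin (e + 1))) (τ : Equiv.Perm (Fin (m + 1))) Δ Δ',
      IsRelabel σ τ Δ Δ' → (P' Δ' ↔ P Δ))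
    (h : IsRelabel σ τ Γ Γ') :
    splitSum K P' Γ' - ((Equiv.Perm.sign σ : ℤ) : K) • splitSum K P Γ ∈
      Rel n (m + 1) (e + 1) K := by
  have key : ∀ v, (∑ S : Finset (Fin e), splitTerm K P' Γ' (vtxEquiv n τ v) S) -
      ((Equiv.Perm.sign σ : ℤ) : K) • (∑ S : Finset (Fin e), splitTerm K P Γ v S) ∈
      Rel n (m + 1) (e + 1) K := by
    intro v
    rw [← Equiv.sum_comp (σ⁻¹.finsetCongr), Finset.smul_sum, ← Finset.sum_sub_distrib]
    exact Submodule.sum_mem _ fun S _ => splitTerm_relabel K hP h v S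
  have h1 : ∀ j : Fin n, vtxEquiv n τ (Sum.inl j) = Sum.inl j := fun j => rfl
  have h2 : ∀ v : Fin m, vtxEquiv n τ (Sum.inr v) = Sum.inr (τ v) := fun j => rfl
  unfold splitSum
  rw [← Equiv.sum_comp τ (fun v => ∑ S : Finset (Fin e), splitTerm K P' Γ' (Sum.inr v) S)]
  have e1 := Submodule.sum_mem (Rel n (m + 1) (e + 1) K) (t := univ)
    fun (j : Fin n) _ => key (Sum.inl j)
  have e2 := Submodule.smul_mem (Rel n (m + 1) (e + 1) K) (2⁻¹ : K)
    (Submodule.sum_mem (Rel n (m + 1) (e + 1) K) (t := univ) fun (v : Fin m) _ => key (Sum.inr v))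
  have e3 := Submodule.add_mem _ e1 e2
  convert e3 using 1
  simp only [h1, h2, Finset.sum_sub_distrib, ← Finset.smul_sum, smul_add, smul_sub]
  rw [smul_comm (2⁻¹ : K)]
  abel

/-! ### The differential and its components -/

variable (n m e) in
/-- Vertex splitting on linear combinations of graphs, keeping only the graphs with `b` loops
obtained from graphs with `a` loops such that `R a b`. -/
def dFree (R : ℕ → ℕ → Prop) : (Gph n m e →₀ K) →ₗ[K] (Gph n (m + 1) (e + 1) →₀ K) :=
  Finsupp.lift _ K _ fun Γ => splitSum K (fun Δ => R (loops Γ.1) (loops Δ)) Γ.1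

variable (n m e) in
/-- `dFree` on the quotient by the relations. -/
def dPiece (R : ℕ → ℕ → Prop) : Piece n m e K →ₗ[K] Piece n (m + 1) (e + 1) K :=
  Submodule.mapQ _ _ (dFree n m e K R) (by
    refine Submodule.span_le.2 ?_
    rintro _ ⟨σ, τ, Γ, Γ', h, rfl⟩
    simp only [SetLike.mem_coe, Submodule.mem_comap, map_sub, map_smul]
    have := splitSum_relabel K (P := fun Δ => R (loops Γ.1) (loops Δ))
      (P' := fun Δ => R (loops Γ'.1) (loops Δ)) (fun _ _ Δ Δ' hΔ => by
        rw [hΔ.loops_eq, h.loops_eq]) h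
    simpa [dFree] using this)

/-- The underlying function of `dRestr`. -/
def dFun (R : ℕ → ℕ → Prop) (x : ICG n K) : ICG n K
  | m + 1, e + 1 => dPiece n m e K R (x m e)
  | 0, _ => 0
  | _ + 1, 0 => 0

variable (n) in
/-- Vertex splitting on `ICG(n)`, restricted as in `dFree`. -/
def dRestr (R : ℕ → ℕ → Prop) : ICG n K →ₗ[K] ICG n K where
  toFun := dFun K R
  map_add' x y := by
    funext m e
    rcases m with _ | m <;> rcases e with _ | e <;> simp [dFun]
  map_smul' c x := by
    funext m e
    rcases m with _ | m <;> rcases e with _ | e <;> simp [dFun]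

variable (n) in
/-- The differential of `ICG(n)`: vertex splitting. -/
abbrev d : ICG n K →ₗ[K] ICG n K := dRestr n K fun _ _ => True

variable (n) in
/-- The component of the differential which creates exactly `i` internal loops. -/
abbrev dLoop (i : ℕ) : ICG n K →ₗ[K] ICG n K := dRestr n K fun a b => b = a + i

/-! ### The spectral sequence of the filtration by internal loops -/

variable (n) in
/-- Cocycles of degree `p + q` in the `p`-th piece of the associated graded. -/
def Z₁ (p : ℕ) (q : ℤ) : Submodule K (ICG n K) :=
  Gr n K p ⊓ degPart n K (p + q) ⊓ LinearMap.ker (dLoop n K 0)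

variable (n) in
/-- Coboundaries of degree `p + q` in the `p`-th piece of the associated graded. -/
def B₁ (p : ℕ) (q : ℤ) : Submodule K (ICG n K) :=
  (Gr n K p ⊓ degPart n K (p + q - 1)).map (dLoop n K 0)

variable (n) in
/-- The first page `E₁^{p,q} = H^{p+q}(gr^p ICG(n), d₀)`. -/
abbrev E₁ (p : ℕ) (q : ℤ) := Z₁ n K p q ⧸ (B₁ n K p q).submoduleOf (Z₁ n K p q)

variable (n) in
/-- The class of a cocycle in the first page. -/
abbrev cls₁ (p : ℕ) (q : ℤ) : Z₁ n K p q →ₗ[K] E₁ n K p q :=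
  ((B₁ n K p q).submoduleOf (Z₁ n K p q)).mkQ

variable (n) in
/-- Elements `x` of degree `0` with `d x = 0` modulo `r` loops. -/
def Zr (r : ℕ) : Submodule K (ICG n K) := degPart n K 0 ⊓ (Fil n K r).comap (d n K)

variable (n) in
/-- The elements which represent zero in `E_r^{0,0}`: coboundaries, and elements of `Zr` all of
whose graphs have at least one internal loop. -/
def Qr (r : ℕ) : Submodule K (ICG n K) := (degPart n K (-1)).map (d n K) ⊔ (Zr n K r ⊓ Fil n K 1)

variable (n) in
/-- `E_r^{0,0}`. -/
abbrev Er (r : ℕ) := Zr n K r ⧸ (Qr n K r).submoduleOf (Zr n K r)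

/-! #### The part of a series with a given number of internal loops -/

variable (n m e) in
/-- Keep the graphs with exactly `p` internal loops. -/
def partFree (p : ℕ) : (Gph n m e →₀ K) →ₗ[K] (Gph n m e →₀ K) :=
  Finsupp.lift _ K _ fun Γ => if loops Γ.1 = p then Finsupp.single Γ 1 else 0

theorem partFree_single (p : ℕ) (Γ : Gph n m e) :
    partFree n m e K p (Finsupp.single Γ 1) =
      if loops Γ.1 = p then Finsupp.single Γ 1 else 0 := by
  simp [partFree]

variable (n m e) in
/-- `partFree` on the quotient by the relations. -/
def partPiece (p : ℕ) : Piece n m e K →ₗ[K] Piece n m e K :=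
  Submodule.mapQ _ _ (partFree n m e K p) (by
    refine Submodule.span_le.2 ?_
    rintro _ ⟨σ, τ, Γ, Γ', h, rfl⟩
    simp only [SetLike.mem_coe, Submodule.mem_comap, map_sub, map_smul, partFree_single,
      h.loops_eq]
    split_ifs
    · exact Submodule.subset_span ⟨σ, τ, Γ, Γ', h, rfl⟩
    · simp)

variable (n) in
/-- The part `x_p` with exactly `p` internal loops of a series `x = x_0 + x_1 + ⋯`. -/
def loopPart (p : ℕ) : ICG n K →ₗ[K] ICG n K where
  toFun x := fun m e => partPiece n m e K p (x m e)
  map_add' x y := by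
    funext m e
    exact map_add (partPiece n m e K p) (x m e) (y m e)
  map_smul' c x := by
    funext m e
    exact map_smul (partPiece n m e K p) c (x m e)

theorem valence_eq_sum (Γ : EdgeSeq n m e) (v : Vtx n m) :
    valence Γ v = ∑ i, if v ∈ Γ i then 1 else 0 := by
  simp [valence]

theorem valence_split (Γ : EdgeSeq n m e) (v : Vtx n m) (S : Finset (Fin e)) (u) :
    valence (split Γ v S) u = (∑ i : Fin e, if u ∈ split Γ v S i.castSucc then 1 else 0) +
      if u ∈ s(up v, newV) then 1 else 0 := by
  rw [valence_eq_sum, Fin.sum_univ_castSucc]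
  simp [split]

theorem mem_split_inl (Γ : EdgeSeq n m e) (v : Vtx n m) (S : Finset (Fin e)) (j : Fin n)
    (i : Fin e) : Sum.inl j ∈ split Γ v S i.castSucc ↔
      Sum.inl j ∈ Γ i ∧ ¬ (i ∈ S ∧ v = Sum.inl j) := by
  have hup : ∀ a : Vtx n m, up a = Sum.inl j ↔ a = Sum.inl j := by
    intro a
    rcases a with a | a <;> simp [up]
  simp only [split, Fin.snoc_castSucc]
  split_ifs with hS
  · rw [Sym2.mem_map]
    constructor
    · rintro ⟨a, ha, hf⟩
      split_ifs at hf with hav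
      · simp [newV] at hf
      · rw [hup] at hf
        subst hf
        exact ⟨ha, fun hc => hav hc.2.symm⟩
    · rintro ⟨h1, h2⟩
      refine ⟨Sum.inl j, h1, ?_⟩
      rw [if_neg (fun hc => h2 ⟨hS, hc.symm⟩), hup]
  · rw [Sym2.mem_map]
    simp [hup, hS]

theorem split_nonempty {Γ : EdgeSeq n m e} {v : Vtx n m} {S : Finset (Fin e)}
    (h : IsICG (split Γ v S)) : S.Nonempty := by
  by_contra hS
  rw [Finset.not_nonempty_iff_eq_empty] at hS
  subst hS
  have h3 := h.trivalent (Fin.last m)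
  rw [valence_split] at h3
  have h0 : ∀ i : Fin e, ¬ Sum.inr (Fin.last m) ∈ split Γ v ∅ i.castSucc := by
    intro i
    simp only [split, Fin.snoc_castSucc, Finset.notMem_empty, if_false, Sym2.mem_map]
    rintro ⟨a, -, ha⟩
    rcases a with a | a
    · simp [up] at ha
    · simp [up, Fin.castSucc_ne_last] at ha
  simp only [h0, if_false, Finset.sum_const_zero] at h3
  split_ifs at h3 <;> omega

/-- Vertex splitting does not decrease the number of internal loops. -/
theorem loops_le_split {Γ : EdgeSeq n m e} {v : Vtx n m} {S : Finset (Fin e)}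
    (h : IsICG (split Γ v S)) (hS : ∀ i ∈ S, v ∈ Γ i) : loops Γ ≤ loops (split Γ v S) := by
  have key : ∀ j : Fin n, valence (split Γ v S) (Sum.inl j) ≤ valence Γ (Sum.inl j) := by
    intro j
    rw [valence_split, valence_eq_sum]
    simp only [mem_split_inl]
    by_cases hv : v = Sum.inl j
    · obtain ⟨i₀, hi₀⟩ := split_nonempty h
      have hin : (Sum.inl j : Vtx n m) ∈ Γ i₀ := hv ▸ hS i₀ hi₀
      rw [← Finset.add_sum_erase _ _ (Finset.mem_univ i₀),
        ← Finset.add_sum_erase (a := i₀) univ (fun i => if Sum.inl j ∈ Γ i then 1 else 0)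
          (Finset.mem_univ i₀)]
      have h1 : (∑ i ∈ univ.erase i₀, if Sum.inl j ∈ Γ i ∧ ¬ (i ∈ S ∧ v = Sum.inl j) then 1 else 0)
          ≤ ∑ i ∈ univ.erase i₀, if Sum.inl j ∈ Γ i then 1 else 0 := by
        refine Finset.sum_le_sum fun i _ => ?_
        split_ifs with a b <;> first | omega | (exact absurd a.1 b)
      simp only [hin, hi₀, hv, and_self, not_true_eq_false, and_false, if_false, if_true] at h1 ⊢
      split_ifs <;> omega
    · have : ¬ (Sum.inl j : Vtx n (m + 1)) ∈ s(up v, newV) := by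
        rcases v with a | a <;> simp [up, newV] at hv ⊢
        exact fun hc => hv hc.symm
      simp [hv, this]
  have hsum := Finset.sum_le_sum (s := univ) fun (j : Fin n) _ => key j
  unfold loops
  omega

theorem partFree_splitTerm (p : ℕ) (P : EdgeSeq n (m + 1) (e + 1) → Prop) (Γ : EdgeSeq n m e)
    (v : Vtx n m) (S : Finset (Fin e)) :
    partFree n (m + 1) (e + 1) K p (splitTerm K P Γ v S) =
      splitTerm K (fun Δ => P Δ ∧ loops Δ = p) Γ v S := by
  unfold splitTerm
  by_cases h : IsICG (split Γ v S) ∧ (∀ i ∈ S, v ∈ Γ i) ∧ P (split Γ v S)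
  · rw [dif_pos h, partFree_single]
    by_cases hp : loops (split Γ v S) = p
    · rw [if_pos hp, dif_pos ⟨h.1, h.2.1, h.2.2, hp⟩]
    · rw [if_neg hp, dif_neg (fun hc => hp hc.2.2.2)]
  · rw [dif_neg h, dif_neg (fun hc => h ⟨hc.1, hc.2.1, hc.2.2.1⟩), map_zero]

theorem partFree_splitSum (p : ℕ) (P : EdgeSeq n (m + 1) (e + 1) → Prop) (Γ : EdgeSeq n m e) :
    partFree n (m + 1) (e + 1) K p (splitSum K P Γ) =
      splitSum K (fun Δ => P Δ ∧ loops Δ = p) Γ := by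
  simp [splitSum, partFree_splitTerm]

theorem partFree_dFree (z : Gph n m e →₀ K) :
    partFree n (m + 1) (e + 1) K 0 (dFree n m e K (fun _ _ => True) z) =
      dFree n m e K (fun a b => b = a + 0) (partFree n m e K 0 z) := by
  induction z using Finsupp.induction_linear with
  | zero => simp
  | add f g hf hg => simp only [map_add, hf, hg]
  | single Γ c =>
    rw [← mul_one c, ← smul_eq_mul, ← Finsupp.smul_single]
    simp only [map_smul]
    congr 1
    rw [partFree_single]
    have h1 : dFree n m e K (fun _ _ => True) (Finsupp.single Γ 1) =
        splitSum K (fun _ => True) Γ.1 := by simp [dFree]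
    rw [h1, partFree_splitSum]
    split_ifs with h0
    · simp [dFree, h0]
    · rw [map_zero]
      have : ∀ v S, splitTerm K (fun Δ => True ∧ loops Δ = 0) Γ.1 v S = 0 := by
        intro v S
        unfold splitTerm
        refine dif_neg ?_
        rintro ⟨hI, hS, -, hl⟩
        have := loops_le_split hI hS
        omega
      simp only [splitSum, this, Finset.sum_const_zero, smul_zero, add_zero]

theorem loopPart_d (x : ICG n K) : loopPart n K 0 (d n K x) = dLoop n K 0 (loopPart n K 0 x) := by
  funext m e
  rcases m with _ | m
  · exact map_zero (partPiece n 0 e K 0)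
  rcases e with _ | e
  · exact map_zero (partPiece n (m + 1) 0 K 0)
  change partPiece n (m + 1) (e + 1) K 0 (dPiece n m e K _ (x m e)) =
    dPiece n m e K _ (partPiece n m e K 0 (x m e))
  obtain ⟨z, hz⟩ := Submodule.mkQ_surjective _ (x m e)
  rw [← hz]
  exact congrArg (Rel n (m + 1) (e + 1) K).mkQ (partFree_dFree K z)

theorem loopPart_of_mem_Fil {r : ℕ} (hr : 1 ≤ r) {x : ICG n K} (hx : x ∈ Fil n K r) :
    loopPart n K 0 x = 0 := by
  funext m e
  have h : Submodule.span K {y | ∃ Γ : Gph n m e, r ≤ loops Γ.1 ∧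
      y = (Rel n m e K).mkQ (Finsupp.single Γ 1)} ≤ LinearMap.ker (partPiece n m e K 0) := by
    rw [Submodule.span_le]
    rintro _ ⟨Γ, hΓ, rfl⟩
    change (Rel n m e K).mkQ (partFree n m e K 0 (Finsupp.single Γ 1)) = 0
    rw [partFree_single, if_neg (by omega), map_zero]
  exact h (hx m e)

theorem loopPart_mem_Gr (p : ℕ) (x : ICG n K) : loopPart n K p x ∈ Gr n K p := by
  intro m e
  obtain ⟨z, hz⟩ := Submodule.mkQ_surjective _ (x m e)
  change partPiece n m e K p (x m e) ∈ _
  rw [← hz]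
  change (Rel n m e K).mkQ (partFree n m e K p z) ∈ _
  clear hz
  induction z using Finsupp.induction_linear with
  | zero => simp
  | add f g hf hg =>
    simp only [map_add]
    exact Submodule.add_mem _ hf hg
  | single Γ c =>
    rw [← mul_one c, ← smul_eq_mul, ← Finsupp.smul_single]
    simp only [map_smul]
    refine Submodule.smul_mem _ _ ?_
    rw [partFree_single]
    split_ifs with h
    · exact Submodule.subset_span ⟨Γ, h, rfl⟩
    · simp

theorem loopPart_mem_degPart (p : ℕ) {q : ℤ} {x : ICG n K} (hx : x ∈ degPart n K q) :
    loopPart n K p x ∈ degPart n K q := by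
  intro m e h
  change partPiece n m e K p (x m e) = 0
  rw [hx m e h, map_zero]

theorem loopPart_mem_Z₁ {r : ℕ} (hr : 1 ≤ r) {x : ICG n K} (hx : x ∈ Zr n K r) :
    loopPart n K 0 x ∈ Z₁ n K 0 0 := by
  refine ⟨⟨loopPart_mem_Gr K 0 x, ?_⟩, ?_⟩
  · have := loopPart_mem_degPart K 0 hx.1
    simpa using this
  · change dLoop n K 0 (loopPart n K 0 x) = 0
    rw [← loopPart_d]
    exact loopPart_of_mem_Fil K hr hx.2

theorem loopPart_mem_B₁ {r : ℕ} {x : ICG n K} (hx : x ∈ Qr n K r) :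
    loopPart n K 0 x ∈ B₁ n K 0 0 := by
  obtain ⟨_, ⟨y, hy, rfl⟩, z, hz, rfl⟩ := Submodule.mem_sup.1 hx
  rw [map_add, loopPart_of_mem_Fil K le_rfl hz.2, add_zero, loopPart_d]
  refine ⟨loopPart n K 0 y, ⟨loopPart_mem_Gr K 0 y, ?_⟩, rfl⟩
  have := loopPart_mem_degPart K 0 hy
  simpa using this

variable (n) in
/-- The map `i_r : E_r^{0,0} → E₁^{0,0}`, `x_0 + x_1 + ⋯ ↦ x_0`, for `r = k + 1 ≥ 1`. -/
def iMap (k : ℕ) : Er n K (k + 1) →ₗ[K] E₁ n K 0 0 :=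
  Submodule.mapQ _ _
    (((loopPart n K 0) ∘ₗ (Zr n K (k + 1)).subtype).codRestrict (Z₁ n K 0 0)
      fun x => loopPart_mem_Z₁ K (Nat.le_add_left 1 k) x.2)
    fun _ hx => loopPart_mem_B₁ K hx

variable (n) in
/-- `krv_n^{(k)} = i_{k+1}(E_{k+1}^{0,0})`. -/
def krvGraph (k : ℕ) : Submodule K (E₁ n K 0 0) := LinearMap.range (iMap n K k)

/-! ### The Ihara bracket on trees -/

/-- Glue two graphs at the external vertices; the edges of the first graph come first. -/
def glue {m₁ e₁ m₂ e₂ m e : ℕ} (hm : m₁ + m₂ = m) (he : e₁ + e₂ = e)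
    (Γ₁ : EdgeSeq n m₁ e₁) (Γ₂ : EdgeSeq n m₂ e₂) : EdgeSeq n m e := fun i =>
  Fin.append
    (fun i => (Γ₁ i).map (Sum.map id fun v => Fin.cast hm (Fin.castAdd m₂ v)))
    (fun i => (Γ₂ i).map (Sum.map id fun v => Fin.cast hm (Fin.natAdd m₁ v)))
    (Fin.cast he.symm i)

/-- The component `[x, y]₀` of the binary bracket of `ICG(n)` which creates no internal loops:
glue the graphs at the external vertices, split a vertex, and keep the internally connected graphs
which have as many internal loops as the two given graphs together. -/
def ihara (x y : FormalSum n K) : FormalSum n K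
  | m + 1, e + 1 =>
    ∑ p ∈ (antidiagonal m).attach, ∑ q ∈ (antidiagonal e).attach,
      (x p.1.1 q.1.1).sum fun Γ₁ a => (y p.1.2 q.1.2).sum fun Γ₂ b =>
        (a * b) • splitSum K (fun Δ => loops Δ = loops Γ₁.1 + loops Γ₂.1)
          (glue (mem_antidiagonal.1 p.2) (mem_antidiagonal.1 q.2) Γ₁.1 Γ₂.1)
  | 0, _ => 0
  | _ + 1, 0 => 0

variable {K} in
/-- The series all of whose graphs are trees of degree zero (hence internally trivalent). -/
def IsTreeSeries (c : FormalSum n K) : Prop :=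
  ∀ (m e : ℕ) (Γ : Gph n m e), c m e Γ ≠ 0 → loops Γ.1 = 0 ∧ e = 2 * m + 1

/-! ### Noncommutative power series, cyclic words, special derivations -/

variable (n) in
/-- `Ass_n`: formal power series in `n` noncommuting variables, as functions on words. -/
abbrev Ass := List (Fin n) → K

namespace Ass

variable {K}

/-- The generator `x_i`. -/
def X (i : Fin n) : Ass n K := fun w => if w = [i] then 1 else 0

/-- The (concatenation) product. -/
def mul (a b : Ass n K) : Ass n K := fun w =>
  ∑ i ∈ range (w.length + 1), a (w.take i) * b (w.drop i)

/-- The commutator. -/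
def brk (a b : Ass n K) : Ass n K := mul a b - mul b a

/-- The homogeneous component of degree `k`. -/
def homPart (k : ℕ) (a : Ass n K) : Ass n K := fun w => if w.length = k then a w else 0

/-- Lie polynomials: the Lie subalgebra generated by the `x_i`. -/
inductive IsLiePoly : Ass n K → Prop
  | X (i : Fin n) : IsLiePoly (X i)
  | zero : IsLiePoly 0
  | add {a b : Ass n K} : IsLiePoly a → IsLiePoly b → IsLiePoly (a + b)
  | smul (c : K) {a : Ass n K} : IsLiePoly a → IsLiePoly (c • a)
  | brk {a b : Ass n K} : IsLiePoly a → IsLiePoly b → IsLiePoly (brk a b)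

/-- `∂_k a`, where `a = a_0 + ∑ k, (∂_k a) x_k`. -/
def pd (k : Fin n) (a : Ass n K) : Ass n K := fun w => a (w ++ [k])

/-- The continuous derivation `u` of `Ass_n` with `u(x_i) = [x_i, a_i]`, applied to `b`: every
occurrence of a letter `i` in a word is replaced in turn by `[x_i, a_i]`. -/
def act (a : Fin n → Ass n K) (b : Ass n K) : Ass n K := fun w =>
  ∑ s ∈ range (w.length + 1), ∑ t ∈ range (w.length + 1 - s), ∑ i : Fin n,
    b (w.take s ++ [i] ++ w.drop (s + t)) * brk (X i) (a i) ((w.drop s).take t)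

/-- The bracket of tangential derivations. -/
def tderBracket (a b : Fin n → Ass n K) : Fin n → Ass n K := fun k =>
  act a (b k) - act b (a k) + brk (a k) (b k)

end Ass

variable (n) in
/-- The completed free Lie algebra `lie_n`: Lie series, i.e. series all of whose homogeneous
components are Lie polynomials. -/
def lieSeries : Submodule K (Ass n K) where
  carrier := {a | ∀ k, Ass.IsLiePoly (Ass.homPart k a)}
  add_mem' := by
    intro a b ha hb k
    have : Ass.homPart k (a + b) = Ass.homPart k a + Ass.homPart k b := by
      funext w
      simp only [Ass.homPart, Pi.add_apply]
      split_ifs <;> simp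
    rw [this]
    exact (ha k).add (hb k)
  zero_mem' := by
    intro k
    have : Ass.homPart k (0 : Ass n K) = 0 := by
      funext w
      simp [Ass.homPart]
    rw [this]
    exact Ass.IsLiePoly.zero
  smul_mem' := by
    intro c a ha k
    have : Ass.homPart k (c • a) = c • Ass.homPart k a := by
      funext w
      simp [Ass.homPart]
    rw [this]
    exact (ha k).smul c

variable (n) in
/-- Tangential derivations `u(x_k) = [x_k, a_k]`, given by their tuples `(a_1, …, a_n)` of Lie
series. The tuple is made unique by requiring that `a_k` has no linear term in `x_k`. -/
def tder : Submodule K (Fin n → Ass n K) where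
  carrier := {a | ∀ k, a k ∈ lieSeries n K ∧ a k [k] = 0}
  add_mem' := fun ha hb k =>
    ⟨Submodule.add_mem _ (ha k).1 (hb k).1, by simp [(ha k).2, (hb k).2]⟩
  zero_mem' := fun _ => ⟨Submodule.zero_mem _, rfl⟩
  smul_mem' := fun c _ ha k => ⟨Submodule.smul_mem _ c (ha k).1, by simp [(ha k).2]⟩

theorem Ass.brk_add (a b c : Ass n K) : Ass.brk a (b + c) = Ass.brk a b + Ass.brk a c := by
  funext w
  simp only [Ass.brk, Ass.mul, Pi.add_apply, Pi.sub_apply, mul_add, add_mul, sum_add_distrib]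
  ring

theorem Ass.brk_smul (r : K) (a b : Ass n K) : Ass.brk a (r • b) = r • Ass.brk a b := by
  funext w
  simp only [Ass.brk, Ass.mul, Pi.smul_apply, Pi.sub_apply, smul_eq_mul, mul_sub, mul_sum]
  congr 1 <;> exact sum_congr rfl fun _ _ => by ring

variable (n) in
/-- Special derivations: tangential derivations `u` with `u(∑ i, x_i) = 0`. -/
def sder : Submodule K (Fin n → Ass n K) where
  carrier := {a | a ∈ tder n K ∧ ∑ i, Ass.brk (Ass.X i) (a i) = 0}
  add_mem' := fun ha hb => ⟨Submodule.add_mem _ ha.1 hb.1, by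
    simp [Ass.brk_add, sum_add_distrib, ha.2, hb.2]⟩
  zero_mem' := ⟨Submodule.zero_mem _, by
    refine sum_eq_zero fun i _ => ?_
    have := Ass.brk_smul K (0 : K) (Ass.X i) (0 : Ass n K)
    simpa using this⟩
  smul_mem' := fun c _ ha => ⟨Submodule.smul_mem _ c ha.1, by
    simp [Ass.brk_smul, ← smul_sum, ha.2]⟩

variable (n) in
/-- The augmentation ideal `Ass_n^+`. -/
def assPlus : Submodule K (Ass n K) where
  carrier := {a | a [] = 0}
  add_mem' := by
    intro a b ha hb
    simp_all
  zero_mem' := rfl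
  smul_mem' := by
    intro c a ha
    simp_all

variable (n) in
/-- The span of all commutators `ab - ba` in `Ass_n`. -/
def commutators : Submodule K (Ass n K) := Submodule.span K {c | ∃ a b, c = Ass.brk a b}

variable (n) in
/-- The space `tr_n = Ass_n^+ / ⟨ab - ba⟩` of (series of) cyclic words. -/
abbrev Tr := assPlus n K ⧸ (commutators n K).submoduleOf (assPlus n K)

variable (n) in
/-- The map `tr : Ass_n^+ → tr_n`. -/
abbrev tr : assPlus n K →ₗ[K] Tr n K := ((commutators n K).submoduleOf (assPlus n K)).mkQ

/-- `a ↦ x_k (∂_k a)`, as a map to the augmentation ideal. -/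
def xpd (k : Fin n) : Ass n K →ₗ[K] assPlus n K where
  toFun a := ⟨Ass.mul (Ass.X k) (Ass.pd k a), by simp [assPlus, Ass.mul, Ass.X]⟩
  map_add' a b := by
    ext w
    simp [Ass.mul, Ass.pd, mul_add, sum_add_distrib]
  map_smul' c a := by
    ext w
    simp only [Ass.mul, Ass.pd, Pi.smul_apply, smul_eq_mul, RingHom.id_apply,
      Submodule.coe_smul, mul_sum]
    exact sum_congr rfl fun _ _ => by ring

variable (n) in
/-- The divergence `(a_1, …, a_n) ↦ ∑ k, tr(x_k (∂_k a_k))`. -/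
def div : (Fin n → Ass n K) →ₗ[K] Tr n K :=
  ∑ k : Fin n, tr n K ∘ₗ xpd K k ∘ₗ LinearMap.proj k

variable (n) in
/-- The Kashiwara-Vergne Lie algebra `krv_n = {x ∈ sder_n | div x = 0}`. -/
def krv : Submodule K (sder n K) := LinearMap.ker (div n K ∘ₗ (sder n K).subtype)

/-! ### From internally trivalent trees to special derivations -/

/-- The end of the edge `z` other than `v`. -/
def otherEnd {V : Type*} [DecidableEq V] (z : Sym2 V) (v : V) : V :=
  if h : v ∈ z then Sym2.Mem.other' h else v

/-- Read off the binary tree hanging at the end `v` of the edge `i`: its list of edges, ordered as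
root edge `i`, left subtree, right subtree (recursively), and the corresponding Lie word. The first
argument bounds the depth. -/
def readTree (Γ : EdgeSeq n m e) : ℕ → Fin e → Vtx n m → List (Fin e) × Ass n K
  | 0, i, _ => ([i], 0)
  | _ + 1, i, Sum.inl j => ([i], Ass.X j)
  | k + 1, i, Sum.inr v =>
    match (List.finRange e).filter fun f => f ≠ i ∧ Sum.inr v ∈ Γ f with
    | [f, g] =>
      let A := readTree Γ k f (otherEnd (Γ f) (Sum.inr v))
      let B := readTree Γ k g (otherEnd (Γ g) (Sum.inr v))
      (i :: A.1 ++ B.1, Ass.brk A.2 B.2)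
    | _ => ([i], 0)

/-- The sign of an enumeration of `Fin e`, computed from its inversions. -/
def listSign : List (Fin e) → ℤ
  | [] => 1
  | a :: l => (-1) ^ (l.countP fun b => b < a) * listSign l

/-- The Lie series `a_j` attached to an internally trivalent tree: sum over all edges at the
external vertex `j` of the Lie words read off with this edge as root, with the sign which compares
the order of the edges with the order in which they are read. -/
def treeWord (Γ : EdgeSeq n m e) (j : Fin n) : Ass n K :=
  ∑ i : Fin e, if Sum.inl j ∈ Γ i then
    (let A := readTree K Γ e i (otherEnd (Γ i) (Sum.inl j))
    ((listSign A.1 : ℤ) : K) • A.2) else 0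

variable {K} in
/-- The linear extension of `treeWord` to series of internally trivalent trees. A tree with `m`
internal vertices has `2m + 1` edges and gives words of length `m + 1`, so only one component
contributes to the coefficient of a given word. -/
def treeTuple (c : FormalSum n K) (j : Fin n) : Ass n K := fun w =>
  (c (w.length - 1) (2 * w.length - 1)).sum fun Γ a => a * treeWord K Γ.1 j w

/-! ### One-loop graphs and cyclic words -/

/-- The one-loop graph whose loop passes through all its `k` internal vertices `v_0, …, v_{k-1}`,
where `v_t` is joined to the external vertex `w t`. The edges are ordered as
`v_0 w_0, v_0 v_1, v_1 w_1, v_1 v_2, …, v_{k-1} w_{k-1}, v_{k-1} v_0`. -/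
def hairLoop {k : ℕ} (w : Fin k → Fin n) : EdgeSeq n k (2 * k) := fun i =>
  have hk : (i : ℕ) / 2 < k := by omega
  if (i : ℕ) % 2 = 0 then s(Sum.inr ⟨i / 2, hk⟩, Sum.inl (w ⟨i / 2, hk⟩))
  else s(Sum.inr ⟨i / 2, hk⟩, Sum.inr ⟨(i / 2 + 1) % k, Nat.mod_lt _ (by omega)⟩)

/-- The series consisting of a single graph. -/
def single (Γ : Gph n m e) : FormalSum n K := Pi.single m (Pi.single e (Finsupp.single Γ 1))

/-- The cyclic word `tr(x_{w_1} ⋯ x_{w_k})` of a nonempty word. -/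
def trWord (w : List (Fin n)) (hw : w ≠ []) : Tr n K :=
  tr n K ⟨fun u => if u = w then 1 else 0, if_neg hw.symm⟩

/-- `j` sends the one-loop graph with legs `w_1, …, w_k` to
`(-1)^k tr(x_{w_k} ⋯ x_{w_1}) - tr(x_{w_1} ⋯ x_{w_k})`. -/
def IsCyclicWordMap (j : E₁ n K 1 0 →ₗ[K] Tr n K) : Prop :=
  ∀ (k : ℕ) (w : Fin k → Fin n) (hw : List.ofFn w ≠ []) (hI : IsICG (hairLoop w)),
    ∃ h : toICG n K (single K ⟨hairLoop w, hI⟩) ∈ Z₁ n K 1 0,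
      j (cls₁ n K 1 0 ⟨_, h⟩) =
        (-1 : K) ^ k • trWord K (List.ofFn w).reverse (by simpa using hw) -
          trWord K (List.ofFn w) hw

end KV

/-!
Graphs without internal loops in degree zero are trivalent trees, and those with one internal loop
are closed chains of trivalent trees. Both are read off as words, and the theorem says that these
readings are complete invariants modulo coboundaries.

*Trees.* Rooting a tree at an edge gives a planar binary tree on each side of it (`Full`), together
with a sign comparing the orders of the edges. The tuple of Lie words of all rootings at the
external vertices is `treeWord`; `treePiece` and `psi` extend it linearly. In degree `-1` a tree has
one 4-valent vertex, its differential is the sum of the three splittings of this vertex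
(`mk_splitSum`), and the corresponding words satisfy the Jacobi identity (`Quad.treePiece_sum`).
Hence `psi` is defined on cohomology. The relation `∑ [x_i, a_i] = 0` holds because each edge is
seen from both sides. Conversely, the class of a tree obtained by joining two binary trees is a
function which is antisymmetric, satisfies the Jacobi identity in each argument, and may be rerooted
(`treeClass_isInvariant`); so it factors through Lie words, and a nonzero multiple of the class is
recovered from the words (`recover_treePiece`). This gives injectivity
(`mem_bdPiece_of_treePiece`). For surjectivity, a special derivation with homogeneous components
`a_k` is the image of a multiple of the trees which join a leaf `k` to the right-normed trees of
`a_k`: with the antipode and Dynkin's identity, `∑ [x_i, a_i] = 0` computes the sum of all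
rerootings at a given letter (`sum_reroot_eq_dynkin`).

*Brackets.* Splitting an external vertex of two glued trees without creating loops must join one
edge of each tree at a new trivalent vertex, which produces brackets of the two rooted words.
Summing over all pairs of edges gives the bracket of tangential derivations
(`IsGlue.treePiece_mk_splitSum`, `psi_ihara`), since rerooting after replacing the leaves of a
tree expresses the action of a derivation (`rr_der`).

*Loops.* Walking around the loop of a graph, the product of the Lie words of the trees met is
defined up to rotation, and up to the antipode with a sign when the walk is reversed. The cyclic
word so obtained (`loopPiece`, `loopSeries`, `loopMap`) is again compatible with the three
splittings of a 4-valent vertex (`Quad.loopPiece_sum`): on the loop, this is the identity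
`[s, t] = s t - t s`, and away from it the Jacobi identity. Modulo coboundaries, the same identity
expands every tree with at least two leaves, until only loops with single legs are left. Those are
determined by their cyclic words, so `loopMap` is injective (`IsLoop.ofWords_eq`,
`mem_bdPiece_of_loopPiece`).

*Divergence.* The part of the differential of a tree which creates a loop joins two edges of a
tree at the same external vertex `j`. The cyclic word of the result is the product of the subtrees
along the path between the two edges, and the sum over all paths which end at a leaf `j` is the
right derivative `∂_j` of the rooted word (`Branch.sum_spine`). Hence `d₁` induces the divergence
(`loopPiece_splitSum`, `loopMap_dLoop`). A class survives to the second page exactly when its `d₁`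
is the coboundary of a series of graphs with one loop, which by the injectivity of `loopMap` means
that its divergence vanishes (`map_krvGraph`).
-/

open Sum (inl inr)
open Function (Injective)
open Submodule (smul_mem span_induction subset_span mkQ_surjective span)
open List (finRange ofFn nodup_finRange cons_append nil_append mem_finRange perm_iff_count count_cons
  count_append not_mem_nil nodup_cons append_nil count_nil nodup_append' append_assoc)

namespace KV
open Ass (brk act homPart tderBracket)

/-- Planar binary trees with leaves labelled by external vertices. -/
notation "BTree" n:max => FreeMagma (Fin n)

variable {n m e : ℕ} {Γ Γ' : EdgeSeq n m e} {K : Type*} [Field K] {x y x' y' u u' : Vtx n m}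
variable {i j f g p q a b : Fin e} {w : Fin m} {S S' : Finset (Fin e)} {A A' B l : List (Fin e)}
variable {s t z : BTree n} {ε ε' : ℤ} {L L' : List (Fin e)} {Ts Us : List (BTree n)}

section

/-! ### Noncommutative polynomials -/

variable (n K) in
/-- Noncommutative polynomials in `n` variables. -/
abbrev NCP := MonoidAlgebra K (FreeMonoid (Fin n))

variable {p q : NCP n K} {d d' : ℕ}

/-- The monomial of a word. -/
def wd (w : List (Fin n)) : NCP n K := MonoidAlgebra.single (FreeMonoid.ofList w) 1

theorem wd_append (u v : List (Fin n)) : (wd (u ++ v) : NCP n K) = wd u * wd v := by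
  simp [wd, MonoidAlgebra.single_mul_single]

theorem wd_cons (k : Fin n) (v : List (Fin n)) : (wd (k :: v) : NCP n K) = wd [k] * wd v :=
  wd_append [k] v

theorem wd_nil : (wd [] : NCP n K) = 1 := rfl

theorem NCP.induct {p : NCP n K → Prop} (x : NCP n K) (h0 : p 0)
    (ha : ∀ a b, p a → p b → p (a + b)) (hs : ∀ (c : K) w, p (c • wd w)) : p x := by
  obtain ⟨f⟩ := x
  induction f using Finsupp.induction_linear with
  | zero => exact h0
  | add f g hf hg => exact ha _ _ hf hg
  | single w c =>
    have := hs c w.toList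
    simpa [wd] using this

theorem NCP.lin_ext {M : Type*} [AddCommGroup M] [Module K M] {f g : NCP n K →ₗ[K] M}
    (h : ∀ w, f (wd w) = g (wd w)) : f = g := by
  refine LinearMap.ext fun x => ?_
  induction x using NCP.induct with
  | h0 => simp
  | ha a b ha hb => simp [ha, hb]
  | hs c w => simp [h]

/-- The linear map with given values on monomials. -/
def NCP.lin {M : Type*} [AddCommGroup M] [Module K M] (f : List (Fin n) → M) : NCP n K →ₗ[K] M :=
  (Finsupp.lift M K (FreeMonoid (Fin n)) fun w => f w.toList) ∘ₗ
    (MonoidAlgebra.coeffLinearEquiv K).toLinearMap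

@[simp] theorem NCP.lin_wd {M : Type*} [AddCommGroup M] [Module K M] (f : List (Fin n) → M)
    (w : List (Fin n)) : NCP.lin f (wd w : NCP n K) = f w := by
  simp [NCP.lin, wd]

/-- A polynomial, as a series. -/
def toAss : NCP n K →ₗ[K] Ass n K where
  toFun p w := p.coeff (FreeMonoid.ofList w)
  map_add' p q := by ext w; simp
  map_smul' c p := by ext w; simp

theorem toAss_wd (u w : List (Fin n)) : toAss (wd u : NCP n K) w = if w = u then 1 else 0 := by
  classical
  change (Finsupp.single (FreeMonoid.ofList u) (1 : K)) (FreeMonoid.ofList w) = _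
  rw [Finsupp.single_apply]
  exact if_congr ⟨fun h => (FreeMonoid.ofList.injective h).symm, fun h => by rw [h]⟩ rfl rfl

theorem toAss_injective : Injective (toAss : NCP n K → Ass n K) := by
  intro p q h
  ext w
  exact congrFun h w.toList

theorem Ass.mul_add (a b c : Ass n K) : Ass.mul a (b + c) = Ass.mul a b + Ass.mul a c := by
  ext w
  simp [Ass.mul, _root_.mul_add, sum_add_distrib]

theorem Ass.add_mul (a b c : Ass n K) : Ass.mul (a + b) c = Ass.mul a c + Ass.mul b c := by
  ext w
  simp [Ass.mul, _root_.add_mul, sum_add_distrib]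

theorem Ass.mul_smul (r : K) (a b : Ass n K) : Ass.mul a (r • b) = r • Ass.mul a b := by
  ext w
  simp only [Ass.mul, Pi.smul_apply, smul_eq_mul, mul_sum]
  exact sum_congr rfl fun _ _ => by ring

theorem Ass.smul_mul (r : K) (a b : Ass n K) : Ass.mul (r • a) b = r • Ass.mul a b := by
  ext w
  simp only [Ass.mul, Pi.smul_apply, smul_eq_mul, mul_sum]
  exact sum_congr rfl fun _ _ => by ring

theorem Ass.zero_mul (a : Ass n K) : Ass.mul 0 a = 0 := by
  ext w
  simp [Ass.mul]

theorem Ass.mul_zero (a : Ass n K) : Ass.mul a 0 = 0 := by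
  ext w
  simp [Ass.mul]

theorem toAss_mul (p q : NCP n K) : toAss (p * q) = Ass.mul (toAss p) (toAss q) := by
  induction p using NCP.induct with
  | h0 => simp [Ass.zero_mul]
  | ha a b ha hb => simp only [_root_.add_mul, map_add, ha, hb, Ass.add_mul]
  | hs c u =>
    induction q using NCP.induct with
    | h0 => simp [Ass.mul_zero]
    | ha a b ha hb => simp only [_root_.mul_add, map_add, ha, hb, Ass.mul_add]
    | hs c' v =>
      simp only [smul_mul_assoc, mul_smul_comm, map_smul, Ass.mul_smul, Ass.smul_mul]
      congr 2
      ext w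
      rw [← wd_append, toAss_wd, Ass.mul]
      simp only [toAss_wd]
      split_ifs with h
      · subst h
        rw [Finset.sum_eq_single u.length]
        all_goals grind
      · refine (Finset.sum_eq_zero fun i _ => ?_).symm
        split_ifs with h1 h2
        · exact absurd (by rw [← h1, ← h2, List.take_append_drop]) h
        all_goals simp

instance : LieRing (NCP n K) := LieRing.ofAssociativeRing

instance : LieAlgebra K (NCP n K) := LieAlgebra.ofAssociativeAlgebra

theorem bracket_def (p q : NCP n K) : ⁅p, q⁆ = p * q - q * p :=
  LieRing.of_associative_ring_bracket p q

theorem toAss_brk (p q : NCP n K) : toAss ⁅p, q⁆ = brk (toAss p) (toAss q) := by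
  rw [bracket_def, map_sub, toAss_mul, toAss_mul, brk]

theorem toAss_X (k : Fin n) : toAss (wd [k] : NCP n K) = Ass.X k := by
  ext w
  rw [toAss_wd, Ass.X]

/-! ### Lie words of binary trees -/

/-- The Lie word of a binary tree. -/
def lieW : BTree n → NCP n K
  | .of k => wd [k]
  | .mul s t => ⁅lieW s, lieW t⁆

@[simp] theorem lieW_of (k : Fin n) : (lieW (.of k) : NCP n K) = wd [k] := rfl

@[simp] theorem lieW_mul (s t : BTree n) :
    (lieW (s * t) : NCP n K) = ⁅(lieW s : NCP n K), (lieW t : NCP n K)⁆ := rfl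

theorem isLiePoly_lieW (s : BTree n) : Ass.IsLiePoly (toAss (lieW s : NCP n K)) := by
  induction s with
  | ih1 k => rw [lieW_of, toAss_X]; exact .X k
  | ih2 s t hs ht =>
    rw [lieW_mul, toAss_brk]
    exact hs.brk ht

variable (n K) in
/-- The space of Lie polynomials. -/
abbrev lieSpan : Submodule K (NCP n K) := span K (Set.range lieW)

/-- Lie polynomials are the linear combinations of Lie words. -/
theorem Ass.IsLiePoly.exists_span {a : Ass n K} (h : Ass.IsLiePoly a) :
    ∃ p ∈ lieSpan n K, a = toAss p := by
  induction h with
  | X i => exact ⟨wd [i], subset_span ⟨.of i, rfl⟩, (toAss_X i).symm⟩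
  | zero => exact ⟨0, zero_mem _, by simp⟩
  | add _ _ h1 h2 =>
    obtain ⟨p, hp, rfl⟩ := h1
    obtain ⟨q, hq, rfl⟩ := h2
    exact ⟨p + q, add_mem hp hq, by simp⟩
  | smul c _ h =>
    obtain ⟨p, hp, rfl⟩ := h
    exact ⟨c • p, smul_mem _ c hp, by simp⟩
  | brk _ _ h1 h2 =>
    obtain ⟨p, hp, rfl⟩ := h1
    obtain ⟨q, hq, rfl⟩ := h2
    refine ⟨⁅p, q⁆, ?_, (toAss_brk p q).symm⟩
    refine LinearMap.BilinMap.apply_apply_mem_of_mem_span _ _ _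
      (LinearMap.mul K (NCP n K) - (LinearMap.mul K _).flip) ?_ _ _ hp hq
    rintro _ ⟨s, rfl⟩ _ ⟨t, rfl⟩
    exact subset_span ⟨s * t, rfl⟩

/-- All words of a polynomial have the given length. -/
def IsHomog (d : ℕ) (p : NCP n K) : Prop := ∀ w : List (Fin n), w.length ≠ d → toAss p w = 0

theorem IsHomog.mul (hp : IsHomog d p) (hq : IsHomog d' q) : IsHomog (d + d') (p * q) := by
  intro w hw
  rw [toAss_mul, Ass.mul]
  refine Finset.sum_eq_zero fun i hi => ?_
  by_cases h : (w.take i).length = d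
  · rw [hq, mul_zero]
    simp only [List.length_take, List.length_drop, mem_range] at *
    omega
  · rw [hp _ h, zero_mul]

theorem IsHomog.sub (hp : IsHomog d p) (hq : IsHomog d q) : IsHomog d (p - q) := by
  intro w hw
  rw [map_sub, Pi.sub_apply, hp w hw, hq w hw, sub_zero]

theorem isHomog_wd (u : List (Fin n)) : IsHomog u.length (wd u : NCP n K) := by
  intro w hw
  rw [toAss_wd, if_neg]
  rintro rfl
  exact hw rfl

theorem isHomog_lieW (s : BTree n) : IsHomog s.length (lieW s : NCP n K) := by
  induction s with
  | ih1 k => exact isHomog_wd [k]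
  | ih2 s t hs ht =>
    change IsHomog (s.length + t.length) _
    rw [lieW_mul, bracket_def]
    exact (hs.mul ht).sub (by rw [add_comm]; exact ht.mul hs)

/-- The constant term. -/
def aug : NCP n K →ₗ[K] K := LinearMap.proj [] ∘ₗ toAss

theorem aug_wd (w : List (Fin n)) : aug (wd w : NCP n K) = if w = [] then 1 else 0 := by
  change toAss (wd w) [] = _
  rw [toAss_wd]
  exact if_congr eq_comm rfl rfl

theorem aug_lieW (s : BTree n) : aug (lieW s : NCP n K) = 0 :=
  isHomog_lieW s [] (by have := s.length_pos; simp; omega)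

/-- The right partial derivative `∂_k`. -/
def pdP (k : Fin n) : NCP n K →ₗ[K] NCP n K :=
  NCP.lin fun w => if w.getLast? = some k then wd w.dropLast else 0

theorem pdP_concat (k j : Fin n) (u : List (Fin n)) :
    pdP k (wd (u ++ [j]) : NCP n K) = if j = k then wd u else 0 := by
  simp [pdP]

theorem toAss_pdP (k : Fin n) (p : NCP n K) : toAss (pdP k p) = Ass.pd k (toAss p) := by
  have : (toAss ∘ₗ pdP k : NCP n K →ₗ[K] Ass n K) =
      LinearMap.funLeft K K (fun w => w ++ [k]) ∘ₗ toAss := by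
    refine NCP.lin_ext fun w => ?_
    ext v
    simp only [LinearMap.comp_apply, LinearMap.funLeft_apply, toAss_wd]
    rcases List.eq_nil_or_concat w with rfl | ⟨u, j, rfl⟩
    · simp [pdP]
    · rw [List.concat_eq_append, pdP_concat]
      by_cases h : j = k
      · subst h
        simp [toAss_wd]
      · simp only [h, if_false, map_zero, Pi.zero_apply]
        rw [if_neg]
        intro h'
        have := List.append_inj_right' h' rfl
        simp at this
        exact h this.symm
  exact LinearMap.congr_fun this p

theorem pdP_mul (k : Fin n) (p q : NCP n K) : pdP k (p * q) = p * pdP k q + aug q • pdP k p := by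
  have key : ∀ u v, pdP k (wd u * wd v : NCP n K) =
      wd u * pdP k (wd v) + aug (wd v : NCP n K) • pdP k (wd u) := by
    intro u v
    rcases List.eq_nil_or_concat v with rfl | ⟨v, j, rfl⟩
    · rw [wd_nil, mul_one, ← wd_nil, aug_wd]
      simp [pdP]
    · rw [List.concat_eq_append, ← wd_append, ← append_assoc, pdP_concat, pdP_concat,
        aug_wd, if_neg (show ¬ v ++ [j] = [] by simp), zero_smul, add_zero]
      split_ifs
      · rw [wd_append]
      · simp
  induction q using NCP.induct with
  | h0 => simp
  | ha a b ha hb => simp only [mul_add, map_add, ha, hb, add_smul]; abel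
  | hs c v =>
    induction p using NCP.induct with
    | h0 => simp
    | ha a b ha hb => simp only [add_mul, map_add, ha, hb, smul_add]; abel
    | hs c' u =>
      simp only [smul_mul_assoc, mul_smul_comm, map_smul, key, smul_eq_mul]
      module

/-- The commutator with `x`, as a linear map. -/
def adl (x : NCP n K) : NCP n K →ₗ[K] NCP n K :=
  LinearMap.mulLeft K x - LinearMap.mulRight K x

@[simp] theorem adl_apply (x y : NCP n K) : adl x y = ⁅x, y⁆ := rfl

/-! ### Rerooting -/

section Reroot

variable {M : Type*} [AddCommGroup M] [Module K M]

/-- Sum over the leaves of a tree `s`: with a tree `z` attached at the root of `s`, each leaf `j`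
contributes `F j` of the Lie word of the tree rerooted at this leaf. It is a linear function of the
Lie word of `z`. -/
def rr (F : Fin n → NCP n K →ₗ[K] M) : BTree n → (NCP n K →ₗ[K] M)
  | .of j => F j
  | .mul s t => rr F s ∘ₗ adl (lieW t) - rr F t ∘ₗ adl (lieW s)

@[simp] theorem rr_of (F : Fin n → NCP n K →ₗ[K] M) (j : Fin n) : rr F (.of j) = F j := rfl

theorem rr_mul (F : Fin n → NCP n K →ₗ[K] M) (s t : BTree n) (y : NCP n K) :
    rr F (s * t) y = rr F s ⁅(lieW t : NCP n K), y⁆ + rr F t ⁅y, (lieW s : NCP n K)⁆ := by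
  change rr F s ⁅(lieW t : NCP n K), y⁆ - rr F t ⁅(lieW s : NCP n K), y⁆ = _
  rw [← lie_skew y, map_neg, sub_eq_add_neg]

theorem rr_ad (s : BTree n) (y : NCP n K) : rr (fun j => (adl (wd [j]) : NCP n K →ₗ[K] NCP n K)) s y
    = ⁅(lieW s : NCP n K), y⁆ := by
  induction s generalizing y with
  | ih1 j => rfl
  | ih2 s t hs ht =>
    refine (rr_mul _ s t y).trans ?_
    rw [hs, ht]
    rw [lieW_mul, lie_lie, ← lie_skew (lieW s) y, lie_neg]
    abel

theorem rr_jacobi (F : Fin n → NCP n K →ₗ[K] M) (a b c : BTree n) (y : NCP n K) :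
    rr F ((a * b) * c) y + rr F ((b * c) * a) y + rr F ((c * a) * b) y = 0 := by
  simp only [rr_mul, lieW_mul]
  have key : ∀ (a b c : BTree n), rr F a ⁅(lieW b : NCP n K), ⁅(lieW c : NCP n K), y⁆⁆ +
      rr F a ⁅⁅(lieW b : NCP n K), y⁆, (lieW c : NCP n K)⁆ +
        rr F a ⁅y, ⁅(lieW b : NCP n K), (lieW c : NCP n K)⁆⁆ = 0 := by
    intro a b c
    rw [← map_add, ← map_add]
    convert map_zero (rr F a)
    simp only [bracket_def]
    noncomm_ring
  have h1 := key a b c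
  have h2 := key b c a
  have h3 := key c a b
  have := congrArg₂ (· + ·) (congrArg₂ (· + ·) h1 h2) h3
  simp only [add_zero] at this
  rw [← this]
  abel

end Reroot

/-- The adjoint action of polynomials: `x_{i_1} ⋯ x_{i_d}` acts by
`ad(x_{i_1}) ⋯ ad(x_{i_d})`. -/
def adP : NCP n K →ₐ[K] Module.End K (NCP n K) :=
  MonoidAlgebra.lift K _ _ (FreeMonoid.lift fun k => adl (wd [k]))

theorem adP_var (k : Fin n) (y : NCP n K) : adP (wd [k]) y = ⁅(wd [k] : NCP n K), y⁆ := by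
  simp only [adP, wd, MonoidAlgebra.lift_single, one_smul]
  erw [FreeMonoid.lift_eval_of]
  rfl

theorem adP_lieW (s : BTree n) (y : NCP n K) : adP (lieW s) y = ⁅(lieW s : NCP n K), y⁆ := by
  induction s generalizing y with
  | ih1 k => exact adP_var k y
  | ih2 s t hs ht =>
    rw [lieW_mul, bracket_def (lieW s), map_sub, map_mul, map_mul]
    simp only [LinearMap.sub_apply, Module.End.mul_apply, hs, ht]
    rw [← bracket_def, lie_lie]

/-- The antipode `x_{i_1} ⋯ x_{i_d} ↦ (-1)^d x_{i_d} ⋯ x_{i_1}`, with values in the opposite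
algebra. -/
def antipode : NCP n K →ₐ[K] (NCP n K)ᵐᵒᵖ :=
  MonoidAlgebra.lift K _ _ (FreeMonoid.lift fun k => MulOpposite.op (-(wd [k])))

/-- The antipode, as a linear map. -/
def anti : NCP n K →ₗ[K] NCP n K :=
  (MulOpposite.opLinearEquiv K).symm.toLinearMap ∘ₗ antipode.toLinearMap

theorem anti_var (k : Fin n) : anti (wd [k] : NCP n K) = -wd [k] := by
  change MulOpposite.unop (antipode (wd [k])) = _
  simp only [antipode, wd, MonoidAlgebra.lift_single, one_smul]
  erw [FreeMonoid.lift_eval_of]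
  rfl

theorem anti_mul (p q : NCP n K) : anti (p * q) = anti q * anti p := by
  change MulOpposite.unop (antipode (p * q)) = _
  rw [map_mul]
  rfl

theorem anti_lieW (s : BTree n) : anti (lieW s : NCP n K) = -lieW s := by
  induction s with
  | ih1 k => exact anti_var k
  | ih2 s t hs ht =>
    rw [lieW_mul, bracket_def, map_sub, anti_mul, anti_mul, hs, ht, neg_mul_neg,
      neg_mul_neg, neg_sub]

/-- The functional that keeps the leaves `k` in `rr`. -/
def dl (k : Fin n) : Fin n → NCP n K →ₗ[K] NCP n K := fun j => if j = k then LinearMap.id else 0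

/-- `rr (dl k) s` depends only on the Lie word of `s`, and linearly so. -/
theorem rr_dl (k : Fin n) (s : BTree n) (y : NCP n K) :
    rr (dl k) s y = adP (anti (pdP k (lieW s))) y := by
  induction s generalizing y with
  | ih1 j =>
    rw [rr_of, lieW_of, show [j] = [] ++ [j] from rfl, pdP_concat, dl]
    split_ifs
    · have h1 : anti (1 : NCP n K) = 1 := by
        change MulOpposite.unop (antipode 1) = _
        rw [map_one]; rfl
      rw [wd_nil, h1, map_one]; rfl
    · simp
  | ih2 s t hs ht =>
    refine (rr_mul _ s t y).trans ?_
    have h1 : pdP k (lieW (s * t) : NCP n K) =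
        lieW s * pdP k (lieW t) - lieW t * pdP k (lieW s) := by
      rw [lieW_mul, bracket_def, map_sub, pdP_mul, pdP_mul, aug_lieW, aug_lieW]
      simp
    have h2 : anti (pdP k (lieW (s * t) : NCP n K)) =
        anti (pdP k (lieW s)) * lieW t - anti (pdP k (lieW t)) * lieW s := by
      rw [h1, map_sub, anti_mul, anti_mul, anti_lieW, anti_lieW, mul_neg, mul_neg]
      abel
    rw [h2, map_sub, map_mul, map_mul, LinearMap.sub_apply, Module.End.mul_apply,
      Module.End.mul_apply, adP_lieW, adP_lieW, hs, ht, ← lie_skew y, map_neg, sub_eq_add_neg]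

/-! ### The Dynkin operator -/

/-- The right-normed binary tree `[k, [l_1, [l_2, …]]]`. -/
def comb : Fin n → List (Fin n) → BTree n
  | k, [] => .of k
  | k, l :: ls => .of k * comb l ls

/-- The Dynkin operator: a word is mapped to its right-normed bracket. -/
def dynkin : NCP n K →ₗ[K] NCP n K :=
  NCP.lin fun w => match w with
    | [] => 0
    | k :: l => lieW (comb k l)

theorem dynkin_cons (k : Fin n) (l : List (Fin n)) :
    dynkin (wd (k :: l) : NCP n K) = lieW (comb k l) := by
  rw [dynkin, NCP.lin_wd]

theorem adP_wd_cons (k : Fin n) (u : List (Fin n)) (y : NCP n K) :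
    adP (wd (k :: u)) y = ⁅(wd [k] : NCP n K), adP (wd u) y⁆ := by
  rw [wd_cons, map_mul, Module.End.mul_apply, adP_var]

theorem dynkin_mul (p q : NCP n K) : dynkin (p * q) = adP p (dynkin q) + aug q • dynkin p := by
  have key : ∀ u v, dynkin (wd u * wd v : NCP n K) =
      adP (wd u) (dynkin (wd v)) + aug (wd v : NCP n K) • dynkin (wd u) := by
    intro u v
    rcases v with _ | ⟨j, v⟩
    · rw [wd_nil, mul_one, ← wd_nil, aug_wd, if_pos rfl, one_smul]
      simp [dynkin]
    · rw [← wd_append, aug_wd, if_neg (by simp), zero_smul, add_zero]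
      induction u with
      | nil => rw [wd_nil, map_one]; rfl
      | cons k u ih =>
        rw [adP_wd_cons, ← ih]
        rcases u with _ | ⟨l, u⟩
        · simp only [nil_append, cons_append, dynkin_cons]
          rfl
        · simp only [cons_append, dynkin_cons]
          rfl
  induction q using NCP.induct with
  | h0 => simp
  | ha a b ha hb => simp only [mul_add, map_add, ha, hb, add_smul]; abel
  | hs c v =>
    induction p using NCP.induct with
    | h0 => simp
    | ha a b ha hb => simp only [add_mul, map_add, ha, hb, smul_add, LinearMap.add_apply]; abel
    | hs c' u =>
      simp only [smul_mul_assoc, mul_smul_comm, map_smul, key, smul_eq_mul, LinearMap.smul_apply]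
      module

/-- Dynkin's identity. -/
theorem dynkin_lieW (s : BTree n) : dynkin (lieW s : NCP n K) = (s.length : K) • lieW s := by
  induction s with
  | ih1 k => change dynkin (wd [k]) = ((1 : ℕ) : K) • wd [k]; rw [dynkin_cons]; simp [comb]
  | ih2 s t hs ht =>
    change dynkin _ = ((s.length + t.length : ℕ) : K) • lieW (s * t)
    rw [lieW_mul, bracket_def, map_sub, dynkin_mul, dynkin_mul, aug_lieW, aug_lieW, hs, ht,
      zero_smul, zero_smul, add_zero, add_zero, map_smul, map_smul, adP_lieW, adP_lieW,
      ← lie_skew (lieW s), Nat.cast_add, add_smul, ← bracket_def, ← lie_skew (lieW s)]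
    module

theorem toAss_lin_length (p : NCP n K) (u : List (Fin n)) :
    toAss (NCP.lin (fun w => (w.length : K) • wd w) p) u = u.length * toAss p u := by
  induction p using NCP.induct with
  | h0 => simp
  | ha a b ha hb => simp only [map_add, Pi.add_apply, ha, hb, mul_add]
  | hs c u =>
    simp only [map_smul, NCP.lin_wd, Pi.smul_apply, toAss_wd, smul_eq_mul]
    grind

theorem IsHomog.lin_length (hd : IsHomog d p) :
    NCP.lin (fun w => (w.length : K) • wd w) p = (d : K) • p := by
  refine toAss_injective (funext fun w => ?_)
  rw [toAss_lin_length, map_smul, Pi.smul_apply, smul_eq_mul]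
  by_cases h : w.length = d
  · rw [h]
  · rw [hd w h, mul_zero, mul_zero]

theorem dynkin_of_mem_span (hp : p ∈ lieSpan n K) (hd : IsHomog d p) :
    dynkin p = (d : K) • p := by
  refine (LinearMap.eqOn_span (g := NCP.lin fun w => (w.length : K) • wd w) ?_ hp).trans
    hd.lin_length
  rintro _ ⟨s, rfl⟩
  rw [dynkin_lieW, (isHomog_lieW s).lin_length]

theorem anti_of_mem_span (hp : p ∈ lieSpan n K) : anti p = -p :=
  LinearMap.eqOn_span (g := -LinearMap.id) (by rintro _ ⟨s, rfl⟩; exact anti_lieW s) hp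

theorem aug_of_mem_span (hp : p ∈ lieSpan n K) : aug p = 0 :=
  LinearMap.eqOn_span (g := 0) (by rintro _ ⟨s, rfl⟩; exact aug_lieW s) hp

/-- If `∑ [x_i, p_i] = 0` for Lie polynomials `p_i`, then `p_k = ∑ x_i (∂_k p_i)`; applying the
antipode and the Dynkin operator computes the sum of all rerootings at the letter `k`. -/
theorem sum_reroot_eq_dynkin {p : Fin n → NCP n K} (hp : ∀ i, p i ∈ lieSpan n K)
    (h : ∑ i, ⁅(wd [i] : NCP n K), p i⁆ = 0) (k : Fin n) :
    ∑ i, adP (anti (pdP k (p i))) (wd [i]) = dynkin (p k) := by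
  have h1 : p k = ∑ i, wd [i] * pdP k (p i) := by
    have := congrArg (pdP k) h
    rw [map_sum, map_zero] at this
    simp only [bracket_def, map_sub, pdP_mul, aug_of_mem_span (hp _), zero_smul, add_zero] at this
    rw [sum_sub_distrib, sub_eq_zero] at this
    rw [this]
    have : ∀ j, pdP k (wd [j] : NCP n K) = if j = k then 1 else 0 := fun j => by
      have := pdP_concat (K := K) k j []
      simpa [wd_nil] using this
    simp only [this, aug_wd]
    simp
  have h2 : p k = ∑ i, anti (pdP k (p i)) * wd [i] := by
    have := congrArg anti h1
    rw [anti_of_mem_span (hp k), map_sum] at this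
    simp only [anti_mul, anti_var, mul_neg, sum_neg_distrib, neg_inj] at this
    exact this
  conv_rhs => rw [h2]
  rw [map_sum]
  refine sum_congr rfl fun i _ => ?_
  rw [dynkin_mul, aug_wd, if_neg (by simp), zero_smul, add_zero, dynkin_cons]
  rfl

/-! ### Derivations -/

/-- The values on words of the derivation `x_k ↦ y_k`. -/
def derW (y : Fin n → NCP n K) : List (Fin n) → NCP n K
  | [] => 0
  | k :: u => y k * wd u + wd [k] * derW y u

/-- The derivation of the algebra of noncommutative polynomials with `x_k ↦ y_k`. -/
def der (y : Fin n → NCP n K) : NCP n K →ₗ[K] NCP n K := NCP.lin (derW y)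

theorem der_mul (y : Fin n → NCP n K) (p q : NCP n K) :
    der y (p * q) = der y p * q + p * der y q := by
  induction q using NCP.induct with
  | h0 => simp
  | ha a b ha hb => simp only [mul_add, map_add, ha, hb]; abel
  | hs c v =>
    induction p using NCP.induct with
    | h0 => simp
    | ha a b ha hb => simp only [add_mul, map_add, ha, hb]; abel
    | hs c' u =>
      simp only [smul_mul_assoc, mul_smul_comm, map_smul, ← smul_add]
      congr 2
      rw [← wd_append, der, NCP.lin_wd, NCP.lin_wd, NCP.lin_wd]
      induction u with
      | nil => simp [derW, wd_nil]
      | cons k u ih =>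
        rw [cons_append, derW, ih, derW, wd_append, wd_cons k u]
        noncomm_ring

theorem der_lie (y : Fin n → NCP n K) (p q : NCP n K) :
    der y ⁅p, q⁆ = ⁅der y p, q⁆ + ⁅p, der y q⁆ := by
  simp only [bracket_def, map_sub, der_mul]
  abel

theorem der_var (y : Fin n → NCP n K) (k : Fin n) : der y (wd [k]) = y k := by
  simp [der, derW, wd_nil]

theorem Ass.act_add_right (a : Fin n → Ass n K) (b c : Ass n K) :
    act a (b + c) = act a b + act a c := by
  ext w
  simp only [act, Pi.add_apply, _root_.add_mul, sum_add_distrib]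

theorem Ass.act_smul_right (a : Fin n → Ass n K) (r : K) (b : Ass n K) :
    act a (r • b) = r • act a b := by
  ext w
  simp only [act, Pi.smul_apply, smul_eq_mul, mul_sum, mul_assoc]

theorem X_mul_cons (i j : Fin n) (c : Ass n K) (v : List (Fin n)) :
    Ass.mul (Ass.X i) c (j :: v) = if j = i then c v else 0 := by
  rw [Ass.mul, Finset.sum_eq_single 1]
  · simp [Ass.X]
  · rintro (_ | _ | r) hr hne
    · simp [Ass.X]
    · exact absurd rfl hne
    · rcases v with _ | ⟨k, v⟩
      · simp at hr
      · simp [Ass.X]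
  · simp

theorem act_toAss (A : Fin n → NCP n K) (p : NCP n K) :
    act (fun k => toAss (A k)) (toAss p) = toAss (der (fun k => ⁅(wd [k] : NCP n K), A k⁆) p) := by
  induction p using NCP.induct with
  | h0 =>
    rw [map_zero, map_zero, map_zero]
    ext w
    simp [act]
  | ha a b ha hb => simp only [map_add, ha, hb, Ass.act_add_right]
  | hs c u =>
    simp only [map_smul, Ass.act_smul_right]
    congr 1
    rw [der, NCP.lin_wd]
    have hy : ∀ i, brk (Ass.X i) (toAss (A i)) = toAss ⁅(wd [i] : NCP n K), A i⁆ := by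
      intro i
      rw [toAss_brk, toAss_X]
    ext w
    simp only [act, hy, toAss_wd]
    induction u generalizing w with
    | nil => simp [derW]
    | cons k u ih =>
      rw [derW, map_add, toAss_mul, toAss_mul, Finset.sum_range_succ', add_comm, Pi.add_apply]
      congr 1
      · simp only [Ass.mul, List.take_zero, nil_append, List.drop_zero, zero_add, Nat.sub_zero,
          toAss_wd, cons_append, List.cons.injEq]
        refine sum_congr rfl fun t _ => ?_
        rw [Finset.sum_eq_single k]
        all_goals grind
      · rcases w with _ | ⟨c, w⟩
        · simp [Ass.mul, toAss_wd]
        · rw [toAss_X, X_mul_cons]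
          simp only [List.length_cons, List.take_succ_cons, cons_append, List.cons.injEq]
          split_ifs with hc
          · grind
          · exact sum_eq_zero fun s _ => sum_eq_zero fun t _ => sum_eq_zero fun i _ => by
              simp [hc]

/-- Replacing in turn each leaf `j` of the tree `s` (with `z` attached at its root) by `y_j`, and
rerooting at the other leaves `k`. -/
theorem rr_der (y : Fin n → NCP n K) (k : Fin n) (s z : BTree n) : rr
    (fun j => (LinearMap.applyₗ (y j) ∘ₗ adP.toLinearMap) ∘ₗ anti ∘ₗ pdP k) s (lieW z) = rr (dl k) z
    (der y (lieW s)) + der y (rr (dl k) s (lieW z)) - rr (dl k) s (der y (lieW z)) := by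
  induction s generalizing z with
  | ih1 j =>
    change adP (anti (pdP k (lieW z))) (y j) = rr (dl k) z (der y (wd [j])) +
      der y (dl k j (lieW z)) - dl k j (der y (lieW z))
    rw [der_var, rr_dl, dl]
    split_ifs <;> simp
  | ih2 s t hs ht =>
    refine (rr_mul _ s t _).trans ?_
    rw [← lieW_mul t z, ← lieW_mul z s, hs, ht]
    simp only [rr_mul, lieW_mul, der_lie, map_add]
    abel

end

section

/-! ### Signs of orderings of the edges -/

variable {l' : List (Fin e)} {k : ℕ}

/-- The number of inversions between two lists. -/
def cross (A B : List (Fin e)) : ℕ := (A.map fun a => B.countP fun b => b < a).sum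

theorem cross_cons (a : Fin e) (A B : List (Fin e)) :
    cross (a :: A) B = (B.countP fun b => b < a) + cross A B := rfl

theorem cross_append_right (A B B' : List (Fin e)) :
    cross A (B ++ B') = cross A B + cross A B' := by
  induction A with
  | nil => rfl
  | cons a A ih => simp only [cross_cons, List.countP_append, ih]; omega

theorem listSign_append (A B : List (Fin e)) :
    listSign (A ++ B) = listSign A * listSign B * (-1) ^ cross A B := by
  induction A with
  | nil => simp [listSign, cross]
  | cons a A ih =>
    simp only [cons_append, listSign, ih, cross_cons, List.countP_append, pow_add]
    ring

theorem cross_add_cross (h : List.Disjoint A B) : cross A B + cross B A = A.length * B.length := by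
  induction A with
  | nil =>
    have : ∀ B : List (Fin e), cross B [] = 0 := by intro B; simp [cross]
    rw [this]
    simp [cross]
  | cons a A ih =>
    have h1 : ∀ B : List (Fin e), a ∉ B → (B.countP fun b => b < a) + cross B [a] = B.length := by
      intro B hB
      induction B with
      | nil => rfl
      | cons b B ih =>
        simp only [List.mem_cons, not_or] at hB
        have := ih hB.2
        simp only [List.countP_cons, cross_cons, List.countP_nil, List.length_cons, zero_add]
        grind
    have h2 := ih (List.disjoint_of_disjoint_cons_left h)
    have h3 := h1 B (List.disjoint_cons_left.1 h).1
    have h4 : cross B (a :: A) = cross B [a] + cross B A := cross_append_right B [a] A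
    rw [cross_cons, h4, List.length_cons, Nat.succ_mul]
    omega

/-- Exchanging two neighbouring blocks changes the sign by the product of their lengths. -/
theorem listSign_swap (P A B Q : List (Fin e)) (h : (P ++ (A ++ (B ++ Q))).Nodup) : listSign
    (P ++ (A ++ (B ++ Q))) = (-1) ^ (A.length * B.length) * listSign (P ++ (B ++ (A ++ Q))) := by
  have hd : List.Disjoint A B := by
    rw [nodup_append', nodup_append'] at h
    exact fun x hA hB => h.2.1.2.2 hA (List.mem_append_left _ hB)
  rw [← cross_add_cross hd]
  have h2 : ((-1 : ℤ) ^ cross B A) * (-1) ^ cross B A = 1 := by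
    rw [← mul_pow]; simp
  simp only [listSign_append, cross_append_right, pow_add]
  linear_combination (-1 : ℤ) * (listSign P * (listSign A * (listSign B * listSign Q *
    (-1) ^ cross B Q) * ((-1) ^ cross A B * (-1) ^ cross A Q)) *
      ((-1) ^ cross P A * ((-1) ^ cross P B * (-1) ^ cross P Q))) * h2

theorem listSign_swap_odd (P A B Q : List (Fin e)) (h : (P ++ (A ++ (B ++ Q))).Nodup)
    (hA : Odd A.length) (hB : Odd B.length) :
    listSign (P ++ (A ++ (B ++ Q))) = - listSign (P ++ (B ++ (A ++ Q))) := by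
  rw [listSign_swap P A B Q h, (hA.mul hB).neg_one_pow, neg_one_mul]

theorem listSign_swap_even (P A B Q : List (Fin e)) (h : (P ++ (A ++ (B ++ Q))).Nodup)
    (hA : Even (A.length * B.length)) : listSign (P ++ (A ++ (B ++ Q))) = listSign
    (P ++ (B ++ (A ++ Q))) := by
  rw [listSign_swap P A B Q h, hA.neg_one_pow, one_mul]

theorem listSign_mul_self (l : List (Fin e)) : listSign l * listSign l = 1 := by
  induction l with
  | nil => rfl
  | cons a l ih =>
    rw [listSign, mul_mul_mul_comm, ih, mul_one, ← mul_pow]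
    simp

theorem neg_one_pow_countP_ofFn (a : Fin e) (g : Fin k → Fin e) : (-1 : ℤ) ^
    ((ofFn g).countP fun b => b < a) = ∏ j, if a < g j then 1 else if g j < a then -1 else 1 := by
  induction k with
  | zero => simp
  | succ k ih =>
    rw [List.ofFn_succ, List.countP_cons, Fin.prod_univ_succ, pow_add, ih, mul_comm]
    grind

theorem listSign_ofFn (f : Fin k → Fin e) :
    listSign (ofFn f) = ∏ i, ∏ j ∈ Ioi i, if f i < f j then 1 else if f j < f i then -1 else 1 := by
  induction k with
  | zero => simp [listSign]
  | succ k ih =>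
    rw [List.ofFn_succ, listSign, ih, Fin.prod_univ_succ, Fin.prod_Ioi_zero,
      neg_one_pow_countP_ofFn]
    simp only [Fin.prod_Ioi_succ]

theorem listSign_perm (σ : Equiv.Perm (Fin e)) : listSign (ofFn σ) = Equiv.Perm.sign σ := by
  rw [listSign_ofFn, Equiv.Perm.sign_eq_prod_prod_Ioi, Units.coe_prod]
  refine prod_congr rfl fun i _ => ?_
  rw [Units.coe_prod]
  refine prod_congr rfl fun j hj => ?_
  have : i ≠ j := (mem_Ioi.1 hj).ne
  by_cases h : σ i < σ j
  · simp [h]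
  · have : σ j < σ i := lt_of_le_of_ne (not_lt.1 h) fun hc => this (σ.injective hc.symm)
    simp [h, this]

/-- A complete list of the edges is a permutation. -/
theorem exists_perm_of_complete (h : l.Perm (finRange e)) :
    ∃ σ : Equiv.Perm (Fin e), l = ofFn σ := by
  have hl : l.length = e := by rw [h.length_eq, List.length_finRange]
  have hn : l.Nodup := h.nodup_iff.2 (nodup_finRange e)
  have hinj : Injective fun i : Fin e => l.get (i.cast hl.symm) := by
    intro i j hij
    have := (List.nodup_iff_injective_get.1 hn) hij
    simpa using this
  refine ⟨Equiv.ofBijective _ (Finite.injective_iff_bijective.1 hinj), ?_⟩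
  apply List.ext_get
  · simp [hl]
  · intro i h1 h2
    simp

/-- Two complete lists of the edges, in graphs with the same number of edges, differ by a
permutation. -/
theorem exists_perm_map (h : l.Perm (finRange e)) (h' : l'.Perm (finRange e)) : ∃ σ : Equiv.Perm
    (Fin e), l' = l.map σ ∧ listSign l' = Equiv.Perm.sign σ * listSign l := by
  obtain ⟨σ, rfl⟩ := exists_perm_of_complete h
  obtain ⟨τ, rfl⟩ := exists_perm_of_complete h'
  refine ⟨τ * σ⁻¹, ?_, ?_⟩
  · rw [List.map_ofFn]
    congr 1
    ext i
    simp
  · rw [listSign_perm, listSign_perm, Equiv.Perm.sign_mul, Equiv.Perm.sign_inv]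
    push_cast
    rw [mul_assoc]
    simp

theorem listSign_map (h : l.Perm (finRange e)) (σ : Equiv.Perm (Fin e)) :
    listSign (l.map σ) = Equiv.Perm.sign σ * listSign l := by
  obtain ⟨τ, rfl⟩ := exists_perm_of_complete h
  have : List.map σ (ofFn τ) = ofFn (σ * τ) := by
    rw [List.map_ofFn]
    rfl
  rw [this, listSign_perm, listSign_perm, Equiv.Perm.sign_mul, Units.val_mul]

theorem perm_map_finRange (h : l.Perm (finRange e))
    (σ : Equiv.Perm (Fin e)) : (l.map σ).Perm (finRange e) :=
  (List.perm_of_nodup_nodup_toFinset_eq ((h.nodup_iff.2 (nodup_finRange e)).map σ.injective)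
    (nodup_finRange e) (by
      ext x
      simp only [List.mem_toFinset, List.mem_map, mem_finRange, iff_true]
      exact ⟨σ⁻¹ x, h.mem_iff.2 (mem_finRange _), by simp⟩))

end

section

/-! ### Reading trees and loops off a graph -/

variable {v : Fin m} {f' g' h : Fin e} {M : List (Fin e)}
variable {s' t' : BTree n} {α : Type*} {a : ℤ}
variable {σ : Equiv.Perm (Fin e)} {τ : Equiv.Perm (Fin m)}

/-- The internal vertex `v` is trivalent, and its three edges are `i`, `f`, `g`. -/
def Tri (Γ : EdgeSeq n m e) (v : Fin m) (i f g : Fin e) : Prop :=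
  i ≠ f ∧ i ≠ g ∧ f ≠ g ∧ ∀ h, inr v ∈ Γ h ↔ h = i ∨ h = f ∨ h = g

theorem Tri.rot (h : Tri Γ v i f g) : Tri Γ v f g i :=
  ⟨h.2.2.1, h.1.symm, h.2.1.symm, fun a => by rw [h.2.2.2]; tauto⟩

theorem Tri.swap (h : Tri Γ v i f g) : Tri Γ v i g f :=
  ⟨h.2.1, h.1, h.2.2.1.symm, fun a => by rw [h.2.2.2]; tauto⟩

theorem Tri.eq_or_eq (h : Tri Γ v i f g)
    (h' : Tri Γ v i f' g') : (f' = f ∧ g' = g) ∨ (f' = g ∧ g' = f) := by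
  have h1 := (h.2.2.2 f').1 ((h'.2.2.2 f').2 (by tauto))
  have h2 := (h.2.2.2 g').1 ((h'.2.2.2 g').2 (by tauto))
  obtain ⟨a1, a2, a3, -⟩ := h
  obtain ⟨b1, b2, b3, -⟩ := h'
  grind

/-- `Branch Γ x i A s`: the part of `Γ` beyond the end `x` of the edge `i` is the binary tree `s`,
and `A` lists its edges (without `i`), root edge, left subtree, right subtree at each node. -/
inductive Branch (Γ : EdgeSeq n m e) :
    Vtx n m → Fin e → List (Fin e) → BTree n → Prop
  | leaf (k : Fin n) (i : Fin e) : Branch Γ (inl k) i [] (FreeMagma.of k)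
  | node {v : Fin m} {i f g : Fin e} {x y : Vtx n m} {A B : List (Fin e)}
      {s t : BTree n} (hv : Tri Γ v i f g) (hf : Γ f = s(inr v, x))
      (hg : Γ g = s(inr v, y)) (h1 : Branch Γ x f A s) (h2 : Branch Γ y g B t) :
      Branch Γ (inr v) i (f :: (A ++ g :: B)) (s * t)

theorem Branch.inl_inv {k : Fin n} (h : Branch Γ (inl k) i A s) : A = [] ∧ s = FreeMagma.of k := by
  cases h
  exact ⟨rfl, rfl⟩

theorem Branch.inr_inv (h : Branch Γ (inr v) i A s) : ∃ f g x y A₁ A₂ s₁ s₂, Tri Γ v i f g ∧ Γ f =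
    s(inr v, x) ∧ Γ g = s(inr v, y) ∧ Branch Γ x f A₁ s₁ ∧ Branch Γ y g A₂ s₂ ∧ A = f ::
    (A₁ ++ g :: A₂) ∧ s = s₁ * s₂ := by
  cases h with
  | node hv hf hg h1 h2 => exact ⟨_, _, _, _, _, _, _, _, hv, hf, hg, h1, h2, rfl, rfl⟩

theorem mul_inj_magma (h : s * t = s' * t') : s = s' ∧ t = t' := by
  injection h with h1 h2
  exact ⟨h1, h2⟩

theorem Branch.even (h : Branch Γ x i A s) : Even A.length := by
  induction h with
  | leaf => simp
  | node _ _ _ _ _ ih1 ih2 =>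
    grind

theorem Branch.length_eq (h : Branch Γ x i A s) : A.length + 2 = 2 * s.length := by
  induction h with
  | leaf => simp [FreeMagma.length]
  | @node _ _ _ _ _ _ _ _ s t _ _ _ _ _ ih1 ih2 =>
    simp only [List.length_cons, List.length_append]
    have : (s * t).length = s.length + t.length := rfl
    omega

/-- `Flip s s' δ`: the tree `s'` arises from `s` by exchanging subtrees at the nodes, and `δ` is
the resulting sign for antisymmetric products. -/
inductive Flip : BTree n → BTree n → ℤ → Prop
  | of (k : Fin n) : Flip (FreeMagma.of k) (FreeMagma.of k) 1
  | mul {s s' t t' : BTree n} {a b : ℤ} (h1 : Flip s s' a) (h2 : Flip t t' b) :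
      Flip (s * t) (s' * t') (a * b)
  | swap {s s' t t' : BTree n} {a b : ℤ} (h1 : Flip s s' a) (h2 : Flip t t' b) :
      Flip (s * t) (t' * s') (-(a * b))

theorem Flip.lieW (h : Flip s s' a) : (lieW s : NCP n K) = (a : K) • lieW s' := by
  induction h with
  | of k => simp
  | mul h1 h2 ih1 ih2 =>
    rw [lieW_mul, lieW_mul, ih1, ih2, smul_lie, lie_smul, smul_smul]
    push_cast
    rfl
  | swap h1 h2 ih1 ih2 =>
    rw [lieW_mul, lieW_mul, ih1, ih2, smul_lie, lie_smul, smul_smul, ← lie_skew, smul_neg,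
      ← neg_smul]
    push_cast
    rfl

theorem Sym2.other_eq {z : Sym2 α} {a b c : α} (h : z = s(a, b)) (h' : z = s(a, c)) :
    b = c := Sym2.congr_right.1 (h.symm.trans h')

/-- Two readings of the same branch differ by exchanging subtrees; the sign of the order of the
edges changes accordingly. -/
theorem Branch.det (h : Branch Γ x i A s) (h' : Branch Γ x i A' s') : A.Perm A' ∧ ∃ δ : ℤ, Flip s s'
    δ ∧ ∀ P Q : List (Fin e), (P ++ (A ++ Q)).Nodup → listSign (P ++ (A ++ Q)) = δ * listSign
    (P ++ (A' ++ Q)) := by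
  induction h generalizing A' s' with
  | leaf k i =>
    obtain ⟨rfl, rfl⟩ := h'.inl_inv
    exact ⟨List.Perm.refl _, 1, Flip.of k, fun P Q _ => by simp⟩
  | @node v i f g x y A B s t hv hf hg h1 h2 ih1 ih2 =>
    obtain ⟨f', g', x', y', A₁, A₂, s₁, s₂, hv', hf', hg', b1, b2, rfl, rfl⟩ := h'.inr_inv
    rcases hv.eq_or_eq hv' with ⟨rfl, rfl⟩ | ⟨rfl, rfl⟩
    · obtain rfl := Sym2.other_eq hf hf'
      obtain rfl := Sym2.other_eq hg hg'
      obtain ⟨p1, a, q1, r1⟩ := ih1 b1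
      obtain ⟨p2, b, q2, r2⟩ := ih2 b2
      refine ⟨List.Perm.cons _ (p1.append (p2.cons _)), a * b, q1.mul q2, fun P Q hn => ?_⟩
      have e1 := r1 (P ++ [f']) (g' :: (B ++ Q)) (by simpa using hn)
      have e2 := r2 (P ++ f' :: (A₁ ++ [g'])) Q (by
        refine (List.Perm.nodup_iff ?_).1 hn
        simp only [append_assoc, cons_append, nil_append]
        exact (List.Perm.cons _ (p1.append_right _)).append_left P)
      grind
    · obtain rfl := Sym2.other_eq hf hg'
      obtain rfl := Sym2.other_eq hg hf'
      obtain ⟨p1, a, q1, r1⟩ := ih1 b2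
      obtain ⟨p2, b, q2, r2⟩ := ih2 b1
      have p3 : (g' :: (A ++ f' :: B)).Perm (f' :: (A₁ ++ g' :: A₂)) := by
        grind
      refine ⟨p3, -(a * b), q1.swap q2, fun P Q hn => ?_⟩
      have e1 := r1 (P ++ [g']) (f' :: (B ++ Q)) (by simpa using hn)
      have hn2 : (P ++ g' :: (A₂ ++ f' :: (B ++ Q))).Nodup := by
        refine (List.Perm.nodup_iff ?_).1 hn
        grind
      have e2 := r2 (P ++ g' :: (A₂ ++ [f'])) Q (by simpa using hn2)
      have hn3 : (P ++ (g' :: A₂ ++ (f' :: A₁ ++ Q))).Nodup := by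
        refine (List.Perm.nodup_iff ?_).1 hn2
        simp only [cons_append]
        exact (((p2.append_right Q).cons f').append_left (g' :: A₂)).append_left P
      have e3 := listSign_swap_odd P (g' :: A₂) (f' :: A₁) Q hn3 (by simpa using b2.even.add_one)
        (by simpa using b1.even.add_one)
      grind

theorem IsRelabel.tri (h : IsRelabel σ τ Γ Γ') (hv : Tri Γ v i f g) : Tri Γ' (τ v) (σ⁻¹ i) (σ⁻¹ f)
    (σ⁻¹ g) := by
  refine ⟨by simpa using hv.1, by simpa using hv.2.1, by simpa using hv.2.2.1, fun a => ?_⟩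
  have h1 := h.mem_iff (inr v) a
  have h2 : vtxEquiv n τ (inr v) = inr (τ v) := rfl
  rw [h2] at h1
  rw [h1, hv.2.2.2]
  simp only [Equiv.Perm.eq_inv_iff_eq]

theorem IsRelabel.edge (h : IsRelabel σ τ Γ Γ') (hi : Γ i = s(x, y)) : Γ' (σ⁻¹ i) =
    s(vtxEquiv n τ x, vtxEquiv n τ y) := by
  rw [h]
  simp [hi]

theorem IsRelabel.branch (h : IsRelabel σ τ Γ Γ') (hb : Branch Γ x i A s) : Branch Γ'
    (vtxEquiv n τ x) (σ⁻¹ i) (A.map (σ⁻¹ : Equiv.Perm (Fin e))) s := by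
  induction hb with
  | leaf k i => exact Branch.leaf k _
  | node hv hf hg h1 h2 ih1 ih2 =>
    simp only [List.map_cons, List.map_append]
    exact Branch.node (h.tri hv) (h.edge hf) (h.edge hg) ih1 ih2

/-- A branch which avoids the vertices in `U` (because each of them has an edge outside the branch)
is also a branch of every graph which coincides with `Γ` away from `U`. -/
theorem Branch.congr {U : Fin m → Prop} (hU : ∀ v, ¬ U v → ∀ h, inr v ∈ Γ h ↔ inr v ∈ Γ' h) (hE : ∀
    h x y, (∀ v, x = inr v → ¬ U v) → (∀ v, y = inr v → ¬ U v) → Γ h = s(x, y) → Γ' h = s(x, y))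
    (hb : Branch Γ x i A s) (hA : ∀ v, U v → ∃ h, inr v ∈ Γ h ∧ h ∉ i :: A) :
    (∀ v, x = inr v → ¬ U v) ∧ Branch Γ' x i A s := by
  induction hb with
  | leaf k i => exact ⟨by simp, Branch.leaf k i⟩
  | @node v i f g x y A B s t hv hf hg h1 h2 ih1 ih2 =>
    have hvU : ¬ U v := by
      intro hvU
      obtain ⟨h, hh, hn⟩ := hA v hvU
      have := (hv.2.2.2 h).1 hh
      grind
    have hx : ∀ w, inr v = (inr w : Vtx n m) → ¬ U w := by
      grind
    obtain ⟨a1, b1⟩ := ih1 fun w hw => by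
      grind
    obtain ⟨a2, b2⟩ := ih2 fun w hw => by
      grind
    refine ⟨hx, Branch.node ⟨hv.1, hv.2.1, hv.2.2.1, fun h => ?_⟩ (hE _ _ _ hx a1 hf)
      (hE _ _ _ hx a2 hg) b1 b2⟩
    rw [← hU v hvU, hv.2.2.2]

/-! #### Trees -/

/-- `Full Γ i x x' s z ε`: the graph `Γ` is a tree which consists of the edge `i = {x, x'}` and
the binary trees `s`, `z` at its two ends; `ε` is the sign of the order in which the edges are
read. -/
def Full (Γ : EdgeSeq n m e) (i : Fin e) (x x' : Vtx n m) (s z : BTree n) (ε : ℤ) :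
    Prop :=
  ∃ A M, Γ i = s(x, x') ∧ Branch Γ x i A s ∧ Branch Γ x' i M z ∧
    (i :: (A ++ M)).Perm (finRange e) ∧ listSign (i :: (A ++ M)) = ε

theorem Full.symm (h : Full Γ i x x' s z ε) : Full Γ i x' x z s ε := by
  obtain ⟨A, M, h1, h2, h3, h4, h5⟩ := h
  refine ⟨M, A, h1.trans Sym2.eq_swap, h3, h2, (List.perm_append_comm.cons i).trans h4, ?_⟩
  have hn := h4.nodup_iff.2 (nodup_finRange e)
  have := listSign_swap_even [i] A M [] (by simpa using hn) (h2.even.mul_right _)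
  simp only [append_nil, cons_append, nil_append] at this
  rw [← h5, this]

theorem Full.shift_aux (hv : Tri Γ v i f g) (hf : Γ f = s(inr v, x)) (hg : Γ g = s(inr v, y))
    (h1 : Branch Γ x f A s) (h2 : Branch Γ y g B t) (hi : Γ i = s(inr v, x'))
    (h3 : Branch Γ x' i M z) (h4 : (i :: (f :: (A ++ g :: B) ++ M)).Perm (finRange e)) : Γ f =
    s(x, inr v) ∧ Branch Γ x f A s ∧ Branch Γ (inr v) f (g :: (B ++ i :: M)) (t * z) ∧
    (f :: (A ++ g :: (B ++ i :: M))).Perm (finRange e) ∧ listSign (f :: (A ++ g :: (B ++ i :: M))) =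
    listSign (i :: (f :: (A ++ g :: B) ++ M)) := by
  refine ⟨hf.trans Sym2.eq_swap, h1, Branch.node hv.rot hg hi h2 h3, ?_, ?_⟩
  · refine List.Perm.trans ?_ h4
    rw [perm_iff_count]
    grind
  · have hn := h4.nodup_iff.2 (nodup_finRange e)
    have := listSign_swap_even [] [i] (f :: A ++ g :: B) M (by simpa using hn) (by
      simp only [List.length_append, List.length_cons]
      have := h1.even
      have := h2.even
      grind)
    simp only [append_assoc, cons_append, nil_append] at this ⊢
    rw [this]

/-- Moving the root edge across a node. -/
theorem Full.shift (h : Full Γ i x x' (s * t) z ε) : ∃ f y y', Full Γ f y y' s (t * z) ε := by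
  obtain ⟨A, M, h1, h2, h3, h4, h5⟩ := h
  rcases x with k | v
  · exact absurd h2.inl_inv.2 (by intro hc; cases hc)
  · obtain ⟨f, g, a, b, A₁, A₂, s₁, s₂, hv, hf, hg, b1, b2, rfl, hs⟩ := h2.inr_inv
    obtain ⟨rfl, rfl⟩ := mul_inj_magma hs
    obtain ⟨c1, c2, c3, c4, c5⟩ := Full.shift_aux hv hf hg b1 b2 h1 h3 h4
    exact ⟨f, a, inr v, _, _, c1, c2, c3, c4, c5.trans h5⟩

theorem Branch.full_of_mem (hb : Branch Γ x i A s) (h1 : Γ i = s(x, x')) (h3 : Branch Γ x' i M z)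
    (h4 : (i :: (A ++ M)).Perm (finRange e)) (hh : h ∈ A) : ∃ y y' t u, Full Γ h y y' t u
    (listSign (i :: (A ++ M))) := by
  induction hb generalizing x' M z with
  | leaf k i => simp at hh
  | @node v i f g x y A B s t hv hf hg b1 b2 ih1 ih2 =>
    obtain ⟨c1, c2, c3, c4, c5⟩ := Full.shift_aux hv hf hg b1 b2 h1 h3 h4
    have F : Full Γ i (inr v) x' (s * t) z (listSign (i :: (f :: (A ++ g :: B) ++ M))) :=
      ⟨_, _, h1, Branch.node hv hf hg b1 b2, h3, h4, rfl⟩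
    obtain ⟨d1, d2, d3, d4, d5⟩ := Full.shift_aux hv.rot hg h1 b2 h3 hf b1 (by
      refine List.Perm.trans ?_ c4
      rw [perm_iff_count]
      intro a
      simp only [count_cons, count_append]
      omega)
    have e5 : listSign (f :: (g :: (B ++ i :: M) ++ A)) =
        listSign (i :: (f :: (A ++ g :: B) ++ M)) := by
      rw [← c5]
      have := listSign_swap_even [f] (g :: (B ++ i :: M)) A [] (by
        have hn := c4.nodup_iff.2 (nodup_finRange e)
        refine (List.Perm.nodup_iff ?_).1 hn
        rw [perm_iff_count]
        intro a
        simp only [count_cons, count_append, count_nil]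
        omega) (b1.even.mul_left _)
      simpa using this
    simp only [List.mem_cons, List.mem_append] at hh
    rcases hh with rfl | hh | rfl | hh
    · rw [← c5]
      exact ⟨_, _, _, _, _, _, c1, c2, c3, c4, rfl⟩
    · grind
    · rw [← e5, ← d5]
      exact ⟨_, _, _, _, _, _, d1, d2, d3, d4, rfl⟩
    grind

/-- A tree can be rooted at every edge, and this does not change the sign. -/
theorem Full.exists_at (h : Full Γ i x x' s z ε) (f : Fin e) : ∃ y y' t u, Full Γ f y y' t u ε := by
  obtain ⟨A, M, h1, h2, h3, h4, h5⟩ := id h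
  have hf : f ∈ i :: (A ++ M) := h4.mem_iff.2 (mem_finRange f)
  simp only [List.mem_cons, List.mem_append] at hf
  rcases hf with rfl | hf | hf
  · exact ⟨_, _, _, _, h⟩
  · rw [← h5]
    exact h2.full_of_mem h1 h3 h4 hf
  · obtain ⟨A', M', h1', h2', h3', h4', h5'⟩ := h.symm
    have hp := (h2'.det h3).1
    rw [← h5']
    exact h2'.full_of_mem h1' h3' h4' (hp.mem_iff.2 hf)

theorem IsRelabel.full (h : IsRelabel σ τ Γ Γ') (hF : Full Γ i x x' s z ε) : Full Γ' (σ⁻¹ i)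
    (vtxEquiv n τ x) (vtxEquiv n τ x') s z (Equiv.Perm.sign σ * ε) := by
  obtain ⟨A, M, h1, h2, h3, h4, h5⟩ := hF
  refine ⟨_, _, h.edge h1, h.branch h2, h.branch h3, ?_, ?_⟩
  · have := perm_map_finRange h4 σ⁻¹
    simpa using this
  · have := listSign_map h4 σ⁻¹
    rw [h5, Equiv.Perm.sign_inv] at this
    simpa using this

end

section

/-! ### The derivation attached to a tree -/

variable {M : List (Fin e)}
variable {k : Fin n}

theorem otherEnd_eq {V : Type*} [DecidableEq V] {z : Sym2 V} {a b : V} (h : z = s(a, b)) :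
    otherEnd z a = b := by
  subst h
  unfold otherEnd
  rw [dif_pos (Sym2.mem_mk_left a b)]
  exact Sym2.congr_right.1 (Sym2.other_spec' (Sym2.mem_mk_left a b))

theorem Tri.filter_eq {v : Fin m} (h : Tri Γ v i f g) :
    ((finRange e).filter fun a => a ≠ i ∧ inr v ∈ Γ a) = [f, g] ∨
    ((finRange e).filter fun a => a ≠ i ∧ inr v ∈ Γ a) = [g, f] := by
  obtain ⟨h1, h2, h3, h4⟩ := h
  have hp : ((finRange e).filter fun a => a ≠ i ∧ inr v ∈ Γ a).Perm [f, g] := by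
    refine List.perm_of_nodup_nodup_toFinset_eq ((nodup_finRange e).filter _) (by simpa using h3) ?_
    ext a
    simp only [List.mem_toFinset, List.mem_filter, mem_finRange, true_and, decide_eq_true_eq,
      List.mem_cons, not_mem_nil, or_false, h4]
    grind
  obtain ⟨a, b, hab⟩ := List.length_eq_two.1 hp.length_eq
  rw [hab] at hp ⊢
  have ha := hp.mem_iff (a := a)
  have hb := hp.mem_iff (a := b)
  have hn : [a, b].Nodup := hp.nodup_iff.2 (by simpa using h3)
  simp only [List.mem_cons, not_mem_nil, or_false] at ha hb
  simp only [nodup_cons, List.mem_singleton] at hn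
  have := hn.1
  grind

theorem Branch.readTree_eq (h : Branch Γ x i A s) {k : ℕ} (hk : A.length < k) : ∃ A' s', Branch Γ x
    i A' s' ∧ readTree K Γ k i x = (i :: A', toAss (lieW s')) := by
  induction h generalizing k with
  | leaf j i =>
    obtain ⟨k, rfl⟩ : ∃ l, k = l + 1 := ⟨k - 1, by omega⟩
    exact ⟨_, _, Branch.leaf j i, by rw [readTree, lieW_of, toAss_X]⟩
  | @node v i f g x y A B s t hv hf hg h1 h2 ih1 ih2 =>
    obtain ⟨k, rfl⟩ : ∃ l, k = l + 1 := ⟨k - 1, by omega⟩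
    simp only [List.length_cons, List.length_append] at hk
    obtain ⟨A', s', b1, e1⟩ := ih1 (k := k) (by omega)
    obtain ⟨B', t', b2, e2⟩ := ih2 (k := k) (by omega)
    rcases hv.filter_eq with hl | hl
    · refine ⟨_, _, Branch.node hv hf hg b1 b2, ?_⟩
      rw [readTree, hl]
      simp only [otherEnd_eq hf, otherEnd_eq hg, e1, e2, lieW_mul, toAss_brk]
      simp
    · refine ⟨_, _, Branch.node hv.swap hg hf b2 b1, ?_⟩
      rw [readTree, hl]
      simp only [otherEnd_eq hf, otherEnd_eq hg, e1, e2, lieW_mul, toAss_brk]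
      simp

/-- The contribution of the edge `i` to the component of the external vertex `k`. -/
def leafVal (K : Type*) [Field K] (Γ : EdgeSeq n m e) (k : Fin n) (i : Fin e) : Ass n K :=
  if inl k ∈ Γ i then
    ((listSign (readTree K Γ e i (otherEnd (Γ i) (inl k))).1 : ℤ) : K) •
      (readTree K Γ e i (otherEnd (Γ i) (inl k))).2 else 0

theorem treeWord_eq_sum (k : Fin n) : treeWord K Γ k = ∑ i, leafVal K Γ k i := rfl

theorem treeWord_eq_list_sum (hl : l.Perm (finRange e)) (k : Fin n) :
    treeWord K Γ k = (l.map (leafVal K Γ k)).sum := by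
  rw [treeWord_eq_sum, (hl.map _).sum_eq, Fin.sum_univ_def]

theorem readTree_sign (h2 : Branch Γ x i A s) (h4 : (i :: (A ++ M)).Perm (finRange e))
    (hM : M = []) : ((listSign (readTree K Γ e i x).1 : ℤ) : K) • (readTree K Γ e i x).2 =
    ((listSign (i :: (A ++ M)) : ℤ) : K) • toAss (lieW s) := by
  subst hM
  have hlen := h4.length_eq
  simp only [List.length_cons, append_nil, List.length_finRange] at hlen
  obtain ⟨A', s', b, e1⟩ := h2.readTree_eq (K := K) (k := e) (by omega)
  obtain ⟨-, δ, q, r⟩ := h2.det b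
  have := r [i] [] (by
    have := h4.nodup_iff.2 (nodup_finRange e)
    simpa using this)
  simp only [append_nil, cons_append, nil_append] at this ⊢
  have hW := q.lieW (K := K)
  rw [e1, this, hW, map_smul, smul_smul]
  have hδ : (δ : ℤ) * δ = 1 := by
    have h1 := listSign_mul_self (i :: A)
    have h2 := listSign_mul_self (i :: A')
    grind
  congr 1
  have hδ' : (δ : K) * δ = 1 := by rw [← Int.cast_mul, hδ, Int.cast_one]
  push_cast
  linear_combination (-(listSign (i :: A') : K)) * hδ'

theorem leafVal_eq (h1 : Γ i = s(x, inl k)) (h2 : Branch Γ x i A s)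
    (h3 : Branch Γ (inl k) i M z) (h4 : (i :: (A ++ M)).Perm (finRange e)) :
    leafVal K Γ k i = ((listSign (i :: (A ++ M)) : ℤ) : K) • toAss (lieW s) := by
  rw [leafVal, if_pos (by rw [h1]; simp), otherEnd_eq (h1.trans Sym2.eq_swap)]
  exact readTree_sign h2 h4 h3.inl_inv.1

theorem leafVal_of_notMem (h : ¬ inl k ∈ Γ i) :
    leafVal K Γ k i = 0 := if_neg h

/-- The sum over the external vertices of a branch. -/
theorem Branch.sum_leafVal (h2 : Branch Γ x i A s) (h1 : Γ i = s(x, x')) (h3 : Branch Γ x' i M z)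
    (h4 : (i :: (A ++ M)).Perm (finRange e)) (k : Fin n) : (A.map (leafVal K Γ k)).sum +
    (if x = inl k then ((listSign (i :: (A ++ M)) : ℤ) : K) • toAss (lieW z) else 0) =
    ((listSign (i :: (A ++ M)) : ℤ) : K) • toAss (rr (dl k) s (lieW z)) := by
  induction h2 generalizing x' M z with
  | leaf j i =>
    simp only [List.map_nil, List.sum_nil, zero_add, rr_of, dl, inl.injEq]
    split_ifs
    · rfl
    · simp
  | @node v i f g x y A B s t hv hf hg b1 b2 ih1 ih2 =>
    obtain ⟨c1, c2, c3, c4, c5⟩ := Full.shift_aux hv hf hg b1 b2 h1 h3 h4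
    have c4' : (f :: (g :: (B ++ i :: M) ++ A)).Perm (finRange e) := by
      grind
    obtain ⟨d1, d2, d3, d4, d5⟩ := Full.shift_aux hv.rot hg h1 b2 h3 hf b1 c4'
    have e5 : listSign (f :: (g :: (B ++ i :: M) ++ A)) =
        listSign (i :: (f :: (A ++ g :: B) ++ M)) := by
      rw [← c5]
      have := listSign_swap_even [f] (g :: (B ++ i :: M)) A [] (by
        have hn := c4'.nodup_iff.2 (nodup_finRange e)
        simpa using hn) (b1.even.mul_left _)
      simpa using this
    have i1 := ih1 c1 c3 c4
    have i2 := ih2 d1 d3 d4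
    rw [c5] at i1
    rw [d5, e5] at i2
    have key : ∀ {f : Fin e} {x : Vtx n m} {A M : List (Fin e)} {s z : BTree n},
        Γ f = s(x, inr v) → Branch Γ x f A s → Branch Γ (inr v) f M z →
        (f :: (A ++ M)).Perm (finRange e) → leafVal K Γ k f =
        if x = inl k then ((listSign (f :: (A ++ M)) : ℤ) : K) • toAss (lieW z) else 0 := by
      intro f x A M s z hf ha hm hp
      split_ifs with hx
      · subst hx
        have hp' : (f :: (M ++ A)).Perm (finRange e) :=
          (List.perm_append_comm.cons f).trans hp
        rw [leafVal_eq (hf.trans Sym2.eq_swap) hm ha hp']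
        have := listSign_swap_even [f] A M [] (by
          have hn := hp.nodup_iff.2 (nodup_finRange e)
          simpa using hn) (ha.even.mul_right _)
        simp only [append_nil, cons_append, nil_append] at this
        rw [this]
      · refine leafVal_of_notMem ?_
        rw [hf, Sym2.mem_iff]
        rintro (h | h)
        · exact hx h.symm
        · cases h
    have k1 := key c1 c2 c3 c4
    have k2 := key d1 d2 d3 d4
    rw [c5] at k1
    rw [d5, e5] at k2
    rw [← k1, lieW_mul] at i1
    rw [← k2, lieW_mul] at i2
    rw [rr_mul, map_add, smul_add, ← i1, ← i2, if_neg (by simp)]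
    simp only [List.map_cons, List.map_append, List.sum_cons, List.sum_append]
    abel

/-- The component at `k` of the tuple of Lie words attached to a tree rooted at any edge. -/
theorem Full.treeWord_eq (h : Full Γ i x x' s z ε) (hl : ¬ (Γ i).IsDiag) (k : Fin n) :
    treeWord K Γ k = (ε : K) • toAss (rr (dl k) s (lieW z) + rr (dl k) z (lieW s)) := by
  obtain ⟨A, M, h1, h2, h3, h4, h5⟩ := id h
  have h4' : (i :: (M ++ A)).Perm (finRange e) :=
    (List.perm_append_comm.cons i).trans h4
  have hs : listSign (i :: (M ++ A)) = listSign (i :: (A ++ M)) := by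
    have := listSign_swap_even [i] A M [] (by
      have hn := h4.nodup_iff.2 (nodup_finRange e)
      simpa using hn) (h2.even.mul_right _)
    grind
  have i1 := h2.sum_leafVal (K := K) h1 h3 h4 k
  have i2 := h3.sum_leafVal (K := K) (h1.trans Sym2.eq_swap) h2 h4' k
  rw [hs] at i2
  rw [h5] at i1 i2
  have key : leafVal K Γ k i = (if x = inl k then (ε : K) • toAss (lieW z) else 0) +
      (if x' = inl k then (ε : K) • toAss (lieW s) else 0) := by
    by_cases hx : x = inl k
    · have hx' : x' ≠ inl k := by
        rintro rfl
        exact hl (by rw [h1, hx]; simp)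
      subst hx
      rw [if_pos rfl, if_neg hx', add_zero, leafVal_eq (h1.trans Sym2.eq_swap) h3 h2 h4', hs, h5]
    · rw [if_neg hx, zero_add]
      by_cases hx' : x' = inl k
      · subst hx'
        rw [if_pos rfl, leafVal_eq h1 h2 h3 h4, h5]
      · rw [if_neg hx']
        refine leafVal_of_notMem ?_
        rw [h1, Sym2.mem_iff]
        rintro (h | h)
        · exact hx h.symm
        · exact hx' h.symm
  rw [treeWord_eq_list_sum h4, map_add, smul_add, ← i1, ← i2]
  simp only [List.map_cons, List.map_append, List.sum_cons, List.sum_append, key]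
  abel

/-- A sum of the components over all external vertices. -/
theorem sum_comp_rr_dl {M : Type*} [AddCommGroup M] [Module K M] (T : Fin n → NCP n K →ₗ[K] M)
    (s : BTree n) (y : NCP n K) : ∑ k, T k (rr (dl k) s y) = rr T s y := by
  induction s using FreeMagma.recOnMul generalizing y with
  | ih1 j =>
    simp only [rr_of, dl]
    rw [Finset.sum_eq_single j]
    · simp
    · intro k _ hk
      simp [hk.symm]
    · simp
  | ih2 s t hs ht => simp only [rr_mul, map_add, sum_add_distrib, hs, ht]

end

section

variable {v : Fin m} {h : Fin e}

/-! ### Graphs with at most one loop are trees, or closed chains of trees -/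

section Tree
variable {N : Type*} {T : SimpleGraph N}
variable {a b c b' : N}

theorem exists_pred (hT : T.Connected) (r : N) (ha : a ≠ r) :
    ∃ b, T.Adj a b ∧ T.dist r b + 1 = T.dist r a := by
  obtain ⟨w, hw⟩ := hT.exists_walk_length_eq_dist r a
  have hnil : ¬ w.Nil := fun h => ha h.eq.symm
  refine ⟨w.penultimate, (w.adj_penultimate hnil).symm, ?_⟩
  have h1 : T.dist r w.penultimate ≤ w.dropLast.length := SimpleGraph.dist_le _
  have h2 : w.dropLast.length + 1 = w.length := w.length_dropLast_add_one hnil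
  have h3 := (w.adj_penultimate hnil).diff_dist_adj (u := r)
  omega

theorem pred_unique (hT : T.IsTree) (r : N) (h1 : T.Adj a b) (h2 : T.Adj a c)
    (h3 : T.dist r b + 1 = T.dist r a) (h4 : T.dist r c + 1 = T.dist r a) : b = c := by
  obtain ⟨w, hw⟩ := hT.connected.exists_walk_length_eq_dist r b
  obtain ⟨w', hw'⟩ := hT.connected.exists_walk_length_eq_dist r c
  have p1 : (w.concat h1.symm).IsPath := SimpleGraph.Walk.isPath_of_length_eq_dist _ (by
    rw [SimpleGraph.Walk.length_concat]; omega)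
  have p2 : (w'.concat h2.symm).IsPath := SimpleGraph.Walk.isPath_of_length_eq_dist _ (by
    rw [SimpleGraph.Walk.length_concat]; omega)
  have := (hT.existsUnique_path r a).unique p1 p2
  have := congrArg SimpleGraph.Walk.penultimate this
  simpa using this

/-- The parent function of a tree with root `r`. -/
theorem exists_parent (hT : T.IsTree) (r : N) : ∃ (p : N → N) (dep : N → ℕ), p r = r ∧ dep r = 0 ∧
    (∀ a, a ≠ r → T.Adj a (p a) ∧ dep (p a) + 1 = dep a) ∧ ∀ a b, T.Adj a b → a = p b ∧ b ≠ r ∨ b =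
    p a ∧ a ≠ r := by
  classical
  choose! f hf using fun a (ha : a ≠ r) => exists_pred hT.connected r ha
  refine ⟨fun a => if a = r then r else f a, T.dist r, by simp, by simp, ?_, ?_⟩
  · intro a ha
    simpa [ha] using hf a ha
  · intro a b hab
    rcases hT.dist_eq_dist_add_one_of_adj r hab with h | h
    · right
      have ha : a ≠ r := by
        rintro rfl
        simp at h
      refine ⟨?_, ha⟩
      simp only [if_neg ha]
      exact pred_unique hT r hab (hf a ha).1 (by omega) (hf a ha).2
    · left
      have hb : b ≠ r := by
        rintro rfl
        simp at h
      refine ⟨?_, hb⟩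
      simp only [if_neg hb]
      exact pred_unique hT r hab.symm (hf b hb).1 (by omega) (hf b hb).2

/-- `c` is an iterated parent of `a`. -/
def Anc (p : N → N) (c a : N) : Prop := ∃ k, p^[k] a = c

variable {p : N → N} {dep : N → ℕ} {r : N}

theorem Anc.step (hr : p r = r) : Anc p c a ↔ a = c ∨ ∃ b, b ≠ r ∧ p b = c ∧ Anc p b a := by
  constructor
  · rintro ⟨k, hk⟩
    induction k with
    | zero => exact Or.inl hk
    | succ k ih =>
      rw [Function.iterate_succ_apply'] at hk
      by_cases hb : p^[k] a = r
      · grind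
      · exact Or.inr ⟨_, hb, hk, k, rfl⟩
  · rintro (rfl | ⟨b, -, rfl, k, hk⟩)
    · exact ⟨0, rfl⟩
    · exact ⟨k + 1, by rw [Function.iterate_succ_apply', hk]⟩

theorem dep_iterate (hr : p r = r) (h0 : dep r = 0) (hd : ∀ a, a ≠ r → dep (p a) + 1 = dep a)
    (a : N) (k : ℕ) : dep (p^[k] a) = dep a - k := by
  induction k with
  | zero => rfl
  | succ k ih =>
    rw [Function.iterate_succ_apply']
    by_cases hb : p^[k] a = r
    all_goals grind

theorem Anc.dep_le (hr : p r = r) (h0 : dep r = 0) (hd : ∀ a, a ≠ r → dep (p a) + 1 = dep a)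
    (h : Anc p c a) : dep c ≤ dep a := by
  obtain ⟨k, rfl⟩ := h
  rw [dep_iterate hr h0 hd]
  omega

theorem Anc.root (hr : p r = r) (h0 : dep r = 0) (hd : ∀ a, a ≠ r → dep (p a) + 1 = dep a)
    (a : N) : Anc p r a := by
  refine ⟨dep a, ?_⟩
  by_contra hc
  have h1 := hd _ hc
  have h2 := dep_iterate hr h0 hd a (dep a)
  omega

theorem Anc.eq_of_dep (hr : p r = r) (h0 : dep r = 0) (hd : ∀ a, a ≠ r → dep (p a) + 1 = dep a)
    (h : Anc p b a) (h' : Anc p b' a) (hbb : dep b = dep b') : b = b' := by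
  have key : ∀ (j : ℕ) (c : N), dep c = dep (p^[j] c) → c = p^[j] c := by
    intro j c hc
    rw [dep_iterate hr h0 hd] at hc
    rcases j with _ | j
    · rfl
    · have hcr : c = r := by
        grind
      subst hcr
      exact (Function.iterate_fixed hr _).symm
  obtain ⟨k, rfl⟩ := h
  obtain ⟨l, rfl⟩ := h'
  rcases le_total k l with hkl | hkl
  · obtain ⟨j, rfl⟩ := Nat.exists_eq_add_of_le' hkl
    rw [Function.iterate_add_apply] at hbb ⊢
    exact key _ _ hbb
  · obtain ⟨j, rfl⟩ := Nat.exists_eq_add_of_le' hkl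
    rw [Function.iterate_add_apply] at hbb ⊢
    exact (key _ _ hbb.symm).symm

end Tree

section Incidence

/-- The bipartite incidence graph of internal vertices and edges. -/
def incGraph (Γ : EdgeSeq n m e) : SimpleGraph (Fin m ⊕ Fin e) where
  Adj
    | inl v, inr h => inr v ∈ Γ h
    | inr h, inl v => inr v ∈ Γ h
    | _, _ => False
  symm := ⟨by rintro (a | a) (b | b) h <;> exact h⟩
  loopless := ⟨by rintro (a | a) h <;> exact h⟩

theorem incGraph_adj :
    (incGraph Γ).Adj (inl v) (inr h) ↔ inr v ∈ Γ h := Iff.rfl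

/-- `Spine Γ x i x' i' L Ts`: a path which enters `x` through the edge `i` and reaches `x'` through
the edge `i'`, with a binary tree branching off at each vertex. `L` lists the edges before `i'`. -/
inductive Spine (Γ : EdgeSeq n m e) : Vtx n m → Fin e → Vtx n m → Fin e → List (Fin e) →
    List (BTree n) → Prop
  | nil (x : Vtx n m) (i : Fin e) : Spine Γ x i x i [] []
  | cons {v : Fin m} {i f g i' : Fin e} {y z x' : Vtx n m} {A L : List (Fin e)}
      {s : BTree n} {Ts : List (BTree n)} (hv : Tri Γ v i f g)
      (hf : Γ f = s(inr v, y)) (hb : Branch Γ y f A s) (hg : Γ g = s(inr v, z))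
      (hs : Spine Γ z g x' i' L Ts) :
      Spine Γ (inr v) i x' i' (i :: f :: (A ++ L)) (s :: Ts)

theorem exists_tri (hv : valence Γ (inr v) = 3) (hh : inr v ∈ Γ h) : ∃ f g, Tri Γ v h f g := by
  obtain ⟨a, b, c, hab, hac, hbc, hs⟩ := Finset.card_eq_three.1 hv
  have key : ∀ k, inr v ∈ Γ k ↔ k = a ∨ k = b ∨ k = c := by
    intro k
    have := Finset.ext_iff.1 hs k
    simpa using this
  rcases (key h).1 hh with rfl | rfl | rfl
  · exact ⟨b, c, hab, hac, hbc, key⟩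
  · exact ⟨a, c, hab.symm, hbc, hac, fun k => by rw [key]; tauto⟩
  · exact ⟨a, b, hac.symm, hbc.symm, hab, fun k => by rw [key]; tauto⟩

/-- `c` lies under the vertex `x`. -/
def Under (p : Fin m ⊕ Fin e → Fin m ⊕ Fin e) (x : Vtx n m) (c : Fin m ⊕ Fin e) : Prop :=
  ∃ u, x = inr u ∧ Anc p (inl u) c

/-- The edge `f` is the parent of its end `x`. -/
def Down (Γ : EdgeSeq n m e) (p : Fin m ⊕ Fin e → Fin m ⊕ Fin e) (f : Fin e) (x : Vtx n m) :
    Prop :=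
  x ∈ Γ f ∧ ∀ u, x = inr u → p (inl u) = inr f

/-- A rooted spanning tree of the incidence graph, missing only incidences with the root edge. -/
structure Rooted (Γ : EdgeSeq n m e) (p : Fin m ⊕ Fin e → Fin m ⊕ Fin e)
    (dep : Fin m ⊕ Fin e → ℕ) (i₀ : Fin e) : Prop where
  tri : ∀ v, valence Γ (inr v) = 3
  loopless : ∀ i, ¬ (Γ i).IsDiag
  root : p (inr i₀) = inr i₀
  dep_root : dep (inr i₀) = 0
  dep_eq : ∀ a, a ≠ inr i₀ → dep (p a) + 1 = dep a
  adj : ∀ a, a ≠ inr i₀ → (incGraph Γ).Adj a (p a)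
  edge : ∀ v h, inr v ∈ Γ h → h ≠ i₀ → p (inr h) = inl v ∨ p (inl v) = inr h

variable {p : Fin m ⊕ Fin e → Fin m ⊕ Fin e} {dep : Fin m ⊕ Fin e → ℕ} {i₀ : Fin e}

theorem Rooted.exists_vertex (R : Rooted Γ p dep i₀) (hh : h ≠ i₀) :
    ∃ v, p (inr h) = inl v ∧ inr v ∈ Γ h := by
  have h' := R.adj (inr h) (by simpa using hh)
  rcases hp : p (inr h) with u | u
  · rw [hp] at h'
    exact ⟨u, rfl, h'⟩
  · rw [hp] at h'
    exact h'.elim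

theorem Rooted.not_both (R : Rooted Γ p dep i₀)
    (h1 : p (inl v) = inr h) (h2 : p (inr h) = inl v) : False := by
  have h3 := R.dep_eq (inl v) (by simp)
  have h4 := R.dep_eq (inr h) (by rintro hc; rw [hc, R.root] at h2; cases h2)
  rw [h1] at h3
  rw [h2] at h4
  omega

theorem Rooted.eq_or_eq_of_parent (R : Rooted Γ p dep i₀) (hu : p (inl v) = inr f)
    (ht : Tri Γ v f a b) (hh : h ≠ i₀) (hp : p (inr h) = inl v) : h = a ∨ h = b := by
  obtain ⟨w, w1, w2⟩ := R.exists_vertex hh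
  rw [hp] at w1
  obtain rfl := inl.inj w1
  rcases (ht.2.2.2 h).1 w2 with rfl | h | h
  · exact (R.not_both hu hp).elim
  all_goals tauto

/-- The nodes under an edge `f` entered from `v`. -/
theorem Rooted.anc_edge (R : Rooted Γ p dep i₀) (hf : Γ f = s(inr v, x)) (hp : p (inr f) = inl v)
    (hx : Down Γ p f x) (c : Fin m ⊕ Fin e) : Anc p (inr f) c ↔ c = inr f ∨ Under p x c := by
  rw [Anc.step R.root]
  refine or_congr_right ⟨?_, ?_⟩
  · rintro ⟨b, hb, hbf, hc⟩
    have ha := R.adj b hb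
    rw [hbf] at ha
    rcases b with u | u
    · have hu : inr u ∈ Γ f := ha
      rw [hf, Sym2.mem_iff] at hu
      rcases hu with hu | hu
      · obtain rfl := inr.inj hu
        exact (R.not_both hbf hp).elim
      · exact ⟨u, hu.symm, hc⟩
    · exact ha.elim
  · rintro ⟨u, rfl, hc⟩
    exact ⟨inl u, by simp, hx.2 u rfl, hc⟩

/-- The edges under a vertex. -/
theorem Rooted.anc_vertex (R : Rooted Γ p dep i₀) {u : Fin m} : Anc p (inl u) (inr h) ↔
    ∃ a, a ≠ i₀ ∧ p (inr a) = inl u ∧ Anc p (inr a) (inr h) := by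
  rw [Anc.step R.root]
  constructor
  · rintro (h | ⟨b, hb, hbf, hc⟩)
    · cases h
    · rcases b with w | w
      · have ha := R.adj _ hb
        rw [hbf] at ha
        exact ha.elim
      · exact ⟨w, by simpa using hb, hbf, hc⟩
  · rintro ⟨a, ha, h1, h2⟩
    exact Or.inr ⟨_, by simpa using ha, h1, h2⟩

/-- The far end of an edge whose parent is its near end. -/
theorem Rooted.exists_far (R : Rooted Γ p dep i₀) (hf : inr v ∈ Γ f) (hne : f ≠ i₀)
    (hv : p (inl v) ≠ inr f) : ∃ x, Γ f = s(inr v, x) ∧ p (inr f) = inl v ∧ Down Γ p f x := by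
  obtain ⟨x, hx⟩ := hf
  have hp : p (inr f) = inl v := by
    rcases R.edge v f (by rw [hx]; simp) hne with h | h
    · exact h
    · exact absurd h hv
  refine ⟨x, hx, hp, by rw [hx]; simp, ?_⟩
  rintro u rfl
  rcases R.edge u f (by rw [hx]; simp) hne with h | h
  · rw [hp] at h
    obtain rfl := inl.inj h
    exact absurd (by rw [hx]; simp) (R.loopless f)
  · exact h

theorem Rooted.disjoint (R : Rooted Γ p dep i₀) {u : Fin m} (hfg : f ≠ g)
    (hf : p (inr f) = inl u) (hg : p (inr g) = inl u) {c : Fin m ⊕ Fin e}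
    (h1 : Anc p (inr f) c) (h2 : Anc p (inr g) c) : False := by
  have a1 := R.dep_eq (inr f) (by rintro hc; rw [hc, R.root] at hf; cases hf)
  have a2 := R.dep_eq (inr g) (by rintro hc; rw [hc, R.root] at hg; cases hg)
  rw [hf] at a1
  rw [hg] at a2
  exact hfg (inr.inj (Anc.eq_of_dep R.root R.dep_root R.dep_eq h1 h2 (by omega)))

theorem Rooted.not_anc (R : Rooted Γ p dep i₀) {u : Fin m}
    (hf : p (inr f) = inl u) : ¬ Anc p (inr f) (inl u) := by
  intro h
  have a1 := R.dep_eq (inr f) (by rintro hc; rw [hc, R.root] at hf; cases hf)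
  rw [hf] at a1
  have := h.dep_le R.root R.dep_root R.dep_eq
  omega

theorem Rooted.not_under (R : Rooted Γ p dep i₀) (hx : Down Γ p f x) : ¬ Under p x (inr f) := by
  rintro ⟨u, rfl, h⟩
  have h1 := hx.2 u rfl
  have a1 := R.dep_eq (inl u) (by simp)
  rw [h1] at a1
  have := h.dep_le R.root R.dep_root R.dep_eq
  omega

/-- A branch without vertices on the root edge. -/
theorem Rooted.exists_branch (R : Rooted Γ p dep i₀) (D : ℕ) (hD : ∀ a, dep a ≤ D) (N : ℕ)
    (hx : Down Γ p f x) (hN : ∀ u, x = inr u → D < dep (inl u) + N)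
    (hbad : ∀ u, Under p x (inl u) → inr u ∈ Γ i₀ → p (inl u) = inr i₀) : ∃ A s, Branch Γ x f A s ∧
    A.Nodup ∧ ∀ h, h ∈ A ↔ Under p x (inr h) := by
  induction N generalizing f x with
  | zero =>
    rcases x with k | u
    · exact ⟨_, _, Branch.leaf k f, by simp, fun h => by simp [Under]⟩
    all_goals grind
  | succ N ih =>
    rcases x with k | u
    · grind
    · obtain ⟨a, b, ht⟩ := exists_tri (R.tri u) hx.1
      have hpu := hx.2 u rfl
      have hUu : Under p (inr u : Vtx n m) (inl u) := ⟨u, rfl, 0, rfl⟩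
      have main : ∀ a, inr u ∈ Γ a → a ≠ f → ∃ y A s, Γ a = s(inr u, y) ∧ a ≠ i₀ ∧
          p (inr a) = inl u ∧ Branch Γ y a A s ∧ (a :: A).Nodup ∧
          ∀ h, h ∈ a :: A ↔ Anc p (inr a) (inr h) := by
        intro a ha haf
        have hai : a ≠ i₀ := by
          grind
        obtain ⟨y, hy, hp, hd⟩ := R.exists_far ha hai (by
          rw [hpu]
          exact fun hc => haf (inr.inj hc).symm)
        have hanc := R.anc_edge hy hp hd
        have hsub : ∀ c, Under p y c → Under p (inr u : Vtx n m) c := by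
          intro c hc
          refine ⟨u, rfl, (Anc.step R.root).2 (Or.inr ⟨inr a, by simpa using hai, hp, ?_⟩)⟩
          exact (hanc c).2 (Or.inr hc)
        obtain ⟨A, s, h1, h2, h3⟩ := ih hd (by
          rintro w rfl
          have h1 := R.dep_eq (inl w) (by simp)
          rw [hd.2 w rfl] at h1
          have h2 := R.dep_eq (inr a) (by simpa using hai)
          rw [hp] at h2
          have := hN u rfl
          omega) (fun w hw => hbad w (hsub _ hw))
        refine ⟨y, A, s, hy, hai, hp, h1, ?_, ?_⟩
        · rw [nodup_cons, h3]
          exact ⟨R.not_under hd, h2⟩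
        · intro h
          rw [hanc, List.mem_cons, h3, inr.injEq]
      obtain ⟨y, A, s, a1, a2, a3, a4, a5, a6⟩ := main a ((ht.2.2.2 a).2 (by tauto)) ht.1.symm
      obtain ⟨z, B, t, b1, b2, b3, b4, b5, b6⟩ := main b ((ht.2.2.2 b).2 (by tauto)) ht.2.1.symm
      refine ⟨_, _, Branch.node ht a1 b1 a4 b4, ?_, ?_⟩
      · have : (a :: A ++ b :: B).Nodup := by
          rw [nodup_append']
          refine ⟨a5, b5, ?_⟩
          intro c hc hc'
          exact R.disjoint ht.2.2.1 a3 b3 ((a6 c).1 hc) ((b6 c).1 hc')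
        simpa using this
      · intro h
        have : h ∈ a :: (A ++ b :: B) ↔ h ∈ a :: A ∨ h ∈ b :: B := by simp [or_assoc]
        rw [this, a6, b6]
        simp only [Under, inr.injEq, exists_eq_left', R.anc_vertex]
        constructor
        · grind
        · rintro ⟨c, c1, c2, c3⟩
          rcases R.eq_or_eq_of_parent hpu ht c1 c2 with rfl | rfl <;> grind

end Incidence

end

section

variable {p : Fin m ⊕ Fin e → Fin m ⊕ Fin e} {dep : Fin m ⊕ Fin e → ℕ} {i₀ : Fin e}
variable {u v₀ : Fin m} {z : Vtx n m}

theorem Rooted.exists_child (R : Rooted Γ p dep i₀) (hx : p (inl u) = inr f) (ha : inr u ∈ Γ a)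
    (haf : a ≠ f) (hai : a ≠ i₀) : ∃ y, Γ a = s(inr u, y) ∧ p (inr a) = inl u ∧ Down Γ p a y ∧
    (∀ c, Anc p (inr a) c ↔ c = inr a ∨ Under p y c) ∧
    ((∀ w, Under p y (inl w) → inr w ∈ Γ i₀ → p (inl w) = inr i₀) → ∃ A s, Branch Γ y a A s ∧
    (a :: A).Nodup ∧ ∀ h, h ∈ a :: A ↔ Anc p (inr a) (inr h)) :=
    by
  obtain ⟨y, hy, hp, hd⟩ := R.exists_far ha hai (by
    rw [hx]
    exact fun hc => haf (inr.inj hc).symm)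
  have hanc := R.anc_edge hy hp hd
  refine ⟨y, hy, hp, hd, hanc, fun hbad => ?_⟩
  obtain ⟨A, s, h1, h2, h3⟩ := R.exists_branch (univ.sup dep)
    (fun a => Finset.le_sup (f := dep) (mem_univ a)) (univ.sup dep + 1) hd (by intros; omega) hbad
  refine ⟨A, s, h1, ?_, ?_⟩
  · rw [nodup_cons, h3]
    exact ⟨R.not_under hd, h2⟩
  · intro h
    rw [hanc, List.mem_cons, h3, inr.injEq]

/-- The path to the vertex `v₀` at which the root edge closes a loop. -/
theorem Rooted.exists_spine (R : Rooted Γ p dep i₀) (hz : Γ i₀ = s(inr v₀, z))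
    (h₀ : p (inl v₀) ≠ inr i₀) (hbad : ∀ u, inr u ∈ Γ i₀ → p (inl u) ≠ inr i₀ → u = v₀) (D : ℕ)
    (hD : ∀ a, dep a ≤ D) (N : ℕ) (hx : Down Γ p f x) (hN : ∀ u, x = inr u → D < dep (inl u) + N)
    (hv : Under p x (inl v₀)) : ∃ L Ts, Spine Γ x f z i₀ L Ts ∧ L.Nodup ∧ ∀ h, h ∈ L ↔ h = f ∨ Under
    p x (inr h) := by
  induction N generalizing f x with
  | zero =>
    obtain ⟨u, rfl, -⟩ := hv
    grind
  | succ N ih =>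
    obtain ⟨u, rfl, hu⟩ := hv
    have hpu := hx.2 u rfl
    have hd1 := R.dep_eq (inl u) (by simp)
    rw [hpu] at hd1
    have hbad' : ∀ w, ¬ w = v₀ → inr w ∈ Γ i₀ → p (inl w) = inr i₀ := by
      grind
    -- at `v₀` the spine ends with the root edge
    by_cases huv : u = v₀
    · subst huv
      have hfi : f ≠ i₀ := by
        rintro rfl
        exact h₀ hpu
      have hui : inr u ∈ Γ i₀ := by rw [hz]; simp
      obtain ⟨a, ht⟩ : ∃ a, Tri Γ u f a i₀ := by
        obtain ⟨a, b, ht⟩ := exists_tri (R.tri u) hx.1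
        rcases (ht.2.2.2 i₀).1 hui with h | h | h
        · exact absurd h.symm hfi
        · subst h
          exact ⟨b, ht.swap⟩
        · subst h
          exact ⟨a, ht⟩
      obtain ⟨y, a1, a2, a3, a4, a5⟩ := R.exists_child hpu ((ht.2.2.2 a).2 (by tauto)) ht.1.symm
        ht.2.2.1
      have hnot : ∀ w, Under p y (inl w) → ¬ w = u := by
        rintro w hw rfl
        exact R.not_anc a2 ((a4 _).2 (Or.inr hw))
      obtain ⟨A, s, b1, b2, b3⟩ := a5 fun w hw => hbad' w (hnot w hw)
      refine ⟨_, _, Spine.cons ht a1 b1 hz (Spine.nil z i₀), ?_, ?_⟩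
      · rw [append_nil, nodup_cons, b3]
        refine ⟨fun hc => ?_, b2⟩
        have := hc.dep_le R.root R.dep_root R.dep_eq
        have h2 := R.dep_eq (inr a) (by simpa using ht.2.2.1)
        rw [a2] at h2
        omega
      · intro h
        rw [append_nil, List.mem_cons, b3]
        simp only [Under, inr.injEq, exists_eq_left', R.anc_vertex]
        refine or_congr_right ⟨fun h => ⟨a, ht.2.2.1, a2, h⟩, ?_⟩
        rintro ⟨c, c1, c2, c3⟩
        rcases R.eq_or_eq_of_parent hpu ht c1 c2 with rfl | rfl <;> grind
    · have hne : ∀ a, inr u ∈ Γ a → a ≠ f → a ≠ i₀ := by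
        grind
      -- exactly one of the two children leads on to `v₀`; the other one carries a tree
      obtain ⟨a, b, ht, hpa, hav⟩ : ∃ a b, Tri Γ u f a b ∧ p (inr a) = inl u ∧
          Anc p (inr a) (inl v₀) := by
        obtain ⟨a, b, ht⟩ := exists_tri (R.tri u) hx.1
        rcases (Anc.step R.root).1 hu with h | ⟨c, c1, c2, c3⟩
        · exact absurd (inl.inj h).symm huv
        · rcases c with w | c
          · have := R.adj _ c1
            rw [c2] at this
            exact this.elim
          · rcases R.eq_or_eq_of_parent hpu ht (by simpa using c1) c2 with rfl | rfl
            · exact ⟨c, b, ht, c2, c3⟩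
            · exact ⟨c, a, ht.swap, c2, c3⟩
      have hua : inr u ∈ Γ a := (ht.2.2.2 a).2 (by tauto)
      have hub : inr u ∈ Γ b := (ht.2.2.2 b).2 (by tauto)
      have hai := hne a hua ht.1.symm
      have hbi := hne b hub ht.2.1.symm
      obtain ⟨y, a1, -, a3, a4, -⟩ := R.exists_child hpu hua ht.1.symm hai
      obtain ⟨w, b1, b2, b3, b4, b5⟩ := R.exists_child hpu hub ht.2.1.symm hbi
      obtain ⟨B, s, c1, c2, c3⟩ := b5 fun q hq => hbad' q (by
        rintro rfl
        exact R.disjoint ht.2.2.1 hpa b2 hav ((b4 _).2 (Or.inr hq)))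
      obtain ⟨L, Ts, d1, d2, d3⟩ := ih a3 (by
        rintro q rfl
        have h1 := R.dep_eq (inl q) (by simp)
        rw [a3.2 q rfl] at h1
        have h2 := R.dep_eq (inr a) (by simpa using hai)
        rw [hpa] at h2
        have := hN u rfl
        omega) (by
        rcases (a4 _).1 hav with h | h
        · cases h
        · exact h)
      have d3' : ∀ h, h ∈ L ↔ Anc p (inr a) (inr h) := by
        grind
      have hdep : ∀ a, a ≠ i₀ → p (inr a) = inl u → ¬ Anc p (inr a) (inr f) := by
        intro a hai hpa hc
        have := hc.dep_le R.root R.dep_root R.dep_eq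
        have h2 := R.dep_eq (inr a) (by simpa using hai)
        rw [hpa] at h2
        omega
      refine ⟨_, _, Spine.cons ht.swap b1 c1 a1 d1, ?_, ?_⟩
      · have : (f :: (b :: B ++ L)).Nodup := by
          rw [nodup_cons, nodup_append', List.mem_append, c3, d3']
          refine ⟨fun hc => ?_, c2, d2, ?_⟩
          · grind
          · intro c hc hc'
            exact R.disjoint ht.2.2.1 hpa b2 ((d3' c).1 hc') ((c3 c).1 hc)
        simpa using this
      · intro h
        have : h ∈ f :: b :: (B ++ L) ↔ h = f ∨ (h ∈ b :: B ∨ h ∈ L) := by simp [or_assoc]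
        rw [this, c3, d3']
        simp only [Under, inr.injEq, exists_eq_left', R.anc_vertex]
        refine or_congr_right ⟨?_, ?_⟩
        · grind
        · rintro ⟨c, k1, k2, k3⟩
          rcases R.eq_or_eq_of_parent hpu ht k1 k2 with rfl | rfl <;> grind

theorem Rooted.under_root (R : Rooted Γ p dep i₀) (c : Fin m ⊕ Fin e) :
    c = inr i₀ ∨ ∃ u, inr u ∈ Γ i₀ ∧ p (inl u) = inr i₀ ∧ Anc p (inl u) c := by
  have := Anc.root R.root R.dep_root R.dep_eq c
  rcases (Anc.step R.root).1 this with h | ⟨b, h1, h2, h3⟩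
  · exact Or.inl h
  · have ha := R.adj b h1
    rw [h2] at ha
    rcases b with b | b
    · exact Or.inr ⟨b, ha, h2, h3⟩
    · exact ha.elim

/-- If every incidence belongs to the rooted tree, then the graph is a tree. -/
theorem Rooted.exists_full (R : Rooted Γ p dep i₀) (hbad : ∀ u, inr u ∈ Γ i₀ → p (inl u) = inr i₀)
    (hi : Γ i₀ = s(x, x')) : ∃ s z ε, Full Γ i₀ x x' s z ε := by
  have main : ∀ x, x ∈ Γ i₀ → ∃ A s, Branch Γ x i₀ A s ∧ A.Nodup ∧
      ∀ h, h ∈ A ↔ Under p x (inr h) := fun x hx =>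
    R.exists_branch (univ.sup dep) (fun a => Finset.le_sup (f := dep) (mem_univ a))
      (univ.sup dep + 1) ⟨hx, by rintro u rfl; exact hbad u hx⟩ (by intros; omega)
      (fun u _ => hbad u)
  obtain ⟨A, s, a1, a2, a3⟩ := main x (by rw [hi]; simp)
  obtain ⟨M, z, b1, b2, b3⟩ := main x' (by rw [hi]; simp)
  have hdown : ∀ x, x ∈ Γ i₀ → Down Γ p i₀ x := fun x hx => ⟨hx, by rintro u rfl; exact hbad u hx⟩
  refine ⟨s, z, _, A, M, hi, a1, b1, ?_, rfl⟩
  refine List.perm_of_nodup_nodup_toFinset_eq ?_ (nodup_finRange e) ?_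
  · rw [nodup_cons, nodup_append', List.mem_append, a3, b3]
    refine ⟨?_, a2, b2, ?_⟩
    · rintro (h | h)
      · exact R.not_under (hdown x (by rw [hi]; simp)) h
      · exact R.not_under (hdown x' (by rw [hi]; simp)) h
    · intro c hc hc'
      obtain ⟨u, rfl, hu⟩ := (a3 c).1 hc
      obtain ⟨w, rfl, hw⟩ := (b3 c).1 hc'
      have d1 := R.dep_eq (inl u) (by simp)
      have d2 := R.dep_eq (inl w) (by simp)
      rw [hbad u (by rw [hi]; simp)] at d1
      rw [hbad w (by rw [hi]; simp)] at d2
      have := Anc.eq_of_dep R.root R.dep_root R.dep_eq hu hw (by omega)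
      obtain rfl := inl.inj this
      exact R.loopless i₀ (by rw [hi]; simp)
  · ext h
    simp only [List.mem_toFinset, List.mem_cons, List.mem_append, mem_finRange, iff_true, a3, b3]
    rcases R.under_root (inr h) with hc | ⟨u, h1, h2, h3⟩
    · exact Or.inl (inr.inj hc)
    · rw [hi, Sym2.mem_iff] at h1
      rcases h1 with rfl | rfl
      · exact Or.inr (Or.inl ⟨u, rfl, h3⟩)
      · exact Or.inr (Or.inr ⟨u, rfl, h3⟩)

/-- If one incidence is missing in the rooted tree, then the graph is a closed chain of trees. -/
theorem Rooted.exists_closed (R : Rooted Γ p dep i₀) (hz : Γ i₀ = s(inr v₀, z))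
    (h₀ : p (inl v₀) ≠ inr i₀) (hbad : ∀ u, inr u ∈ Γ i₀ → p (inl u) ≠ inr i₀ → u = v₀) : ∃ L Ts,
    Spine Γ z i₀ z i₀ L Ts ∧ L.Perm (finRange e) := by
  have hne : ∀ u, z = inr u → u ≠ v₀ := by
    rintro u rfl rfl
    exact R.loopless i₀ (by rw [hz]; simp)
  have hdown : Down Γ p i₀ z := by
    refine ⟨by rw [hz]; simp, ?_⟩
    grind
  have key : ∀ c, c = inr i₀ ∨ Under p z c := by
    intro c
    refine (R.under_root c).imp_right ?_
    rintro ⟨u, h1, h2, h3⟩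
    rw [hz, Sym2.mem_iff] at h1
    rcases h1 with h1 | h1
    · grind
    · exact ⟨u, h1.symm, h3⟩
  obtain ⟨L, Ts, h1, h2, h3⟩ := R.exists_spine hz h₀ hbad (univ.sup dep)
    (fun a => Finset.le_sup (f := dep) (mem_univ a)) (univ.sup dep + 1) hdown
    (by intros; omega) (by
      rcases key (inl v₀) with h | h
      · cases h
      · exact h)
  refine ⟨L, Ts, h1, List.perm_of_nodup_nodup_toFinset_eq h2 (nodup_finRange e) ?_⟩
  ext h
  simp only [List.mem_toFinset, mem_finRange, iff_true, h3]
  rcases key (inr h) with hc | hc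
  · exact Or.inl (inr.inj hc)
  · exact Or.inr hc

/-! #### Counting -/

/-- The number of edges at external vertices, counted with multiplicity. -/
def legs (Γ : EdgeSeq n m e) : ℕ := ∑ j : Fin n, valence Γ (inl j)

theorem sum_valence (hl : ∀ i, ¬ (Γ i).IsDiag) :
    legs Γ + ∑ v : Fin m, valence Γ (inr v) = 2 * e := by
  unfold legs
  have h : ∀ i : Fin e, (∑ u : Vtx n m, if u ∈ Γ i then 1 else 0) = 2 := by
    intro i
    have := hl i
    induction hz : Γ i with
    | _ a b =>
    rw [hz] at this
    have hab : a ≠ b := by simpa using this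
    rw [← Finset.card_filter]
    have : (univ.filter fun u => u ∈ s(a, b)) = {a, b} := by
      ext u
      simp [Sym2.mem_iff]
    rw [this, Finset.card_pair hab]
  have h2 := Finset.sum_comm (s := (univ : Finset (Vtx n m))) (t := (univ : Finset (Fin e)))
    (f := fun u i => if u ∈ Γ i then 1 else 0)
  simp only [h, Finset.sum_const, Finset.card_univ, Fintype.card_fin, smul_eq_mul,
    ← valence_eq_sum] at h2
  rw [← Fintype.sum_sum_type (fun u => valence Γ u), h2, mul_comm]

theorem incGraph_connected (hc : (SimpleGraph.fromRel fun i k : Fin e => ∃ v : Fin m, inr v ∈ Γ i ∧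
    inr v ∈ Γ k).Connected) (hv : ∀ v : Fin m, ∃ h, inr v ∈ Γ h) : (incGraph Γ).Connected := by
  have : Nonempty (Fin e) := hc.nonempty
  have key : ∀ h k : Fin e, (incGraph Γ).Reachable (inr h) (inr k) := by
    intro h k
    obtain ⟨w⟩ := hc.preconnected h k
    induction w with
    | nil => exact SimpleGraph.Reachable.refl _
    | @cons a b c hab w ih =>
      refine SimpleGraph.Reachable.trans ?_ ih
      have : ∃ v : Fin m, inr v ∈ Γ a ∧ inr v ∈ Γ b := by
        rcases (SimpleGraph.fromRel_adj _ _ _).1 hab with ⟨-, h | ⟨v, h1, h2⟩⟩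
        all_goals grind
      obtain ⟨v, h1, h2⟩ := this
      have e1 : (incGraph Γ).Adj (inr a) (inl v) := h1
      have e2 : (incGraph Γ).Adj (inl v) (inr b) := h2
      exact e1.reachable.trans e2.reachable
  obtain ⟨i⟩ := hc.nonempty
  have key2 : ∀ a, (incGraph Γ).Reachable a (inr i) := by
    rintro (v | h)
    · obtain ⟨h, hh⟩ := hv v
      have e1 : (incGraph Γ).Adj (inl v) (inr h) := hh
      exact e1.reachable.trans (key h i)
    · exact key h i
  have : Nonempty (Fin m ⊕ Fin e) := ⟨inr i⟩
  exact SimpleGraph.Connected.mk fun a b => (key2 a).trans (key2 b).symm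

theorem incGraph_card [DecidableRel (incGraph Γ).Adj] :
    (incGraph Γ).edgeFinset.card = ∑ v : Fin m, valence Γ (inr v) := by
  classical
  have h1 : (incGraph Γ).edgeFinset = (univ.filter fun q : Fin m × Fin e => inr q.1 ∈ Γ q.2).image
      fun q => s(inl q.1, inr q.2) := by
    ext z
    induction z with
    | _ a b =>
    simp only [SimpleGraph.mem_edgeFinset, SimpleGraph.mem_edgeSet, mem_image, mem_filter,
      mem_univ, true_and, Prod.exists]
    rcases a with a | a <;> rcases b with b | b
    · exact ⟨fun h => h.elim, by rintro ⟨c, d, -, h⟩; simp at h⟩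
    · rw [incGraph_adj]
      constructor
      · intro h
        exact ⟨a, b, h, rfl⟩
      · rintro ⟨c, d, h, hc⟩
        simp at hc
        obtain ⟨rfl, rfl⟩ := hc
        exact h
    · rw [SimpleGraph.adj_comm, incGraph_adj]
      constructor
      · intro h
        exact ⟨b, a, h, Sym2.eq_swap⟩
      · rintro ⟨c, d, h, hc⟩
        simp at hc
        obtain ⟨rfl, rfl⟩ := hc
        exact h
    · exact ⟨fun h => h.elim, by rintro ⟨c, d, -, h⟩; simp at h⟩
  rw [h1, Finset.card_image_of_injective]
  · rw [Finset.card_filter, Fintype.sum_prod_type]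
    simp only [valence_eq_sum]
  · rintro ⟨a, b⟩ ⟨c, d⟩ h
    simpa using h

end

section

variable {v : Vtx n m} {k : Fin e}

theorem exists_mem_of_valence (h : valence Γ v ≠ 0) : ∃ i, v ∈ Γ i := by
  by_contra hc
  push Not at hc
  exact h (by simp [valence, hc])

theorem IsICG.incGraph_connected (h : IsICG Γ) : (incGraph Γ).Connected :=
  KV.incGraph_connected h.connected fun v => exists_mem_of_valence (by
    have := h.trivalent v
    omega)

theorem IsICG.add_legs_le (h : IsICG Γ) : m + legs Γ ≤ e + 1 := by
  classical
  obtain ⟨T, hT, hT'⟩ := h.incGraph_connected.exists_isTree_le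
  have h1 := hT'.card_edgeFinset
  have h2 := Finset.card_le_card (SimpleGraph.edgeFinset_mono hT)
  rw [incGraph_card] at h2
  have h3 := sum_valence h.loopless
  simp only [Fintype.card_sum, Fintype.card_fin] at h1
  omega

theorem IsICG.loops_add (h : IsICG Γ) : loops Γ + (m + legs Γ) = e + 1 := by
  have := h.add_legs_le
  unfold loops
  unfold legs at this ⊢
  omega

theorem IsICG.sum_valence_inr (h : IsICG Γ) :
    ∑ v : Fin m, valence Γ (inr v) + 1 = e + m + loops Γ := by
  have h1 := h.loops_add
  have h2 := sum_valence h.loopless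
  omega

/-- In degree equal to the number of loops, the internal vertices are trivalent. -/
theorem IsICG.valence_eq_three (h : IsICG Γ) (he : e + loops Γ = 2 * m + 1) (v : Fin m) :
    valence Γ (inr v) = 3 := by
  have h1 := h.sum_valence_inr
  have h2 : ∑ v : Fin m, valence Γ (inr v) = ∑ v : Fin m, 3 := by
    simp only [sum_const, card_univ, Fintype.card_fin, smul_eq_mul]
    omega
  have h3 := (Finset.sum_eq_sum_iff_of_le fun v _ => h.trivalent v).1 h2.symm
  exact (h3 v (mem_univ v)).symm

/-- In the degree below, exactly one internal vertex is 4-valent. -/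
theorem IsICG.exists_four (h : IsICG Γ) (he : e + loops Γ = 2 * m + 2) :
    ∃ w : Fin m, valence Γ (inr w) = 4 ∧ ∀ v, v ≠ w → valence Γ (inr v) = 3 := by
  have h1 := h.sum_valence_inr
  have h4 : ∃ w : Fin m, 3 < valence Γ (inr w) := by
    by_contra hc
    push Not at hc
    have := Finset.sum_le_sum fun v (_ : v ∈ (univ : Finset (Fin m))) => hc v
    simp only [sum_const, card_univ, Fintype.card_fin, smul_eq_mul] at this
    omega
  obtain ⟨w, hw⟩ := h4
  rw [← Finset.add_sum_erase _ _ (mem_univ w)] at h1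
  have h5 : ∑ v ∈ univ.erase w, 3 ≤ ∑ v ∈ univ.erase w, valence Γ (inr v) :=
    Finset.sum_le_sum fun v _ => h.trivalent v
  have h6 : ∑ v ∈ univ.erase w, 3 = 3 * (m - 1) := by
    rw [Finset.sum_const, Finset.card_erase_of_mem (mem_univ w)]
    simp [mul_comm]
  have hm : 0 < m := by
    have := w.2
    omega
  refine ⟨w, by omega, fun v hv => ?_⟩
  have h7 : ∑ v ∈ univ.erase w, 3 = ∑ v ∈ univ.erase w, valence Γ (inr v) := by omega
  exact ((Finset.sum_eq_sum_iff_of_le fun v _ => h.trivalent v).1 h7 v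
    (by simp [hv])).symm

theorem IsICG.exists_rooted {T : SimpleGraph (Fin m ⊕ Fin e)} (h : IsICG Γ)
    (hv : ∀ v, valence Γ (inr v) = 3) (hT : T.IsTree) (hle : T ≤ incGraph Γ) (i₀ : Fin e)
    (hi : ∀ v k, inr v ∈ Γ k → k ≠ i₀ → T.Adj (inl v) (inr k)) : ∃ p dep, Rooted Γ p dep i₀ ∧ ∀ v, p
    (inl v) = inr i₀ ↔ T.Adj (inl v) (inr i₀) := by
  obtain ⟨p, dep, h1, h2, h3, h4⟩ := exists_parent hT (inr i₀)
  refine ⟨p, dep, ⟨hv, h.loopless, h1, h2, fun a ha => (h3 a ha).2, fun a ha => hle (h3 a ha).1,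
    fun v k hk hne => ?_⟩, fun v => ⟨fun hp => ?_, fun ha => ?_⟩⟩
  · rcases h4 _ _ (hi v k hk hne) with h | h
    · exact Or.inl h.1.symm
    · exact Or.inr h.1.symm
  · have := (h3 (inl v) (by simp)).1
    rwa [hp] at this
  · rcases h4 _ _ ha with h | h
    · exact absurd rfl h.2
    · exact h.1.symm

/-- An internally trivalent tree can be read off from any edge. -/
theorem IsICG.exists_full (h : IsICG Γ) (h0 : loops Γ = 0) (he : e = 2 * m + 1) (i : Fin e) :
    ∃ x x' s z ε, Full Γ i x x' s z ε := by
  classical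
  have hv := h.valence_eq_three (by omega)
  obtain ⟨T, hT, hT'⟩ := h.incGraph_connected.exists_isTree_le
  have h1 := hT'.card_edgeFinset
  have h2 : T.edgeFinset = (incGraph Γ).edgeFinset := by
    refine Finset.eq_of_subset_of_card_le (SimpleGraph.edgeFinset_mono hT) ?_
    rw [incGraph_card]
    simp only [Fintype.card_sum, Fintype.card_fin] at h1
    have := h.sum_valence_inr
    omega
  rw [SimpleGraph.edgeFinset_inj] at h2
  obtain ⟨p, dep, R, hp⟩ := h.exists_rooted hv hT' hT i fun v k hk _ => by
    rw [h2]
    exact hk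
  induction hz : Γ i with
  | _ x x' =>
  obtain ⟨s, z, ε, hF⟩ := R.exists_full (fun u hu => (hp u).2 (by rw [h2]; exact hu)) hz
  exact ⟨x, x', s, z, ε, hF⟩

/-- An internally trivalent one-loop graph is a closed chain of trees. -/
theorem IsICG.exists_closed (h : IsICG Γ) (h0 : loops Γ = 1) (he : e = 2 * m) :
    ∃ x i L Ts, Spine Γ x i x i L Ts ∧ L.Perm (finRange e) := by
  classical
  have hv := h.valence_eq_three (by omega)
  obtain ⟨T, hT, hT'⟩ := h.incGraph_connected.exists_isTree_le
  have h1 := hT'.card_edgeFinset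
  have hsub := SimpleGraph.edgeFinset_mono hT
  have h2 : ((incGraph Γ).edgeFinset \ T.edgeFinset).card = 1 := by
    rw [Finset.card_sdiff_of_subset hsub, incGraph_card]
    simp only [Fintype.card_sum, Fintype.card_fin] at h1
    have := h.sum_valence_inr
    omega
  obtain ⟨a, ha⟩ := Finset.card_eq_one.1 h2
  have key : ∀ v k, inr v ∈ Γ k → (¬ T.Adj (inl v) (inr k) ↔ s(inl v, inr k) = a) := by
    intro v k hk
    have := Finset.ext_iff.1 ha s(inl v, inr k)
    simp only [mem_sdiff, SimpleGraph.mem_edgeFinset, SimpleGraph.mem_edgeSet, mem_singleton]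
      at this
    rw [← this]
    exact ⟨fun h => ⟨hk, h⟩, fun h => h.2⟩
  obtain ⟨v₀, i₀, hvi, rfl⟩ : ∃ v₀ i₀, inr v₀ ∈ Γ i₀ ∧ a = s(inl v₀, inr i₀) := by
    have : a ∈ (incGraph Γ).edgeFinset := by
      have := Finset.ext_iff.1 ha a
      grind
    induction a with
    | _ b c =>
    simp only [SimpleGraph.mem_edgeFinset, SimpleGraph.mem_edgeSet] at this
    rcases b with b | b <;> rcases c with c | c
    · exact this.elim
    · exact ⟨b, c, this, rfl⟩
    · exact ⟨c, b, this, Sym2.eq_swap⟩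
    · exact this.elim
  have key2 : ∀ v k, inr v ∈ Γ k → (¬ T.Adj (inl v) (inr k) ↔ v = v₀ ∧ k = i₀) := by
    intro v k hk
    rw [key v k hk]
    simp
  obtain ⟨p, dep, R, hp⟩ := h.exists_rooted hv hT' hT i₀ fun v k hk hne => by
    grind
  obtain ⟨z, hz⟩ := id hvi
  obtain ⟨L, Ts, h3, h4⟩ := R.exists_closed hz
    (fun hc => (key2 v₀ i₀ hvi).2 ⟨rfl, rfl⟩ ((hp v₀).1 hc))
    (fun u hu hne => ((key2 u i₀ hu).1 fun hc => hne ((hp u).2 hc)).1)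
  exact ⟨z, i₀, L, Ts, h3, h4⟩

/-! #### A tree which can be read off is internally connected -/

theorem reachable_edge {v : Fin m} (hi : inr v ∈ Γ i) (hk : inr v ∈ Γ k) :
    (SimpleGraph.fromRel fun i k : Fin e => ∃ v : Fin m, inr v ∈ Γ i ∧ inr v ∈ Γ k).Reachable i
    k := by
  by_cases h : i = k
  · rw [h]
  · refine SimpleGraph.Adj.reachable ?_
    rw [SimpleGraph.fromRel_adj]
    exact ⟨h, Or.inl ⟨v, hi, hk⟩⟩

theorem Branch.reachable (h : Branch Γ x i A s) (hk : k ∈ A) :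
    (SimpleGraph.fromRel fun i k : Fin e => ∃ v : Fin m, inr v ∈ Γ i ∧ inr v ∈ Γ k).Reachable i
    k := by
  induction h with
  | leaf => simp at hk
  | @node v i f g x y A B s t hv hf hg h1 h2 ih1 ih2 =>
    have e1 := reachable_edge ((hv.2.2.2 i).2 (by tauto)) ((hv.2.2.2 f).2 (by tauto))
    have e2 := reachable_edge ((hv.2.2.2 i).2 (by tauto)) ((hv.2.2.2 g).2 (by tauto))
    simp only [List.mem_cons, List.mem_append] at hk
    rcases hk with rfl | hk | rfl | hk
    · exact e1
    · exact e1.trans (ih1 hk)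
    · exact e2
    · exact e2.trans (ih2 hk)

theorem Branch.exists_leaf
    (h : Branch Γ x i A s) : (∃ k, x = inl k) ∨ ∃ f ∈ A, ∃ k, inl k ∈ Γ f := by
  induction h with
  | leaf k => exact Or.inl ⟨k, rfl⟩
  | @node v i f g x y A B s t hv hf hg h1 h2 ih1 ih2 =>
    right
    rcases ih1 with ⟨k, rfl⟩ | ⟨a, ha, k, hk⟩
    · exact ⟨f, by simp, k, by rw [hf]; simp⟩
    · exact ⟨a, by simp [ha], k, hk⟩

/-- In a graph with connected line graph, every vertex is connected with every end of every
edge. -/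
theorem vtx_reachable (hc : (SimpleGraph.fromRel fun i k : Fin e => ∃ v : Fin m, inr v ∈ Γ i ∧ inr
    v ∈ Γ k).Connected) (hu : u ∈ Γ i) (hv : v ∈ Γ k) :
    (SimpleGraph.fromEdgeSet (Set.range Γ)).Reachable u v := by
  have key : ∀ {i : Fin e} {u v : Vtx n m}, u ∈ Γ i → v ∈ Γ i →
      (SimpleGraph.fromEdgeSet (Set.range Γ)).Reachable u v := by
    intro i u v hu hv
    by_cases huv : u = v
    · rw [huv]
    · refine SimpleGraph.Adj.reachable ?_
      rw [SimpleGraph.fromEdgeSet_adj]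
      exact ⟨⟨i, ((Sym2.mem_and_mem_iff huv).1 ⟨hu, hv⟩)⟩, huv⟩
  obtain ⟨w⟩ := hc.preconnected i k
  induction w generalizing u with
  | nil => exact key hu hv
  | @cons a b c hab w ih =>
    have : ∃ v : Fin m, inr v ∈ Γ a ∧ inr v ∈ Γ b := by
      rcases (SimpleGraph.fromRel_adj _ _ _).1 hab with ⟨-, h | ⟨v, h1, h2⟩⟩
      all_goals grind
    obtain ⟨x, h1, h2⟩ := this
    exact (key hu h1).trans (ih h2 hv)

theorem isICG_of_reachable (hs : Injective Γ) (hl : ∀ i, ¬ (Γ i).IsDiag)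
    (ht : ∀ v : Fin m, 3 ≤ valence Γ (inr v)) (hr : ∀ k, (SimpleGraph.fromRel fun i k : Fin e => ∃
    v : Fin m, inr v ∈ Γ i ∧ inr v ∈ Γ k).Reachable i k) (hk : ∃ f k, inl k ∈ Γ f) : IsICG Γ := by
  have : Nonempty (Fin e) := ⟨i⟩
  have hc : (SimpleGraph.fromRel fun i k : Fin e =>
      ∃ v : Fin m, inr v ∈ Γ i ∧ inr v ∈ Γ k).Connected :=
    SimpleGraph.Connected.mk fun a b => (hr a).symm.trans (hr b)
  obtain ⟨f, k, hk⟩ := hk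
  refine ⟨hs, hl, ht, fun v => ⟨k, ?_⟩, hc⟩
  obtain ⟨a, ha⟩ := exists_mem_of_valence (Γ := Γ) (v := inr v) (by have := ht v; omega)
  exact vtx_reachable hc ha hk

/-- The conditions on a graph which do not follow from being a tree. -/
theorem Full.isICG (h : Full Γ i x x' s z ε) (hs : Injective Γ) (hl : ∀ i, ¬ (Γ i).IsDiag)
    (ht : ∀ v : Fin m, 3 ≤ valence Γ (inr v)) : IsICG Γ := by
  obtain ⟨A, M, h1, h2, h3, h4, h5⟩ := h
  refine isICG_of_reachable hs hl ht (i := i) (fun k => ?_) ?_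
  · have hk : k ∈ i :: (A ++ M) := h4.mem_iff.2 (mem_finRange k)
    simp only [List.mem_cons, List.mem_append] at hk
    rcases hk with rfl | hk | hk
    · exact SimpleGraph.Reachable.refl _
    · exact h2.reachable hk
    · exact h3.reachable hk
  · rcases h2.exists_leaf with ⟨k, rfl⟩ | ⟨f, -, k, hk⟩
    · exact ⟨i, k, by rw [h1]; simp⟩
    · exact ⟨f, k, hk⟩

end

section

/-! ### Branches and vertex splitting -/

variable {y : Vtx n (m + 1)} {h p' q' a' b' : Fin e} {v : Vtx n m}

theorem up_injective : Injective (up : Vtx n m → Vtx n (m + 1)) := by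
  rintro (a | a) (b | b) h <;> simp_all [up]

theorem up_ne_newV (x : Vtx n m) : up x ≠ (newV : Vtx n (m + 1)) := by
  rcases x with a | a
  · simp [up, newV]
  · simp [up, newV, Fin.castSucc_ne_last]

theorem up_inr (v : Fin m) : up (inr v : Vtx n m) = inr v.castSucc := rfl

theorem up_inl (k : Fin n) : up (inl k : Vtx n m) = inl k := rfl

theorem newV_def : (newV : Vtx n (m + 1)) = inr (Fin.last m) := rfl

theorem exists_up (hy : y ≠ newV) : ∃ x, y = up x := by
  rcases y with k | v
  · exact ⟨inl k, rfl⟩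
  · induction v using Fin.lastCases with
    | last => exact absurd rfl hy
    | cast v => exact ⟨inr v, rfl⟩

theorem split_last : split Γ u S (Fin.last e) = s(up u, newV) := by simp [split]

theorem split_of_notMem (hh : h ∉ S) :
    split Γ u S h.castSucc = (Γ h).map up := by simp [split, hh]

theorem split_of_notMem' {y : Vtx n m} (hh : h ∉ S) (hx : Γ h = s(x, y)) :
    split Γ u S h.castSucc = s(up x, up y) := by
  rw [split_of_notMem hh, hx, Sym2.map_mk]

theorem split_of_mem (hh : h ∈ S) (hx : Γ h = s(u, x)) (hxu : x ≠ u) :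
    split Γ u S h.castSucc = s(newV, up x) := by
  simp [split, hh, hx, hxu]

theorem split_loopless (hl : ∀ i, ¬ (Γ i).IsDiag) (i : Fin (e + 1)) : ¬ (split Γ u S i).IsDiag := by
  induction i using Fin.lastCases with
  | last =>
    rw [split_last, Sym2.mk_isDiag_iff]
    exact up_ne_newV u
  | cast i =>
    by_cases hi : i ∈ S
    · simp only [split, Fin.snoc_castSucc, hi, if_true]
      rw [Sym2.isDiag_map]
      · exact hl i
      · intro a b hab
        simp only at hab
        split_ifs at hab with h1 h2 h2
        · rw [h1, h2]
        · exact absurd hab.symm (up_ne_newV b)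
        · exact absurd hab (up_ne_newV a)
        · exact up_injective hab
    · rw [split_of_notMem hi, Sym2.isDiag_map up_injective]
      exact hl i

theorem mem_split_castSucc (hv : v ≠ u) (h : Fin e) : up v ∈ split Γ u S h.castSucc ↔ v ∈ Γ h := by
  simp only [split, Fin.snoc_castSucc]
  split_ifs
  · rw [Sym2.mem_map]
    constructor
    · rintro ⟨a, ha, hav⟩
      split_ifs at hav with h1
      · exact absurd hav.symm (up_ne_newV v)
      · rwa [← up_injective hav]
    · intro h
      exact ⟨v, h, by simp [hv]⟩
  · rw [Sym2.mem_map]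
    constructor
    · rintro ⟨a, ha, hav⟩
      rwa [← up_injective hav]
    · intro h
      exact ⟨v, h, rfl⟩

theorem mem_split_self : up u ∈ split Γ u S h.castSucc ↔ u ∈ Γ h ∧ h ∉ S := by
  by_cases hS : h ∈ S
  · simp only [split, Fin.snoc_castSucc, hS, if_true, not_true_eq_false, and_false, iff_false]
    rw [Sym2.mem_map]
    rintro ⟨a, ha, hav⟩
    split_ifs at hav with h1
    · exact absurd hav.symm (up_ne_newV u)
    · exact h1 (up_injective hav)
  · rw [split_of_notMem hS, Sym2.mem_map]
    constructor
    · rintro ⟨a, ha, hav⟩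
      rw [← up_injective hav]
      exact ⟨ha, hS⟩
    · intro h
      exact ⟨u, h.1, rfl⟩

theorem mem_split_newV : newV ∈ split Γ u S h.castSucc ↔ u ∈ Γ h ∧ h ∈ S := by
  by_cases hS : h ∈ S
  · simp only [split, Fin.snoc_castSucc, hS, if_true, and_true]
    rw [Sym2.mem_map]
    constructor
    · rintro ⟨a, ha, hav⟩
      split_ifs at hav with h1
      · rwa [← h1]
      · exact absurd hav (up_ne_newV a)
    · intro h
      exact ⟨u, h, by simp⟩
  · rw [split_of_notMem hS, Sym2.mem_map]
    constructor
    · rintro ⟨a, ha, hav⟩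
      exact absurd hav (up_ne_newV a)
    · intro h
      exact absurd h.2 hS

theorem mem_split_last {x : Vtx n (m + 1)} :
    x ∈ split Γ u S (Fin.last e) ↔ x = up u ∨ x = newV := by
  rw [split_last, Sym2.mem_iff]

theorem valence_split_of_ne (hv : v ≠ u) : valence (split Γ u S) (up v) = valence Γ v := by
  rw [valence_eq_sum, Fin.sum_univ_castSucc, valence_eq_sum]
  have : ¬ up v ∈ split Γ u S (Fin.last e) := by
    rw [mem_split_last]
    rintro (h | h)
    · exact hv (up_injective h)
    · exact up_ne_newV v h
  simp [this, mem_split_castSucc hv]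

theorem valence_split_newV (hS : ∀ i ∈ S, u ∈ Γ i) : valence (split Γ u S) newV = S.card + 1 := by
  rw [valence_eq_sum, Fin.sum_univ_castSucc]
  have h1 : newV ∈ split Γ u S (Fin.last e) := mem_split_last.2 (Or.inr rfl)
  have h2 : ∀ i, newV ∈ split Γ u S i.castSucc ↔ i ∈ S := by
    intro i
    rw [mem_split_newV]
    grind
  simp [h1, h2]

theorem Tri.split {v : Fin m} (h : Tri Γ v i f g) (hv : inr v ≠ u) :
    Tri (split Γ u S) v.castSucc i.castSucc f.castSucc g.castSucc := by
  refine ⟨by simpa using h.1, by simpa using h.2.1, by simpa using h.2.2.1, fun k => ?_⟩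
  induction k using Fin.lastCases with
  | last =>
    rw [← up_inr, mem_split_last]
    constructor
    · rintro (hc | hc)
      · exact absurd (up_injective hc) hv
      · exact absurd hc (up_ne_newV _)
    grind
  | cast k =>
    rw [← up_inr, mem_split_castSucc hv, h.2.2.2]
    simp

theorem Tri.of_split {v : Fin m}
    (h : Tri (KV.split Γ u S) v.castSucc i.castSucc f.castSucc g.castSucc) (hv : inr v ≠ u) : Tri Γ
    v i f g := by
  refine ⟨by simpa using h.1, by simpa using h.2.1, by simpa using h.2.2.1, fun k => ?_⟩
  have := h.2.2.2 k.castSucc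
  rw [← up_inr, mem_split_castSucc hv] at this
  simpa using this

/-- A branch which avoids the split vertex and the moved edges survives a splitting. -/
theorem Branch.split (hu : ∀ w i f g, u = inr w → ¬ Tri Γ w i f g) (h : Branch Γ x i A s)
    (hA : ∀ f ∈ A, f ∉ S) : Branch (KV.split Γ u S) (up x) i.castSucc (A.map Fin.castSucc) s := by
  induction h with
  | leaf k i => exact Branch.leaf k _
  | @node v i f g x y A B s t hv hf hg h1 h2 ih1 ih2 =>
    simp only [List.map_cons, List.map_append]
    have hvu : inr v ≠ u := fun hc => hu _ _ _ _ hc.symm hv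
    simp only [List.mem_cons, List.mem_append] at hA
    exact Branch.node (hv.split hvu) (split_of_notMem' (hA f (by tauto)) hf)
      (split_of_notMem' (hA g (by tauto)) hg) (ih1 fun a ha => hA a (by tauto))
      (ih2 fun a ha => hA a (by tauto))

theorem edge_of_split (hf : split Γ u S f.castSucc = s(up v, y)) (hy : y ≠ newV) : ∃ x, Γ f =
    s(v, x) ∧ y = up x := by
  by_cases hS : f ∈ S
  · simp only [split, Fin.snoc_castSucc, hS, if_true] at hf
    induction hz : Γ f with
    | _ a b =>
    have key : ∀ {a : Vtx n m} {z : Vtx n m}, (if a = u then newV else up a) = up z → a = z := by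
      intro a z h
      split_ifs at h
      · exact absurd h.symm (up_ne_newV z)
      · exact up_injective h
    obtain ⟨x, rfl⟩ := exists_up hy
    rw [hz, Sym2.map_mk, Sym2.eq_iff] at hf
    rcases hf with ⟨h1, h2⟩ | ⟨h1, h2⟩
    · exact ⟨x, by rw [key h1, key h2], rfl⟩
    · exact ⟨x, by rw [key h1, key h2, Sym2.eq_swap], rfl⟩
  · rw [split_of_notMem hS] at hf
    induction hz : Γ f with
    | _ a b =>
    obtain ⟨x, rfl⟩ := exists_up hy
    rw [hz, Sym2.map_mk, Sym2.eq_iff] at hf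
    rcases hf with ⟨h1, h2⟩ | ⟨h1, h2⟩
    · exact ⟨x, by rw [up_injective h1, up_injective h2], rfl⟩
    · exact ⟨x, by rw [up_injective h1, up_injective h2, Sym2.eq_swap], rfl⟩

theorem Branch.ne_newV {i : Fin (e + 1)} {A : List (Fin (e + 1))}
    (h : Branch (KV.split Γ u S) y i A s) (hi : i ≠ Fin.last e) (hA : Fin.last e ∉ A) : y ≠
    newV := by
  rintro rfl
  obtain ⟨f, g, x, y, A₁, A₂, s₁, s₂, hv, hf, hg, b1, b2, rfl, rfl⟩ := h.inr_inv
  have := (hv.2.2.2 (Fin.last e)).1 (mem_split_last.2 (Or.inr rfl))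
  simp only [List.mem_cons, List.mem_append, not_or] at hA
  rcases this with h | h | h
  · exact hi h.symm
  · exact hA.1 h
  · exact hA.2.2.1 h

/-- A branch of a splitting which avoids the new edge is a branch of the original graph. -/
theorem Branch.of_split {j : Fin (e + 1)} {A' : List (Fin (e + 1))}
    (h : Branch (KV.split Γ u S) y j A' s) (hy : y = up x) (hj : j = i.castSucc)
    (hA : Fin.last e ∉ A') : ∃ A, A' = A.map Fin.castSucc ∧ Branch Γ x i A s := by
  induction h generalizing x i with
  | leaf k j =>
    refine ⟨[], rfl, ?_⟩
    rw [← up_inl] at hy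
    rw [← up_injective hy]
    exact Branch.leaf k i
  | @node v j f g x₁ y₁ A B s t hv hf hg h1 h2 ih1 ih2 =>
    simp only [List.mem_cons, List.mem_append, not_or] at hA
    obtain ⟨a1, a2, a3, a4⟩ := hA
    obtain ⟨f, rfl⟩ := Fin.exists_castSucc_eq.2 (Ne.symm a1)
    obtain ⟨g, rfl⟩ := Fin.exists_castSucc_eq.2 (Ne.symm a3)
    subst hj
    rcases x with k | w
    · cases hy
    have hvw : v = w.castSucc := inr.inj hy
    subst hvw
    have hwu : inr w ≠ u := by
      intro hwu
      have := (hv.2.2.2 (Fin.last e)).1 (mem_split_last.2 (Or.inl (by rw [← hwu, up_inr])))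
      grind
    obtain ⟨x, hx, rfl⟩ := edge_of_split (v := inr w) hf (h1.ne_newV (Fin.castSucc_ne_last _) a2)
    obtain ⟨y, hy, rfl⟩ := edge_of_split (v := inr w) hg (h2.ne_newV (Fin.castSucc_ne_last _) a4)
    obtain ⟨A, rfl, b1⟩ := ih1 rfl rfl a2
    obtain ⟨B, rfl, b2⟩ := ih2 rfl rfl a4
    exact ⟨_, by simp, Branch.node (hv.of_split hwu) hx hy b1 b2⟩

/-! #### Splitting a 4-valent vertex -/

/-- The internal vertex `w` is 4-valent, with edges `p`, `q`, `a`, `b`. -/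
def Quad (Γ : EdgeSeq n m e) (w : Fin m) (p q a b : Fin e) : Prop :=
  [p, q, a, b].Nodup ∧ ∀ h, inr w ∈ Γ h ↔ h ∈ [p, q, a, b]

theorem Quad.perm (h : Quad Γ w p q a b)
    (hp : [p, q, a, b].Perm [p', q', a', b']) : Quad Γ w p' q' a' b' :=
  ⟨hp.nodup_iff.1 h.1, fun k => (h.2 k).trans hp.mem_iff⟩

theorem Quad.rot (h : Quad Γ w p q a b) : Quad Γ w p a b q := h.perm (by grind)

theorem exists_quad (h : valence Γ (inr w) = 4) : ∃ p q a b, Quad Γ w p q a b := by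
  have hl : ((univ.filter fun i => inr w ∈ Γ i).toList).length = 4 := by
    rw [Finset.length_toList]
    exact h
  have hn := Finset.nodup_toList (univ.filter fun i => inr w ∈ Γ i)
  have hm : ∀ i, i ∈ (univ.filter fun i => inr w ∈ Γ i).toList ↔ inr w ∈ Γ i := by
    intro i
    simp
  match (univ.filter fun i => inr w ∈ Γ i).toList, hl, hn, hm with
  | [p, q, a, b], _, hn, hm => exact ⟨p, q, a, b, hn, fun i => (hm i).symm⟩

theorem Quad.not_tri (h : Quad Γ w p q a b) (i f g : Fin e) : ¬ Tri Γ w i f g := by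
  intro ht
  have h1 : [p, q, a, b] ⊆ [i, f, g] := by
    intro k hk
    simpa using (ht.2.2.2 k).1 ((h.2 k).2 hk)
  have h2 := (h.1.subperm h1).length_le
  simp at h2

theorem Quad.tri_new (h : Quad Γ w p q a b) :
    Tri (split Γ (inr w) {a, b}) (Fin.last m) (Fin.last e) a.castSucc b.castSucc := by
  have h1 := h.1
  simp only [nodup_cons, List.mem_cons, not_mem_nil, or_false, not_or] at h1
  refine ⟨(Fin.castSucc_ne_last a).symm, (Fin.castSucc_ne_last b).symm, by
    simpa using h1.2.2.1, fun k => ?_⟩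
  induction k using Fin.lastCases with
  | last => simp [mem_split_last, newV_def]
  | cast k =>
    rw [← newV_def, mem_split_newV, h.2]
    grind

theorem Quad.tri_old (h : Quad Γ w p q a b) :
    Tri (split Γ (inr w) {a, b}) w.castSucc p.castSucc (Fin.last e) q.castSucc := by
  have h1 := h.1
  simp only [nodup_cons, List.mem_cons, not_mem_nil, or_false, not_or] at h1
  refine ⟨Fin.castSucc_ne_last p, by simpa using h1.1.1, (Fin.castSucc_ne_last q).symm,
    fun k => ?_⟩
  induction k using Fin.lastCases with
  | last => simp [mem_split_last, up_inr]
  | cast k =>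
    rw [← up_inr, mem_split_self, h.2]
    grind

end

section

/-! ### The differential on classes of graphs -/

variable (K)
variable {M : Type*}

/-- The class of a graph, which is zero unless the graph is admissible and internally connected. -/
def cl (Γ : EdgeSeq n m e) : Piece n m e K := by
  classical exact if h : IsICG Γ then (Rel n m e K).mkQ (Finsupp.single ⟨Γ, h⟩ 1) else 0

theorem cl_of (Γ : Gph n m e) : cl K Γ.1 = (Rel n m e K).mkQ (Finsupp.single Γ 1) := dif_pos Γ.2

theorem cl_of_not (h : ¬ IsICG Γ) : cl K Γ = 0 := dif_neg h

theorem cl_relabel {σ : Equiv.Perm (Fin e)} {τ : Equiv.Perm (Fin m)} (h : IsRelabel σ τ Γ Γ') :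
    cl K Γ' = ((Equiv.Perm.sign σ : ℤ) : K) • cl K Γ := by
  by_cases hΓ : IsICG Γ
  · have hΓ' := h.isICG hΓ
    rw [cl_of K ⟨Γ, hΓ⟩, cl_of K ⟨Γ', hΓ'⟩, ← map_smul, ← sub_eq_zero, ← map_sub]
    exact (Submodule.Quotient.mk_eq_zero _).2 (subset_span ⟨σ, τ, _, _, h, rfl⟩)
  · rw [cl_of_not K hΓ, cl_of_not K fun h' => hΓ (h.symm.isICG h'), smul_zero]

theorem mk_splitTerm (P : EdgeSeq n (m + 1) (e + 1) → Prop) [DecidablePred P] (Γ : EdgeSeq n m e)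
    (v : Vtx n m) (S : Finset (Fin e)) : (Rel n (m + 1) (e + 1) K).mkQ (splitTerm K P Γ v S) = if
    (∀ i ∈ S, v ∈ Γ i) ∧ P (split Γ v S) then cl K (split Γ v S) else 0 := by
  unfold splitTerm
  by_cases hI : IsICG (split Γ v S)
  · by_cases hP : (∀ i ∈ S, v ∈ Γ i) ∧ P (split Γ v S)
    · rw [dif_pos ⟨hI, hP⟩, if_pos hP, cl_of K ⟨_, hI⟩]
    · rw [dif_neg fun h => hP h.2, if_neg hP, map_zero]
  · rw [dif_neg fun h => hI h.1, map_zero, cl_of_not K hI, ite_self]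

/-- The two vertices created by splitting an internal vertex play the same role. -/
theorem split_compl (hS : ∀ h, inr w ∈ Γ h → (h ∈ S' ↔ h ∉ S)) : IsRelabel 1
    (Equiv.swap w.castSucc (Fin.last m)) (split Γ (inr w) S) (split Γ (inr w) S') := by
  have h1 : vtxEquiv n (Equiv.swap w.castSucc (Fin.last m)) (up (inr w)) = newV := by
    simp [vtxEquiv, up, newV]
  have h2 : vtxEquiv n (Equiv.swap w.castSucc (Fin.last m)) newV = up (inr w) := by
    simp [vtxEquiv, up, newV]
  have h3 : ∀ x : Vtx n m, x ≠ inr w →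
      vtxEquiv n (Equiv.swap w.castSucc (Fin.last m)) (up x) = up x := by
    rintro (x | x) hx
    · rfl
    · simp only [vtxEquiv, up, Equiv.sumCongr_apply, Sum.map_inr]
      rw [Equiv.swap_apply_of_ne_of_ne]
      · simpa using hx
      · exact Fin.castSucc_ne_last x
  intro i
  rw [Equiv.Perm.one_apply]
  induction i using Fin.lastCases with
  | last => rw [split_last, split_last, Sym2.map_mk, h1, h2, Sym2.eq_swap]
  | cast i =>
    simp only [split, Fin.snoc_castSucc]
    by_cases hw : inr w ∈ Γ i
    · have := hS i hw
      by_cases hi : i ∈ S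
      · rw [if_neg (by tauto), if_pos hi, Sym2.map_map]
        refine Sym2.map_congr fun x _ => ?_
        grind
      · rw [if_pos (by tauto), if_neg hi, Sym2.map_map]
        grind
    · have key : ∀ x ∈ Γ i, x ≠ inr w := by
        rintro x hx rfl
        exact hw hx
      split_ifs <;> rw [Sym2.map_map] <;> refine Sym2.map_congr fun x hx => ?_ <;>
        simp [key x hx, h3 x (key x hx)]

theorem cl_split_compl (hS : ∀ h, inr w ∈ Γ h → (h ∈ S' ↔ h ∉ S)) : cl K (split Γ (inr w) S') = cl K
    (split Γ (inr w) S) := by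
  rw [cl_relabel K (split_compl hS)]
  simp

/-- Splitting an internal vertex does not change the number of internal loops. -/
theorem loops_split_inr : loops (split Γ (inr w) S) = loops Γ := by
  unfold loops
  have : ∀ j : Fin n, valence (split Γ (inr w) S) (inl j) = valence Γ (inl j) :=
    fun j => valence_split_of_ne (v := inl j) (by simp)
  simp only [this]
  omega

theorem sum_pairs [AddCommMonoid M] (hn : [p, q, a, b].Nodup) (f : Finset (Fin e) → M)
    (hf : ∀ S, f S ≠ 0 → (∀ h ∈ S, h ∈ [p, q, a, b]) ∧ S.card = 2) : ∑ S, f S = f {a, b} + f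
    {p, q} + (f {b, q} + f {a, p}) + (f {q, a} + f {p, b}) := by
  have hinj : Injective [p, q, a, b].get := List.nodup_iff_injective_get.1 hn
  let emb : Fin 4 ↪ Fin e := ⟨[p, q, a, b].get, hinj⟩
  have h1 : ∑ S, f S = ∑ S ∈ powersetCard 2 (univ.map emb), f S := by
    symm
    refine Finset.sum_subset (subset_univ _) fun S _ hS => ?_
    by_contra hc
    obtain ⟨h2, h3⟩ := hf S hc
    refine hS (mem_powersetCard.2 ⟨fun h hh => ?_, h3⟩)
    obtain ⟨k, hk⟩ := List.get_of_mem (h2 h hh)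
    exact Finset.mem_map.2 ⟨k, mem_univ _, hk⟩
  have h4 : powersetCard 2 (univ : Finset (Fin 4)) =
      {{0, 1}, {0, 2}, {0, 3}, {1, 2}, {1, 3}, {2, 3}} := by decide
  have e0 : emb 0 = p := rfl
  have e1 : emb 1 = q := rfl
  have e2 : emb 2 = a := rfl
  have e3 : emb 3 = b := rfl
  rw [h1, Finset.powersetCard_map, Finset.sum_map, h4]
  rw [sum_insert (by decide), sum_insert (by decide), sum_insert (by decide),
    sum_insert (by decide), sum_insert (by decide), sum_singleton]
  simp only [RelEmbedding.coe_toEmbedding, Finset.mapEmbedding_apply, Finset.map_insert,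
    Finset.map_singleton, e0, e1, e2, e3]
  rw [Finset.pair_comm a p, Finset.pair_comm b q, Finset.pair_comm q a, Finset.pair_comm a q]
  abel

theorem Quad.cl_split_compl (hw : Quad Γ w p q a b) :
    cl K (split Γ (inr w) {p, q}) = cl K (split Γ (inr w) {a, b}) :=
  KV.cl_split_compl K fun h hh => by
    have h1 := (hw.2 h).1 hh
    have h2 := hw.1
    simp only [nodup_cons, List.mem_cons, not_mem_nil, or_false, not_or] at h1 h2
    simp only [mem_insert, mem_singleton]
    grind

/-- In the degree just below the trivalent graphs, the differential splits the 4-valent vertex in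
the three possible ways. -/
theorem mk_splitSum [CharZero K] (he : e + loops Γ = 2 * m + 2) (hw : Quad Γ w p q a b) :
    (Rel n (m + 1) (e + 1) K).mkQ (splitSum K (fun Δ => loops Δ = loops Γ + 0) Γ) = cl K
    (split Γ (inr w) {a, b}) + cl K (split Γ (inr w) {b, q}) + cl K (split Γ (inr w) {q, a}) := by
  have h4 : valence Γ (inr w) = 4 := by
    have : (univ.filter fun i => inr w ∈ Γ i) = [p, q, a, b].toFinset := by
      ext i
      simp [hw.2]
    rw [valence, this, List.toFinset_card_of_nodup hw.1]
    rfl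
  -- if another vertex is split, then `w` stays 4-valent, which the number of edges excludes
  have hne : ∀ u S, u ≠ inr w → (Rel n (m + 1) (e + 1) K).mkQ
      (splitTerm K (fun Δ => loops Δ = loops Γ + 0) Γ u S) = 0 := by
    intro u S hu
    rw [mk_splitTerm]
    split_ifs with h
    · refine cl_of_not K fun hc => ?_
      have h1 := hc.valence_eq_three (by omega) w.castSucc
      rw [← up_inr, valence_split_of_ne hu.symm] at h1
      omega
    · rfl
  have hwS : ∀ S, (Rel n (m + 1) (e + 1) K).mkQ
      (splitTerm K (fun Δ => loops Δ = loops Γ + 0) Γ (inr w) S) =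
      if (∀ i ∈ S, inr w ∈ Γ i) then cl K (split Γ (inr w) S) else 0 := by
    intro S
    rw [mk_splitTerm]
    simp only [loops_split_inr, add_zero, and_true]
  rw [splitSum, map_add, map_sum, map_smul, map_sum]
  simp only [map_sum]
  rw [Finset.sum_eq_zero (fun j _ => Finset.sum_eq_zero fun S _ => hne _ S (by simp)), zero_add,
    Finset.sum_eq_single w (fun v _ hv => Finset.sum_eq_zero fun S _ => hne _ S (by simpa using hv))
      (by simp)]
  simp only [hwS]
  rw [sum_pairs hw.1 (fun S => if (∀ i ∈ S, inr w ∈ Γ i) then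
    cl K (split Γ (inr w) S) else 0)]
  · have hmem : ∀ x ∈ [p, q, a, b], ∀ y ∈ [p, q, a, b], ∀ i ∈ ({x, y} : Finset (Fin e)),
        inr w ∈ Γ i := by
      intro x hx y hy i hi
      rw [hw.2]
      simp only [mem_insert, mem_singleton] at hi
      rcases hi with rfl | rfl <;> assumption
    rw [if_pos (hmem a (by simp) b (by simp)), if_pos (hmem p (by simp) q (by simp)),
      if_pos (hmem b (by simp) q (by simp)), if_pos (hmem a (by simp) p (by simp)),
      if_pos (hmem q (by simp) a (by simp)), if_pos (hmem p (by simp) b (by simp))]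
    have c2 : cl K (split Γ (inr w) {a, p}) = cl K (split Γ (inr w) {b, q}) :=
      (hw.perm (by grind)).cl_split_compl K
    have c3 : cl K (split Γ (inr w) {p, b}) = cl K (split Γ (inr w) {q, a}) :=
      (hw.perm (by grind)).cl_split_compl K
    -- complementary pairs give the same graph, which accounts for the factor `1/2`
    rw [hw.cl_split_compl K, c2, c3, ← two_smul K (cl K (split Γ (inr w) {a, b})),
      ← two_smul K (cl K (split Γ (inr w) {b, q})),
      ← two_smul K (cl K (split Γ (inr w) {q, a})), ← smul_add, ← smul_add, smul_smul,
      inv_mul_cancel₀ (two_ne_zero' K), one_smul]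
  · intro S hS
    simp only [ne_eq, ite_eq_right_iff, Classical.not_imp] at hS
    have hI' : IsICG (split Γ (inr w) S) := by
      by_contra hc
      exact hS.2 (cl_of_not K hc)
    have h1 := hI'.valence_eq_three (by rw [loops_split_inr]; omega) (Fin.last m)
    rw [← newV_def, valence_split_newV hS.1] at h1
    exact ⟨fun h hh => (hw.2 h).1 (hS.1 h hh), by omega⟩

end

section

variable (K)
variable {h k : Fin e}

theorem exists_inl_mem (h : IsICG Γ) (v : Fin m) : ∃ f k, inl k ∈ Γ f := by
  obtain ⟨j, ⟨w⟩⟩ := h.anchored v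
  have hnil : ¬ w.Nil := fun hc => by have := hc.eq; simp at this
  have := w.adj_penultimate hnil
  rw [SimpleGraph.fromEdgeSet_adj] at this
  obtain ⟨⟨f, hf⟩, -⟩ := this
  exact ⟨f, j, by rw [hf]; simp⟩

/-- Contracting an internal edge keeps a graph internally connected, as long as no double edge
arises. -/
theorem IsICG.of_split (h : IsICG (split Γ (inr w) S)) (hs : Injective Γ) (hl : ∀ i, ¬ (Γ i).IsDiag)
    (ht : ∀ v : Fin m, 3 ≤ valence Γ (inr v)) : IsICG Γ := by
  obtain ⟨p, hp⟩ := exists_mem_of_valence (Γ := Γ) (v := inr w) (by have := ht w; omega)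
  let f : Fin (e + 1) → Fin e := Fin.lastCases p id
  have f1 : ∀ i : Fin e, f i.castSucc = i := fun i => by simp [f]
  have f2 : f (Fin.last e) = p := by simp [f]
  have hmem : ∀ (v : Fin (m + 1)) (k : Fin (e + 1)), inr v ∈ split Γ (inr w) S k →
      inr (Fin.lastCases w id v : Fin m) ∈ Γ (f k) := by
    intro v k hk
    induction k using Fin.lastCases with
    | last =>
      rw [f2]
      rw [mem_split_last] at hk
      rcases hk with hk | hk
      · rw [up_inr] at hk
        grind
      · rw [newV_def] at hk
        grind
    | cast k =>
      rw [f1]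
      induction v using Fin.lastCases with
      | last =>
        rw [← newV_def, mem_split_newV] at hk
        simpa using hk.1
      | cast v =>
        simp only [Fin.lastCases_castSucc, id]
        by_cases hv : v = w
        · subst hv
          rw [← up_inr, mem_split_self] at hk
          exact hk.1
        · rwa [← up_inr, mem_split_castSucc (by simpa using hv)] at hk
  have hr : ∀ {a b : Fin (e + 1)}, (SimpleGraph.fromRel fun i k : Fin (e + 1) =>
      ∃ v : Fin (m + 1), inr v ∈ split Γ (inr w) S i ∧
        inr v ∈ split Γ (inr w) S k).Reachable a b → (SimpleGraph.fromRel fun i k : Fin e =>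
      ∃ v : Fin m, inr v ∈ Γ i ∧ inr v ∈ Γ k).Reachable (f a) (f b) := by
    rintro a b ⟨W⟩
    induction W with
    | nil => exact SimpleGraph.Reachable.refl _
    | @cons a b c hab W ih =>
      refine SimpleGraph.Reachable.trans ?_ ih
      have : ∃ v : Fin (m + 1), inr v ∈ split Γ (inr w) S a ∧ inr v ∈ split Γ (inr w) S b := by
        rcases (SimpleGraph.fromRel_adj _ _ _).1 hab with ⟨-, h | ⟨v, h1, h2⟩⟩
        · exact h
        · exact ⟨v, h2, h1⟩
      obtain ⟨v, h1, h2⟩ := this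
      exact reachable_edge (hmem v a h1) (hmem v b h2)
  refine isICG_of_reachable hs hl ht (i := p) (fun k => ?_) ?_
  · have := hr (h.connected.preconnected p.castSucc k.castSucc)
    rwa [f1, f1] at this
  · obtain ⟨k, j, hj⟩ := exists_inl_mem h (Fin.last m)
    induction k using Fin.lastCases with
    | last =>
      rw [mem_split_last, up_inr, newV_def] at hj
      simp at hj
    | cast k => exact ⟨k, j, (mem_split_castSucc (v := inl j) (by simp) k).1 hj⟩

/-- Exchanging two parallel edges in a splitting. -/
theorem cl_split_double (hk : h ≠ k) (hhk : Γ h = Γ k) (hS : ∀ i, i ∈ S' ↔ Equiv.swap h k i ∈ S) :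
    cl K (split Γ u S') = - cl K (split Γ u S) := by
  have h1 : IsRelabel (Equiv.swap h k) 1 Γ Γ := by
    intro i
    have h2 : (vtxEquiv n (1 : Equiv.Perm (Fin m)) : Vtx n m → Vtx n m) = id := by
      funext x
      rcases x with x | x <;> rfl
    rw [h2, Sym2.map_id, id]
    grind
  have h3 := h1.split u S
  have h4 : (Equiv.swap h k)⁻¹.finsetCongr S = S' := by
    ext i
    rw [hS]
    simp only [Equiv.finsetCongr_apply, Finset.mem_map, Equiv.coe_toEmbedding, Equiv.swap_inv]
    grind
  have h5 : vtxEquiv n (1 : Equiv.Perm (Fin m)) u = u := by rcases u with u | u <;> rfl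
  rw [h4, h5] at h3
  rw [cl_relabel K h3, sign_permSnoc, Equiv.Perm.sign_swap hk]
  simp

theorem cl_split_eq_zero (hk : h ≠ k)
    (hhk : Γ h = Γ k) (hS : h ∈ S ↔ k ∈ S) : cl K (split Γ u S) = 0 := by
  refine cl_of_not K fun hc => hk ?_
  have : split Γ u S h.castSucc = split Γ u S k.castSucc := by
    simp only [split, Fin.snoc_castSucc, hhk, hS]
  exact Fin.castSucc_injective _ (hc.simple this)

/-- If one of the three splittings of a 4-valent vertex is admissible, then either the original
graph is admissible as well, or the classes of the three splittings add up to zero. -/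
theorem ihx_cl (hw : Quad Γ w p q a b) (hl : ∀ i, ¬ (Γ i).IsDiag)
    (ht : ∀ v : Fin m, 3 ≤ valence Γ (inr v)) (hI : IsICG (split Γ (inr w) {a, b})) : IsICG Γ ∨ cl K
    (split Γ (inr w) {a, b}) + cl K (split Γ (inr w) {b, q}) + cl K
    (split Γ (inr w) {q, a}) = 0 := by
  by_cases hs : Injective Γ
  · exact Or.inl (hI.of_split hs hl ht)
  · right
    have hn := hw.1
    simp only [nodup_cons, List.mem_cons, not_mem_nil, or_false, not_or] at hn
    have hcompl : ∀ {x y z t : Fin e}, [p, q, a, b].Perm [x, y, z, t] →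
        cl K (split Γ (inr w) {x, y}) = cl K (split Γ (inr w) {z, t}) :=
      fun hp => (hw.perm hp).cl_split_compl K
    -- if only one of two parallel edges is moved to the new vertex, then one of the three
    -- terms has a double edge, and the other two cancel, by exchanging the parallel edges
    have key : ∀ h k, h ≠ k → Γ h = Γ k → h ∈ ({a, b} : Finset (Fin e)) →
        cl K (split Γ (inr w) {a, b}) + cl K (split Γ (inr w) {b, q}) +
          cl K (split Γ (inr w) {q, a}) = 0 := by
      intro h k hk hhk hh
      have hks : k ∉ ({a, b} : Finset (Fin e)) := by
        intro hks
        have : split Γ (inr w) {a, b} h.castSucc = split Γ (inr w) {a, b} k.castSucc := by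
          simp only [split, Fin.snoc_castSucc, hhk, hh, hks]
        exact hk (Fin.castSucc_injective _ (hI.simple this))
      have hkw : k ∈ [p, q, a, b] := by
        rw [← hw.2, ← hhk, hw.2]
        grind
      simp only [mem_insert, mem_singleton, not_or] at hh hks
      simp only [List.mem_cons, not_mem_nil, or_false] at hkw
      have hk2 : k = p ∨ k = q := by tauto
      rcases hh with rfl | rfl <;> rcases hk2 with rfl | rfl
      · rw [cl_split_eq_zero K (S := {b, q}) hk hhk (by simp; grind),
          hcompl (x := q) (y := h) (z := k) (t := b) (by grind),
          cl_split_double K (S := {h, b}) (S' := {k, b}) hk hhk (by grind)]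
        abel
      · rw [cl_split_eq_zero K (S := {k, h}) hk hhk (by simp),
          show cl K (split Γ (inr w) {b, k}) = - cl K (split Γ (inr w) {h, b}) from
          cl_split_double K hk hhk (by grind)]
        abel
      · rw [cl_split_eq_zero K (S := {q, a}) hk hhk (by simp; grind),
          hcompl (x := h) (y := q) (z := k) (t := a) (by grind),
          cl_split_double K (S := {a, h}) (S' := {k, a}) hk hhk (by grind)]
        abel
      · rw [cl_split_eq_zero K (S := {h, k}) hk hhk (by simp),
          cl_split_double K (S := {a, h}) (S' := {k, a}) hk hhk (by grind)]
        abel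
    simp only [Injective, not_forall] at hs
    obtain ⟨h, k, hhk, hk⟩ := hs
    by_cases hh : h ∈ ({a, b} : Finset (Fin e))
    · exact key h k hk hhk hh
    · by_cases hks : k ∈ ({a, b} : Finset (Fin e))
      · exact key k h (Ne.symm hk) hhk.symm hks
      -- a double edge away from the new vertex would survive the splitting
      · have : split Γ (inr w) {a, b} h.castSucc = split Γ (inr w) {a, b} k.castSucc := by
          simp only [split, Fin.snoc_castSucc, hhk, hh, hks]
        exact absurd (Fin.castSucc_injective _ (hI.simple this)) hk

end

section

variable {σ : Equiv.Perm (Fin e)}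

section TreeValue

variable {P Q : List (Fin e)} {v : Fin m} {h : Fin e}
variable {xp xq xa xb : Vtx n m} {sp sq sa sb : BTree n}

theorem perm_castSucc :
    (Fin.last e :: l.map Fin.castSucc).Perm (finRange (e + 1)) ↔ l.Perm (finRange e) := by
  rw [List.finRange_succ_last]
  constructor
  · intro h
    have h1 := (h.trans (List.perm_append_comm (l₂ := [Fin.last e]))).cons_inv
    exact (List.map_perm_map_iff (Fin.castSucc_injective e)).1 h1
  · intro h
    exact ((h.map _).cons _).trans (List.perm_append_comm (l₁ := [Fin.last e]))

theorem Branch.node_of_tri (h : Branch Γ (inr v) i A s) (ht : Tri Γ v i f g)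
    (hf : Γ f = s(inr v, x)) (hg : Γ g = s(inr v, y)) : ∃ A₁ A₂ s₁ s₂, Branch Γ x f A₁ s₁ ∧ Branch Γ
    y g A₂ s₂ ∧ A.Perm (f :: (A₁ ++ g :: A₂)) := by
  obtain ⟨f', g', x', y', A₁, A₂, s₁, s₂, hv', hf', hg', b1, b2, rfl, rfl⟩ := h.inr_inv
  rcases ht.eq_or_eq hv' with ⟨rfl, rfl⟩ | ⟨rfl, rfl⟩
  · rw [Sym2.other_eq hf hf', Sym2.other_eq hg hg']
    exact ⟨_, _, _, _, b1, b2, List.Perm.refl _⟩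
  · rw [Sym2.other_eq hf hg', Sym2.other_eq hg hf']
    refine ⟨_, _, _, _, b2, b1, ?_⟩
    rw [perm_iff_count]
    grind

theorem edge_split_mem (hl : ∀ i, ¬ (Γ i).IsDiag) (hh : h ∈ ({a, b} : Finset (Fin e)))
    (hx : Γ h = s(inr w, x)) : split Γ (inr w) {a, b} h.castSucc = s(inr (Fin.last m), up x) := by
  refine split_of_mem hh hx ?_
  rintro rfl
  exact hl h (by rw [hx]; simp)

/-- The four trees around the 4-valent vertex of a tree. -/
theorem Quad.exists_branches (hw : Quad Γ w p q a b) (hl : ∀ i, ¬ (Γ i).IsDiag)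
    (hp : Γ p = s(inr w, xp)) (hq : Γ q = s(inr w, xq)) (ha : Γ a = s(inr w, xa))
    (hb : Γ b = s(inr w, xb)) (hI : IsICG (split Γ (inr w) {a, b})) (h0 : loops Γ = 0)
    (he : e = 2 * m + 2) : ∃ P Q A B sp sq sa sb, Branch Γ xp p P sp ∧ Branch Γ xq q Q sq ∧ Branch Γ
    xa a A sa ∧ Branch Γ xb b B sb ∧ (p :: P ++ (a :: A ++ (b :: B ++ q :: Q))).Perm
    (finRange e) := by
  have hn := hw.1
  simp only [nodup_cons, List.mem_cons, not_mem_nil, or_false, not_or] at hn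
  have hpS : p ∉ ({a, b} : Finset (Fin e)) := by simp; tauto
  have hqS : q ∉ ({a, b} : Finset (Fin e)) := by simp; tauto
  have hp' := split_of_notMem' (u := inr w) hpS hp
  have hq' := split_of_notMem' (u := inr w) hqS hq
  have ha' := edge_split_mem hl (show a ∈ ({a, b} : Finset _) by simp) ha
  have hb' := edge_split_mem hl (show b ∈ ({a, b} : Finset _) by simp) hb
  obtain ⟨A', M', s, z, hA, hM, hperm⟩ : ∃ A' M' s z,
      Branch (split Γ (inr w) {a, b}) (inr w.castSucc) p.castSucc A' s ∧
      Branch (split Γ (inr w) {a, b}) (up xp) p.castSucc M' z ∧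
      (p.castSucc :: (A' ++ M')).Perm (finRange (e + 1)) := by
    obtain ⟨x, x', s, z, ε, hF⟩ := hI.exists_full (by rw [loops_split_inr, h0]) (by omega)
      p.castSucc
    obtain ⟨A', M', h1, h2, h3, h4, -⟩ := id hF
    rw [hp', up_inr, Sym2.eq_iff] at h1
    rcases h1 with ⟨rfl, rfl⟩ | ⟨rfl, rfl⟩
    · exact ⟨_, _, _, _, h2, h3, h4⟩
    · exact ⟨_, _, _, _, h3, h2, (List.perm_append_comm.cons _).trans h4⟩
  obtain ⟨A₁, A₂, s₁, s₂, b1, b2, q1⟩ := hA.node_of_tri hw.tri_old split_last hq'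
  obtain ⟨B₁, B₂, t₁, t₂, c1, c2, q2⟩ := b1.node_of_tri hw.tri_new ha' hb'
  have hperm2 : (Fin.last e :: (p.castSucc :: M' ++ (a.castSucc :: B₁ ++
      (b.castSucc :: B₂ ++ q.castSucc :: A₂)))).Perm (finRange (e + 1)) := by
    refine List.Perm.trans ?_ hperm
    rw [perm_iff_count] at q1 q2 ⊢
    grind
  have hnod := hperm2.nodup_iff.2 (nodup_finRange _)
  rw [nodup_cons] at hnod
  have hlast := hnod.1
  simp only [List.mem_append, List.mem_cons, not_or] at hlast
  obtain ⟨P, rfl, d1⟩ := hM.of_split rfl rfl (by tauto)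
  obtain ⟨Q, rfl, d2⟩ := b2.of_split rfl rfl (by tauto)
  obtain ⟨A, rfl, d3⟩ := c1.of_split rfl rfl (by tauto)
  obtain ⟨B, rfl, d4⟩ := c2.of_split rfl rfl (by tauto)
  refine ⟨P, Q, A, B, _, _, _, _, d1, d2, d3, d4, perm_castSucc.1 ?_⟩
  simpa using hperm2

theorem Quad.full (hw : Quad Γ w p q a b) (hl : ∀ i, ¬ (Γ i).IsDiag) (hp : Γ p = s(inr w, xp))
    (hq : Γ q = s(inr w, xq)) (ha : Γ a = s(inr w, xa)) (hb : Γ b = s(inr w, xb))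
    (b1 : Branch Γ xp p P sp) (b2 : Branch Γ xq q Q sq) (b3 : Branch Γ xa a A sa)
    (b4 : Branch Γ xb b B sb) (h : (p :: P ++ (a :: A ++ (b :: B ++ q :: Q))).Perm (finRange e)) :
    Full (split Γ (inr w) {a, b}) p.castSucc (inr w.castSucc) (up xp) ((sa * sb) * sq) sp (listSign
    ([p.castSucc, Fin.last e] ++ ((a :: A).map Fin.castSucc ++ ((b :: B).map Fin.castSucc ++ ((q ::
    Q).map Fin.castSucc ++ P.map Fin.castSucc))))) := by
  have hnl := h.nodup_iff.2 (nodup_finRange e)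
  have hn := hw.1
  simp only [nodup_cons, List.mem_cons, not_mem_nil, or_false, not_or] at hn
  have hpS : p ∉ ({a, b} : Finset (Fin e)) := by simp; tauto
  have hqS : q ∉ ({a, b} : Finset (Fin e)) := by simp; tauto
  have hp' := split_of_notMem' (u := inr w) hpS hp
  have hq' := split_of_notMem' (u := inr w) hqS hq
  have ha' := edge_split_mem hl (show a ∈ ({a, b} : Finset _) by simp) ha
  have hb' := edge_split_mem hl (show b ∈ ({a, b} : Finset _) by simp) hb
  have hu : ∀ w' i f g, (inr w : Vtx n m) = inr w' → ¬ Tri Γ w' i f g := by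
    rintro w' i f g hw'
    obtain rfl := inr.inj hw'
    exact hw.not_tri i f g
  have hS : ∀ f, f ∈ P ∨ f ∈ Q ∨ f ∈ A ∨ f ∈ B → f ∉ ({a, b} : Finset (Fin e)) := by
    grind
  refine ⟨_, _, hp'.trans Sym2.eq_swap |>.trans Sym2.eq_swap, Branch.node hw.tri_old
    (split_last.trans rfl) hq' (Branch.node hw.tri_new ha' hb'
      (b3.split hu fun f hf => hS f (by tauto)) (b4.split hu fun f hf => hS f (by tauto)))
    (b2.split hu fun f hf => hS f (by tauto)), b1.split hu fun f hf => hS f (by tauto), ?_, ?_⟩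
  · refine List.Perm.trans ?_ (perm_castSucc.2 h)
    rw [perm_iff_count]
    grind
  · simp

/-- The three ways to separate the four branches at a 4-valent vertex of a tree by a new edge. -/
theorem Quad.full_three (hw : Quad Γ w p q a b) (hl : ∀ i, ¬ (Γ i).IsDiag) (hp : Γ p = s(inr w, xp))
    (hq : Γ q = s(inr w, xq)) (ha : Γ a = s(inr w, xa)) (hb : Γ b = s(inr w, xb))
    (b1 : Branch Γ xp p P sp) (b2 : Branch Γ xq q Q sq) (b3 : Branch Γ xa a A sa)
    (b4 : Branch Γ xb b B sb) (h : (p :: P ++ (a :: A ++ (b :: B ++ q :: Q))).Perm (finRange e)) : ∃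
    x ε, Full (split Γ (inr w) {a, b}) p.castSucc (inr w.castSucc) x ((sa * sb) * sq) sp ε ∧ Full
    (split Γ (inr w) {b, q}) p.castSucc (inr w.castSucc) x ((sb * sq) * sa) sp ε ∧ Full
    (split Γ (inr w) {q, a}) p.castSucc (inr w.castSucc) x ((sq * sa) * sb) sp ε := by
  have h2 : (p :: P ++ (b :: B ++ (q :: Q ++ a :: A))).Perm (finRange e) := by
    grind
  have h3 : (p :: P ++ (q :: Q ++ (a :: A ++ b :: B))).Perm (finRange e) := by
    grind
  have f1 := hw.full hl hp hq ha hb b1 b2 b3 b4 h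
  have f2 := hw.rot.full hl hp ha hb hq b1 b3 b4 b2 h2
  have f3 := hw.rot.rot.full hl hp hb hq ha b1 b4 b2 b3 h3
  have rot : ∀ {a b q : Fin e} {A B Q : List (Fin e)}, Even A.length → Even B.length →
      Even Q.length → (p :: P ++ (a :: A ++ (b :: B ++ q :: Q))).Perm (finRange e) →
      listSign ([p.castSucc, Fin.last e] ++ ((a :: A).map Fin.castSucc ++
        ((b :: B).map Fin.castSucc ++ ((q :: Q).map Fin.castSucc ++ P.map Fin.castSucc)))) =
      listSign ([p.castSucc, Fin.last e] ++ ((b :: B).map Fin.castSucc ++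
        ((q :: Q).map Fin.castSucc ++ ((a :: A).map Fin.castSucc ++ P.map Fin.castSucc)))) := by
    intro a b q A B Q hA hB hQ hperm
    have hn : ([p.castSucc, Fin.last e] ++ ((a :: A).map Fin.castSucc ++
        (((b :: B).map Fin.castSucc ++ (q :: Q).map Fin.castSucc) ++
          P.map Fin.castSucc))).Nodup := by
      refine (List.Perm.nodup_iff ?_).1 ((perm_castSucc.2 hperm).nodup_iff.2 (nodup_finRange _))
      rw [perm_iff_count]
      grind
    have := listSign_swap_even _ _ _ _ hn (by
      simp only [List.length_map, List.length_append, List.length_cons]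
      grind)
    simpa using this
  have r1 := rot b3.even b4.even b2.even h
  have r2 := rot b4.even b2.even b3.even h2
  refine ⟨_, _, f1, ?_, ?_⟩
  · rw [r1]
    exact f2
  · rw [r1, r2]
    exact f3

/-- The three splittings of the 4-valent vertex of a tree. -/
theorem Quad.exists_full (hw : Quad Γ w p q a b) (hl : ∀ i, ¬ (Γ i).IsDiag)
    (hI : IsICG (split Γ (inr w) {a, b})) (h0 : loops Γ = 0) (he : e = 2 * m + 2) : ∃ x sp sq sa sb
    ε, Full (split Γ (inr w) {a, b}) p.castSucc (inr w.castSucc) x ((sa * sb) * sq) sp ε ∧ Full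
    (split Γ (inr w) {b, q}) p.castSucc (inr w.castSucc) x ((sb * sq) * sa) sp ε ∧ Full
    (split Γ (inr w) {q, a}) p.castSucc (inr w.castSucc) x ((sq * sa) * sb) sp ε := by
  obtain ⟨xp, hp⟩ := (hw.2 p).2 (by simp)
  obtain ⟨xq, hq⟩ := (hw.2 q).2 (by simp)
  obtain ⟨xa, ha⟩ := (hw.2 a).2 (by simp)
  obtain ⟨xb, hb⟩ := (hw.2 b).2 (by simp)
  obtain ⟨P, Q, A, B, sp, sq, sa, sb, b1, b2, b3, b4, h⟩ :=
    hw.exists_branches hl hp hq ha hb hI h0 he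
  obtain ⟨x, ε, f⟩ := hw.full_three hl hp hq ha hb b1 b2 b3 b4 h
  exact ⟨x, sp, sq, sa, sb, ε, f⟩

theorem Full.treeWord_relabel (h : Full Γ i x x' s z ε) (hl : ∀ i, ¬ (Γ i).IsDiag)
    {τ : Equiv.Perm (Fin m)} (hr : IsRelabel σ τ Γ Γ') (k : Fin n) : treeWord K Γ' k =
    ((Equiv.Perm.sign σ : ℤ) : K) • treeWord K Γ k := by
  have h1 := hr.full h
  have h2 : ¬ (Γ' (σ⁻¹ i)).IsDiag := by
    rw [hr, Sym2.isDiag_map (vtxEquiv n τ).injective]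
    exact hl _
  rw [h1.treeWord_eq h2, h.treeWord_eq (hl i), smul_smul]
  push_cast
  rfl

theorem isRelabel_swap (hab : Γ a = Γ b) : IsRelabel (Equiv.swap a b) 1 Γ Γ := by
  intro i
  have h2 : (vtxEquiv n (1 : Equiv.Perm (Fin m)) : Vtx n m → Vtx n m) = id := by
    funext x
    rcases x with x | x <;> rfl
  rw [h2, Sym2.map_id, id, Equiv.swap_apply_def]
  grind

/-- Trees with double edges do not contribute. -/
theorem Full.treeWord_eq_zero [CharZero K] (h : Full Γ i x x' s z ε) (hl : ∀ i, ¬ (Γ i).IsDiag)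
    (hs : ¬ Injective Γ) (k : Fin n) : treeWord K Γ k = 0 := by
  simp only [Injective, not_forall] at hs
  obtain ⟨a, b, hab, hne⟩ := hs
  have h1 := isRelabel_swap hab
  have h2 := h.treeWord_relabel (K := K) hl h1 k
  rw [Equiv.Perm.sign_swap hne] at h2
  have h3 : (2 : K) • treeWord K Γ k = 0 := by
    rw [two_smul]
    nth_rw 1 [h2]
    simp
  exact (smul_eq_zero.1 h3).resolve_left two_ne_zero

variable (n m e) (K) in
/-- The tuple of Lie words, as a linear map on the space of graphs. -/
def treePiece : Piece n m e K →ₗ[K] (Fin n → Ass n K) :=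
  (Rel n m e K).liftQ (Finsupp.lift _ K _ fun Γ : Gph n m e =>
      if loops Γ.1 = 0 ∧ e = 2 * m + 1 then treeWord K Γ.1 else 0) (show Rel n m e K ≤ _ by
    refine Submodule.span_le.2 ?_
    rintro _ ⟨σ, τ, Γ, Γ', h, rfl⟩
    rw [SetLike.mem_coe, LinearMap.mem_ker, map_sub, map_smul, sub_eq_zero]
    simp only [Finsupp.lift_apply, Finsupp.sum_single_index, zero_smul, one_smul, h.loops_eq]
    split_ifs with h0
    · obtain ⟨_, _, _, _, _, hF⟩ := Γ.2.exists_full h0.1 h0.2 ⟨0, by omega⟩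
      funext k
      exact hF.treeWord_relabel Γ.2.loopless h k
    · rw [smul_zero])

theorem treePiece_cl (Γ : Gph n m e) :
    treePiece n m e K (cl K Γ.1) = if loops Γ.1 = 0 ∧ e = 2 * m + 1 then treeWord K Γ.1 else 0 := by
  rw [cl_of]
  change (Finsupp.lift _ K _ _) (Finsupp.single Γ 1) = _
  simp [Finsupp.sum_single_index]

theorem loops_of_valence (hl : ∀ i, ¬ (Γ i).IsDiag)
    (ht : ∀ v : Fin m, valence Γ (inr v) = 3) : loops Γ = 2 * m + 1 - e := by
  have h1 := sum_valence hl
  simp only [ht, sum_const, card_univ, Fintype.card_fin, smul_eq_mul] at h1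
  unfold loops
  unfold legs at h1
  omega

theorem Full.treePiece_eq [CharZero K] (h : Full Γ i x x' s z ε) (hl : ∀ i, ¬ (Γ i).IsDiag)
    (ht : ∀ v : Fin m, valence Γ (inr v) = 3) (he : e = 2 * m + 1) (k : Fin n) : treePiece n m e K
    (cl K Γ) k = (ε : K) • toAss (rr (dl k) s (lieW z) + rr (dl k) z (lieW s)) := by
  rw [← h.treeWord_eq (hl i)]
  by_cases hs : Injective Γ
  · have hI := h.isICG hs hl fun v => (ht v).ge
    have := treePiece_cl (K := K) ⟨Γ, hI⟩
    rw [this, if_pos ⟨by change loops Γ = 0; have := loops_of_valence hl ht; omega, he⟩]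
  · rw [cl_of_not K fun hc => hs hc.simple, map_zero, h.treeWord_eq_zero hl hs]
    rfl

theorem Tri.valence_eq (h : Tri Γ v i f g) : valence Γ (inr v) = 3 := by
  have : (univ.filter fun k => inr v ∈ Γ k) = {i, f, g} := by
    ext k
    simp [h.2.2.2]
  rw [valence, this, Finset.card_eq_three]
  exact ⟨i, f, g, h.1, h.2.1, h.2.2.1, rfl⟩

theorem valence_split_quad (hw : Quad Γ w p q a b) (ht : ∀ v, v ≠ w → valence Γ (inr v) = 3)
    (v : Fin (m + 1)) : valence (split Γ (inr w) {a, b}) (inr v) = 3 := by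
  induction v using Fin.lastCases with
  | last => exact hw.tri_new.valence_eq
  | cast v =>
    by_cases hv : v = w
    · subst hv
      exact hw.tri_old.valence_eq
    · rw [← up_inr, valence_split_of_ne (by simpa using hv), ht v hv]

/-- The tuples of Lie words of the three splittings of a 4-valent vertex add up to zero. -/
theorem Quad.treePiece_sum [CharZero K] (hw : Quad Γ w p q a b) (hl : ∀ i, ¬ (Γ i).IsDiag)
    (ht : ∀ v, v ≠ w → valence Γ (inr v) = 3) (hI : IsICG (split Γ (inr w) {a, b}))
    (h0 : loops Γ = 0) (he : e = 2 * m + 2) : treePiece n (m + 1) (e + 1) K (cl K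
    (split Γ (inr w) {a, b}) + cl K (split Γ (inr w) {b, q}) + cl K
    (split Γ (inr w) {q, a})) = 0 := by
  obtain ⟨x, sp, sq, sa, sb, ε, f1, f2, f3⟩ := hw.exists_full hl hI h0 he
  have hl' : ∀ S i, ¬ (split Γ (inr w) S i).IsDiag := fun S => split_loopless hl
  funext k
  rw [map_add, map_add, Pi.add_apply, Pi.add_apply,
    f1.treePiece_eq (hl' _) (valence_split_quad hw ht) (by omega),
    f2.treePiece_eq (hl' _) (valence_split_quad hw.rot ht) (by omega),
    f3.treePiece_eq (hl' _) (valence_split_quad hw.rot.rot ht) (by omega),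
    ← smul_add, ← smul_add, ← map_add, ← map_add]
  have j1 := rr_jacobi (dl (K := K) k) sa sb sq (lieW sp)
  have j2 : rr (dl (K := K) k) sp (lieW (sa * sb * sq)) + rr (dl k) sp (lieW (sb * sq * sa)) +
      rr (dl k) sp (lieW (sq * sa * sb)) = 0 := by
    rw [← map_add, ← map_add]
    convert map_zero (rr (dl (K := K) k) sp)
    simp only [lieW_mul, bracket_def]
    noncomm_ring
  rw [show ∀ a b c d e f : NCP n K, a + b + (c + d) + (e + f) = (a + c + e) + (b + d + f) by
    intros; abel, j1, j2, add_zero, map_zero, smul_zero]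
  rfl

end TreeValue

end

section

/-! ### Trees are determined by their readings -/

variable {i' : Fin e} {l' : List (Fin e)}
variable {l V V' : List (Fin m)}

/-- A branch is determined by its binary tree, up to the names of its vertices and edges. -/
theorem Branch.unique (h : Branch Γ x i A s) (h' : Branch Γ' x' i' A' s) : ∃ V V' : List (Fin m),
    V.length + 1 = s.length ∧ V'.length = V.length ∧ (∀ v, x = inr v → v ∈ V) ∧
    (∀ v, x' = inr v → v ∈ V') ∧ (∀ f ∈ A, ∀ v, inr v ∈ Γ f → v ∈ V) ∧
    (∀ f ∈ A', ∀ v, inr v ∈ Γ' f → v ∈ V') ∧ ∀ τ : Fin m → Fin m, V' = V.map τ → x' = Sum.map id τ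
    x ∧ A'.map Γ' = A.map fun f => (Γ f).map (Sum.map id τ) := by
  induction h generalizing x' i' A' with
  | leaf k i =>
    rcases x' with k' | v'
    · obtain ⟨rfl, h2⟩ := h'.inl_inv
      refine ⟨[], [], rfl, rfl, by simp, by simp, by simp, by simp, fun τ _ => ⟨?_, rfl⟩⟩
      injection h2 with h2
      rw [h2]
      rfl
    · obtain ⟨f, g, x, y, A₁, A₂, s₁, s₂, hv, hf, hg, b1, b2, rfl, hs⟩ := h'.inr_inv
      cases hs
  | @node v i f g x y A B s t hv hf hg h1 h2 ih1 ih2 =>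
    rcases x' with k' | v'
    · cases h'.inl_inv.2
    · obtain ⟨f', g', x', y', A₁, A₂, s₁, s₂, hv', hf', hg', b1, b2, rfl, hs⟩ := h'.inr_inv
      obtain ⟨rfl, rfl⟩ := mul_inj_magma hs
      obtain ⟨V, V', a1, a2, a3, a4, a5, a6, a7⟩ := ih1 b1
      obtain ⟨U, U', c1, c2, c3, c4, c5, c6, c7⟩ := ih2 b2
      have key : ∀ {Γ : EdgeSeq n m e} {v : Fin m} {f : Fin e} {x : Vtx n m} {V : List (Fin m)},
          Γ f = s(inr v, x) → (∀ w, x = inr w → w ∈ V) → ∀ w, inr w ∈ Γ f → w = v ∨ w ∈ V := by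
        intro Γ v f x V hf hx w hw
        rw [hf, Sym2.mem_iff] at hw
        rcases hw with hw | hw
        · exact Or.inl (inr.inj hw)
        · exact Or.inr (hx w hw.symm)
      refine ⟨v :: (V ++ U), v' :: (V' ++ U'), ?_, by simp [a2, c2], ?_, ?_, ?_, ?_, ?_⟩
      · have : (s * t).length = s.length + t.length := rfl
        grind
      · grind
      · grind
      · intro c hc w hw
        simp only [List.mem_cons, List.mem_append] at hc ⊢
        grind
      · intro c hc w hw
        simp only [List.mem_cons, List.mem_append] at hc ⊢
        grind
      · intro τ hτ
        rw [List.map_cons, List.map_append] at hτ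
        injection hτ with h3 h4
        obtain ⟨h5, h6⟩ := List.append_inj h4 (by simp [a2])
        obtain ⟨d1, d2⟩ := a7 τ h5
        obtain ⟨d3, d4⟩ := c7 τ h6
        refine ⟨by rw [h3]; rfl, ?_⟩
        simp only [List.map_cons, List.map_append, d2, d4, hf, hg, hf', hg', Sym2.map_mk, h3, d1,
          d3, Sum.map_inr]

theorem perm_finRange_of_length (hl : l.length = m) (h : ∀ v, v ∈ l) : l.Perm (finRange m) := by
  have h1 : finRange m ⊆ l := fun v _ => h v
  exact (((nodup_finRange m).subperm h1).perm_of_length_le (by simp [hl])).symm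

/-- If two graphs carry matching complete lists of edges and of vertices, then they are relabellings
of each other. -/
theorem exists_relabel {l : List (Fin e)} (hl : l.Perm (finRange e)) (hl' : l'.Perm (finRange e))
    (hV : V.Perm (finRange m)) (hV' : V'.Perm (finRange m)) (h : ∀ τ : Fin m → Fin m, V' = V.map τ →
    l'.map Γ' = l.map fun f => (Γ f).map (Sum.map id τ)) : ∃ σ τ, IsRelabel σ τ Γ Γ' ∧ listSign l =
    Equiv.Perm.sign σ * listSign l' := by
  obtain ⟨τ, hτ, -⟩ := exists_perm_map hV hV'
  obtain ⟨σ, hσ, hs⟩ := exists_perm_map hl' hl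
  refine ⟨σ, τ, ?_, hs⟩
  intro i
  have h1 := h τ hτ
  rw [hσ, List.map_map, List.map_inj_left] at h1
  exact h1 i (hl'.mem_iff.2 (mem_finRange i))

/-- All internal vertices are trivalent, and there are no simple loops. -/
def IsTrivalent (Γ : EdgeSeq n m e) : Prop :=
  (∀ i, ¬ (Γ i).IsDiag) ∧ ∀ v : Fin m, valence Γ (inr v) = 3

theorem IsRelabel.isTrivalent {σ : Equiv.Perm (Fin e)} {τ : Equiv.Perm (Fin m)}
    (h : IsRelabel σ τ Γ Γ') (hT : IsTrivalent Γ) : IsTrivalent Γ' := by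
  constructor
  · intro i
    rw [h, Sym2.isDiag_map (vtxEquiv n τ).injective]
    exact hT.1 _
  · intro v
    have := h.valence_eq (inr (τ⁻¹ v))
    rw [hT.2] at this
    simpa [vtxEquiv] using this

theorem Full.unique (hΓ : IsTrivalent Γ) (hΓ' : IsTrivalent Γ') (he : e = 2 * m + 1)
    (h : Full Γ i x y s z ε) (h' : Full Γ' i' x' y' s z ε') : (ε : K) • cl K Γ = (ε' : K) • cl K
    Γ' := by
  obtain ⟨A, M, h1, h2, h3, h4, h5⟩ := h
  obtain ⟨A', M', h1', h2', h3', h4', h5'⟩ := h'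
  obtain ⟨V, V', a1, a2, a3, a4, a5, a6, a7⟩ := h2.unique h2'
  obtain ⟨U, U', c1, c2, c3, c4, c5, c6, c7⟩ := h3.unique h3'
  have hlen := h4.length_eq
  have e1 := h2.length_eq
  have e2 := h3.length_eq
  simp only [List.length_cons, List.length_append, List.length_finRange] at hlen
  have key : ∀ {Γ : EdgeSeq n m e} {i : Fin e} {x y : Vtx n m} {A M : List (Fin e)}
      {V U : List (Fin m)}, IsTrivalent Γ → (V ++ U).length = m → Γ i = s(x, y) →
      (i :: (A ++ M)).Perm (finRange e) → (∀ v, x = inr v → v ∈ V) →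
      (∀ v, y = inr v → v ∈ U) → (∀ f ∈ A, ∀ v, inr v ∈ Γ f → v ∈ V) →
      (∀ f ∈ M, ∀ v, inr v ∈ Γ f → v ∈ U) → (V ++ U).Perm (finRange m) := by
    intro Γ i x y A M V U hT hl hi hp hx hy hA hM
    refine perm_finRange_of_length hl fun v => ?_
    obtain ⟨f, hf⟩ := exists_mem_of_valence (Γ := Γ) (v := inr v) (by rw [hT.2]; omega)
    have := hp.mem_iff.2 (mem_finRange f)
    simp only [List.mem_cons, List.mem_append] at this ⊢
    rcases this with rfl | hfA | hfM
    · rw [hi, Sym2.mem_iff] at hf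
      rcases hf with hf | hf
      · exact Or.inl (hx v hf.symm)
      · exact Or.inr (hy v hf.symm)
    · exact Or.inl (hA f hfA v hf)
    · exact Or.inr (hM f hfM v hf)
  have hV := key hΓ (by simp only [List.length_append]; omega) h1 h4 a3 c3 a5 c5
  have hV' := key hΓ' (by simp only [List.length_append]; omega) h1' h4' a4 c4 a6 c6
  obtain ⟨σ, τ, hr, hs⟩ := exists_relabel (Γ := Γ) (Γ' := Γ') h4 h4' hV hV' (by
    intro τ hτ
    rw [List.map_append] at hτ
    obtain ⟨h7, h8⟩ := List.append_inj hτ (by simp [a2])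
    obtain ⟨d1, d2⟩ := a7 τ h7
    obtain ⟨d3, d4⟩ := c7 τ h8
    simp only [List.map_cons, List.map_append, d2, d4, h1, h1', d1, d3, Sym2.map_mk])
  rw [cl_relabel K hr, smul_smul, ← h5, ← h5', hs]
  congr 1
  push_cast
  ring

/-! #### Contracting an edge -/

/-- The vertex map which identifies the last internal vertex with `w`. -/
def collapse (w : Fin m) : Vtx n (m + 1) → Vtx n m := Sum.map id (Fin.lastCases w id)

theorem collapse_up (w : Fin m) (x : Vtx n m) : collapse w (up x) = x := by
  rcases x with x | x <;> simp [collapse, up]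

theorem collapse_newV (w : Fin m) : collapse w (newV : Vtx n (m + 1)) = inr w := by
  simp [collapse, newV]

/-- A trivalent graph in which the last edge joins a vertex to the last one arises by splitting a
4-valent vertex. -/
theorem exists_split {Δ : EdgeSeq n (m + 1) (e + 1)} (hΔ : IsTrivalent Δ)
    (h1 : Tri Δ w.castSucc p.castSucc (Fin.last e) q.castSucc)
    (h2 : Tri Δ (Fin.last m) (Fin.last e) a.castSucc b.castSucc) (hn : [p, q, a, b].Nodup) : ∃ Γ :
    EdgeSeq n m e, Δ = split Γ (inr w) {a, b} ∧ Quad Γ w p q a b ∧ (∀ i, ¬ (Γ i).IsDiag) ∧ ∀ v, v ≠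
    w → valence Γ (inr v) = 3 := by
  -- the contraction of the last edge
  let Γ : EdgeSeq n m e := fun i => (Δ i.castSucc).map (collapse w)
  have hlast : Δ (Fin.last e) = s(up (inr w), newV) := by
    have e1 := (h1.2.2.2 (Fin.last e)).2 (by tauto)
    have e2 := (h2.2.2.2 (Fin.last e)).2 (by tauto)
    exact (Sym2.mem_and_mem_iff (up_ne_newV _)).1 ⟨e1, e2⟩
  have hab : ∀ i, i ∈ ({a, b} : Finset (Fin e)) ↔ newV ∈ Δ i.castSucc := by
    intro i
    rw [newV_def, h2.2.2.2]
    simp [Fin.castSucc_ne_last]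
  have hpq : ∀ i : Fin e, up (inr w) ∈ Δ i.castSucc ↔ i = p ∨ i = q := by
    intro i
    rw [up_inr, h1.2.2.2]
    simp [Fin.castSucc_ne_last]
  simp only [nodup_cons, List.mem_cons, not_mem_nil, or_false, not_or] at hn
  have hmem : ∀ i ∈ ({a, b} : Finset (Fin e)), ∃ x, Δ i.castSucc = s(newV, up x) ∧
      x ≠ inr w ∧ Γ i = s(inr w, x) := by
    intro i hi
    obtain ⟨y, hy⟩ := (hab i).1 hi
    have hy1 : y ≠ newV := by
      rintro rfl
      exact hΔ.1 _ (by rw [hy]; simp)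
    obtain ⟨x, rfl⟩ := exists_up hy1
    refine ⟨x, hy, ?_, by
      change (Δ i.castSucc).map (collapse w) = _
      rw [hy, Sym2.map_mk, collapse_newV, collapse_up]⟩
    rintro rfl
    have := (hpq i).1 (by rw [hy]; simp)
    simp only [mem_insert, mem_singleton] at hi
    grind
  have hnot : ∀ i, i ∉ ({a, b} : Finset (Fin e)) → (Γ i).map up = Δ i.castSucc := by
    intro i hi
    rw [hab] at hi
    change ((Δ i.castSucc).map (collapse w)).map up = _
    rw [Sym2.map_map]
    have hid : Δ i.castSucc = (Δ i.castSucc).map id := by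
      rw [Sym2.map_id]
      rfl
    conv_rhs => rw [hid]
    refine Sym2.map_congr fun x hx => ?_
    obtain ⟨y, rfl⟩ := exists_up (fun hc => hi (hc ▸ hx))
    simp [collapse_up]
  have hΓ : Δ = split Γ (inr w) {a, b} := by
    funext i
    induction i using Fin.lastCases with
    | last => rw [split_last, hlast]
    | cast i =>
      by_cases hi : i ∈ ({a, b} : Finset (Fin e))
      · obtain ⟨x, hx, hxw, this⟩ := hmem i hi
        rw [split_of_mem hi this hxw, hx]
      · rw [split_of_notMem hi, hnot i hi]
  have hl : ∀ i, ¬ (Γ i).IsDiag := by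
    intro i hd
    by_cases hi : i ∈ ({a, b} : Finset (Fin e))
    · obtain ⟨x, hx, hxw, this⟩ := hmem i hi
      rw [this] at hd
      exact hxw (Sym2.mk_isDiag_iff.1 hd).symm
    · refine hΔ.1 i.castSucc ?_
      rw [← hnot i hi, Sym2.isDiag_map up_injective]
      exact hd
  refine ⟨Γ, hΓ, ⟨by simp; tauto, fun i => ?_⟩, hl, fun v hv => ?_⟩
  · have e1 := mem_split_self (Γ := Γ) (u := inr w) (S := {a, b}) (h := i)
    have e2 := mem_split_newV (Γ := Γ) (u := inr w) (S := {a, b}) (h := i)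
    rw [← hΓ] at e1 e2
    rw [hpq] at e1
    rw [← hab] at e2
    simp only [mem_insert, mem_singleton] at e1 e2
    simp only [List.mem_cons, not_mem_nil, or_false]
    tauto
  · rw [← valence_split_of_ne (u := inr w) (S := {a, b}) (by simpa using hv), ← hΓ]
    exact hΔ.2 _

/-- Every internal edge can be made the last one, with one of its ends the last vertex. -/
theorem exists_relabel_last {Γ : EdgeSeq n (m + 1) (e + 1)} (f : Fin (e + 1)) (v : Fin (m + 1)) :
    ∃ σ τ Γ', IsRelabel σ τ Γ Γ' ∧ σ⁻¹ f = Fin.last e ∧ τ v = Fin.last m := by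
  refine ⟨Equiv.swap f (Fin.last e), Equiv.swap v (Fin.last m), fun i => _, fun i => rfl, ?_, ?_⟩
  · rw [Equiv.swap_inv, Equiv.swap_apply_left]
  · rw [Equiv.swap_apply_left]

end

section

/-! ### Invariant functions of pairs of trees -/

variable {M : Type*} [AddCommGroup M] [Module K M]

/-- The properties of a function of two binary trees which depends only on the tree obtained by
joining their roots, and which is compatible with antisymmetry and the Jacobi identity. -/
structure IsInvariant (γ : BTree n → BTree n → M) : Prop where
  symm : ∀ s z, γ s z = γ z s
  shift : ∀ s t z, γ (s * t) z = γ s (t * z)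
  swap : ∀ s t z, γ (s * t) z = - γ (t * s) z
  jacobi : ∀ a b c z, γ ((a * b) * c) z + γ ((b * c) * a) z + γ ((c * a) * b) z = 0

/-- The function `s ↦ γ s z`, evaluated on right-normed trees and extended linearly. -/
def combLin (γ : BTree n → BTree n → M) (z : BTree n) :
    NCP n K →ₗ[K] M :=
  NCP.lin fun w => match w with
    | [] => 0
    | k :: l => γ (comb k l) z

theorem combLin_cons (γ : BTree n → BTree n → M) (z : BTree n)
    (k : Fin n) (l : List (Fin n)) : combLin γ z (wd (k :: l) : NCP n K) = γ (comb k l) z := by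
  rw [combLin, NCP.lin_wd]

variable {γ : BTree n → BTree n → M}

theorem IsInvariant.cyclic (h : IsInvariant γ) (s t z : BTree n) : γ (s * t) z = γ t (z * s) := by
  rw [h.shift, h.symm, h.shift]

theorem IsInvariant.jacobi' (h : IsInvariant γ) (t z a b : BTree n) :
    γ t ((z * a) * b) - γ t ((z * b) * a) = γ t (z * (a * b)) := by
  have h1 := h.jacobi z a b t
  have h2 : γ ((b * z) * a) t = - γ ((z * b) * a) t := by
    rw [h.shift, h.swap, h.shift (z * b)]
  rw [h.swap (a * b), h2] at h1
  rw [h.symm t, h.symm t, h.symm t, ← sub_eq_zero, ← h1]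
  abel

theorem IsInvariant.combLin_lieW_mul (h : IsInvariant γ) (z s : BTree n) (q : NCP n K) : combLin γ z
    (lieW s * q) = combLin γ (z * s) q + aug q • combLin γ z (lieW s : NCP n K) := by
  induction s using FreeMagma.recOnMul generalizing z q with
  | ih1 k =>
    rw [lieW_of]
    have : combLin γ z ∘ₗ LinearMap.mulLeft K (wd [k] : NCP n K) =
        combLin γ (z * .of k) + LinearMap.smulRight aug (combLin γ z (wd [k] : NCP n K)) := by
      refine NCP.lin_ext fun w => ?_
      rw [LinearMap.comp_apply, LinearMap.mulLeft_apply, ← wd_cons, LinearMap.add_apply,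
        LinearMap.smulRight_apply, aug_wd]
      rcases w with _ | ⟨j, w⟩
      · rw [if_pos rfl, one_smul]
        simp [combLin]
      · rw [if_neg (by simp), zero_smul, add_zero, combLin_cons, combLin_cons]
        exact h.cyclic _ _ _
    exact LinearMap.congr_fun this q
  | ih2 a b ha hb =>
    have key : ∀ q : NCP n K, combLin γ ((z * a) * b) q - combLin γ ((z * b) * a) q =
        combLin γ (z * (a * b)) q := by
      intro q
      rw [← LinearMap.sub_apply]
      congr 1
      refine NCP.lin_ext fun w => ?_
      rcases w with _ | ⟨j, w⟩
      · simp [combLin]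
      · rw [LinearMap.sub_apply, combLin_cons, combLin_cons, combLin_cons]
        exact h.jacobi' _ _ _ _
    have haug : ∀ p q : NCP n K, aug p = 0 → aug (p * q) = 0 := by
      intro p q hp
      change toAss (p * q) [] = 0
      change toAss p [] = 0 at hp
      simp [toAss_mul, Ass.mul, hp]
    simp only [lieW_mul, bracket_def, sub_mul, map_sub, mul_assoc, ha, hb, haug _ _ (aug_lieW b),
      haug _ _ (aug_lieW a), aug_lieW, ← key]
    module

theorem IsInvariant.combLin_lieW (h : IsInvariant γ) (z s : BTree n) :
    combLin γ z (lieW s : NCP n K) = (s.length : K) • γ s z := by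
  induction s using FreeMagma.recOnMul generalizing z with
  | ih1 k =>
    rw [lieW_of, combLin_cons]
    change _ = ((1 : ℕ) : K) • _
    rw [Nat.cast_one, one_smul]
    rfl
  | ih2 a b ha hb =>
    change _ = ((a.length + b.length : ℕ) : K) • _
    rw [lieW_mul, bracket_def, map_sub, h.combLin_lieW_mul, h.combLin_lieW_mul, aug_lieW, aug_lieW,
      zero_smul, zero_smul, add_zero, add_zero, ha, hb, ← h.cyclic, ← h.cyclic, h.swap b a]
    push_cast
    module

/-- The sum over all leaves of a tree recovers the value of an invariant function, up to the
number of pairs of different leaves. -/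
theorem IsInvariant.rr_combLin (h : IsInvariant γ) (s z : BTree n) : rr
    (fun k => (combLin γ (.of k) : NCP n K →ₗ[K] M)) s (lieW z) =
    (s.length * (s.length + z.length - 1) : K) • γ s z := by
  induction s using FreeMagma.recOnMul generalizing z with
  | ih1 k =>
    rw [rr_of, h.combLin_lieW, h.symm]
    change _ = (((1 : ℕ) : K) * (((1 : ℕ) : K) + _ - 1)) • _
    congr 1
    push_cast
    ring
  | ih2 a b ha hb =>
    rw [rr_mul, ← lieW_mul, ← lieW_mul, ha, hb, ← h.shift, ← h.cyclic]
    have e1 : ∀ s t : BTree n, (s * t).length = s.length + t.length := fun _ _ => rfl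
    simp only [e1]
    push_cast
    module

/-- The homogeneous component of degree `d` of a series, as a polynomial. -/
def trunc (d : ℕ) : Ass n K →ₗ[K] NCP n K where
  toFun a := ∑ u : Fin d → Fin n, a (ofFn u) • wd (ofFn u)
  map_add' a b := by simp only [Pi.add_apply, add_smul, sum_add_distrib]
  map_smul' c a := by
    simp only [Pi.smul_apply, smul_eq_mul, mul_smul, smul_sum, RingHom.id_apply]

theorem toAss_trunc (d : ℕ) (a : Ass n K) : toAss (trunc d a) = homPart d a := by
  funext w
  change toAss (∑ u : Fin d → Fin n, a (ofFn u) • wd (ofFn u)) w = _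
  simp only [map_sum, map_smul, Finset.sum_apply, Pi.smul_apply, toAss_wd, smul_eq_mul]
  by_cases hw : w.length = d
  · subst hw
    rw [Finset.sum_eq_single w.get]
    · simp [homPart]
    all_goals grind
  · rw [homPart, if_neg hw]
    refine sum_eq_zero fun u _ => ?_
    grind

theorem IsHomog.trunc_toAss {d : ℕ} {p : NCP n K} (h : IsHomog d p) : trunc d (toAss p) = p := by
  apply toAss_injective
  rw [toAss_trunc]
  funext w
  unfold homPart
  split_ifs with hw
  · rfl
  · exact (h w hw).symm

end

section

/-! ### The relation of the three splittings modulo coboundaries -/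

theorem dFree_single (R : ℕ → ℕ → Prop) (Γ : Gph n m e) :
    dFree n m e K R (Finsupp.single Γ 1) =
      splitSum K (fun Δ => R (loops Γ.1) (loops Δ)) Γ.1 := by simp [dFree]

variable (n m e) (K) in
/-- The part of a series with `m` internal vertices and `e` edges. -/
def ICG.piece : ICG n K →ₗ[K] Piece n m e K where
  toFun x := x m e
  map_add' _ _ := rfl
  map_smul' _ _ := rfl

variable (n m e) (K) in
/-- The coboundaries of degree `p` with `p` internal loops in the space of graphs with `m` internal
vertices and `e` edges. -/
def bdPiece (p : ℕ) : Submodule K (Piece n m e K) :=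
  (B₁ n K p 0).map (ICG.piece n m e K)

theorem mem_B₁_iff {p : ℕ} {x : ICG n K} : x ∈ B₁ n K p 0 ↔ ∀ m e, x m e ∈ bdPiece n m e K p := by
  constructor
  · intro hx m e
    exact ⟨x, hx, rfl⟩
  · intro hx
    choose z hz hz' using hx
    choose y hy hy' using hz
    refine ⟨fun m e => y (m + 1) (e + 1) m e, ⟨fun m e => (hy _ _).1 m e,
      fun m e h => (hy _ _).2 m e h⟩, ?_⟩
    funext m e
    rw [← hz' m e]
    change _ = z m e m e
    rw [← hy' m e]
    rcases m with _ | m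
    · rfl
    rcases e with _ | e
    · rfl
    rfl

theorem mk_splitSum_mem_bdPiece (Γ : Gph n m e) (h : e + loops Γ.1 = 2 * m + 2) :
    (Rel n (m + 1) (e + 1) K).mkQ (splitSum K (fun Δ => loops Δ = loops Γ.1 + 0) Γ.1) ∈ bdPiece n
    (m + 1) (e + 1) K (loops Γ.1) := by
  classical
  have h0 : ∀ m' e', (Pi.single m (Pi.single e (cl K Γ.1)) : ICG n K) m' e' = 0 ∨
      (m' = m ∧ e' = e) := by
    intro m' e'
    by_cases hm : m' = m
    · subst hm
      by_cases he : e' = e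
      · exact Or.inr ⟨rfl, he⟩
      · left
        rw [Pi.single_eq_same, Pi.single_eq_of_ne he]
    · left
      rw [Pi.single_eq_of_ne hm]
      rfl
  have h1 : (Pi.single m (Pi.single e (cl K Γ.1)) : ICG n K) m e = cl K Γ.1 := by
    rw [Pi.single_eq_same, Pi.single_eq_same]
  refine ⟨_, ⟨Pi.single m (Pi.single e (cl K Γ.1)), ⟨fun m' e' => ?_, fun m' e' hne => ?_⟩, rfl⟩,
    ?_⟩
  · rcases h0 m' e' with h2 | ⟨rfl, rfl⟩
    · rw [h2]
      exact zero_mem _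
    · rw [h1]
      exact subset_span ⟨Γ, rfl, cl_of K Γ⟩
  · rcases h0 m' e' with h2 | ⟨rfl, rfl⟩
    · exact h2
    · omega
  · change dPiece n m e K _ ((Pi.single m (Pi.single e (cl K Γ.1)) : ICG n K) m e) = _
    rw [h1, cl_of]
    change (Rel n (m + 1) (e + 1) K).mkQ (dFree n m e K _ (Finsupp.single Γ 1)) = _
    rw [dFree_single]

/-- To prove a property of the sum of the three splittings of a 4-valent vertex, it may be assumed
that the first of them is admissible. -/
theorem Quad.sum_induction (hw : Quad Γ w p q a b) {P : Piece n (m + 1) (e + 1) K → Prop} (h0 : P 0)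
    (h : ∀ {q a b : Fin e}, Quad Γ w p q a b → IsICG (split Γ (inr w) {a, b}) → P (cl K (split Γ
    (inr w) {a, b}) + cl K (split Γ (inr w) {b, q}) + cl K (split Γ (inr w) {q, a}))) : P (cl K
    (split Γ (inr w) {a, b}) + cl K (split Γ (inr w) {b, q}) + cl K (split Γ (inr w) {q, a})) := by
  by_cases h1 : IsICG (split Γ (inr w) {a, b})
  · exact h hw h1
  by_cases h2 : IsICG (split Γ (inr w) {b, q})
  · convert h hw.rot h2 using 1
    abel
  by_cases h3 : IsICG (split Γ (inr w) {q, a})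
  · convert h hw.rot.rot h3 using 1
    abel
  · rw [cl_of_not K h1, cl_of_not K h2, cl_of_not K h3]
    simpa using h0

/-- The three ways to split a 4-valent vertex add up to a coboundary. -/
theorem Quad.sum_mem_bdPiece [CharZero K] (hw : Quad Γ w p q a b) (hl : ∀ i, ¬ (Γ i).IsDiag)
    (ht : ∀ v, v ≠ w → valence Γ (inr v) = 3) {r : ℕ} (hr : loops Γ = r) (he : e + r = 2 * m + 2) :
    cl K (split Γ (inr w) {a, b}) + cl K (split Γ (inr w) {b, q}) + cl K (split Γ (inr w) {q, a}) ∈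
    bdPiece n (m + 1) (e + 1) K r := by
  subst hr
  have ht' : ∀ v : Fin m, 3 ≤ valence Γ (inr v) := by
    intro v
    by_cases hv : v = w
    · subst hv
      have : [p, q, a, b].toFinset ⊆ univ.filter fun i => inr v ∈ Γ i := by
        intro i hi
        simpa [hw.2] using hi
      have := card_le_card this
      rw [List.toFinset_card_of_nodup hw.1] at this
      exact le_trans (by simp) this
    · exact (ht v hv).ge
  refine hw.sum_induction (P := (· ∈ bdPiece n (m + 1) (e + 1) K (loops Γ)))
    (zero_mem _) fun {q a b} hw hI => ?_
  rcases ihx_cl K hw hl ht' hI with h | h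
  · rw [← mk_splitSum K he hw]
    exact mk_splitSum_mem_bdPiece ⟨Γ, h⟩ he
  · rw [h]
    exact zero_mem _

/-- Every internal edge of a trivalent graph arises, up to relabelling, by splitting a 4-valent
vertex. -/
theorem exists_contract {Γ : EdgeSeq n (m + 1) (e + 1)} (hΓ : IsTrivalent Γ) {w v : Fin (m + 1)}
    {p f q a b : Fin (e + 1)} (h1 : Tri Γ w p f q) (h2 : Tri Γ v f a b) (hn : [p, q, a, b].Nodup) :
    ∃ (σ : Equiv.Perm (Fin (e + 1))) (τ : Equiv.Perm (Fin (m + 1))) (Γ' : EdgeSeq n m e)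
    (w' : Fin m) (p' q' a' b' : Fin e), IsRelabel σ τ Γ (split Γ' (inr w') {a', b'}) ∧ Quad Γ' w' p'
    q' a' b' ∧ (∀ i, ¬ (Γ' i).IsDiag) ∧ (∀ u, u ≠ w' → valence Γ' (inr u) = 3) ∧ σ⁻¹ f = Fin.last
    e ∧ σ⁻¹ p = p'.castSucc ∧ σ⁻¹ q = q'.castSucc ∧ σ⁻¹ a = a'.castSucc ∧ σ⁻¹ b = b'.castSucc ∧ τ
    w = w'.castSucc ∧ τ v = Fin.last m := by
  obtain ⟨σ, τ, Δ, hr, hf, hv⟩ := exists_relabel_last (Γ := Γ) f v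
  have hne : ∀ g, g ≠ f → ∃ g', σ⁻¹ g = Fin.castSucc g' := by
    intro g hg
    refine ⟨(σ⁻¹ g).castPred fun hc => hg ?_, by simp⟩
    rw [← hf] at hc
    exact σ⁻¹.injective hc
  obtain ⟨p', hp⟩ := hne p h1.1
  obtain ⟨q', hq⟩ := hne q h1.2.2.1.symm
  obtain ⟨a', ha⟩ := hne a h2.1.symm
  obtain ⟨b', hb⟩ := hne b h2.2.1.symm
  have hwv : w ≠ v := by
    rintro rfl
    have := (h2.2.2.2 p).1 ((h1.2.2.2 p).2 (by tauto))
    grind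
  obtain ⟨w', hw⟩ : ∃ w', τ w = Fin.castSucc w' := by
    refine ⟨(τ w).castPred fun hc => hwv ?_, by simp⟩
    rw [← hv] at hc
    exact τ.injective hc
  have t1 := hr.tri h1
  have t2 := hr.tri h2
  rw [hp, hf, hq, hw] at t1
  rw [hf, ha, hb, hv] at t2
  have hn' : [p', q', a', b'].Nodup := by
    have := hn.map σ⁻¹.injective
    grind
  obtain ⟨Γ', rfl, hQ, hl, ht⟩ := exists_split (hr.isTrivalent hΓ) t1 t2 hn'
  exact ⟨σ, τ, Γ', w', p', q', a', b', hr, hQ, hl, ht, hf, hp, hq, ha, hb, hw, hv⟩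

end

section

variable {τ : Equiv.Perm (Fin (m + 1))} {Y : List (Fin (e + 1))}

/-! ### The invariant function given by the classes of trees -/

section TreeClass

variable {r' : Fin e} {s' z' a b c : BTree n}

/-- A tree can be drawn with its first node's subtrees exchanged. -/
theorem Full.swap (h : Full Γ i x x' (s * t) z ε) : Full Γ i x x' (t * s) z (-ε) := by
  obtain ⟨A, M, h1, h2, h3, h4, h5⟩ := h
  rcases x with k | v
  · exact absurd h2.inl_inv.2 (by intro hc; cases hc)
  obtain ⟨f, g, a, b, A₁, A₂, s₁, s₂, hv, hf, hg, b1, b2, rfl, hs⟩ := h2.inr_inv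
  obtain ⟨rfl, rfl⟩ := mul_inj_magma hs
  refine ⟨_, _, h1, Branch.node hv.swap hg hf b2 b1, h3, ?_, ?_⟩
  · refine List.Perm.trans ?_ h4
    rw [perm_iff_count]
    grind
  · have hn := h4.nodup_iff.2 (nodup_finRange e)
    have := listSign_swap_odd [i] (f :: A₁) (g :: A₂) M (by simpa using hn)
      (by simpa using b1.even.add_one) (by simpa using b2.even.add_one)
    simp only [append_assoc, cons_append, nil_append] at this h5 ⊢
    rw [← h5, this, neg_neg]

/-- Trivalent trees read as a pair of binary trees from an edge. -/
def TreeOf (Γ : EdgeSeq n m e) (s z : BTree n) (ε : ℤ) : Prop :=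
  IsTrivalent Γ ∧ ∃ i x x', Full Γ i x x' s z ε

variable (m e) (K) in
/-- The class, modulo coboundaries, of the trivalent tree obtained by joining the roots of two
binary trees, with the order of the edges given by reading the trees; it is zero if the number of
internal vertices is wrong. -/
def treeClass (s z : BTree n) : Piece n m e K ⧸ bdPiece n m e K 0 := by
  classical exact
    if h : ∃ p : EdgeSeq n m e × ℤ, TreeOf p.1 s z p.2 then
      (bdPiece n m e K 0).mkQ ((h.choose.2 : K) • cl K h.choose.1)
    else 0

theorem TreeOf.treeClass_eq (h : TreeOf Γ s z ε) (he : e = 2 * m + 1) : treeClass m e K s z =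
    (bdPiece n m e K 0).mkQ ((ε : K) • cl K Γ) := by
  have h1 : ∃ p : EdgeSeq n m e × ℤ, TreeOf p.1 s z p.2 := ⟨(Γ, ε), h⟩
  rw [treeClass, dif_pos h1]
  congr 1
  obtain ⟨a, _, _, _, b⟩ := h1.choose_spec
  obtain ⟨c, _, _, _, d⟩ := h
  exact b.unique a c he d

theorem treeClass_of_not
    (h : ∀ (Γ : EdgeSeq n m e) ε, ¬ TreeOf Γ s z ε) : treeClass m e K s z = 0 :=
  dif_neg fun ⟨p, hp⟩ => h p.1 p.2 hp

theorem TreeOf.symm (h : TreeOf Γ s z ε) : TreeOf Γ z s ε :=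
  ⟨h.1, by obtain ⟨i, x, x', h⟩ := h.2; exact ⟨i, x', x, h.symm⟩⟩

theorem TreeOf.shift (h : TreeOf Γ (s * t) z ε) : TreeOf Γ s (t * z) ε :=
  ⟨h.1, by obtain ⟨i, x, x', h⟩ := h.2; exact h.shift⟩

theorem TreeOf.swap (h : TreeOf Γ (s * t) z ε) : TreeOf Γ (t * s) z (-ε) :=
  ⟨h.1, by obtain ⟨i, x, x', h⟩ := h.2; exact ⟨i, x, x', h.swap⟩⟩

theorem treeClass_congr (he : e = 2 * m + 1)
    (h : ∀ (Γ : EdgeSeq n m e) ε, TreeOf Γ s z ε → TreeOf Γ s' z' ε)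
    (h' : ∀ (Γ : EdgeSeq n m e) ε, TreeOf Γ s' z' ε → TreeOf Γ s z ε) : treeClass m e K s z =
    treeClass m e K s' z' := by
  by_cases hex : ∃ (Γ : EdgeSeq n m e) (ε : ℤ), TreeOf Γ s z ε
  · obtain ⟨Γ, ε, hΓ⟩ := hex
    rw [hΓ.treeClass_eq he, (h Γ ε hΓ).treeClass_eq he]
  · push Not at hex
    rw [treeClass_of_not hex, treeClass_of_not fun Γ ε hc => hex Γ ε (h' Γ ε hc)]

/-- A branch away from a contracted edge is a branch of the contracted graph. -/
theorem Branch.contract {Γ : EdgeSeq n (m + 1) (e + 1)} {σ : Equiv.Perm (Fin (e + 1))}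
    (hr : IsRelabel σ τ Γ (KV.split Γ' u' S)) {f r : Fin (e + 1)} (hf : σ⁻¹ f = Fin.last e)
    {y : Vtx n (m + 1)} (b : Branch Γ y r Y s) (hY : f ∉ Y) (hr' : σ⁻¹ r = r'.castSucc)
    {u : Fin (m + 1)} (hy : Γ r = s(inr u, y))
    (hx : KV.split Γ' u' S r'.castSucc = s(inr (τ u), up x)) : ∃ Y', Y.map
    (σ⁻¹ : Equiv.Perm (Fin (e + 1))) = Y'.map Fin.castSucc ∧ Branch Γ' x r' Y' s := by
  have h1 := hr.edge hy
  rw [hr'] at h1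
  have h2 : vtxEquiv n τ y = up x := Sym2.other_eq h1 hx
  refine (hr.branch b).of_split h2 hr' ?_
  rw [← hf, List.mem_map]
  rintro ⟨g, hg, hgf⟩
  rw [← σ⁻¹.injective hgf] at hY
  exact hY hg

/-- The Jacobi identity for a tree with two adjacent internal vertices. -/
theorem TreeOf.jacobi [CharZero K] (h : TreeOf Γ ((a * b) * c) z ε) (he : e = 2 * m + 1) : treeClass
    m e K ((a * b) * c) z + treeClass m e K ((b * c) * a) z + treeClass m e K ((c * a) * b) z = 0 :=
    by
  obtain ⟨hΓ, p, x, x', A, M, h1, h2, h3, h4, -⟩ := h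
  rcases x with k | w
  · exact absurd h2.inl_inv.2 (by intro hc; cases hc)
  obtain ⟨f, q, y, xq, A₁, Q, s₁, s₂, hw, hf, hq, b1, b2, rfl, hs⟩ := h2.inr_inv
  obtain ⟨rfl, rfl⟩ := mul_inj_magma hs
  rcases y with k | v
  · exact absurd b1.inl_inv.2 (by intro hc; cases hc)
  obtain ⟨g, k, xa, xb, A, B, s₁, s₂, hv, hg, hk, b3, b4, rfl, hs⟩ := b1.inr_inv
  obtain ⟨rfl, rfl⟩ := mul_inj_magma hs
  have hn := h4.nodup_iff.2 (nodup_finRange e)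
  obtain ⟨m, rfl⟩ : ∃ m', m = m' + 1 :=
    Nat.exists_eq_succ_of_ne_zero (by rintro rfl; exact w.elim0)
  obtain ⟨e, rfl⟩ : ∃ e', e = e' + 1 :=
    Nat.exists_eq_succ_of_ne_zero (by rintro rfl; exact p.elim0)
  have hn' := hn
  simp only [nodup_append', nodup_cons, List.mem_append, List.mem_cons, not_or,
    List.disjoint_cons_right, cons_append] at hn'
  -- contract the edge joining the two vertices: the three trees are the splittings of the result
  obtain ⟨σ, τ, Γ', w', p', q', a', b', hr, hQ, hl, ht, hf', hp', hq', ha', hb', hw', hv'⟩ :=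
    exists_contract hΓ hw hv (by
      simp only [nodup_cons, List.mem_cons, not_mem_nil, or_false, not_or]
      tauto)
  have hn1 := hQ.1
  simp only [nodup_cons, List.mem_cons, not_mem_nil, or_false, not_or] at hn1
  obtain ⟨yp, hyp⟩ := (hQ.2 p').2 (by simp)
  obtain ⟨yq, hyq⟩ := (hQ.2 q').2 (by simp)
  obtain ⟨ya, hya⟩ := (hQ.2 a').2 (by simp)
  obtain ⟨yb, hyb⟩ := (hQ.2 b').2 (by simp)
  have ep := split_of_notMem' (u := inr w') (S := {a', b'}) (by simp; tauto) hyp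
  have eq := split_of_notMem' (u := inr w') (S := {a', b'}) (by simp; tauto) hyq
  have ea := edge_split_mem hl (show a' ∈ ({a', b'} : Finset _) by simp) hya
  have eb := edge_split_mem hl (show b' ∈ ({a', b'} : Finset _) by simp) hyb
  rw [up_inr, ← hw'] at ep eq
  rw [← hv'] at ea eb
  obtain ⟨P', hP, c1⟩ := h3.contract hr hf' (by tauto) hp' h1 ep
  obtain ⟨Q', hQ', c2⟩ := b2.contract hr hf' (by tauto) hq' hq eq
  obtain ⟨A', hA, c3⟩ := b3.contract hr hf' (by tauto) ha' hg ea
  obtain ⟨B', hB, c4⟩ := b4.contract hr hf' (by tauto) hb' hk eb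
  have hperm : (p' :: P' ++ (a' :: A' ++ (b' :: B' ++ q' :: Q'))).Perm (finRange e) := by
    rw [← perm_castSucc]
    refine List.Perm.trans ?_ (perm_map_finRange h4 σ⁻¹)
    simp only [List.map_append, List.map_cons, hP, hQ', hA, hB, hf', hp', hq', ha', hb']
    grind
  obtain ⟨x, ε, f1, f2, f3⟩ := hQ.full_three hl hyp hyq hya hyb c1 c2 c3 c4 hperm
  have g1 : TreeOf _ _ _ ε := ⟨⟨split_loopless hl, valence_split_quad hQ ht⟩, _, _, _, f1⟩
  have g2 : TreeOf _ _ _ ε :=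
    ⟨⟨split_loopless hl, valence_split_quad hQ.rot ht⟩, _, _, _, f2⟩
  have g3 : TreeOf _ _ _ ε :=
    ⟨⟨split_loopless hl, valence_split_quad hQ.rot.rot ht⟩, _, _, _, f3⟩
  rw [g1.treeClass_eq he, g2.treeClass_eq he, g3.treeClass_eq he, ← map_add, ← map_add,
    ← smul_add, ← smul_add]
  refine (Submodule.Quotient.mk_eq_zero _).2 (smul_mem _ _ ?_)
  have h0 : loops Γ' = 0 := by
    have := loops_of_valence (split_loopless hl) (valence_split_quad hQ ht)
    rw [loops_split_inr] at this
    omega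
  exact hQ.sum_mem_bdPiece hl ht h0 (by omega)

theorem treeClass_isInvariant [CharZero K] (he : e = 2 * m + 1) :
    IsInvariant (treeClass (n := n) m e K) where
  symm s z := treeClass_congr he (fun _ _ h => h.symm) (fun _ _ h => h.symm)
  shift s t z := treeClass_congr he (fun _ _ h => h.shift)
    (fun _ _ h => h.symm.shift.symm.shift.symm)
  swap s t z := by
    by_cases hex : ∃ (Γ : EdgeSeq n m e) (ε : ℤ), TreeOf Γ (s * t) z ε
    · obtain ⟨Γ, ε, hΓ⟩ := hex
      rw [hΓ.treeClass_eq he, hΓ.swap.treeClass_eq he, ← map_neg]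
      simp
    · push Not at hex
      rw [treeClass_of_not hex, treeClass_of_not fun Γ ε hc => hex Γ (-ε) hc.swap, neg_zero]
  jacobi a b c z := by
    by_cases h1 : ∃ (Γ : EdgeSeq n m e) (ε : ℤ), TreeOf Γ ((a * b) * c) z ε
    · obtain ⟨Γ, ε, hΓ⟩ := h1
      exact hΓ.jacobi he
    by_cases h2 : ∃ (Γ : EdgeSeq n m e) (ε : ℤ), TreeOf Γ ((b * c) * a) z ε
    · obtain ⟨Γ, ε, hΓ⟩ := h2
      rw [← hΓ.jacobi (K := K) he]
      abel
    by_cases h3 : ∃ (Γ : EdgeSeq n m e) (ε : ℤ), TreeOf Γ ((c * a) * b) z ε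
    · obtain ⟨Γ, ε, hΓ⟩ := h3
      rw [← hΓ.jacobi (K := K) he]
      abel
    push Not at h1 h2 h3
    rw [treeClass_of_not h1, treeClass_of_not h2, treeClass_of_not h3]
    simp

variable (n m e) (K) in
/-- The linear map which recovers (a multiple of) the class of a tree from its tuple of Lie words. -/
def recover : (Fin n → Ass n K) →ₗ[K] Piece n m e K ⧸ bdPiece n m e K 0 :=
  ∑ k, combLin (treeClass m e K) (.of k) ∘ₗ trunc (m + 1) ∘ₗ LinearMap.proj k

/-- Rerooting produces words of the expected length. -/
theorem isHomog_rr_dl (k : Fin n) (s : BTree n) {d : ℕ} {y : NCP n K}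
    (hy : IsHomog d y) : IsHomog (s.length + d - 1) (rr (dl k) s y) := by
  induction s using FreeMagma.recOnMul generalizing d y with
  | ih1 j =>
    have : (FreeMagma.of j).length + d - 1 = d := by
      change 1 + d - 1 = d
      omega
    rw [this, rr_of, dl]
    split_ifs
    · exact hy
    · intro w _
      simp
  | ih2 s t hs ht =>
    have e1 : (s * t).length = s.length + t.length := rfl
    have hadd : ∀ {d : ℕ} {p q : NCP n K}, IsHomog d p → IsHomog d q → IsHomog d (p + q) := by
      intro d p q hp hq w hw
      rw [map_add, Pi.add_apply, hp w hw, hq w hw, add_zero]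
    rw [rr_mul, e1]
    refine hadd ?_ ?_
    · have := hs (y := ⁅(lieW t : NCP n K), y⁆) (d := t.length + d) (by
        rw [bracket_def]
        exact ((isHomog_lieW t).mul hy).sub (by rw [add_comm]; exact hy.mul (isHomog_lieW t)))
      convert this using 1
      omega
    · have := ht (y := ⁅y, (lieW s : NCP n K)⁆) (d := s.length + d) (by
        rw [bracket_def]
        exact (show IsHomog (s.length + d) _ by
          rw [add_comm]; exact hy.mul (isHomog_lieW s)).sub ((isHomog_lieW s).mul hy))
      convert this using 1
      omega

theorem Full.length_add
    (h : Full Γ i x x' s z ε) (he : e = 2 * m + 1) : s.length + z.length = m + 2 := by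
  obtain ⟨A, M, h1, h2, h3, h4, h5⟩ := h
  have := h4.length_eq
  have := h2.length_eq
  have := h3.length_eq
  simp only [List.length_cons, List.length_append, List.length_finRange] at *
  omega

theorem Full.isHomog (h : Full Γ i x x' s z ε) (he : e = 2 * m + 1) (k : Fin n) : IsHomog (m + 1)
    (rr (dl k) s (lieW z) + rr (dl k) z (lieW s) : NCP n K) := by
  have h1 := h.length_add he
  have h2 := isHomog_rr_dl (K := K) k s (isHomog_lieW z)
  have h3 := isHomog_rr_dl (K := K) k z (isHomog_lieW s)
  intro w hw
  rw [map_add, Pi.add_apply, h2 w (by omega), h3 w (by omega), add_zero]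

/-- By the invariance of `treeClass`, each rerooting of a tree gives back its class; hence the Lie
words of a tree determine a nonzero multiple of its class. -/
theorem recover_treePiece [CharZero K] (he : e = 2 * m + 1) (Γ : Gph n m e) (h0 : loops Γ.1 = 0) :
    recover n m e K (treePiece n m e K (cl K Γ.1)) = ((m + 2) * (m + 1) : K) •
    (bdPiece n m e K 0).mkQ (cl K Γ.1) := by
  obtain ⟨x, x', s, z, ε, hF⟩ := Γ.2.exists_full h0 he ⟨0, by omega⟩
  have hv := Γ.2.valence_eq_three (by omega)
  have hT : TreeOf Γ.1 s z ε := ⟨⟨Γ.2.loopless, hv⟩, _, _, _, hF⟩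
  have hI := treeClass_isInvariant (n := n) (K := K) he
  rw [recover, LinearMap.sum_apply]
  have h1 : ∀ k, (combLin (treeClass m e K) (.of k) ∘ₗ trunc (m + 1) ∘ₗ LinearMap.proj k :
      (Fin n → Ass n K) →ₗ[K] _) (treePiece n m e K (cl K Γ.1)) =
      (ε : K) • (combLin (treeClass m e K) (.of k) (rr (dl (K := K) k) s (lieW z)) +
        combLin (treeClass m e K) (.of k) (rr (dl (K := K) k) z (lieW s))) := by
    intro k
    rw [LinearMap.comp_apply, LinearMap.comp_apply, LinearMap.proj_apply,
      hF.treePiece_eq Γ.2.loopless hv he, map_smul, (hF.isHomog he k).trunc_toAss, map_smul, map_add]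
  rw [sum_congr rfl fun k _ => h1 k, ← smul_sum, sum_add_distrib,
    sum_comp_rr_dl (fun k => combLin (treeClass m e K) (.of k)),
    sum_comp_rr_dl (fun k => combLin (treeClass m e K) (.of k)), hI.rr_combLin, hI.rr_combLin,
    hI.symm z s, hT.treeClass_eq he, ← add_smul, map_smul, smul_smul, smul_smul]
  congr 1
  have h2 : (s.length + z.length : K) = m + 2 := by
    have := hF.length_add he
    exact_mod_cast this
  have h3 : (ε : K) * ε = 1 := by
    obtain ⟨A, M, -, -, -, -, rfl⟩ := hF
    exact_mod_cast listSign_mul_self _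
  have h4 : (z.length + s.length : K) = m + 2 := by rw [add_comm, h2]
  rw [h2, h4]
  linear_combination (m + 2 - 1 : K) * (s.length + z.length) * h3 + (m + 2 - 1 : K) * h2

/-- A series of trees is determined, up to coboundaries, by its Lie words. -/
theorem mem_bdPiece_of_treePiece [CharZero K] (he : e = 2 * m + 1) {x : Piece n m e K} (hx : x ∈
    span K {y | ∃ Γ : Gph n m e, loops Γ.1 = 0 ∧ y = (Rel n m e K).mkQ (Finsupp.single Γ 1)})
    (h : treePiece n m e K x = 0) : x ∈ bdPiece n m e K 0 := by
  have key : recover n m e K (treePiece n m e K x) =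
      ((m + 2) * (m + 1) : K) • (bdPiece n m e K 0).mkQ x := by
    clear h
    induction hx using span_induction with
    | zero => simp
    | add a b _ _ ha hb => rw [map_add, map_add, ha, hb, map_add, smul_add]
    | smul c a _ ha => rw [map_smul, map_smul, ha, map_smul, smul_comm]
    | mem a ha =>
      obtain ⟨Γ, h0, rfl⟩ := ha
      rw [← cl_of, recover_treePiece he Γ h0]
  rw [h, map_zero] at key
  have h2 : ((m + 2) * (m + 1) : K) ≠ 0 := by
    have : ((m + 2) * (m + 1) : ℕ) ≠ 0 := by positivity
    exact_mod_cast this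
  exact (Submodule.Quotient.mk_eq_zero _).1 ((smul_eq_zero.1 key.symm).resolve_left h2)

end TreeClass

end

section

/-! ### The isomorphism with special derivations -/

variable {x : ICG n K} {c : FormalSum n K} {w : List (Fin n)}

/-- In the degree of the trivalent graphs every element is a cocycle: there are not enough edges for
one more vertex. -/
theorem mem_Z₁_of_mem {p : ℕ} (h1 : x ∈ Gr n K p) (h2 : x ∈ degPart n K p) : x ∈ Z₁ n K p 0 := by
  refine ⟨⟨h1, by simpa using h2⟩, ?_⟩
  change dLoop n K 0 x = 0
  funext m e
  rcases m with _ | m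
  · rfl
  rcases e with _ | e
  · rfl
  change dPiece n m e K _ (x m e) = 0
  by_cases he : 1 - (e : ℤ) + 2 * (m : ℤ) = p
  · have h3 := h1 m e
    generalize x m e = y at h3
    induction h3 using span_induction with
    | zero => simp
    | add a b _ _ ha hb => rw [map_add, ha, hb, add_zero]
    | smul c a _ ha => rw [map_smul, ha, smul_zero]
    | mem a ha =>
      obtain ⟨Γ, rfl, rfl⟩ := ha
      change (Rel n (m + 1) (e + 1) K).mkQ (dFree n m e K _ (Finsupp.single Γ 1)) = 0
      have h4 : dFree n m e K (fun a b => b = a + 0) (Finsupp.single Γ 1) = 0 := by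
        have : ∀ v S, splitTerm K (fun Δ => loops Δ = loops Γ.1 + 0) Γ.1 v S = 0 := by
          intro v S
          unfold splitTerm
          refine dif_neg ?_
          rintro ⟨hI, -, hl⟩
          have h5 := hI.sum_valence_inr
          have h6 := Finset.sum_le_sum fun v (_ : v ∈ univ) => hI.trivalent v
          simp only [sum_const, card_univ, Fintype.card_fin, smul_eq_mul] at h6
          omega
        rw [dFree_single]
        simp only [splitSum, this, sum_const_zero, smul_zero]
        exact add_zero _
      rw [h4, map_zero]
  · rw [h2 m e he, map_zero]

theorem toICG_mem_Z₁ (hc : IsTreeSeries c) : toICG n K c ∈ Z₁ n K 0 0 := by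
  refine mem_Z₁_of_mem (fun m e => ?_) fun m e h => ?_
  · change (Rel n m e K).mkQ (c m e) ∈ _
    rw [← Finsupp.sum_single (c m e), Finsupp.sum, map_sum]
    refine sum_mem fun Γ hΓ => ?_
    have h1 := hc m e Γ (by simpa using hΓ)
    rw [← mul_one (c m e Γ), ← smul_eq_mul, ← Finsupp.smul_single, map_smul]
    exact smul_mem _ _ (subset_span ⟨Γ, h1.1, rfl⟩)
  · have : c m e = 0 := by
      ext Γ
      by_contra hne
      have := (hc m e Γ hne).2
      push_cast at h
      omega
    change (Rel n m e K).mkQ (c m e) = 0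
    rw [this, map_zero]

variable (n K) in
/-- The standard map from series of trees to tuples of series. -/
def psi : ICG n K →ₗ[K] (Fin n → Ass n K) where
  toFun x k w := treePiece n (w.length - 1) (2 * w.length - 1) K (x _ _) k w
  map_add' x y := by
    funext k w
    simp
  map_smul' c x := by
    funext k w
    simp

theorem psi_apply (x : ICG n K) (k : Fin n) (hm : w.length = m + 1)
    (he : e = 2 * m + 1) : psi n K x k w = treePiece n m e K (x m e) k w := by
  obtain rfl : m = w.length - 1 := by omega
  obtain rfl : e = 2 * w.length - 1 := by omega
  rfl

theorem treePiece_mk (y : Gph n m e →₀ K) : treePiece n m e K ((Rel n m e K).mkQ y) = y.sum fun Γ a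
    => a • if loops Γ.1 = 0 ∧ e = 2 * m + 1 then treeWord K Γ.1 else 0 := by
  change (Finsupp.lift _ K _ _) y = _
  rw [Finsupp.lift_apply]

theorem psi_toICG (hc : IsTreeSeries c) : psi n K (toICG n K c) = treeTuple c := by
  funext k w
  change treePiece n _ _ K ((Rel n _ _ K).mkQ (c _ _)) k w = _
  rw [treePiece_mk, treeTuple, Finsupp.sum, Finsupp.sum, Finset.sum_apply, Finset.sum_apply]
  refine sum_congr rfl fun Γ hΓ => ?_
  rw [if_pos (hc _ _ Γ (by simpa using hΓ))]
  rfl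

/-- A property of tuples which is closed under linear combinations holds for the image of
`treePiece` if it holds for trees. -/
theorem treePiece_induction [CharZero K] {P : (Fin n → Ass n K) → Prop} (h0 : P 0)
    (ha : ∀ a b, P a → P b → P (a + b)) (hs : ∀ (c : K) a, P a → P (c • a)) (h : ∀ (Γ : Gph n m e) i
    x x' s z ε, e = 2 * m + 1 → Full Γ.1 i x x' s z ε → P fun k => toAss
    (rr (dl k) s (lieW z) + rr (dl k) z (lieW s))) (y : Piece n m e K) : P
    (treePiece n m e K y) := by
  obtain ⟨y, rfl⟩ := mkQ_surjective _ y
  induction y using Finsupp.induction_linear with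
  | zero => simpa using h0
  | add f g hf hg =>
    grind
  | single Γ c =>
    rw [← mul_one c, ← smul_eq_mul, ← Finsupp.smul_single, map_smul, map_smul]
    refine hs _ _ ?_
    rw [← cl_of, treePiece_cl]
    split_ifs with hΓ
    · obtain ⟨x, x', s, z, ε, hF⟩ := Γ.2.exists_full hΓ.1 hΓ.2 ⟨0, by omega⟩
      have : treeWord K Γ.1 = (ε : K) •
          fun k => toAss (rr (dl k) s (lieW z) + rr (dl k) z (lieW s)) := by
        funext k
        exact hF.treeWord_eq (Γ.2.loopless _) k
      grind
    · exact h0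

theorem treePiece_isHomog [CharZero K] (y : Piece n m e K) (k : Fin n)
    (hw : w.length ≠ m + 1) : treePiece n m e K y k w = 0 :=
  treePiece_induction (P := fun a => a k w = 0) rfl
    (fun a b ha hb => by rw [Pi.add_apply, Pi.add_apply, ha, hb, add_zero])
    (fun c a ha => by rw [Pi.smul_apply, Pi.smul_apply, ha, smul_zero])
    (fun Γ i x x' s z ε he hF => hF.isHomog he k w hw) y

theorem homPart_psi [CharZero K] (x : ICG n K) (k : Fin n) (he : e = 2 * m + 1) :
    homPart (m + 1) (psi n K x k) = treePiece n m e K (x m e) k := by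
  funext w
  unfold homPart
  split_ifs with hw
  · exact psi_apply x k hw he
  · exact (treePiece_isHomog _ k hw).symm

theorem psi_nil [CharZero K] (x : ICG n K) (k : Fin n) : psi n K x k [] = 0 :=
  treePiece_isHomog (m := 0) (e := 0) (x 0 0) k (w := []) (by simp)

/-! #### The image consists of special derivations -/

theorem isLiePoly_rr_dl (k : Fin n) (s : BTree n) {y : NCP n K}
    (hy : Ass.IsLiePoly (toAss y)) : Ass.IsLiePoly (toAss (rr (dl k) s y)) := by
  induction s using FreeMagma.recOnMul generalizing y with
  | ih1 j =>
    rw [rr_of, dl]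
    split_ifs
    · exact hy
    · rw [LinearMap.zero_apply, map_zero]
      exact .zero
  | ih2 s t hs ht =>
    rw [rr_mul, map_add]
    refine (hs ?_).add (ht ?_)
    · rw [toAss_brk]
      exact (isLiePoly_lieW t).brk hy
    · rw [toAss_brk]
      exact hy.brk (isLiePoly_lieW s)

theorem brk_X_homPart (i : Fin n) (d : ℕ) (a : Ass n K) (w : List (Fin n)) : brk (Ass.X i)
    (homPart d a) w = if w.length = d + 1 then brk (Ass.X i) a w else 0 := by
  have h1 : Ass.mul (Ass.X i) (homPart d a) w =
      if w.length = d + 1 then Ass.mul (Ass.X i) a w else 0 := by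
    have key : ∀ r, Ass.X i (w.take r) * homPart d a (w.drop r) =
        if w.length = d + 1 then (Ass.X i (w.take r) * a (w.drop r) : K) else 0 := by
      intro r
      by_cases hr : w.take r = [i]
      · have h1 : (w.take r).length + (w.drop r).length = w.length := by
          grind
        rw [hr, List.length_singleton] at h1
        rw [homPart, mul_ite, mul_zero]
        exact if_congr (by omega) rfl rfl
      · rw [Ass.X, if_neg hr, zero_mul, zero_mul, ite_self]
    simp only [Ass.mul, key]
    split_ifs <;> simp
  have h2 : Ass.mul (homPart d a) (Ass.X i) w =
      if w.length = d + 1 then Ass.mul a (Ass.X i) w else 0 := by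
    have key : ∀ r, homPart d a (w.take r) * Ass.X i (w.drop r) =
        if w.length = d + 1 then (a (w.take r) * Ass.X i (w.drop r) : K) else 0 := by
      intro r
      by_cases hr : w.drop r = [i]
      · have h1 : (w.take r).length + (w.drop r).length = w.length := by
          grind
        rw [hr, List.length_singleton] at h1
        rw [homPart, ite_mul, zero_mul]
        exact if_congr (by omega) rfl rfl
      · rw [Ass.X, if_neg hr, mul_zero, mul_zero, ite_self]
    simp only [Ass.mul, key]
    split_ifs <;> simp
  rw [brk, brk, Pi.sub_apply, Pi.sub_apply, h1, h2]
  split_ifs <;> simp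

theorem sum_brk_treePiece [CharZero K] (y : Piece n m e K) :
    ∑ i, brk (Ass.X i) (treePiece n m e K y i) = 0 := by
  refine treePiece_induction (P := fun a => ∑ i, brk (Ass.X i) (a i) = 0) ?_ ?_ ?_ ?_ y
  · refine sum_eq_zero fun i _ => ?_
    have := Ass.brk_smul K (0 : K) (Ass.X i) (0 : Ass n K)
    simpa using this
  · intro a b ha hb
    simp only [Pi.add_apply, Ass.brk_add, sum_add_distrib, ha, hb, add_zero]
  · intro c a ha
    simp only [Pi.smul_apply, Ass.brk_smul, ← smul_sum, ha, smul_zero]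
  · intro Γ i x x' s z ε _ _
    simp only [← toAss_X, ← toAss_brk, ← map_sum]
    convert map_zero (toAss (n := n) (K := K))
    have h1 := sum_comp_rr_dl (fun j => (adl (wd [j]) : NCP n K →ₗ[K] NCP n K)) s (lieW z)
    have h2 := sum_comp_rr_dl (fun j => (adl (wd [j]) : NCP n K →ₗ[K] NCP n K)) z (lieW s)
    rw [rr_ad] at h1 h2
    simp only [adl_apply] at h1 h2
    simp only [lie_add, sum_add_distrib, h1, h2]
    rw [← lie_skew]
    abel

theorem psi_mem_sder [CharZero K] (x : ICG n K) : psi n K x ∈ sder n K := by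
  refine ⟨fun k => ⟨fun d => ?_, ?_⟩, ?_⟩
  · rcases d with _ | m
    · have : homPart 0 (psi n K x k) = 0 := by
        funext w
        unfold homPart
        split_ifs with hw
        · rw [List.length_eq_zero_iff.1 hw]
          exact psi_nil x k
        · rfl
      rw [this]
      exact .zero
    · rw [homPart_psi x k rfl]
      refine treePiece_induction (P := fun a => Ass.IsLiePoly (a k)) .zero
        (fun a b ha hb => ha.add hb) (fun c a ha => ha.smul c) ?_ _
      intro Γ i y y' s z ε _ _
      change Ass.IsLiePoly (toAss (_ + _))
      rw [map_add]
      exact (isLiePoly_rr_dl k s (isLiePoly_lieW z)).add (isLiePoly_rr_dl k z (isLiePoly_lieW s))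
  · rw [psi_apply x k (m := 0) (e := 1) rfl rfl]
    refine treePiece_induction (P := fun a => a k [k] = 0) rfl
      (fun a b ha hb => by rw [Pi.add_apply, Pi.add_apply, ha, hb, add_zero])
      (fun c a ha => by rw [Pi.smul_apply, Pi.smul_apply, ha, smul_zero]) ?_ _
    rintro Γ i (a | v) (b | v) s z ε _ ⟨A, M, h1, h2, h3, -, -⟩
    · obtain ⟨-, rfl⟩ := h2.inl_inv
      obtain ⟨-, rfl⟩ := h3.inl_inv
      have hab : a ≠ b := by
        rintro rfl
        exact Γ.2.loopless i (by rw [h1]; simp)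
      have hba := hab.symm
      simp only [rr_of, dl, lieW_of]
      split_ifs <;> simp_all [toAss_wd]
    · exact v.elim0
    · exact v.elim0
    · exact v.elim0
  · funext w
    rcases w with _ | ⟨j, w⟩
    · simp [brk, Ass.mul, Ass.X]
    · rcases w with _ | ⟨l, w⟩
      · simp [brk, Ass.mul, Ass.X, sum_range_succ, psi_nil]
      · have h1 := congrFun (sum_brk_treePiece (x (w.length) (2 * w.length + 1))) (j :: l :: w)
        rw [← h1, Finset.sum_apply, Finset.sum_apply]
        refine sum_congr rfl fun i _ => ?_
        rw [← homPart_psi x i rfl, brk_X_homPart, if_pos (by simp)]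

/-! #### The kernel consists of coboundaries -/

theorem psi_eq_zero_of_mem_B₁ [CharZero K] (hx : x ∈ B₁ n K 0 0) : psi n K x = 0 := by
  obtain ⟨y, hy, rfl⟩ := hx
  have key : ∀ m e, treePiece n m e K (dLoop n K 0 y m e) = 0 := by
    intro m e
    rcases m with _ | m
    · exact map_zero _
    rcases e with _ | e
    · exact map_zero _
    change treePiece n (m + 1) (e + 1) K (dPiece n m e K _ (y m e)) = 0
    by_cases he : e = 2 * m + 2
    · have h1 := hy.1 m e
      generalize y m e = z at h1
      induction h1 using span_induction with
      | zero => simp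
      | add a b _ _ ha hb => rw [map_add, map_add, ha, hb, add_zero]
      | smul c a _ ha => rw [map_smul, map_smul, ha, smul_zero]
      | mem a ha =>
        obtain ⟨Γ, h0, rfl⟩ := ha
        change treePiece n (m + 1) (e + 1) K ((Rel n (m + 1) (e + 1) K).mkQ
          (dFree n m e K _ (Finsupp.single Γ 1))) = 0
        obtain ⟨w, hw4, hw3⟩ := Γ.2.exists_four (by omega)
        obtain ⟨p, q, a, b, hw⟩ := exists_quad hw4
        rw [dFree_single, mk_splitSum K (by omega) hw]
        exact hw.sum_induction (P := fun z => treePiece n (m + 1) (e + 1) K z = 0) (map_zero _)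
          fun hw hI => hw.treePiece_sum Γ.2.loopless hw3 hI h0 he
    · rw [hy.2 m e (by push_cast; omega), map_zero, map_zero]
  funext k w
  exact congrFun (congrFun (key _ _) k) w

theorem mem_B₁_of_psi_eq_zero [CharZero K] (hx : x ∈ Z₁ n K 0 0)
    (h : psi n K x = 0) : x ∈ B₁ n K 0 0 := by
  rw [mem_B₁_iff]
  intro m e
  by_cases he : e = 2 * m + 1
  · refine mem_bdPiece_of_treePiece he (hx.1.1 m e) ?_
    funext k w
    by_cases hw : w.length = m + 1
    · rw [← psi_apply x k hw he, h]
    · exact treePiece_isHomog _ k hw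
  · rw [hx.1.2 m e (by push_cast; omega)]
    exact zero_mem _

end

section

/-! ### Every special derivation comes from trees -/

variable {a : Fin n → Ass n K}

/-- The tree with a root edge at the external vertex `i` and the internal vertices `0, …, m - 1` in
a row; the vertex `t` carries a leg at `u t`, and the row ends at `u m`. The edges are in the order
in which they are read from the root. -/
def combGraph (i : Fin n) (u : Fin (m + 1) → Fin n) : EdgeSeq n m e := fun h =>
  let x : Vtx n m := if ht : (h : ℕ) / 2 < m then inr ⟨h / 2, ht⟩ else inl (u (Fin.last m))
  if (h : ℕ) % 2 = 0 then
    s(if ht : (h : ℕ) / 2 - 1 < m ∧ (h : ℕ) ≠ 0 then inr ⟨h / 2 - 1, ht.1⟩ else inl i, x)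
  else s(x, inl (u (Fin.ofNat (m + 1) (h / 2))))

theorem combGraph_tri (i : Fin n) (u : Fin (m + 1) → Fin n) (he : e = 2 * m + 1) (t : ℕ)
    (ht : t < m) : Tri (combGraph i u : EdgeSeq n m e) ⟨t, ht⟩ ⟨2 * t, by omega⟩
    ⟨2 * t + 1, by omega⟩ ⟨2 * t + 2, by omega⟩ := by
  refine ⟨by simp, by simp, by simp, fun h => ?_⟩
  obtain ⟨h, hh⟩ := h
  simp only [combGraph, Fin.mk.injEq]
  obtain ⟨r, rfl | rfl⟩ : ∃ r, h = 2 * r ∨ h = 2 * r + 1 := ⟨h / 2, by omega⟩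
  · have e1 : 2 * r / 2 = r := by omega
    have e2 : 2 * r % 2 = 0 := by omega
    simp only [e1, e2, if_true]
    split_ifs <;> simp <;> omega
  · have e1 : (2 * r + 1) / 2 = r := by omega
    have e2 : ¬ (2 * r + 1) % 2 = 0 := by omega
    simp only [e1, e2, if_false]
    split_ifs <;> simp <;> omega

theorem combGraph_branch (i : Fin n) (u : Fin (m + 1) → Fin n) (he : e = 2 * m + 1) (r : ℕ) : ∀
    (t : ℕ) (ht : t + r = m), Branch (combGraph i u : EdgeSeq n m e)
    (if ht : t < m then inr ⟨t, ht⟩ else inl (u (Fin.last m))) ⟨2 * t, by omega⟩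
    (((finRange e).drop (2 * t + 1))) (comb (u ⟨t, by omega⟩) ((ofFn u).drop (t + 1))) := by
  induction r with
  | zero =>
    rintro t rfl
    rw [dif_neg (by simp), List.drop_of_length_le (by simp; omega),
      List.drop_of_length_le (by simp)]
    exact Branch.leaf _ _
  | succ r ih =>
    intro t ht
    have htm : t < m := by omega
    have h1 := ih (t + 1) (by omega)
    rw [dif_pos htm]
    have e1 : (finRange e).drop (2 * t + 1) = ⟨2 * t + 1, by omega⟩ :: ([] ++
        ⟨2 * t + 2, by omega⟩ :: (finRange e).drop (2 * (t + 1) + 1)) := by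
      rw [List.drop_eq_getElem_cons (by simp; omega), nil_append,
        List.drop_eq_getElem_cons (by simp; omega)]
      simp
      rfl
    have e2 : (ofFn u).drop (t + 1) = u ⟨t + 1, by omega⟩ :: (ofFn u).drop (t + 1 + 1) := by
      rw [List.drop_eq_getElem_cons (by simp; omega)]
      simp
    rw [e1, e2]
    refine Branch.node (combGraph_tri i u he t htm) (x := inl (u ⟨t, by omega⟩)) ?_ ?_
      (Branch.leaf _ _) h1
    · simp only [combGraph]
      have e1 : (2 * t + 1) / 2 = t := by omega
      have e2 : ¬ (2 * t + 1) % 2 = 0 := by omega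
      rw [if_neg e2]
      simp only [e1, dif_pos htm]
      congr 4
      ext
      simp
      omega
    · simp only [combGraph]
      grind

theorem listSign_finRange : listSign (finRange e) = 1 := by
  have := listSign_perm (1 : Equiv.Perm (Fin e))
  rw [Equiv.Perm.sign_one, Equiv.Perm.coe_one, List.ofFn_id] at this
  simpa using this

theorem combGraph_full (i : Fin n) (u : Fin (m + 1) → Fin n) (he : e = 2 * m + 1) : ∃ f x, Full
    (combGraph i u : EdgeSeq n m e) f x (inl i) (comb (u 0) ((ofFn u).drop 1)) (.of i) 1 := by
  have h1 : (⟨0, by omega⟩ : Fin e) :: ((finRange e).drop 1 ++ []) = finRange e := by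
    subst he
    rw [List.finRange_succ]
    simp
  refine ⟨⟨0, by omega⟩, _, _, [], ?_, combGraph_branch i u he m 0 (by omega), Branch.leaf _ _,
    ?_, ?_⟩
  · simp only [combGraph]
    simp [Sym2.eq_swap]
  · exact List.Perm.of_eq h1
  · rw [← listSign_finRange (e := e)]
    exact congrArg listSign h1

theorem combGraph_valence (i : Fin n) (u : Fin (m + 1) → Fin n) (he : e = 2 * m + 1)
    (v : Fin m) : valence (combGraph i u : EdgeSeq n m e) (inr v) = 3 :=
  (combGraph_tri i u he v.1 v.2).valence_eq

theorem combGraph_loopless (i : Fin n) (u : Fin (m + 1) → Fin n) (h : m = 0 → u 0 ≠ i)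
    (he : e = 2 * m + 1) (f : Fin e) : ¬ ((combGraph i u : EdgeSeq n m e) f).IsDiag := by
  obtain ⟨f, hf⟩ := f
  obtain ⟨r, rfl | rfl⟩ : ∃ r, f = 2 * r ∨ f = 2 * r + 1 := ⟨f / 2, by omega⟩
  · have e1 : 2 * r / 2 = r := by omega
    have e2 : 2 * r % 2 = 0 := by omega
    simp only [combGraph, e1, e2, if_true, Sym2.mk_isDiag_iff]
    split_ifs with h1 h2 h2
    · simp
      omega
    · simp
    · simp
    · obtain rfl : m = 0 := by omega
      simpa using (h rfl).symm
  · have e1 : (2 * r + 1) / 2 = r := by omega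
    have e2 : ¬ (2 * r + 1) % 2 = 0 := by omega
    simp only [combGraph, e1, e2, if_false, Sym2.mk_isDiag_iff]
    rw [dif_pos (by omega)]
    simp

theorem treePiece_combGraph [CharZero K] (i : Fin n) (u : Fin (m + 1) → Fin n) (h : m = 0 → u 0 ≠ i)
    (he : e = 2 * m + 1) (k : Fin n) : treePiece n m e K (cl K (combGraph i u)) k = toAss (adP
    (anti (pdP k (dynkin (wd (ofFn u))))) (wd [i]) + if i = k then dynkin (wd (ofFn u)) else 0) :=
    by
  obtain ⟨f, x, hF⟩ := combGraph_full i u he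
  have h1 : (lieW (comb (u 0) ((ofFn u).drop 1)) : NCP n K) = dynkin (wd (ofFn u)) := by
    rw [List.ofFn_succ, dynkin_cons]
    rfl
  rw [hF.treePiece_eq (combGraph_loopless i u h he) (combGraph_valence i u he) he, rr_dl, h1,
    rr_of, dl]
  simp only [Int.cast_one, one_smul, lieW_of]
  congr 2
  split_ifs <;> rfl

variable (m e) in
/-- The combination of the trees `combGraph` with the coefficients of a tuple of series. -/
def combSum (a : Fin n → Ass n K) : Piece n m e K :=
  ∑ i, ∑ u : Fin (m + 1) → Fin n, a i (ofFn u) • cl K (combGraph i u)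

theorem trunc_eq (d : ℕ) (a : Ass n K) :
    trunc d a = ∑ u : Fin d → Fin n, a (ofFn u) • wd (ofFn u) := rfl

theorem trunc_mem_span {a : Ass n K} (ha : a ∈ lieSeries n K) (d : ℕ) :
    trunc d a ∈ lieSpan n K := by
  obtain ⟨p, hp, h⟩ := (ha d).exists_span
  rw [← toAss_trunc] at h
  rwa [toAss_injective h]

theorem isHomog_trunc (d : ℕ) (a : Ass n K) : IsHomog d (trunc d a) := by
  intro w hw
  rw [toAss_trunc, homPart, if_neg hw]

theorem sum_lie_trunc (h : ∑ i, brk (Ass.X i) (a i) = 0) (d : ℕ) :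
    ∑ i, ⁅(wd [i] : NCP n K), trunc d (a i)⁆ = 0 := by
  apply toAss_injective
  rw [map_sum, map_zero]
  funext w
  simp only [toAss_brk, toAss_X, toAss_trunc, Finset.sum_apply, brk_X_homPart]
  have h1 := congrFun h w
  rw [Finset.sum_apply] at h1
  split_ifs
  · exact h1
  · simp

theorem treePiece_combSum [CharZero K] (ha : a ∈ sder n K) (he : e = 2 * m + 1) (k : Fin n) :
    treePiece n m e K (combSum m e a) k = ((m + 1) * (m + 2) : K) • homPart (m + 1) (a k) := by
  have hs := fun i => trunc_mem_span (ha.1 i).1 (m + 1)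
  have hd : ∀ i, dynkin (trunc (m + 1) (a i)) = ((m + 1 : ℕ) : K) • trunc (m + 1) (a i) :=
    fun i => dynkin_of_mem_span (hs i) (isHomog_trunc _ _)
  have h1 : ∀ i (u : Fin (m + 1) → Fin n),
      a i (ofFn u) • treePiece n m e K (cl K (combGraph i u)) k =
      toAss (adP (anti (pdP k (dynkin (a i (ofFn u) • wd (ofFn u))))) (wd [i]) +
        if i = k then dynkin (a i (ofFn u) • wd (ofFn u)) else 0) := by
    intro i u
    by_cases hc : m = 0 → u 0 ≠ i
    · rw [treePiece_combGraph i u hc he, ← map_smul, smul_add]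
      simp only [map_smul, LinearMap.smul_apply, smul_ite, smul_zero]
    · push Not at hc
      obtain ⟨rfl, rfl⟩ := hc
      have : a (u 0) (ofFn u) = 0 := by
        rw [← (ha.1 (u 0)).2]
        simp
      rw [this]
      simp
  have h2 : treePiece n m e K (combSum m e a) k =
      toAss (∑ i, (adP (anti (pdP k (dynkin (trunc (m + 1) (a i))))) (wd [i]) +
        if i = k then dynkin (trunc (m + 1) (a i)) else 0)) := by
    simp only [combSum, map_sum, map_smul, Finset.sum_apply, Pi.smul_apply, h1]
    refine sum_congr rfl fun i _ => ?_
    rw [← map_sum, sum_add_distrib, trunc_eq]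
    congr 2
    · simp only [map_sum, LinearMap.sum_apply, map_smul, LinearMap.smul_apply]
    · split_ifs
      · simp only [map_sum, map_smul]
      · simp
  rw [h2, sum_add_distrib, Finset.sum_ite_eq' univ k, if_pos (mem_univ k)]
  simp only [hd, map_smul, LinearMap.smul_apply]
  rw [← smul_sum, sum_reroot_eq_dynkin hs (sum_lie_trunc ha.2 _), hd, smul_smul, ← add_smul,
    map_smul, toAss_trunc]
  congr 1
  push_cast
  ring

theorem cl_mem_span (hv : ∀ v : Fin m, valence Γ (inr v) = 3) {p : ℕ} (hp : 2 * m + 1 - e = p) : cl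
    K Γ ∈ span K
    {y | ∃ Γ : Gph n m e, loops Γ.1 = p ∧ y = (Rel n m e K).mkQ (Finsupp.single Γ 1)} := by
  by_cases h : IsICG Γ
  · exact subset_span ⟨⟨Γ, h⟩, by rw [← hp]; exact loops_of_valence h.loopless hv,
      cl_of K ⟨Γ, h⟩⟩
  · rw [cl_of_not K h]
    exact zero_mem _

theorem exists_psi_eq [CharZero K] (ha : a ∈ sder n K) : ∃ x ∈ Z₁ n K 0 0, psi n K x = a := by
  obtain ⟨x, hx⟩ : ∃ x : ICG n K, ∀ m e, x m e =
      if e = 2 * m + 1 then ((m + 1) * (m + 2) : K)⁻¹ • combSum m e a else 0 :=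
    ⟨fun m e => _, fun m e => rfl⟩
  refine ⟨x, mem_Z₁_of_mem (fun m e => ?_) (fun m e h => (hx m e).trans (if_neg fun hc => h ?_)),
    ?_⟩
  · rw [hx]
    split_ifs with he
    · exact smul_mem _ _ (sum_mem fun i _ => sum_mem fun u _ =>
        smul_mem _ _ (cl_mem_span (combGraph_valence i u he) (by omega)))
    · exact zero_mem _
  · push_cast
    omega
  · funext k w
    rcases hw : w.length with _ | m
    · rw [List.length_eq_zero_iff.1 hw, psi_nil]
      have h1 := (trunc_mem_span (ha.1 k).1 0)
      have h2 := aug_of_mem_span h1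
      change toAss (trunc 0 (a k)) [] = 0 at h2
      rw [toAss_trunc] at h2
      exact h2.symm
    · rw [psi_apply _ k hw rfl, hx, if_pos rfl, map_smul, Pi.smul_apply, treePiece_combSum ha rfl,
        smul_smul, inv_mul_cancel₀, one_smul, homPart, if_pos hw]
      have : ((m + 1) * (m + 2) : ℕ) ≠ 0 := by positivity
      exact_mod_cast this

variable (n K) in
/-- `psi`, as a map from cocycles to special derivations. -/
def psiZ [CharZero K] : Z₁ n K 0 0 →ₗ[K] sder n K :=
  (psi n K ∘ₗ (Z₁ n K 0 0).subtype).codRestrict (sder n K) fun x => psi_mem_sder x.1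

variable (n K) in
/-- The isomorphism between the trees in the first page and special derivations. -/
def Psi [CharZero K] : E₁ n K 0 0 ≃ₗ[K] sder n K :=
  LinearEquiv.ofBijective (Submodule.liftQ _ (psiZ n K) fun x hx =>
      Subtype.ext (psi_eq_zero_of_mem_B₁ (x := x.1) hx)) (by
    constructor
    · refine (injective_iff_map_eq_zero _).2 fun q hq => ?_
      obtain ⟨x, rfl⟩ := mkQ_surjective _ q
      change psiZ n K x = 0 at hq
      exact (Submodule.Quotient.mk_eq_zero _).2
        (mem_B₁_of_psi_eq_zero x.2 (congrArg Subtype.val hq))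
    · rintro ⟨a, ha⟩
      obtain ⟨x, hx, rfl⟩ := exists_psi_eq ha
      exact ⟨Submodule.Quotient.mk ⟨x, hx⟩, rfl⟩)

theorem coe_Psi [CharZero K] (x : Z₁ n K 0 0) :
    (Psi n K (cls₁ n K 0 0 x) : Fin n → Ass n K) = psi n K x := rfl

end

section

/-! ### Gluing two trees -/

variable {m₁ e₁ m₂ e₂ : ℕ} {Γ₁ : EdgeSeq n m₁ e₁} {Γ₂ : EdgeSeq n m₂ e₂}
variable {i g f₁ : Fin e₁} {x y x₁ : Vtx n m₁} {A l₁ : List (Fin e₁)}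
variable {s₁ s₂ : BTree n} {j : Fin n} {f₂ : Fin e₂}
variable {x₂ : Vtx n m₂} {ε₁ ε₂ : ℤ}

theorem listSign_map_strictMono {ι : Fin e₁ → Fin e} (h : StrictMono ι) (l : List (Fin e₁)) :
    listSign (l.map ι) = listSign l := by
  induction l with
  | nil => rfl
  | cons a l ih =>
    rw [List.map_cons, listSign, listSign, ih, List.countP_map]
    congr 2
    refine List.countP_congr fun b _ => ?_
    simp [h.lt_iff_lt]

/-- `Γ₁` is a part of `Γ` whose internal vertices have no further edges in `Γ`; the edges and the
internal vertices are embedded by `ι` and `ν`. -/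
structure IsPart (Γ₁ : EdgeSeq n m₁ e₁) (Γ : EdgeSeq n m e) (ι : Fin e₁ → Fin e)
    (ν : Fin m₁ → Fin m) : Prop where
  mono : StrictMono ι
  inj : Injective ν
  edge : ∀ i, Γ (ι i) = (Γ₁ i).map (Sum.map id ν)
  closed : ∀ v h, inr (ν v) ∈ Γ h → ∃ i, h = ι i

variable {ι : Fin e₁ → Fin e} {ν : Fin m₁ → Fin m}

theorem IsPart.mem_iff (h : IsPart Γ₁ Γ ι ν) (x : Vtx n m₁) (i : Fin e₁) :
    Sum.map id ν x ∈ Γ (ι i) ↔ x ∈ Γ₁ i := by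
  rw [h.edge, Sym2.mem_map]
  have hinj : Injective (Sum.map id ν : Vtx n m₁ → Vtx n m) :=
    Function.injective_id.sumMap h.inj
  exact ⟨fun ⟨a, ha, hx⟩ => hinj hx ▸ ha, fun hx => ⟨x, hx, rfl⟩⟩

theorem IsPart.tri (h : IsPart Γ₁ Γ ι ν) {v : Fin m₁} {f : Fin e₁} (ht : Tri Γ₁ v i f g) :
    Tri Γ (ν v) (ι i) (ι f) (ι g) := by
  have hinj := h.mono.injective
  refine ⟨hinj.ne ht.1, hinj.ne ht.2.1, hinj.ne ht.2.2.1, fun k => ?_⟩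
  constructor
  · intro hk
    obtain ⟨i', rfl⟩ := h.closed v k hk
    have := (ht.2.2.2 i').1 ((h.mem_iff (inr v) i').1 hk)
    simpa [hinj.eq_iff] using this
  · rintro (rfl | rfl | rfl) <;> exact (h.mem_iff (inr v) _).2 ((ht.2.2.2 _).2 (by tauto))

theorem IsPart.edge_eq (h : IsPart Γ₁ Γ ι ν) (hi : Γ₁ i = s(x, y)) :
    Γ (ι i) = s(Sum.map id ν x, Sum.map id ν y) := by
  rw [h.edge, hi, Sym2.map_mk]

theorem IsPart.branch (h : IsPart Γ₁ Γ ι ν) (hb : Branch Γ₁ x i A s) :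
    Branch Γ (Sum.map id ν x) (ι i) (A.map ι) s := by
  induction hb with
  | leaf k i => exact Branch.leaf k _
  | node hv hf hg h1 h2 ih1 ih2 =>
    simp only [List.map_cons, List.map_append]
    exact Branch.node (h.tri hv) (h.edge_eq hf) (h.edge_eq hg) ih1 ih2

theorem IsPart.valence (h : IsPart Γ₁ Γ ι ν) (v : Fin m₁) :
    valence Γ (inr (ν v)) = valence Γ₁ (inr v) := by
  symm
  refine Finset.card_bij (fun i _ => ι i) ?_ (fun _ _ _ _ hab => h.mono.injective hab) ?_
  · intro i hi
    simpa using (h.mem_iff (inr v) i).2 (by simpa using hi)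
  · intro k hk
    obtain ⟨i, rfl⟩ := h.closed v k (by simpa using hk)
    exact ⟨i, by simpa using (h.mem_iff (inr v) i).1 (by simpa using hk), rfl⟩

/-- If an external vertex is split along edges of one part only, then the result is not connected
unless this part is everything. -/
theorem IsPart.eq_of_split (h : IsPart Γ₁ Γ ι ν) (hI : IsICG (split Γ (inl j) S))
    (hS : ∀ i ∈ S, ∃ i', i = ι i') (k : Fin e) : ∃ i, k = ι i := by
  obtain ⟨h₀⟩ := hI.connected.preconnected (Fin.last e) k.castSucc
  let U : Fin (e + 1) → Prop := fun k => ∀ k' : Fin e, k = k'.castSucc → ∃ i, k' = ι i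
  have key : ∀ (a b : Fin (e + 1)) (v : Fin (m + 1)), inr v ∈ split Γ (inl j) S a →
      inr v ∈ split Γ (inl j) S b → U a → U b := by
    rintro a b v ha hb hU k rfl
    induction v using Fin.lastCases with
    | last => exact hS k (mem_split_newV.1 hb).2
    | cast v =>
      have hb' := (mem_split_castSucc (v := inr v) (by simp) k).1 hb
      induction a using Fin.lastCases with
      | last =>
        rw [mem_split_last] at ha
        rcases ha with ha | ha
        · cases ha
        · exact absurd ha (up_ne_newV (inr v))
      | cast a =>
        obtain ⟨i, rfl⟩ := hU a rfl
        have ha' := (mem_split_castSucc (v := inr v) (by simp) _).1 ha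
        rw [h.edge, Sym2.mem_map] at ha'
        obtain ⟨x | x, -, hx⟩ := ha'
        · cases hx
        · obtain rfl := inr.inj hx
          exact h.closed _ _ hb'
  have hU : ∀ {a b : Fin (e + 1)}, (SimpleGraph.fromRel fun i k : Fin (e + 1) =>
      ∃ v : Fin (m + 1), inr v ∈ split Γ (inl j) S i ∧
        inr v ∈ split Γ (inl j) S k).Walk a b → U a → U b := by
    intro a b w
    induction w with
    | nil => exact id
    | cons hab _ ih =>
      intro ha
      refine ih ?_
      rw [SimpleGraph.fromRel_adj] at hab
      grind
  exact hU h₀ (fun k' hk' => absurd hk'.symm (Fin.castSucc_ne_last _)) k rfl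

theorem glue_isPart_left (hm : m₁ + m₂ = m) (he : e₁ + e₂ = e) : IsPart Γ₁ (glue hm he Γ₁ Γ₂)
    (fun i => Fin.cast he (Fin.castAdd e₂ i)) (fun v => Fin.cast hm (Fin.castAdd m₂ v)) := by
  subst hm he
  have h1 : ∀ i, glue rfl rfl Γ₁ Γ₂ (Fin.castAdd e₂ i) =
      (Γ₁ i).map (Sum.map id (Fin.castAdd m₂)) := fun i => by simp [glue]
  have h2 : ∀ i, glue rfl rfl Γ₁ Γ₂ (Fin.natAdd e₁ i) =
      (Γ₂ i).map (Sum.map id (Fin.natAdd m₁)) := fun i => by simp [glue]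
  refine ⟨fun a b h => h, fun a b h => Fin.castAdd_injective _ _ h, h1, fun v h hv => ?_⟩
  induction h using Fin.addCases with
  | left i => exact ⟨i, rfl⟩
  | right i =>
    rw [h2, Sym2.mem_map] at hv
    obtain ⟨x | x, -, hx⟩ := hv
    · cases hx
    · have := congrArg Fin.val (inr.inj hx)
      simp at this
      omega

theorem glue_isPart_right (hm : m₁ + m₂ = m) (he : e₁ + e₂ = e) : IsPart Γ₂ (glue hm he Γ₁ Γ₂)
    (fun i => Fin.cast he (Fin.natAdd e₁ i)) (fun v => Fin.cast hm (Fin.natAdd m₁ v)) := by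
  subst hm he
  have h1 : ∀ i, glue rfl rfl Γ₁ Γ₂ (Fin.castAdd e₂ i) =
      (Γ₁ i).map (Sum.map id (Fin.castAdd m₂)) := fun i => by simp [glue]
  have h2 : ∀ i, glue rfl rfl Γ₁ Γ₂ (Fin.natAdd e₁ i) =
      (Γ₂ i).map (Sum.map id (Fin.natAdd m₁)) := fun i => by simp [glue]
  refine ⟨fun a b h => by simpa using h, fun a b h => Fin.natAdd_injective _ _ h, h2,
    fun v h hv => ?_⟩
  induction h using Fin.addCases with
  | right i => exact ⟨i, rfl⟩
  | left i =>
    rw [h1, Sym2.mem_map] at hv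
    obtain ⟨x | x, -, hx⟩ := hv
    · cases hx
    · have := congrArg Fin.val (inr.inj hx)
      simp at this
      omega

/-- The data of two complementary parts with an external vertex each edge order of the first before
the second. -/
structure IsGlue (Γ₁ : EdgeSeq n m₁ e₁) (Γ₂ : EdgeSeq n m₂ e₂) (Γ : EdgeSeq n m e)
    (ι₁ : Fin e₁ → Fin e) (ι₂ : Fin e₂ → Fin e) : Prop where
  left : ∃ ν, IsPart Γ₁ Γ ι₁ ν
  right : ∃ ν, IsPart Γ₂ Γ ι₂ ν
  lt : ∀ a b, ι₁ a < ι₂ b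
  cover : ∀ k, (∃ a, k = ι₁ a) ∨ ∃ b, k = ι₂ b
  trivalent : IsTrivalent Γ₁ → IsTrivalent Γ₂ → IsTrivalent Γ

theorem isGlue_glue (hm : m₁ + m₂ = m) (he : e₁ + e₂ = e) :
    ∃ ι₁ ι₂, IsGlue Γ₁ Γ₂ (glue hm he Γ₁ Γ₂) ι₁ ι₂ := by
  have hl := glue_isPart_left (Γ₁ := Γ₁) (Γ₂ := Γ₂) hm he
  have hr := glue_isPart_right (Γ₁ := Γ₁) (Γ₂ := Γ₂) hm he
  subst hm he
  have hc : ∀ k : Fin (e₁ + e₂), (∃ a, k = Fin.castAdd e₂ a) ∨ ∃ b, k = Fin.natAdd e₁ b := by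
    intro k
    induction k using Fin.addCases with
    | left i => exact Or.inl ⟨i, rfl⟩
    | right i => exact Or.inr ⟨i, rfl⟩
  refine ⟨_, _, ⟨_, hl⟩, ⟨_, hr⟩, fun a b => ?_, hc, fun h1 h2 => ⟨fun k => ?_, fun v => ?_⟩⟩
  · change (a : ℕ) < e₁ + b
    omega
  · rcases hc k with ⟨a, rfl⟩ | ⟨b, rfl⟩
    · have := hl.edge a
      rw [show Fin.castAdd e₂ a = Fin.cast rfl (Fin.castAdd e₂ a) from rfl, this,
        Sym2.isDiag_map (Function.injective_id.sumMap hl.inj)]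
      exact h1.1 a
    · have := hr.edge b
      rw [show Fin.natAdd e₁ b = Fin.cast rfl (Fin.natAdd e₁ b) from rfl, this,
        Sym2.isDiag_map (Function.injective_id.sumMap hr.inj)]
      exact h2.1 b
  · induction v using Fin.addCases with
    | left v => exact (hl.valence v).trans (h1.2 v)
    | right v => exact (hr.valence v).trans (h2.2 v)

variable {ι₁ : Fin e₁ → Fin e} {ι₂ : Fin e₂ → Fin e}

theorem listSign_append_of_lt {l' : List (Fin e)} (h : ∀ a ∈ l, ∀ b ∈ l', a < b) :
    listSign (l ++ l') = listSign l * listSign l' := by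
  have : cross l l' = 0 := by
    unfold cross
    refine List.sum_eq_zero fun x hx => ?_
    grind
  rw [listSign_append, this, pow_zero, mul_one]

theorem IsGlue.perm (h : IsGlue Γ₁ Γ₂ Γ ι₁ ι₂) {l₂ : List (Fin e₂)} (h1 : l₁.Perm (finRange e₁))
    (h2 : l₂.Perm (finRange e₂)) : (l₁.map ι₁ ++ l₂.map ι₂).Perm (finRange e) := by
  obtain ⟨ν₁, hl⟩ := h.left
  obtain ⟨ν₂, hr⟩ := h.right
  rw [List.perm_ext_iff_of_nodup _ (nodup_finRange e)]
  · intro k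
    simp only [List.mem_append, List.mem_map, mem_finRange, iff_true]
    rcases h.cover k with ⟨a, rfl⟩ | ⟨b, rfl⟩
    · exact Or.inl ⟨a, h1.mem_iff.2 (mem_finRange a), rfl⟩
    · exact Or.inr ⟨b, h2.mem_iff.2 (mem_finRange b), rfl⟩
  · rw [nodup_append']
    refine ⟨(h1.nodup_iff.2 (nodup_finRange _)).map hl.mono.injective,
      (h2.nodup_iff.2 (nodup_finRange _)).map hr.mono.injective, ?_⟩
    intro k hk hk'
    obtain ⟨a, -, rfl⟩ := List.mem_map.1 hk
    obtain ⟨b, -, hb⟩ := List.mem_map.1 hk'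
    exact absurd (h.lt a b) (by rw [hb]; exact lt_irrefl _)

/-- Splitting an external vertex along one edge of each tree joins the trees at a new node. -/
theorem IsGlue.full (h : IsGlue Γ₁ Γ₂ Γ ι₁ ι₂) (he₁ : e₁ = 2 * m₁ + 1) (he₂ : e₂ = 2 * m₂ + 1)
    (hl₁ : ¬ (Γ₁ f₁).IsDiag) (hl₂ : ¬ (Γ₂ f₂).IsDiag) (h₁ : Full Γ₁ f₁ x₁ (inl j) s₁ (.of j) ε₁)
    (h₂ : Full Γ₂ f₂ x₂ (inl j) s₂ (.of j) ε₂) : Full (split Γ (inl j) {ι₁ f₁, ι₂ f₂}) (Fin.last e)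
    (inr (Fin.last m)) (inl j) (s₁ * s₂) (.of j) (ε₁ * ε₂) := by
  obtain ⟨ν₁, hl⟩ := h.left
  obtain ⟨ν₂, hr⟩ := h.right
  obtain ⟨A₁, M₁, a1, a2, a3, a4, rfl⟩ := h₁
  obtain ⟨A₂, M₂, b1, b2, b3, b4, rfl⟩ := h₂
  obtain ⟨rfl, -⟩ := a3.inl_inv
  obtain ⟨rfl, -⟩ := b3.inl_inv
  rw [append_nil] at a4 b4
  have hne : ι₁ f₁ ≠ ι₂ f₂ := (h.lt _ _).ne
  have e1 := hl.edge_eq (a1.trans Sym2.eq_swap)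
  have e2 := hr.edge_eq (b1.trans Sym2.eq_swap)
  have hinl : ∀ {k l : ℕ} {ν : Fin k → Fin l} {x : Vtx n k}, x ≠ inl j →
      (Sum.map id ν x : Vtx n l) ≠ inl j := by
    rintro k l ν (x | x) hx <;> simp_all
  have t1 := split_of_mem (u := inl j) (S := {ι₁ f₁, ι₂ f₂}) (by simp) e1
    (hinl fun hc => hl₁ (by rw [a1, hc]; simp))
  have t2 := split_of_mem (u := inl j) (S := {ι₁ f₁, ι₂ f₂}) (by simp) e2
    (hinl fun hc => hl₂ (by rw [b1, hc]; simp))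
  have n1 := List.nodup_cons.1 (a4.nodup_iff.2 (nodup_finRange _))
  have n2 := List.nodup_cons.1 (b4.nodup_iff.2 (nodup_finRange _))
  have c1 := (hl.branch a2).split (S := {ι₁ f₁, ι₂ f₂}) (u := inl j) (by simp) (by
    intro f hf
    obtain ⟨g, hg, rfl⟩ := List.mem_map.1 hf
    simp only [mem_insert, mem_singleton, not_or]
    exact ⟨fun hc => n1.1 (hl.mono.injective hc ▸ hg), (h.lt _ _).ne⟩)
  have c2 := (hr.branch b2).split (S := {ι₁ f₁, ι₂ f₂}) (u := inl j) (by simp) (by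
    intro f hf
    obtain ⟨g, hg, rfl⟩ := List.mem_map.1 hf
    simp only [mem_insert, mem_singleton, not_or]
    exact ⟨(h.lt _ _).ne', fun hc => n2.1 (hr.mono.injective hc ▸ hg)⟩)
  have ht : Tri (split Γ (inl j) {ι₁ f₁, ι₂ f₂}) (Fin.last m) (Fin.last e)
      (ι₁ f₁).castSucc (ι₂ f₂).castSucc := by
    refine ⟨(Fin.castSucc_ne_last _).symm, (Fin.castSucc_ne_last _).symm, by simpa using hne,
      fun k => ?_⟩
    induction k using Fin.lastCases with
    | last => simp [← newV_def, mem_split_last]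
    | cast k =>
      rw [← newV_def, mem_split_newV]
      simp only [mem_insert, mem_singleton, Fin.castSucc_inj, Fin.castSucc_ne_last, false_or]
      grind
  have hp := h.perm a4 b4
  have hlen := hp.length_eq
  have hlist : ((ι₁ f₁).castSucc :: ((A₁.map ι₁).map Fin.castSucc ++
      (ι₂ f₂).castSucc :: (A₂.map ι₂).map Fin.castSucc)) ++ [] =
      ((f₁ :: A₁).map ι₁ ++ (f₂ :: A₂).map ι₂).map Fin.castSucc := by simp
  refine ⟨_, [], split_last.trans Sym2.eq_swap, Branch.node ht t1 t2 c1 c2, Branch.leaf _ _, ?_, ?_⟩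
  · rw [hlist]
    exact perm_castSucc.2 hp
  · have hcount : (((f₁ :: A₁).map ι₁ ++ (f₂ :: A₂).map ι₂).map Fin.castSucc).countP
        (fun b => b < Fin.last e) = e := by
      rw [List.countP_eq_length.2, List.length_map, hlen, List.length_finRange]
      intro b hb
      obtain ⟨c, -, rfl⟩ := List.mem_map.1 hb
      simp [Fin.castSucc_lt_last]
    -- the new edge is the last one and has to pass `e` edges, an even number
    have hev : Even e := by
      rw [← List.length_finRange (n := e), ← hlen, List.length_append, List.length_map,
        List.length_map, a4.length_eq, b4.length_eq]
      grind
    rw [hlist, listSign, hcount, hev.neg_one_pow, one_mul,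
      listSign_map_strictMono Fin.strictMono_castSucc, listSign_append_of_lt,
      listSign_map_strictMono hl.mono, listSign_map_strictMono hr.mono, append_nil,
      append_nil]
    intro a ha b hb
    obtain ⟨c, -, rfl⟩ := List.mem_map.1 ha
    obtain ⟨d, -, rfl⟩ := List.mem_map.1 hb
    exact h.lt c d

/-- An edge of a tree at an external vertex, as a root. -/
theorem Full.exists_leaf {i : Fin e} {x : Vtx n m} (h : Full Γ i x x' s z ε) (hj : inl j ∈ Γ f) :
    ∃ y t, Full Γ f y (inl j) t (.of j) ε := by
  obtain ⟨y, y', t, u, hF⟩ := h.exists_at f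
  obtain ⟨A, M, h1, h2, h3, -, -⟩ := id hF
  rw [h1, Sym2.mem_iff] at hj
  rcases hj with rfl | rfl
  · obtain ⟨-, rfl⟩ := h2.inl_inv
    exact ⟨_, _, hF.symm⟩
  · obtain ⟨-, rfl⟩ := h3.inl_inv
    exact ⟨_, _, hF⟩

theorem Full.leafVal_eq {x : Vtx n m}
    (h : Full Γ f x (inl j) s (.of j) ε) : leafVal K Γ j f = (ε : K) • toAss (lieW s) := by
  obtain ⟨A, M, h1, h2, h3, h4, rfl⟩ := h
  exact KV.leafVal_eq h1 h2 h3 h4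

/-- The bilinear expression whose sum over the external vertices `j` is the bracket of tangential
derivations. -/
def gluePair (k j : Fin n) (p q : NCP n K) : NCP n K :=
  adP (anti (pdP k q)) ⁅(wd [j] : NCP n K), p⁆ - adP (anti (pdP k p)) ⁅(wd [j] : NCP n K), q⁆ +
    if j = k then ⁅p, q⁆ else 0

/-- The value of the splitting of an external vertex of two glued trees along one edge of each. -/
theorem IsGlue.treePiece_eq [CharZero K] (h : IsGlue Γ₁ Γ₂ Γ ι₁ ι₂) (he₁ : e₁ = 2 * m₁ + 1)
    (he₂ : e₂ = 2 * m₂ + 1) (hm : m₁ + m₂ = m) (he : e₁ + e₂ = e) (ht₁ : IsTrivalent Γ₁)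
    (ht₂ : IsTrivalent Γ₂) (h₁ : Full Γ₁ f₁ x₁ (inl j) s₁ (.of j) ε₁)
    (h₂ : Full Γ₂ f₂ x₂ (inl j) s₂ (.of j) ε₂) (k : Fin n) : treePiece n (m + 1) (e + 1) K
    (cl K (split Γ (inl j) {ι₁ f₁, ι₂ f₂})) k = toAss
    (gluePair k j ((ε₁ : K) • lieW s₁) ((ε₂ : K) • lieW s₂)) := by
  have hF := h.full he₁ he₂ (ht₁.1 _) (ht₂.1 _) h₁ h₂
  have ht := h.trivalent ht₁ ht₂
  have hv : ∀ v : Fin (m + 1), valence (split Γ (inl j) {ι₁ f₁, ι₂ f₂}) (inr v) = 3 := by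
    intro v
    induction v using Fin.lastCases with
    | last =>
      obtain ⟨A, M, -, h2, -, -, -⟩ := id hF
      obtain ⟨_, _, _, _, _, _, _, _, hv, -⟩ := h2.inr_inv
      exact hv.valence_eq
    | cast v =>
      rw [← up_inr, valence_split_of_ne (by simp)]
      exact ht.2 v
  rw [hF.treePiece_eq (split_loopless ht.1) hv (by omega), ← map_smul, gluePair]
  congr 1
  rw [rr_mul, rr_dl, rr_dl, lieW_of, ← lie_skew, map_neg, rr_of, dl, lieW_mul]
  simp only [map_smul, lie_smul, smul_lie, LinearMap.smul_apply, Int.cast_mul]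
  split_ifs
  · rw [LinearMap.id_apply]
    module
  · rw [LinearMap.zero_apply]
    module

/-- Splitting an internal vertex of two glued trees never gives an admissible graph. -/
theorem not_isICG_split_inr (hw : valence Γ (inr w) = 3)
    (hS : ∀ i ∈ S, inr w ∈ Γ i) : ¬ IsICG (split Γ (inr w) S) := by
  intro hI
  have h1 := hI.trivalent w.castSucc
  have h2 := hI.trivalent (Fin.last m)
  rw [← newV_def, valence_split_newV hS] at h2
  rw [← up_inr, valence_eq_sum, Fin.sum_univ_castSucc, if_pos (mem_split_last.2 (Or.inl rfl))] at h1
  simp only [mem_split_self] at h1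
  have h3 : S.card + ∑ i : Fin e, (if inr w ∈ Γ i ∧ i ∉ S then 1 else 0) = 3 := by
    rw [← hw, valence, ← Finset.card_filter_add_card_filter_not (s := univ.filter _) (· ∈ S),
      ← Finset.card_filter, Finset.filter_filter, Finset.filter_filter]
    congr 2
    ext i
    simpa using fun hi => hS i hi
  omega

/-- The trees obtained by splitting two glued trees. -/
theorem IsGlue.mk_splitSum (h : IsGlue Γ₁ Γ₂ Γ ι₁ ι₂) (he₁ : e₁ = 2 * m₁ + 1)
    (he₂ : e₂ = 2 * m₂ + 1) (hm : m₁ + m₂ = m) (he : e₁ + e₂ = e) (ht₁ : IsTrivalent Γ₁)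
    (ht₂ : IsTrivalent Γ₂) : (Rel n (m + 1) (e + 1) K).mkQ (splitSum K (fun Δ => loops Δ = 0) Γ) = ∑
    j, ∑ f₁, ∑ f₂, if inl j ∈ Γ₁ f₁ ∧ inl j ∈ Γ₂ f₂ then cl K (split Γ (inl j) {ι₁ f₁, ι₂ f₂})
    else 0 := by
  classical
  have ht := h.trivalent ht₁ ht₂
  obtain ⟨ν₁, hl⟩ := h.left
  obtain ⟨ν₂, hr⟩ := h.right
  have h0 : ∀ (w : Fin m) S,
      (Rel n (m + 1) (e + 1) K).mkQ (splitTerm K (fun Δ => loops Δ = 0) Γ (inr w) S) = 0 := by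
    intro w S
    rw [mk_splitTerm]
    split_ifs with hc
    · exact cl_of_not K (not_isICG_split_inr (ht.2 w) hc.1)
    · rfl
  simp only [splitSum, map_add, map_smul, map_sum, h0, sum_const_zero, smul_zero, add_zero]
  refine sum_congr rfl fun j _ => ?_
  rw [← Fintype.sum_prod_type' (f := fun f₁ f₂ => if inl j ∈ Γ₁ f₁ ∧ inl j ∈ Γ₂ f₂ then
        cl K (split Γ (inl j) {ι₁ f₁, ι₂ f₂}) else 0)]
  symm
  have hm1 : ∀ i, inl j ∈ Γ (ι₁ i) ↔ inl j ∈ Γ₁ i := fun i => hl.mem_iff (inl j) i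
  have hm2 : ∀ i, inl j ∈ Γ (ι₂ i) ↔ inl j ∈ Γ₂ i := fun i => hr.mem_iff (inl j) i
  refine Finset.sum_of_injOn (fun f => {ι₁ f.1, ι₂ f.2}) ?_ (fun _ _ => mem_univ _) ?_ ?_
  · rintro ⟨a, b⟩ - ⟨a', b'⟩ - hab
    have h1 : ι₁ a ∈ ({ι₁ a', ι₂ b'} : Finset (Fin e)) := by
      grind
    have h2 : ι₂ b ∈ ({ι₁ a', ι₂ b'} : Finset (Fin e)) := by
      grind
    simp only [mem_insert, mem_singleton, (h.lt _ _).ne, (h.lt _ _).ne', or_false, false_or,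
      hl.mono.injective.eq_iff, hr.mono.injective.eq_iff] at h1 h2
    rw [h1, h2]
  · intro S _ hS
    rw [mk_splitTerm]
    split_ifs with hc
    · refine cl_of_not K fun hI => hS ?_
      have h3 : valence (split Γ (inl j) S) newV = 3 :=
        hI.valence_eq_three (by rw [hc.2]; omega) _
      rw [valence_split_newV hc.1] at h3
      obtain ⟨a, b, hab, rfl⟩ := Finset.card_eq_two.1 (show S.card = 2 by omega)
      rcases h.cover a with ⟨a, rfl⟩ | ⟨a, rfl⟩ <;> rcases h.cover b with ⟨b, rfl⟩ | ⟨b, rfl⟩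
      · obtain ⟨i, hi⟩ := hl.eq_of_split hI (by simp) (ι₂ ⟨0, by omega⟩)
        exact absurd hi (h.lt _ _).ne'
      · exact ⟨(a, b), by simp, rfl⟩
      · exact ⟨(b, a), by simp, Finset.pair_comm _ _⟩
      · obtain ⟨i, hi⟩ := hr.eq_of_split hI (by simp) (ι₁ ⟨0, by omega⟩)
        exact absurd hi (h.lt _ _).ne
    · rfl
  · rintro ⟨a, b⟩ -
    rw [mk_splitTerm]
    simp only [mem_insert, mem_singleton, forall_eq_or_imp, forall_eq, hm1, hm2]
    by_cases hc : inl j ∈ Γ₁ a ∧ inl j ∈ Γ₂ b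
    · rw [if_pos hc]
      split_ifs with hP
      · rfl
      · refine cl_of_not K fun hI => hP ⟨hc, ?_⟩
        have hv : ∀ v : Fin (m + 1), valence (split Γ (inl j) {ι₁ a, ι₂ b}) (inr v) = 3 := by
          intro v
          induction v using Fin.lastCases with
          | last =>
            rw [← newV_def, valence_split_newV (by simpa [hm1, hm2] using hc),
              Finset.card_pair (h.lt _ _).ne]
          | cast v => rw [← up_inr, valence_split_of_ne (by simp), ht.2 v]
        have := loops_of_valence hI.loopless hv
        omega
    · rw [if_neg hc, if_neg fun hc' => hc hc'.1]

theorem gluePair_sum {α β : Type*} (s : Finset α) (t : Finset β) (k j : Fin n) (p : α → NCP n K)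
    (q : β → NCP n K) : gluePair k j (∑ a ∈ s, p a) (∑ b ∈ t, q b) = ∑ a ∈ s, ∑ b ∈ t, gluePair k j
    (p a) (q b) := by
  let T : NCP n K →ₗ[K] NCP n K →ₗ[K] NCP n K := LinearMap.mk₂ K (gluePair k j)
    (fun a b c => by
      simp only [gluePair, lie_add, add_lie, map_add, LinearMap.add_apply]
      split_ifs <;> module)
    (fun r a b => by
      simp only [gluePair, lie_smul, smul_lie, map_smul, LinearMap.smul_apply]
      split_ifs <;> module)
    (fun a b c => by
      simp only [gluePair, lie_add, map_add, LinearMap.add_apply]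
      split_ifs <;> module)
    (fun r a b => by
      simp only [gluePair, lie_smul, map_smul, LinearMap.smul_apply]
      split_ifs <;> module)
  change T _ _ = ∑ a ∈ s, ∑ b ∈ t, T _ _
  simp only [map_sum, LinearMap.sum_apply]
  exact sum_comm

/-- A derivation acts on the tuple of a tree by replacing its leaves. -/
theorem sum_adP_eq_der (y : Fin n → NCP n K) (k : Fin n) (s z : BTree n) : ∑ j, adP
    (anti (pdP k (rr (dl j) s (lieW z) + rr (dl j) z (lieW s)))) (y j) = der y
    (rr (dl k) s (lieW z) + rr (dl k) z (lieW s)) := by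
  have h := fun s z => (sum_comp_rr_dl (fun j => (LinearMap.applyₗ (y j) ∘ₗ adP.toLinearMap) ∘ₗ
    anti ∘ₗ pdP k) s (lieW z)).trans (rr_der y k s z)
  have h' := congrArg₂ (· + ·) (h s z) (h z s)
  simp only [← sum_add_distrib] at h'
  refine Eq.trans (sum_congr rfl fun j _ => ?_) (h'.trans ?_)
  · simp
  · rw [map_add]
    abel

/-- The pairing of two trees is the bracket of the corresponding derivations. -/
theorem IsGlue.treePiece_mk_splitSum [CharZero K] (h : IsGlue Γ₁ Γ₂ Γ ι₁ ι₂) (hI₁ : IsICG Γ₁)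
    (hI₂ : IsICG Γ₂) (hl₁ : loops Γ₁ = 0) (hl₂ : loops Γ₂ = 0) (he₁ : e₁ = 2 * m₁ + 1)
    (he₂ : e₂ = 2 * m₂ + 1) (hm : m₁ + m₂ = m) (he : e₁ + e₂ = e) : treePiece n (m + 1) (e + 1) K
    ((Rel n (m + 1) (e + 1) K).mkQ (splitSum K (fun Δ => loops Δ = 0) Γ)) = tderBracket
    (treeWord K Γ₁) (treeWord K Γ₂) :=
    by
  have key : ∀ {m e : ℕ} {Γ : EdgeSeq n m e}, IsICG Γ → loops Γ = 0 → e = 2 * m + 1 →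
      (∃ (A : Fin n → NCP n K), (∀ k, treeWord K Γ k = toAss (A k)) ∧
        ∀ (y : Fin n → NCP n K) k, ∑ j, adP (anti (pdP k (A j))) (y j) = der y (A k)) ∧
      ∃ a : Fin n → Fin e → NCP n K, ∀ j f, toAss (a j f) = leafVal K Γ j f ∧
        (inl j ∉ Γ f → a j f = 0) ∧ (inl j ∈ Γ f → ∃ x s ε,
          Full Γ f x (inl j) s (.of j) ε ∧ a j f = (ε : K) • lieW s) := by
    intro m e Γ hI hl he
    obtain ⟨x, x', s, z, ε, hF⟩ := hI.exists_full hl he ⟨0, by omega⟩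
    refine ⟨⟨fun k => (ε : K) • (rr (dl k) s (lieW z) + rr (dl k) z (lieW s)), fun k => ?_,
      fun y k => ?_⟩, ?_⟩
    · rw [hF.treeWord_eq (hI.loopless _), map_smul]
    · rw [map_smul, ← sum_adP_eq_der, smul_sum]
      exact sum_congr rfl fun j _ => by simp only [map_smul, LinearMap.smul_apply]
    · have : ∀ j f, ∃ a : NCP n K, toAss a = leafVal K Γ j f ∧
          (inl j ∉ Γ f → a = 0) ∧ (inl j ∈ Γ f → ∃ x s ε,
          Full Γ f x (inl j) s (.of j) ε ∧ a = (ε : K) • lieW s) := by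
        intro j f
        by_cases hj : inl j ∈ Γ f
        · obtain ⟨y, t, hG⟩ := hF.exists_leaf hj
          exact ⟨_, by rw [hG.leafVal_eq, map_smul], fun hc => absurd hj hc,
            fun _ => ⟨_, _, _, hG, rfl⟩⟩
        · exact ⟨0, by rw [leafVal_of_notMem hj, map_zero], fun _ => rfl, fun hc => absurd hc hj⟩
      choose a ha using this
      exact ⟨a, ha⟩
  obtain ⟨⟨A, hA, hA'⟩, a, ha⟩ := key hI₁ hl₁ he₁
  obtain ⟨⟨B, hB, hB'⟩, b, hb⟩ := key hI₂ hl₂ he₂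
  have ht₁ : IsTrivalent Γ₁ := ⟨hI₁.loopless, fun v => hI₁.valence_eq_three (by omega) v⟩
  have ht₂ : IsTrivalent Γ₂ := ⟨hI₂.loopless, fun v => hI₂.valence_eq_three (by omega) v⟩
  have hAs : ∀ j, A j = ∑ f, a j f := fun j => toAss_injective (by
    rw [← hA, treeWord_eq_sum, map_sum]
    exact sum_congr rfl fun f _ => (ha j f).1.symm)
  have hBs : ∀ j, B j = ∑ f, b j f := fun j => toAss_injective (by
    rw [← hB, treeWord_eq_sum, map_sum]
    exact sum_congr rfl fun f _ => (hb j f).1.symm)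
  funext k
  have h1 : treePiece n (m + 1) (e + 1) K ((Rel n (m + 1) (e + 1) K).mkQ
      (splitSum K (fun Δ => loops Δ = 0) Γ)) k = toAss (∑ j, gluePair k j (A j) (B j)) := by
    rw [h.mk_splitSum he₁ he₂ hm he ht₁ ht₂]
    simp only [map_sum, Finset.sum_apply]
    refine sum_congr rfl fun j _ => ?_
    rw [hAs, hBs, gluePair_sum, map_sum]
    refine sum_congr rfl fun f _ => ?_
    rw [map_sum]
    refine sum_congr rfl fun g _ => ?_
    split_ifs with hc
    · obtain ⟨x, s, ε, hF, h5⟩ := (ha j f).2.2 hc.1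
      obtain ⟨x', s', ε', hF', h6⟩ := (hb j g).2.2 hc.2
      rw [h.treePiece_eq he₁ he₂ hm he ht₁ ht₂ hF hF', h5, h6]
    · rw [map_zero, Pi.zero_apply]
      by_cases h7 : inl j ∈ Γ₁ f
      · rw [(hb j g).2.1 fun h8 => hc ⟨h7, h8⟩]
        simp [gluePair]
      · rw [(ha j f).2.1 h7]
        simp [gluePair]
  -- summed over all letters, the pairing is the bracket by `sum_adP_eq_der`
  rw [h1, tderBracket]
  have h2 : treeWord K Γ₁ = fun k => toAss (A k) := funext hA
  have h3 : treeWord K Γ₂ = fun k => toAss (B k) := funext hB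
  rw [h2, h3, act_toAss, act_toAss, ← toAss_brk, ← map_sub, ← map_add, ← hA', ← hB']
  simp only [gluePair, sum_add_distrib, sum_sub_distrib]
  simp

end

section

variable {D : ℕ} {a a' b b' : Ass n K} {w : List (Fin n)} {c c' : FormalSum n K}

theorem Ass.brk_anti (a b : Ass n K) : brk a b = -brk b a := by
  rw [brk, brk, neg_sub]

theorem Ass.act_add_left (a b : Fin n → Ass n K) (c : Ass n K) :
    act (a + b) c = act a c + act b c := by
  funext w
  simp only [act, Pi.add_apply, Ass.brk_add, _root_.mul_add, sum_add_distrib]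

theorem Ass.act_smul_left (r : K) (a : Fin n → Ass n K) (c : Ass n K) :
    act (r • a) c = r • act a c := by
  funext w
  simp only [act, Pi.smul_apply, Ass.brk_smul, smul_eq_mul, mul_sum, mul_left_comm]

/-- The bracket of tangential derivations as a bilinear map. -/
def tderBracketL (n : ℕ) (K : Type*) [Field K] :
    (Fin n → Ass n K) →ₗ[K] (Fin n → Ass n K) →ₗ[K] (Fin n → Ass n K) :=
  LinearMap.mk₂ K tderBracket (fun a b c => by
      funext k
      simp only [tderBracket, Pi.add_apply, Ass.act_add_left, Ass.act_add_right]
      rw [Ass.brk_anti (a k + b k), Ass.brk_anti (a k), Ass.brk_anti (b k), Ass.brk_add]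
      abel)
    (fun r a b => by
      funext k
      simp only [tderBracket, Pi.smul_apply, Ass.act_smul_left, Ass.act_smul_right]
      rw [Ass.brk_anti (r • a k), Ass.brk_anti (a k), Ass.brk_smul]
      module)
    (fun a b c => by
      funext k
      simp only [tderBracket, Pi.add_apply, Ass.act_add_left, Ass.act_add_right, Ass.brk_add]
      abel)
    (fun r a b => by
      funext k
      simp only [tderBracket, Pi.smul_apply, Ass.act_smul_left, Ass.act_smul_right, Ass.brk_smul]
      module)

theorem Ass.mul_congr (ha : ∀ w, w.length ≤ D → a w = a' w) (hb : ∀ w, w.length ≤ D → b w = b' w)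
    (hw : w.length ≤ D) : Ass.mul a b w = Ass.mul a' b' w :=
  sum_congr rfl fun i _ => by
    grind

theorem Ass.brk_congr (ha : ∀ w, w.length ≤ D → a w = a' w) (hb : ∀ w, w.length ≤ D → b w = b' w)
    (hw : w.length ≤ D) : brk a b w = brk a' b' w :=
  congrArg₂ (· - ·) (Ass.mul_congr ha hb hw) (Ass.mul_congr hb ha hw)

theorem Ass.act_congr {a a' : Fin n → Ass n K} (ha : ∀ k w, w.length ≤ D → a k w = a' k w)
    (hb : ∀ w, w.length ≤ D → b w = b' w) (hw : w.length ≤ D) : act a b w = act a' b' w := by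
  refine sum_congr rfl fun s hs => sum_congr rfl fun t ht => sum_congr rfl fun i _ => ?_
  rw [mem_range] at hs ht
  rw [Ass.brk_congr (fun _ _ => rfl) (ha i) (by simp; omega)]
  rcases t with _ | t
  · simp [brk, Ass.mul, mul_comm]
  · rw [hb _ (by simp; omega)]

/-- A coefficient of the bracket depends only on the coefficients of words which are not longer. -/
theorem tderBracket_congr {a a' b b' : Fin n → Ass n K} (ha : ∀ k w, w.length ≤ D → a k w = a' k w)
    (hb : ∀ k w, w.length ≤ D → b k w = b' k w) (k : Fin n) (hw : w.length ≤ D) : tderBracket a b k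
    w = tderBracket a' b' k w := by
  simp only [tderBracket, Pi.add_apply, Pi.sub_apply]
  rw [Ass.act_congr ha (hb k) hw, Ass.act_congr hb (ha k) hw, Ass.brk_congr (ha k) (hb k) hw]

theorem isTreeSeries_ihara (hc : IsTreeSeries c) (hc' : IsTreeSeries c') :
    IsTreeSeries (ihara K c c') := by
  intro m e
  rcases m with _ | m
  · exact fun Γ h => absurd rfl h
  rcases e with _ | e
  · exact fun Γ h => absurd rfl h
  have h : ihara K c c' (m + 1) (e + 1) ∈
      Finsupp.supported K K {Γ | loops Γ.1 = 0 ∧ e + 1 = 2 * (m + 1) + 1} := by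
    refine sum_mem fun p _ => sum_mem fun q _ =>
      sum_mem fun Γ₁ h₁ => sum_mem fun Γ₂ h₂ => smul_mem _ _ ?_
    have h1 := hc _ _ Γ₁ (by simpa using h₁)
    have h2 := hc' _ _ Γ₂ (by simpa using h₂)
    have h3 := mem_antidiagonal.1 p.2
    have h4 := mem_antidiagonal.1 q.2
    have key : ∀ v S, splitTerm K (fun Δ => loops Δ = loops Γ₁.1 + loops Γ₂.1)
        (glue h3 h4 Γ₁.1 Γ₂.1) v S ∈
        Finsupp.supported K K {Γ | loops Γ.1 = 0 ∧ e + 1 = 2 * (m + 1) + 1} := by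
      intro v S
      unfold splitTerm
      split_ifs with hP
      · exact Finsupp.single_mem_supported K _ ⟨by rw [hP.2.2]; omega, by omega⟩
      · exact zero_mem _
    exact add_mem (sum_mem fun j _ => sum_mem fun S _ => key _ _)
      (smul_mem _ _ (sum_mem fun j _ => sum_mem fun S _ => key _ _))
  intro Γ hΓ
  exact (Finsupp.mem_supported K _).1 h (by simpa using hΓ)

theorem IsTreeSeries.treePiece_toICG (hc : IsTreeSeries c) (m e : ℕ) :
    treePiece n m e K (toICG n K c m e) = (c m e).sum fun Γ a => a • treeWord K Γ.1 := by
  refine (treePiece_mk _).trans (sum_congr rfl fun Γ hΓ => ?_)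
  exact congrArg (_ • ·) (if_pos (hc _ _ Γ (by simpa using hΓ)))

variable [CharZero K]

/-- The part of the graph bracket with `m + 1` internal vertices collects the brackets of the parts
with `m₁ + m₂ = m` internal vertices. -/
theorem treePiece_ihara (hc : IsTreeSeries c) (hc' : IsTreeSeries c') (m : ℕ) : treePiece n (m + 1)
    (2 * m + 2 + 1) K (toICG n K (ihara K c c') (m + 1) (2 * m + 2 + 1)) = ∑ p ∈ antidiagonal m,
    tderBracket (treePiece n p.1 (2 * p.1 + 1) K (toICG n K c p.1 (2 * p.1 + 1)))
    (treePiece n p.2 (2 * p.2 + 1) K (toICG n K c' p.2 (2 * p.2 + 1))) := by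
  rw [← sum_attach]
  change treePiece n _ _ K ((Rel n _ _ K).mkQ (∑ p ∈ _, ∑ q ∈ _, _)) = _
  simp only [map_sum]
  refine sum_congr rfl fun p _ => ?_
  have h : ∀ q : {q // q ∈ antidiagonal (2 * m + 2)},
      treePiece n (m + 1) (2 * m + 2 + 1) K ((Rel n _ _ K).mkQ
        ((c p.1.1 q.1.1).sum fun Γ₁ a => (c' p.1.2 q.1.2).sum fun Γ₂ b =>
        (a * b) • splitSum K (fun Δ => loops Δ = loops Γ₁.1 + loops Γ₂.1)
          (glue (HasAntidiagonal.mem_antidiagonal.1 p.2) (HasAntidiagonal.mem_antidiagonal.1 q.2) Γ₁.1 Γ₂.1))) =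
      tderBracketL n K (treePiece n p.1.1 q.1.1 K (toICG n K c p.1.1 q.1.1))
        (treePiece n p.1.2 q.1.2 K (toICG n K c' p.1.2 q.1.2)) := by
    intro q
    rw [hc.treePiece_toICG, hc'.treePiece_toICG]
    simp only [Finsupp.sum, map_sum, LinearMap.sum_apply, map_smul, LinearMap.smul_apply]
    rw [sum_comm]
    refine sum_congr rfl fun Γ₂ h₂ => ?_
    rw [smul_sum]
    refine sum_congr rfl fun Γ₁ h₁ => ?_
    have h1 := hc _ _ Γ₁ (by simpa using h₁)
    have h2 := hc' _ _ Γ₂ (by simpa using h₂)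
    have hp := HasAntidiagonal.mem_antidiagonal.1 p.2
    have hq := HasAntidiagonal.mem_antidiagonal.1 q.2
    obtain ⟨ι₁, ι₂, hG⟩ := isGlue_glue (Γ₁ := Γ₁.1) (Γ₂ := Γ₂.1) hp hq
    have := hG.treePiece_mk_splitSum (K := K) Γ₁.2 Γ₂.2 h1.1 h2.1 h1.2 h2.2 hp hq
    rw [h1.1, h2.1, mul_comm, mul_smul]
    exact congrArg _ (congrArg _ this)
  have hz : ∀ {c : FormalSum n K}, IsTreeSeries c → ∀ m e, e ≠ 2 * m + 1 →
      treePiece n m e K (toICG n K c m e) = 0 := by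
    intro c hc m e he
    rw [hc.treePiece_toICG]
    refine sum_eq_zero fun Γ hΓ => absurd (hc _ _ Γ (by simpa using hΓ)).2 he
  have hp := mem_antidiagonal.1 p.2
  refine (sum_congr rfl fun q _ => h q).trans ?_
  rw [Finset.sum_attach (antidiagonal (2 * m + 2)) fun q =>
    tderBracketL n K (treePiece n p.1.1 q.1 K (toICG n K c p.1.1 q.1))
        (treePiece n p.1.2 q.2 K (toICG n K c' p.1.2 q.2)),
    Finset.sum_eq_single (2 * p.1.1 + 1, 2 * p.1.2 + 1)]
  · rfl
  -- a tree with `m` internal vertices has `2 * m + 1` edges, so all other terms vanish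
  · rintro ⟨q, q'⟩ hq hne
    rw [HasAntidiagonal.mem_antidiagonal] at hq
    simp only at hq ⊢
    by_cases hq1 : q = 2 * p.1.1 + 1
    · rw [hz hc' _ q' fun hq2 => hne (by rw [hq1, hq2]), map_zero]
    · rw [hz hc _ q hq1, map_zero, LinearMap.zero_apply]
  · exact fun hq => absurd (HasAntidiagonal.mem_antidiagonal.2 (by omega)) hq

/-- The tree part of the graph bracket corresponds to the bracket of tangential derivations. -/
theorem psi_ihara (hc : IsTreeSeries c) (hc' : IsTreeSeries c') : psi n K (toICG n K (ihara K c c'))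
    = tderBracket (psi n K (toICG n K c)) (psi n K (toICG n K c')) := by
  set T : FormalSum n K → ℕ → Fin n → Ass n K := fun c m =>
    treePiece n m (2 * m + 1) K (toICG n K c m (2 * m + 1)) with hT
  -- up to any length, the tuple is a finite sum of homogeneous ones
  have hcut : ∀ c D k w, w.length ≤ D → psi n K (toICG n K c) k w = (∑ m ∈ range D, T c m) k w := by
    intro c D k w hw
    rw [Finset.sum_apply, Finset.sum_apply]
    rcases hl : w.length with _ | l
    · rw [List.length_eq_zero_iff.1 hl, psi_nil]
      exact (sum_eq_zero fun m _ => treePiece_isHomog _ k (by simp)).symm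
    · rw [psi_apply _ k hl rfl, Finset.sum_eq_single l]
      · intro m _ hm
        exact treePiece_isHomog _ k (by omega)
      · exact fun hl' => absurd (mem_range.2 (by omega)) hl'
  -- the bracket of homogeneous tuples is homogeneous
  have hpair : ∀ m₁ m₂ k w, w.length ≠ m₁ + m₂ + 2 → tderBracket (T c m₁) (T c' m₂) k w = 0 := by
    intro m₁ m₂ k w hw
    change tderBracketL n K (T c m₁) (T c' m₂) k w = 0
    simp only [hT, hc.treePiece_toICG, hc'.treePiece_toICG, Finsupp.sum, map_sum, map_smul,
      LinearMap.sum_apply, LinearMap.smul_apply, Finset.sum_apply, Pi.smul_apply]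
    refine sum_eq_zero fun Γ₂ h₂ => ?_
    rw [sum_eq_zero, smul_zero]
    intro Γ₁ h₁
    obtain ⟨ι₁, ι₂, hG⟩ := isGlue_glue (Γ₁ := Γ₁.1) (Γ₂ := Γ₂.1) rfl rfl
    have := hG.treePiece_mk_splitSum (K := K) Γ₁.2 Γ₂.2 (hc _ _ Γ₁ (by simpa using h₁)).1
      (hc' _ _ Γ₂ (by simpa using h₂)).1 rfl rfl rfl rfl
    refine smul_eq_zero_of_right _ ((congrFun (congrFun this k) w).symm.trans ?_)
    exact treePiece_isHomog _ k (by omega)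
  funext k w
  rw [tderBracket_congr (hcut c w.length) (hcut c' w.length) k le_rfl]
  change _ = tderBracketL n K _ _ k w
  simp only [map_sum, LinearMap.sum_apply, Finset.sum_apply]
  rcases hl : w.length with _ | _ | l
  · rw [List.length_eq_zero_iff.1 hl, psi_nil]
    simp
  · rw [psi_apply _ k hl rfl]
    change treePiece n 0 _ K ((Rel n 0 _ K).mkQ 0) k w = _
    rw [map_zero, map_zero]
    exact (sum_eq_zero fun i _ => sum_eq_zero fun j _ => hpair _ _ _ _ (by omega)).symm
  · rw [psi_apply _ k hl rfl]
    refine (congrFun (congrFun (treePiece_ihara hc hc' l) k) w).trans ?_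
    rw [Finset.sum_apply, Finset.sum_apply,
      sum_comm, ← Finset.sum_product' (f := fun i j => (tderBracketL n K) (T c i) (T c' j) k w)]
    refine sum_subset (fun p hp => ?_) fun p _ hp => hpair _ _ _ _ fun hc => hp ?_
    · rw [HasAntidiagonal.mem_antidiagonal] at hp
      rw [mem_product, mem_range, mem_range]
      omega
    · rw [HasAntidiagonal.mem_antidiagonal]
      omega

end

section

/-! ### Cyclic words -/

variable {a q c : Ass n K}

/-- The sum over all cyclic rotations of the argument, which represents a cyclic word without
passing to a quotient. -/
def cyc : Ass n K →ₗ[K] Ass n K where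
  toFun a w := ∑ r ∈ range w.length, a (w.rotate r)
  map_add' a b := by funext w; exact sum_add_distrib
  map_smul' c a := by funext w; exact (mul_sum _ _ _).symm

theorem sum_rotate_add (f : List (Fin n) → K) (w : List (Fin n)) (c : ℕ) :
    ∑ r ∈ range w.length, f (w.rotate (r + c)) = ∑ r ∈ range w.length, f (w.rotate r) := by
  induction c with
  | zero => rfl
  | succ c ih =>
    rw [← ih]
    have h1 := sum_range_succ (fun r => f (w.rotate (r + c))) w.length
    rw [sum_range_succ', ← List.rotate_rotate w w.length c, List.rotate_length, zero_add] at h1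
    grind

theorem cyc_rotate (a : Ass n K) (w : List (Fin n)) (c : ℕ) : cyc a (w.rotate c) = cyc a w := by
  change ∑ r ∈ range (w.rotate c).length, a ((w.rotate c).rotate r) = _
  simp only [List.length_rotate, List.rotate_rotate, add_comm c]
  exact sum_rotate_add a w c

theorem cyc_mul_comm (a b : Ass n K) : cyc (Ass.mul a b) = cyc (Ass.mul b a) := by
  funext w
  have hl : ∀ r, (w.rotate r).length = w.length := fun r => List.length_rotate ..
  change ∑ r ∈ range w.length, ∑ i ∈ range ((w.rotate r).length + 1), _ =
    ∑ r ∈ range w.length, ∑ i ∈ range ((w.rotate r).length + 1), _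
  simp only [hl]
  rw [sum_comm, sum_comm (s := range w.length),
    ← sum_range_reflect (fun i => ∑ r ∈ range w.length, b ((w.rotate r).take i) * _)]
  refine sum_congr rfl fun i hi => ?_
  rw [mem_range] at hi
  have hi' : w.length + 1 - 1 - i = w.length - i := by omega
  rw [hi', ← sum_rotate_add (fun v => b (v.take (w.length - i)) * a (v.drop (w.length - i))) w i]
  refine sum_congr rfl fun r _ => ?_
  have h2 : w.length - i = ((w.rotate r).drop i).length := by simp
  have h3 : w.rotate (r + i) = (w.rotate r).drop i ++ (w.rotate r).take i := by
    rw [← List.rotate_rotate, List.rotate_eq_drop_append_take (by rw [hl]; omega)]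
  grind

theorem cyc_eq_zero_of_mem (h : a ∈ commutators n K) : cyc a = 0 := by
  induction h using span_induction with
  | mem x hx =>
    obtain ⟨a, b, rfl⟩ := hx
    rw [brk, map_sub, cyc_mul_comm, sub_self]
  | zero => exact map_zero _
  | add a b _ _ ha hb => rw [map_add, ha, hb, add_zero]
  | smul c a _ ha => rw [map_smul, ha, smul_zero]

variable (n K) in
/-- Division of the coefficient of each word by its length. -/
def avg : Ass n K →ₗ[K] assPlus n K where
  toFun a := ⟨fun w => a w / w.length, by simp [assPlus]⟩
  map_add' a b := by ext w; exact add_div _ _ _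
  map_smul' c a := by ext w; exact mul_div_assoc _ _ _

theorem mul_X_concat (i j : Fin n) (c : Ass n K) (v : List (Fin n)) :
    Ass.mul c (Ass.X i) (v ++ [j]) = if j = i then c v else 0 := by
  rw [Ass.mul, Finset.sum_eq_single v.length]
  · simp [Ass.X]
  · intro r hr hne
    rw [mem_range, List.length_append, List.length_singleton] at hr
    have : ((v ++ [j]).drop r).length ≠ 1 := by
      grind
    rw [Ass.X, if_neg fun h => this (by rw [h]; rfl), mul_zero]
  · simp

variable [CharZero K]

/-- Every series is congruent to its cyclic average modulo commutators. -/
theorem sub_avg_cyc_mem (hq : q [] = 0) : q - (avg n K (cyc q) : Ass n K) ∈ commutators n K := by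
  let C : Ass n K := fun w =>
    (∑ r ∈ range w.length, ((r + 1 : ℕ) : K) * q (w.rotate (r + 1))) / w.length
  have h : q - (avg n K (cyc q) : Ass n K) = ∑ i, brk (Ass.X i) fun v => C (i :: v) := by
    funext w
    change q w - cyc q w / w.length = _
    rw [Finset.sum_apply]
    rcases List.eq_nil_or_concat' w with rfl | ⟨v, l, hw⟩
    · simp [hq, brk, Ass.mul, Ass.X]
    · have hs : ∑ i, brk (Ass.X i) (fun v => C (i :: v)) w = C w - C (l :: v) := by
        simp only [brk, Pi.sub_apply, sum_sub_distrib]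
        congr 1
        · rcases w with _ | ⟨j, u⟩
          · simp at hw
          · simp only [X_mul_cons, sum_ite_eq, mem_univ, if_true]
        · simp only [hw, mul_X_concat, sum_ite_eq, mem_univ, if_true]
      have hw' : w = (l :: v).rotate 1 := by rw [hw]; simp
      have hlen : w.length = (l :: v).length := by rw [hw', List.length_rotate]
      have h0 : ((l :: v).length : K) ≠ 0 := by simp [Nat.cast_add_one_ne_zero]
      rw [hs]
      simp only [C, hlen]
      rw [← sub_div, eq_div_iff h0, sub_mul, div_mul_cancel₀ _ h0]
      change _ - ∑ r ∈ range w.length, q (w.rotate r) = _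
      rw [hw', List.length_rotate]
      simp only [List.rotate_rotate]
      have h1 := sum_range_succ (fun r : ℕ => (r : K) * q ((l :: v).rotate (1 + r)))
        (l :: v).length
      rw [sum_range_succ', add_comm 1 (l :: v).length, ← List.rotate_rotate (l :: v) (l :: v).length 1,
        List.rotate_length] at h1
      have h2 : ∑ r ∈ range (l :: v).length, ((r + 1 : ℕ) : K) * q ((l :: v).rotate (r + 1)) =
          ∑ r ∈ range (l :: v).length, (r : K) * q ((l :: v).rotate (1 + r)) +
            ∑ r ∈ range (l :: v).length, q ((l :: v).rotate (1 + r)) := by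
        rw [← sum_add_distrib]
        exact sum_congr rfl fun r _ => by rw [add_comm 1 r]; push_cast; ring
      grind
  rw [h]
  exact sum_mem fun i _ => subset_span ⟨_, _, rfl⟩

theorem tr_avg_cyc (q : assPlus n K) : tr n K (avg n K (cyc q)) = tr n K q :=
  (Submodule.Quotient.eq _).2 (by
    rw [← neg_mem_iff, neg_sub]
    exact sub_avg_cyc_mem q.2)

theorem eq_zero_of_tr_avg (hc : ∀ w r, c (w.rotate r) = c w) (h0 : c [] = 0)
    (h : tr n K (avg n K c) = 0) : c = 0 := by
  have h1 := cyc_eq_zero_of_mem ((Submodule.Quotient.mk_eq_zero _).1 h)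
  funext w
  have h2 : ∑ r ∈ range w.length, c (w.rotate r) / (w.rotate r).length = 0 := congrFun h1 w
  simp only [hc, List.length_rotate, sum_const, card_range, nsmul_eq_mul] at h2
  rcases w with _ | ⟨j, w⟩
  · exact h0
  · rwa [mul_div_cancel₀] at h2
    simp [Nat.cast_add_one_ne_zero]

end

section

/-! ### Walks around a loop -/

variable {z : Vtx n m} {k : Fin e}

theorem Spine.append (h : Spine Γ x i y j L Ts) (h' : Spine Γ y j z k L' Us) :
    Spine Γ x i z k (L ++ L') (Ts ++ Us) := by
  induction h with
  | nil => exact h'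
  | cons hv hf hb hg hs ih => simpa [append_assoc] using Spine.cons hv hf hb hg (ih h')

theorem Spine.even (h : Spine Γ x i y j L Ts) : Even L.length := by
  induction h with
  | nil => simp
  | cons hv hf hb hg hs ih =>
    have := hb.even
    grind

theorem Spine.eq_nil_or (h : Spine Γ x i y j L Ts) :
    (L = [] ∧ Ts = [] ∧ x = y ∧ i = j) ∨ ∃ L', L = i :: L' := by
  cases h with
  | nil => exact Or.inl ⟨rfl, rfl, rfl, rfl⟩
  | cons => exact Or.inr ⟨_, rfl⟩

theorem IsRelabel.spine {σ : Equiv.Perm (Fin e)} {τ : Equiv.Perm (Fin m)} (hr : IsRelabel σ τ Γ Γ')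
    (h : Spine Γ x i y j L Ts) : Spine Γ' (vtxEquiv n τ x) (σ⁻¹ i) (vtxEquiv n τ y) (σ⁻¹ j)
    (L.map (σ⁻¹ : Equiv.Perm (Fin e))) Ts := by
  induction h with
  | nil => exact Spine.nil _ _
  | cons hv hf hb hg hs ih =>
    simp only [List.map_cons, List.map_append]
    exact Spine.cons (hr.tri hv) (hr.edge hf) (hr.branch hb) (hr.edge hg) ih

theorem Spine.reverse (h : Spine Γ x i y j L Ts) (hi : Γ i = s(u, x)) : ∃ u' L', Γ j = s(u', y) ∧
    Spine Γ u' j u i L' Ts.reverse ∧ (L' ++ [i]).Perm (L ++ [j]) ∧ ∀ P Q, (P ++ (L ++ j :: Q)).Nodup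
    → listSign (P ++ (L ++ j :: Q)) = (-1) ^ Ts.length * listSign (P ++ (L' ++ i :: Q)) := by
  induction h generalizing u with
  | nil x i => exact ⟨u, [], hi, Spine.nil _ _, List.Perm.refl _, fun P Q _ => by simp⟩
  | @cons v i f g j y z y' A L s Ts hv hf hb hg hs ih =>
    obtain ⟨u', L', h1, h2, h3, h4⟩ := ih hg
    have hstep : Spine Γ (inr v) g u i (g :: f :: (A ++ [])) [s] :=
      Spine.cons hv.rot.rot.swap hf hb (hi.trans Sym2.eq_swap) (Spine.nil _ _)
    refine ⟨u', L' ++ g :: f :: A, h1, by simpa using h2.append hstep, ?_, fun P Q hn => ?_⟩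
    · grind
    · have hp : ∀ (R₁ R₂ : List (Fin e)), R₁.Perm R₂ → (P ++ R₁).Nodup → (P ++ R₂).Nodup :=
        fun R₁ R₂ h hn => (h.append_left P).nodup_iff.1 hn
      have e1 := listSign_swap_even P (i :: f :: A) (L ++ [j]) Q (by simpa using hn)
        (Even.mul_right (by simpa [Nat.even_add_one] using hb.even) _)
      have hn2 : (P ++ (L ++ j :: (i :: f :: A ++ Q))).Nodup := by
        refine hp _ _ ?_ hn
        rw [perm_iff_count]
        grind
      have e2 := h4 P (i :: f :: A ++ Q) hn2
      have hn3 : (P ++ L' ++ ([g] ++ ([i] ++ (f :: A ++ Q)))).Nodup := by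
        rw [append_assoc]
        refine hp _ _ ?_ hn2
        rw [perm_iff_count] at h3 ⊢
        grind
      -- only the root edge changes sides, past a block of odd length
      have e3 := listSign_swap_odd (P ++ L' ++ [g]) [i] (f :: A) Q (by simpa using hn3) (by simp)
        (by simpa using hb.even.add_one)
      simp only [append_assoc, cons_append, nil_append, List.length_cons] at e1 e2 e3 ⊢
      rw [e1, e2, e3, pow_succ]
      ring

/-- An edge met by a walk lies on the walk or in one of the trees hanging off it. -/
theorem Branch.exists_sub (h : Branch Γ x i A s) (hk : k ∈ A) :
    ∃ u u' B t, Γ k = s(u, u') ∧ Branch Γ u' k B t ∧ (k :: B).Sublist A := by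
  induction h with
  | leaf => simp at hk
  | @node v i f g x y A B s t hv hf hg h1 h2 ih1 ih2 =>
    grind

theorem Spine.exists_at (h : Spine Γ x i y j L Ts) (hk : k ∈ L) : (∃ L₁ L₂ Us Vs z, L = L₁ ++ L₂ ∧
    Ts = Us ++ Vs ∧ Spine Γ x i z k L₁ Us ∧ Spine Γ z k y j L₂ Vs) ∨ ∃ u u' B t, Γ k = s(u, u') ∧
    Branch Γ u' k B t ∧ (k :: B).Sublist L := by
  induction h with
  | nil => simp at hk
  | @cons v i f g j y z y' A L s Ts hv hf hb hg hs ih =>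
    rw [List.mem_cons, List.mem_cons, List.mem_append] at hk
    rcases hk with rfl | rfl | hk | hk
    · exact Or.inl ⟨[], _, [], _, _, rfl, rfl, Spine.nil _ _, Spine.cons hv hf hb hg hs⟩
    · grind
    · obtain ⟨u, u', B, t, h1, h2, h3⟩ := hb.exists_sub hk
      grind
    · rcases ih hk with ⟨L₁, L₂, Us, Vs, w, rfl, rfl, h1, h2⟩ | ⟨u, u', B, t, h1, h2, h3⟩
      · exact Or.inl ⟨_, _, _, _, _, by simp, rfl, Spine.cons hv hf hb hg h1, h2⟩
      grind

/-- A walk which enters a tree stays in it. -/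
theorem Branch.mem_of_spine (hb : Branch Γ x i A s) (h : Spine Γ x i y j L Ts) : j ∈ i :: A := by
  induction h generalizing A s with
  | nil => simp
  | @cons v i f g j y z y' B L t Ts hv hf hb' hg hs ih =>
    obtain ⟨f', g', a, b, A₁, A₂, s₁, s₂, hv', hf', hg', b1, b2, rfl, rfl⟩ := hb.inr_inv
    rcases hv.eq_or_eq hv' with ⟨rfl, rfl⟩ | ⟨rfl, rfl⟩
    · rw [← Sym2.other_eq hg hg'] at b2
      grind
    · rw [← Sym2.other_eq hg hf'] at b1
      grind

/-- The graph consists of a loop, which passes through the edge `i` from `x'` to `x`, with the trees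
`Ts` hanging off it; `ε` compares the order of the edges with the order in which they are met. -/
def IsLoop (Γ : EdgeSeq n m e) (i : Fin e) (x x' : Vtx n m) (Ts : List (BTree n))
    (ε : ℤ) : Prop :=
  Γ i = s(x', x) ∧ ∃ L, Spine Γ x i x i L Ts ∧ L.Perm (finRange e) ∧ ε = listSign L

theorem Spine.isLoop (h : Spine Γ x i x i L Ts) (hL : L.Perm (finRange e)) :
    ∃ x', IsLoop Γ i x x' Ts (listSign L) := by
  suffices ∃ x', Γ i = s(x', x) from this.imp fun x' hx => ⟨hx, L, h, hL, rfl⟩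
  cases h with
  | nil => exact absurd (hL.mem_iff.2 (mem_finRange i)) (by simp)
  | cons hv hf hb hg hs =>
    obtain ⟨u', -, h1, -⟩ := hs.reverse hg
    exact ⟨u', h1⟩

theorem IsLoop.reverse (h : IsLoop Γ i x x' Ts ε) :
    IsLoop Γ i x' x Ts.reverse (-(-1) ^ Ts.length * ε) := by
  obtain ⟨h0, L, h1, hL, rfl⟩ := h
  cases id h1 with
  | nil => exact absurd (hL.mem_iff.2 (mem_finRange i)) (by simp)
  | @cons v i f g i y z _ A L s Ts hv hf hb hg hs =>
    obtain ⟨u', L', h2, h3, h4, h5⟩ := hs.reverse hg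
    obtain rfl : x' = u' := by
      grind
    have hstep : Spine Γ (inr v) g x' i (g :: f :: (A ++ [])) [s] :=
      Spine.cons hv.rot.rot.swap hf hb (h0.trans Sym2.eq_swap) (Spine.nil _ _)
    have hn := hL.nodup_iff.2 (nodup_finRange e)
    have e1 := listSign_swap_even [] (i :: f :: A) L [] (by simpa using hn) (hs.even.mul_left _)
    have hp : (i :: f :: A ++ L).Perm (L ++ i :: f :: A) := List.perm_append_comm
    have e2 := h5 [] (f :: A) (hp.nodup_iff.1 (by simpa using hn))
    refine ⟨h0.trans Sym2.eq_swap, L' ++ g :: f :: A, by simpa using h3.append hstep, ?_, ?_⟩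
    · refine List.Perm.trans ?_ hL
      rw [perm_iff_count] at h4 ⊢
      grind
    · simp only [cons_append, nil_append, append_nil] at e1 e2
      rw [e1, e2, List.length_cons, pow_succ, mul_neg_one, neg_neg, ← mul_assoc, ← mul_pow]
      simp

theorem IsLoop.not_branch (h : IsLoop Γ i x x' Ts ε) (hb : Branch Γ x i A s) : i ∈ A := by
  obtain ⟨h0, L, h1, hL, -⟩ := h
  cases id h1 with
  | nil => exact absurd (hL.mem_iff.2 (mem_finRange i)) (by simp)
  | @cons v i f g i y z _ B L s Ts hv hf hb' hg hs =>
    obtain ⟨f', g', a, b, A₁, A₂, s₁, s₂, hv', hf', hg', b1, b2, rfl, rfl⟩ := hb.inr_inv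
    rcases hv.eq_or_eq hv' with ⟨rfl, rfl⟩ | ⟨rfl, rfl⟩
    · rw [← Sym2.other_eq hg hg'] at b2
      have := b2.mem_of_spine hs
      grind
    · rw [← Sym2.other_eq hg hf'] at b1
      have := b1.mem_of_spine hs
      grind

/-- All edges on loops occur in every loop, up to the direction. -/
theorem IsLoop.exists_at (h : IsLoop Γ i x x' Ts ε) (h' : IsLoop Γ j y y' Us ε') :
    ∃ Vs Ws z z', Ts = Vs ++ Ws ∧ IsLoop Γ j z z' (Ws ++ Vs) ε := by
  obtain ⟨h0, L, h1, hL, rfl⟩ := h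
  rcases h1.exists_at (hL.mem_iff.2 (mem_finRange j)) with
    ⟨L₁, L₂, Vs, Ws, z, rfl, rfl, h2, h3⟩ | ⟨u, u', B, t, h2, h3, h4⟩
  · have hL' := List.perm_append_comm.trans hL
    obtain ⟨z', h4⟩ := (h3.append h2).isLoop hL'
    have := listSign_swap_even [] L₁ L₂ [] (by simpa using hL.nodup_iff.2 (nodup_finRange e))
      (h2.even.mul_right _)
    simp only [append_nil, nil_append] at this
    rw [← this] at h4
    exact ⟨Vs, Ws, z, z', rfl, h4⟩
  · have hn := List.nodup_cons.1 (h4.nodup (hL.nodup_iff.2 (nodup_finRange e)))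
    have h5 := h'.1
    rw [h2, Sym2.eq_iff] at h5
    rcases h5 with ⟨-, rfl⟩ | ⟨-, rfl⟩
    · exact absurd (h'.not_branch h3) hn.1
    · exact absurd (h'.reverse.not_branch h3) hn.1

end

section

/-! ### The cyclic word of a graph with one loop -/

variable {z : Vtx n m} {k : Fin e}

variable (K) in
/-- The product of the Lie words of the trees hanging off a walk. -/
def prodW (Ts : List (BTree n)) : NCP n K := (Ts.map lieW).prod

theorem prodW_cons (s : BTree n) (Ts : List (BTree n)) :
    prodW K (s :: Ts) = lieW s * prodW K Ts := List.prod_cons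

theorem prodW_append (Ts Us : List (BTree n)) :
    prodW K (Ts ++ Us) = prodW K Ts * prodW K Us := by simp [prodW]

theorem anti_prodW (Ts : List (BTree n)) :
    anti (prodW K Ts) = (-1 : K) ^ Ts.length • prodW K Ts.reverse := by
  induction Ts with
  | nil =>
    have : anti (1 : NCP n K) = 1 := by
      change MulOpposite.unop (antipode 1) = _
      rw [map_one]
      rfl
    simpa [prodW] using this
  | cons s Ts ih =>
    rw [prodW_cons, anti_mul, ih, anti_lieW, List.reverse_cons, prodW_append, prodW_cons s []]
    simp [prodW, pow_succ]

/-- A walk and the trees hanging off it are determined by its ends, up to exchanging subtrees. -/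
theorem Spine.det (h : Spine Γ x i y j L Ts) (h' : Spine Γ x i y j L' Us) (hj : j ∉ L.tail)
    (hj' : j ∉ L'.tail) (h0 : L = [] ↔ L' = []) : ∃ δ : ℤ, prodW K Ts = (δ : K) • prodW K Us ∧
    L.Perm L' ∧ ∀ P Q, (P ++ (L ++ Q)).Nodup → listSign (P ++ (L ++ Q)) = δ * listSign
    (P ++ (L' ++ Q)) := by
  induction h generalizing L' Us with
  | nil x i =>
    obtain rfl := h0.1 rfl
    obtain ⟨-, rfl, -⟩ | ⟨_, h1⟩ := h'.eq_nil_or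
    · exact ⟨1, by simp, List.Perm.refl _, fun P Q _ => by simp⟩
    · cases h1
  | @cons v i f g j y z y' A L s Ts hv hf hb hg hs ih =>
    cases h' with
    | nil => exact absurd (h0.2 rfl) (by simp)
    | @cons _ _ f' g' _ y₁ z₁ _ A' L' s' Us hv' hf' hb' hg' hs' =>
      rw [List.tail_cons, List.mem_cons, List.mem_append] at hj hj'
      rcases hv.eq_or_eq hv' with ⟨rfl, rfl⟩ | ⟨rfl, rfl⟩
      · obtain rfl := Sym2.other_eq hf hf'
        obtain rfl := Sym2.other_eq hg hg'
        have hnil : ∀ {L : List (Fin e)} {Ts}, Spine Γ z g' y' j L Ts → j ∉ L →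
            (L = [] ↔ g' = j) := by
          intro L Ts h hj
          rcases h.eq_nil_or with ⟨h1, -, -, h2⟩ | ⟨_, rfl⟩
          · simp [h1, h2]
          · simp only [List.mem_cons, not_or] at hj
            simpa using fun h => hj.1 h.symm
        obtain ⟨δ, d1, d2, d3⟩ := ih hs' (fun h => hj (Or.inr (Or.inr (List.mem_of_mem_tail h))))
          (fun h => hj' (Or.inr (Or.inr (List.mem_of_mem_tail h))))
          ((hnil hs (by tauto)).trans (hnil hs' (by tauto)).symm)
        obtain ⟨p, a, q, r⟩ := hb.det hb'
        refine ⟨a * δ, ?_, ((p.append d2).cons _).cons _, fun P Q hn => ?_⟩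
        · rw [prodW_cons, prodW_cons, q.lieW, d1, smul_mul_smul_comm]
          push_cast
          rfl
        · have e1 := r (P ++ [i, f']) (L ++ Q) (by simpa using hn)
          have e2 := d3 (P ++ i :: f' :: A') Q (by
            refine (List.Perm.nodup_iff ?_).1 hn
            simpa using ((p.append_right (L ++ Q)).cons f').cons i |>.append_left P)
          grind
      · obtain rfl := Sym2.other_eq hg hf'
        exact absurd (hb'.mem_of_spine hs) (by simp only [List.mem_cons]; tauto)

theorem IsLoop.det (h : IsLoop Γ i x x' Ts ε) (h' : IsLoop Γ i x y' Us ε') :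
    (ε : K) • prodW K Ts = (ε' : K) • prodW K Us := by
  obtain ⟨-, L, h1, hL, rfl⟩ := h
  obtain ⟨-, L', h1', hL', rfl⟩ := h'
  have key : ∀ {L Ts}, Spine Γ x i x i L Ts → L.Perm (finRange e) → L ≠ [] ∧ i ∉ L.tail := by
    intro L Ts h hL
    rcases h.eq_nil_or with ⟨rfl, -⟩ | ⟨L, rfl⟩
    · exact absurd (hL.mem_iff.2 (mem_finRange i)) (by simp)
    · exact ⟨by simp, (List.nodup_cons.1 (hL.nodup_iff.2 (nodup_finRange e))).1⟩
  obtain ⟨k1, k2⟩ := key h1 hL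
  obtain ⟨k3, k4⟩ := key h1' hL'
  obtain ⟨δ, d1, -, d2⟩ := h1.det (K := K) h1' k2 k4 (by simp [k1, k3])
  have d3 := d2 [] [] (by simpa using hL.nodup_iff.2 (nodup_finRange e))
  simp only [nil_append, append_nil] at d3
  have d4 : δ * δ = 1 := by
    have := listSign_mul_self L
    rwa [d3, mul_mul_mul_comm, listSign_mul_self, mul_one] at this
  rw [d1, smul_smul, d3]
  congr 1
  have : ((δ * δ : ℤ) : K) = 1 := by rw [d4, Int.cast_one]
  push_cast at this ⊢
  linear_combination (listSign L' : K) * this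

/-- The cyclic word `tr (q - q*)`, where `q*` is the antipode of `q`, as a sum over rotations. -/
def loopVal : NCP n K →ₗ[K] Ass n K := cyc ∘ₗ toAss ∘ₗ (LinearMap.id - anti)

theorem loopVal_apply (q : NCP n K) : loopVal q = cyc (toAss q) - cyc (toAss (anti q)) := by
  simp [loopVal]

theorem loopVal_mul_comm (p q : NCP n K) : loopVal (p * q) = loopVal (q * p) := by
  simp only [loopVal_apply, anti_mul, toAss_mul, cyc_mul_comm (toAss p),
    cyc_mul_comm (toAss (anti q))]

theorem loopVal_reverse (Ts : List (BTree n)) :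
    loopVal (prodW K Ts.reverse) = (-(-1) ^ Ts.length : K) • loopVal (prodW K Ts) := by
  rw [loopVal_apply, loopVal_apply, anti_prodW, anti_prodW, List.reverse_reverse,
    List.length_reverse, map_smul, map_smul, map_smul, map_smul, smul_sub, smul_smul, neg_mul,
    ← pow_add, Even.neg_one_pow ⟨_, rfl⟩]
  module

/-- The cyclic word of a loop does not depend on where and in which direction it is read. -/
theorem IsLoop.loopVal_eq (h : IsLoop Γ i x x' Ts ε) (h' : IsLoop Γ j y y' Us ε') :
    (ε : K) • loopVal (prodW K Ts) = (ε' : K) • loopVal (prodW K Us) := by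
  obtain ⟨Vs, Ws, z, z', rfl, h1⟩ := h.exists_at h'
  rw [prodW_append, loopVal_mul_comm, ← prodW_append]
  have h2 := h1.1
  rw [h'.1, Sym2.eq_iff] at h2
  rcases h2 with ⟨-, rfl⟩ | ⟨rfl, -⟩
  · rw [← map_smul, h1.det (K := K) h', map_smul]
  · have h3 := congrArg loopVal (h1.det (K := K) h'.reverse)
    rw [map_smul, map_smul, loopVal_reverse, smul_smul] at h3
    rw [h3]
    congr 1
    push_cast
    have : ((-1 : K) ^ Us.length) * (-1) ^ Us.length = 1 := by
      rw [← pow_add, Even.neg_one_pow ⟨_, rfl⟩]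
    linear_combination (ε' : K) * this

theorem IsRelabel.isLoop {σ : Equiv.Perm (Fin e)} {τ : Equiv.Perm (Fin m)}
    (hr : IsRelabel σ τ Γ Γ') (h : IsLoop Γ i x x' Ts ε) :
    IsLoop Γ' (σ⁻¹ i) (vtxEquiv n τ x) (vtxEquiv n τ x') Ts (Equiv.Perm.sign σ * ε) := by
  obtain ⟨h0, L, h1, hL, rfl⟩ := h
  refine ⟨hr.edge h0, _, hr.spine h1, perm_map_finRange hL _, ?_⟩
  rw [listSign_map hL, Equiv.Perm.sign_inv]

/-- Graphs with double edges do not contribute. -/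
theorem IsLoop.loopVal_eq_zero [CharZero K] (h : IsLoop Γ i x x' Ts ε)
    (hs : ¬ Injective Γ) : (ε : K) • loopVal (prodW K Ts) = 0 := by
  simp only [Injective, not_forall] at hs
  obtain ⟨a, b, hab, hne⟩ := hs
  have h1 := (isRelabel_swap hab).isLoop h
  have h2 := h.loopVal_eq (K := K) h1
  rw [Equiv.Perm.sign_swap hne] at h2
  push_cast at h2
  have h3 : (2 : K) • ((ε : K) • loopVal (prodW K Ts)) = 0 := by
    rw [two_smul]
    nth_rw 1 [h2]
    simp
  exact (smul_eq_zero.1 h3).resolve_left two_ne_zero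

variable (K) in
/-- The cyclic word of a graph which consists of a loop with trees hanging off it. -/
def loopWord (Γ : EdgeSeq n m e) : Ass n K := by
  classical exact
    if h : ∃ p : List (BTree n) × ℤ, ∃ i x x', IsLoop Γ i x x' p.1 p.2 then
      (h.choose.2 : K) • loopVal (prodW K h.choose.1)
    else 0

theorem IsLoop.loopWord_eq (h : IsLoop Γ i x x' Ts ε) :
    loopWord K Γ = (ε : K) • loopVal (prodW K Ts) := by
  have h1 : ∃ p : List (BTree n) × ℤ, ∃ i x x', IsLoop Γ i x x' p.1 p.2 :=
    ⟨(Ts, ε), i, x, x', h⟩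
  rw [loopWord, dif_pos h1]
  obtain ⟨_, _, _, h2⟩ := h1.choose_spec
  exact h2.loopVal_eq h

theorem IsICG.exists_isLoop (h : IsICG Γ) (h1 : loops Γ = 1) (he : e = 2 * m) :
    ∃ i x x' Ts ε, IsLoop Γ i x x' Ts ε := by
  obtain ⟨x, i, L, Ts, h2, h3⟩ := h.exists_closed h1 he
  obtain ⟨x', h4⟩ := h2.isLoop h3
  exact ⟨_, _, _, _, _, h4⟩

variable (n m e) (K) in
/-- The cyclic words of the graphs with one loop, as a linear map on the space of graphs. -/
def loopPiece : Piece n m e K →ₗ[K] Ass n K :=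
  (Rel n m e K).liftQ (Finsupp.lift _ K _ fun Γ : Gph n m e =>
      if loops Γ.1 = 1 ∧ e = 2 * m then loopWord K Γ.1 else 0) (show Rel n m e K ≤ _ by
    refine Submodule.span_le.2 ?_
    rintro _ ⟨σ, τ, Γ, Γ', h, rfl⟩
    rw [SetLike.mem_coe, LinearMap.mem_ker, map_sub, map_smul, sub_eq_zero]
    simp only [Finsupp.lift_apply, Finsupp.sum_single_index, zero_smul, one_smul, h.loops_eq]
    split_ifs with h0
    · obtain ⟨_, _, _, _, _, hL⟩ := Γ.2.exists_isLoop h0.1 h0.2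
      rw [hL.loopWord_eq, (h.isLoop hL).loopWord_eq, smul_smul]
      push_cast
      rfl
    · rw [smul_zero])

theorem loopPiece_cl (Γ : Gph n m e) :
    loopPiece n m e K (cl K Γ.1) = if loops Γ.1 = 1 ∧ e = 2 * m then loopWord K Γ.1 else 0 := by
  rw [cl_of]
  change (Finsupp.lift _ K _ _) (Finsupp.single Γ 1) = _
  simp [Finsupp.sum_single_index]

theorem Spine.reachable (h : Spine Γ x i y j L Ts) (hk : k ∈ L) :
    (SimpleGraph.fromRel fun i k : Fin e => ∃ v : Fin m, inr v ∈ Γ i ∧ inr v ∈ Γ k).Reachable i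
    k := by
  induction h with
  | nil => simp at hk
  | @cons v i f g j y z y' A L s Ts hv hf hb hg hs ih =>
    have e1 := reachable_edge ((hv.2.2.2 i).2 (by tauto)) ((hv.2.2.2 f).2 (by tauto))
    have e2 := reachable_edge ((hv.2.2.2 i).2 (by tauto)) ((hv.2.2.2 g).2 (by tauto))
    simp only [List.mem_cons, List.mem_append] at hk
    rcases hk with rfl | rfl | hk | hk
    exacts [SimpleGraph.Reachable.refl _, e1, e1.trans (hb.reachable hk), e2.trans (ih hk)]

theorem IsLoop.isICG (h : IsLoop Γ i x x' Ts ε) (hs : Injective Γ)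
    (hT : IsTrivalent Γ) : IsICG Γ := by
  obtain ⟨h0, L, h1, hL, -⟩ := h
  refine isICG_of_reachable hs hT.1 (fun v => (hT.2 v).ge) (i := i)
    (fun k => h1.reachable (hL.mem_iff.2 (mem_finRange k))) ?_
  cases id h1 with
  | nil => exact absurd (hL.mem_iff.2 (mem_finRange i)) (by simp)
  | @cons v i f g i y z _ A L s Ts hv hf hb hg hs =>
    rcases hb.exists_leaf with ⟨k, rfl⟩ | ⟨f, -, k, hk⟩
    · exact ⟨f, k, by rw [hf]; simp⟩
    · exact ⟨f, k, hk⟩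

theorem IsLoop.loopPiece_eq [CharZero K] (h : IsLoop Γ i x x' Ts ε) (hT : IsTrivalent Γ)
    (he : e = 2 * m) : loopPiece n m e K (cl K Γ) = (ε : K) • loopVal (prodW K Ts) := by
  by_cases hs : Injective Γ
  · have h1 : loops Γ = 1 := by have := loops_of_valence hT.1 hT.2; omega
    have := loopPiece_cl (K := K) ⟨Γ, h.isICG hs hT⟩
    rw [this, if_pos ⟨h1, he⟩, h.loopWord_eq]
  · rw [cl_of_not K fun hc => hs hc.simple, map_zero, h.loopVal_eq_zero hs]

end

section

/-! ### The three splittings of a 4-valent vertex of a graph with one loop -/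

variable {z v₀ : Vtx n m} {k h₀ : Fin e}

/-- A walk which avoids the vertices in `U` (because each of them lies on an edge `h₀` off the walk)
is also a walk in every graph which coincides with `Γ` away from `U`; its last vertex may change. -/
theorem Spine.congr {U : Fin m → Prop} (h0 : ∀ v, U v → inr v ∈ Γ h₀)
    (hU : ∀ v, ¬ U v → ∀ h, inr v ∈ Γ h ↔ inr v ∈ Γ' h) (hE : ∀ h x y, (∀ v, x = inr v → ¬ U v) →
    (∀ v, y = inr v → ¬ U v) → Γ h = s(x, y) → Γ' h = s(x, y)) (h : Spine Γ x i y j L Ts)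
    (hn : h₀ ∉ L ++ [j]) (hj : ∀ v, ¬ U v → Γ j = s(inr v, y) → Γ' j = s(inr v, y')) (hL : L ≠ []) :
    (∀ v, x = inr v → ¬ U v) ∧ Spine Γ' x i y' j L Ts := by
  induction h with
  | nil => exact absurd rfl hL
  | @cons v i f g j y z y₁ A L s Ts hv hf hb hg hs ih =>
    simp only [cons_append, List.mem_cons, List.mem_append, append_assoc, not_or,
      not_mem_nil, or_false] at hn
    have hg0 : h₀ ≠ g := by
      rcases hs.eq_nil_or with ⟨-, -, -, rfl⟩ | ⟨L', rfl⟩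
      all_goals grind
    have hvU : ¬ U v := fun hc => by
      rcases (hv.2.2.2 h₀).1 (h0 v hc) with h | h | h
      exacts [hn.1 h, hn.2.1 h, hg0 h]
    have hx : ∀ w, inr v = (inr w : Vtx n m) → ¬ U w := fun w hw => inr.inj hw ▸ hvU
    obtain ⟨a1, b1⟩ := hb.congr hU hE fun w hw => ⟨h₀, h0 w hw, by simp; tauto⟩
    have hv' : Tri Γ' v i f g := ⟨hv.1, hv.2.1, hv.2.2.1, fun h => by rw [← hU v hvU, hv.2.2.2]⟩
    refine ⟨hx, ?_⟩
    rcases eq_or_ne L [] with rfl | hL'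
    · obtain ⟨-, rfl, rfl, rfl⟩ | ⟨_, h1⟩ := hs.eq_nil_or
      · exact Spine.cons hv' (hE _ _ _ hx a1 hf) b1 (hj v hvU hg) (Spine.nil _ _)
      · cases h1
    · obtain ⟨a2, b2⟩ := ih (by simp; tauto) hj hL'
      exact Spine.cons hv' (hE _ _ _ hx a1 hf) b1 (hE _ _ _ hx a2 hg) b2

/-- From every edge of a branch there is a walk to the root. -/
theorem Branch.exists_up (h : Branch Γ x i A s) (hi : Γ i = s(v₀, x)) (hk : k ∈ A) : ∃ u u' B t L
    Us, Γ k = s(u, u') ∧ Branch Γ u' k B t ∧ Spine Γ u k v₀ i L Us ∧ (B ++ L).Perm A ∧ L ≠ [] := by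
  induction h generalizing v₀ with
  | leaf => simp at hk
  | @node v i f g x y A B s t hv hf hg h1 h2 ih1 ih2 =>
    have hi' := hi.trans Sym2.eq_swap
    have S1 := Spine.cons hv.rot hg h2 hi' (Spine.nil _ _)
    have S2 := Spine.cons hv.rot.rot.swap hf h1 hi' (Spine.nil _ _)
    rw [append_nil] at S1 S2
    have key : ∀ {C L f B B' R} {Us : List (BTree n)}, (C ++ L).Perm B →
        (B ++ f :: B').Perm R → (C ++ (L ++ f :: B') : List (Fin e)).Perm R := fun h h' => by
      rw [← append_assoc]
      exact (h.append_right _).trans h'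
    have hp : (B ++ g :: f :: A).Perm (f :: (A ++ g :: B)) := by
      grind
    have hp' : (A ++ f :: g :: B).Perm (f :: (A ++ g :: B)) := by
      grind
    rw [List.mem_cons, List.mem_append, List.mem_cons] at hk
    rcases hk with rfl | hk | rfl | hk
    · grind
    · obtain ⟨u, u', C, r, L, Us, c1, c2, c3, c4, c5⟩ := ih1 hf hk
      exact ⟨u, u', C, r, _, _, c1, c2, c3.append S1, key (Us := Us) c4 hp', by simp⟩
    · grind
    · obtain ⟨u, u', C, r, L, Us, c1, c2, c3, c4, c5⟩ := ih2 hg hk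
      exact ⟨u, u', C, r, _, _, c1, c2, c3.append S2, key (Us := Us) c4 hp, by simp⟩

/-- A branch and the trees met on the way up form a bigger branch. -/
theorem Spine.branch (h : Spine Γ x i y j L Us) (hi : Γ i = s(x, x')) (hb : Branch Γ x' i B s) : ∃
    y' B', Γ j = s(y, y') ∧ Branch Γ y' j B' (Us.foldl (· * ·) s) ∧ ∀ P Q,
    (P ++ (B ++ (L ++ j :: Q))).Nodup → (B ++ (L ++ j :: Q)).Perm (j :: (B' ++ Q)) ∧ listSign
    (P ++ (B ++ (L ++ j :: Q))) = listSign (P ++ (j :: (B' ++ Q))) := by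
  induction h generalizing x' B s with
  | nil x i =>
    refine ⟨x', B, hi, hb, fun P Q hn => ⟨?_, ?_⟩⟩
    · grind
    · exact listSign_swap_even P B [i] Q (by simpa using hn) (hb.even.mul_right _)
  | @cons v i f g j y z y₁ A L t Us hv hf hb' hg hs ih =>
    obtain ⟨y', B', c1, c2, c3⟩ := ih (hg.trans Sym2.eq_swap) (Branch.node hv.rot.rot hi hf hb hb')
    refine ⟨y', B', c1, c2, fun P Q hn => ?_⟩
    have hp : (B ++ ([i] ++ (f :: (A ++ (L ++ j :: Q))))).Perm
        (i :: (B ++ f :: A) ++ (L ++ j :: Q)) := by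
      rw [perm_iff_count]
      grind
    have e1 := listSign_swap_even P B [i] (f :: (A ++ (L ++ j :: Q))) (by simpa using hn)
      (hb.even.mul_right _)
    obtain ⟨d1, d2⟩ := c3 P Q ((hp.append_left P).nodup_iff.1 (by simpa using hn))
    grind

theorem Spine.locate (h : Spine Γ x i y j L Ts) (hk : k ∈ L.tail ++ [j]) (hL : L ≠ []) : ∃ L₁ Us v
    i' f g y' z A s L₂ Vs, Spine Γ x i (inr v) i' L₁ Us ∧ Tri Γ v i' f g ∧ Γ f = s(inr v, y') ∧
    Branch Γ y' f A s ∧ Γ g = s(inr v, z) ∧ Spine Γ z g y j L₂ Vs ∧ L = L₁ ++ i' :: f :: (A ++ L₂) ∧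
    (k = f ∨ k ∈ A ∨ k = g) := by
  induction h with
  | nil => exact absurd rfl hL
  | @cons v i f g j y z y₁ A L s Ts hv hf hb hg hs ih =>
    by_cases hd : k = f ∨ k ∈ A ∨ k = g
    · exact ⟨[], [], _, _, _, _, _, _, _, _, _, _, Spine.nil _ _, hv, hf, hb, hg, hs, rfl, hd⟩
    rcases hs.eq_nil_or with ⟨rfl, -, -, rfl⟩ | ⟨L', rfl⟩
    · simp at hk
      tauto
    · simp at hk
      obtain ⟨L₁, Us, v', i', f', g', y', z', A', s', L₂, Vs, c1, c2, c3, c4, c5, c6, c7, c8⟩ :=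
        ih (by simp; tauto) (by simp)
      exact ⟨_, _, _, _, _, _, _, _, _, _, _, _, Spine.cons hv hf hb hg c1, c2, c3, c4, c5, c6,
        by simp [c7], c8⟩

/-- Each edge is met after the first one, if the loop is read from a suitable edge. -/
theorem IsLoop.exists_step (h : IsLoop Γ i x x' Ts ε) (k : Fin e) : ∃ v i f g y z A s L Us, Tri Γ v
    i f g ∧ Γ f = s(inr v, y) ∧ Branch Γ y f A s ∧ Γ g = s(inr v, z) ∧ Spine Γ z g (inr v) i L Us ∧
    (i :: f :: (A ++ L)).Perm (finRange e) ∧ (k = f ∨ k ∈ A ∨ k = g) := by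
  obtain ⟨-, L, h1, hL, -⟩ := h
  have hk := hL.mem_iff.2 (mem_finRange k)
  have hk' : k ∈ L.tail ++ [i] := by
    rcases h1.eq_nil_or with ⟨rfl, -⟩ | ⟨L, rfl⟩
    all_goals grind
  obtain ⟨L₁, Us, v, i', f, g, y, z, A, s, L₂, Vs, c1, c2, c3, c4, c5, c6, rfl, c8⟩ :=
    h1.locate hk' (by rintro rfl; simp at hk)
  refine ⟨v, i', f, g, y, z, A, s, _, _, c2, c3, c4, c5, c6.append c1, ?_, c8⟩
  refine List.Perm.trans ?_ hL
  rw [perm_iff_count]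
  grind

end

section

variable {S₀ : Finset (Fin e)}
variable {v vp u : Fin (m + 1)} {y z xp : Vtx n (m + 1)} {i f g : Fin (e + 1)}

/-- The two vertices which arise by splitting the vertex `w`. -/
def IsEnd (w : Fin m) (v : Fin (m + 1)) : Prop := v = w.castSucc ∨ v = Fin.last m

theorem IsEnd.mem_last (hv : IsEnd w v) (S : Finset (Fin e)) :
    inr v ∈ split Γ (inr w) S (Fin.last e) := by
  rw [mem_split_last, up_inr, newV_def]
  exact hv.imp (congrArg _) (congrArg _)

theorem exists_up_of_not (h : ∀ v, y = inr v → ¬ IsEnd w v) : ∃ x, y = up x ∧ x ≠ inr w := by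
  obtain ⟨x, rfl⟩ := exists_up fun hc => h _ hc (Or.inr rfl)
  exact ⟨x, rfl, fun hc => h w.castSucc (by rw [hc, up_inr]) (Or.inl rfl)⟩

theorem not_isEnd_up (hx : x ≠ inr w) (v : Fin (m + 1)) (hv : up x = inr v) : ¬ IsEnd w v := by
  rintro (rfl | rfl)
  · exact hx (up_injective hv)
  · exact up_ne_newV _ hv

theorem mem_split_iff (S S' : Finset (Fin e)) (hv : ¬ IsEnd w v) (h : Fin (e + 1)) : inr v ∈ split Γ
    (inr w) S h ↔ inr v ∈ split Γ (inr w) S' h := by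
  obtain ⟨x, hx, hxw⟩ := exists_up_of_not (n := n) (y := inr v) (w := w) fun u hu => inr.inj hu ▸ hv
  induction h using Fin.lastCases with
  | last => rw [mem_split_last, mem_split_last]
  | cast h => rw [hx, mem_split_castSucc hxw, mem_split_castSucc hxw]

theorem split_edge (S S' : Finset (Fin e)) (h : Fin (e + 1)) (x y : Vtx n (m + 1))
    (hx : ∀ v, x = inr v → ¬ IsEnd w v) (hy : ∀ v, y = inr v → ¬ IsEnd w v)
    (hh : split Γ (inr w) S h = s(x, y)) : split Γ (inr w) S' h = s(x, y) := by
  obtain ⟨x, rfl, hxw⟩ := exists_up_of_not hx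
  obtain ⟨y, rfl, hyw⟩ := exists_up_of_not hy
  induction h using Fin.lastCases with
  | last =>
    rw [split_last, Sym2.eq_iff] at hh
    rcases hh with ⟨-, hc⟩ | ⟨-, hc⟩ <;> exact absurd hc.symm (up_ne_newV _)
  | cast h =>
    obtain ⟨y', hy', hyy⟩ := edge_of_split hh (up_ne_newV _)
    have h1 : inr w ∉ Γ h := by
      rw [hy', ← up_injective hyy, Sym2.mem_iff]
      tauto
    rw [← hh, KV.split, KV.split, Fin.snoc_castSucc, Fin.snoc_castSucc]
    have : (Γ h).map (fun u => if u = inr w then newV else up u) = (Γ h).map up :=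
      Sym2.map_congr fun u hu => if_neg fun hc : u = inr w => h1 (hc ▸ hu)
    simp only [this, ite_self]

/-- The far end of an edge at one of the new vertices is the same for all splittings. -/
theorem split_end (hl : ∀ i, ¬ (Γ i).IsDiag) {h : Fin e} (hv : IsEnd w v)
    (hz : split Γ (inr w) S₀ h.castSucc = s(inr v, z)) : (∀ u, z = inr u → ¬ IsEnd w u) ∧ ∀ S, split
    Γ (inr w) S h.castSucc = s(inr (if h ∈ S then Fin.last m else w.castSucc), z) := by
  have h1 : inr v ∈ split Γ (inr w) S₀ h.castSucc := by rw [hz]; simp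
  have h2 : inr w ∈ Γ h := by
    rcases hv with rfl | rfl
    · exact (mem_split_self.1 h1).1
    · exact (mem_split_newV.1 h1).1
  obtain ⟨x, hx⟩ := h2
  have hxw : x ≠ inr w := by
    rintro rfl
    exact hl h (by rw [hx]; simp)
  have h3 : ∀ S, split Γ (inr w) S h.castSucc =
      s(inr (if h ∈ S then Fin.last m else w.castSucc), up x) := by
    intro S
    split_ifs with hS
    · exact split_of_mem hS hx hxw
    · exact split_of_notMem' hS hx
  have h4 : z = up x := by
    rw [h3 S₀, Sym2.eq_iff] at hz
    rcases hz with ⟨-, hz⟩ | ⟨-, hz⟩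
    · exact hz.symm
    · exact absurd hv (not_isEnd_up hxw v hz)
  subst h4
  exact ⟨not_isEnd_up hxw, h3⟩

theorem Branch.of_isEnd {A : List (Fin (e + 1))} (hb : Branch (KV.split Γ (inr w) S₀) y i A s)
    (hn : Fin.last e ∉ i :: A) : Branch (KV.split Γ (inr w) S) y i A s :=
  (hb.congr (fun _ => mem_split_iff S₀ S) (split_edge S₀ S)
    fun _ hv => ⟨_, hv.mem_last S₀, hn⟩).2

variable {A B Q : List (Fin (e + 1))} {r : BTree n}
variable {L M : List (Fin (e + 1))} {v va vb vq : Fin (m + 1)}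
variable {x y z xa xb xq : Vtx n (m + 1)}

/-- The three splittings of a 4-valent vertex on the loop. -/
theorem Quad.isLoop_of_loop (hw : Quad Γ w p q a b) (hl : ∀ i, ¬ (Γ i).IsDiag) (ha : IsEnd w va)
    (ea : split Γ (inr w) S₀ a.castSucc = s(inr va, xa))
    (h1 : Branch (split Γ (inr w) S₀) xa a.castSucc A s) (hb : IsEnd w vb)
    (eb : split Γ (inr w) S₀ b.castSucc = s(inr vb, xb))
    (h2 : Branch (split Γ (inr w) S₀) xb b.castSucc B t) (hq : IsEnd w vq)
    (eq : split Γ (inr w) S₀ q.castSucc = s(inr vq, xq))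
    (h3 : Spine (split Γ (inr w) S₀) xq q.castSucc (inr v) p.castSucc L Ts) (hv : IsEnd w v) (hp :
    (p.castSucc :: Fin.last e :: (a.castSucc :: A ++ (b.castSucc :: B ++ L))).Perm
    (finRange (e + 1))) : ∃ i₁ x₁ y₁ i₂ x₂ y₂ i₃ x₃ y₃ ε, IsLoop (split Γ (inr w) {a, b}) i₁ x₁ y₁
    (s * t :: Ts) ε ∧ IsLoop (split Γ (inr w) {b, q}) i₂ x₂ y₂ (s :: t :: Ts) (-ε) ∧ IsLoop
    (split Γ (inr w) {q, a}) i₃ x₃ y₃ (t :: s :: Ts) ε := by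
  have hn := hp.nodup_iff.2 (nodup_finRange _)
  have hn' := hn
  have hd := hw.1
  simp only [nodup_cons, List.mem_cons, List.mem_append, not_mem_nil, or_false, not_or,
    cons_append] at hn' hd
  have hL : L ≠ [] := by
    rcases h3.eq_nil_or with ⟨-, -, -, h⟩ | ⟨L', rfl⟩
    all_goals grind
  have b1 : ∀ S, Branch (split Γ (inr w) S) xa a.castSucc A s := fun S =>
    h1.of_isEnd (by simp only [List.mem_cons]; tauto)
  have b2 : ∀ S, Branch (split Γ (inr w) S) xb b.castSucc B t := fun S =>
    h2.of_isEnd (by simp only [List.mem_cons]; tauto)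
  have b3 : ∀ S, p ∉ S → Spine (split Γ (inr w) S) xq q.castSucc (inr w.castSucc)
      p.castSucc L Ts := fun S hS => (h3.congr (fun _ hv => hv.mem_last S₀)
        (fun _ => mem_split_iff S₀ S) (split_edge S₀ S) (by
          simp only [List.mem_append, List.mem_singleton]; tauto) (fun u hu hz => by
        have h5 := (split_end hl hv (hz.trans Sym2.eq_swap)).2 S
        rw [if_neg hS] at h5
        exact h5.trans Sym2.eq_swap) hL).2
  have ea' := (split_end hl ha ea).2
  have eb' := (split_end hl hb eb).2
  have eq' := (split_end hl hq eq).2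
  have el : ∀ S : Finset (Fin e), split Γ (inr w) S (Fin.last e) =
      s(inr w.castSucc, inr (Fin.last m)) := fun S => split_last
  have c1 : Spine (split Γ (inr w) {a, b}) (inr w.castSucc) p.castSucc
      (inr w.castSucc) p.castSucc _ _ :=
    Spine.cons hw.tri_old (el _) (Branch.node hw.tri_new (by rw [ea', if_pos (by simp)])
      (by rw [eb', if_pos (by simp)]) (b1 _) (b2 _)) (by rw [eq', if_neg (by simp; tauto)])
      (b3 _ (by simp; tauto))
  have c2 : Spine (split Γ (inr w) {b, q}) (inr w.castSucc) p.castSucc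
      (inr w.castSucc) p.castSucc _ _ :=
    Spine.cons hw.rot.tri_old.swap (by rw [ea', if_neg (by simp; tauto)]) (b1 _) (el _)
      (Spine.cons hw.rot.tri_new (by rw [eb', if_pos (by simp)]) (b2 _)
        (by rw [eq', if_pos (by simp)]) (b3 _ (by simp; tauto)))
  have c3 : Spine (split Γ (inr w) {q, a}) (inr w.castSucc) p.castSucc
      (inr w.castSucc) p.castSucc _ _ :=
    Spine.cons hw.rot.rot.tri_old.swap (by rw [eb', if_neg (by simp; tauto)]) (b2 _) (el _)
      (Spine.cons hw.rot.rot.tri_new.swap (by rw [ea', if_pos (by simp)]) (b1 _)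
        (by rw [eq', if_pos (by simp)]) (b3 _ (by simp; tauto)))
  -- passing the new edge over an odd block changes the sign
  have s2 := listSign_swap_odd [p.castSucc] [Fin.last e] (a.castSucc :: A) (b.castSucc :: B ++ L)
    hn (by simp) (by simpa using h1.even.add_one)
  have hn3 : ([p.castSucc] ++ ((b.castSucc :: B) ++ (([Fin.last e] ++ a.castSucc :: A) ++ L))).Perm
      (finRange (e + 1)) := by
    refine List.Perm.trans ?_ hp
    rw [perm_iff_count]
    grind
  have s3 := listSign_swap_even [p.castSucc] (b.castSucc :: B) ([Fin.last e] ++ a.castSucc :: A) L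
    (hn3.nodup_iff.2 (nodup_finRange _)) (Even.mul_left (by
      have := h1.even
      simp only [List.length_append, List.length_cons, List.length_nil]
      grind) _)
  simp only [cons_append, nil_append, append_assoc] at c1 c2 c3 s2 s3 hp hn3
  have hp2 : (p.castSucc :: a.castSucc :: (A ++ Fin.last e :: b.castSucc :: (B ++ L))).Perm
      (finRange (e + 1)) := by
    refine List.Perm.trans ?_ hp
    rw [perm_iff_count]
    grind
  obtain ⟨x₁, d1⟩ := c1.isLoop hp
  obtain ⟨x₂, d2⟩ := c2.isLoop hp2
  obtain ⟨x₃, d3⟩ := c3.isLoop hn3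
  rw [s3] at d3
  rw [show listSign (p.castSucc :: a.castSucc :: (A ++ Fin.last e :: b.castSucc :: (B ++ L))) =
    -listSign (p.castSucc :: Fin.last e :: a.castSucc :: (A ++ b.castSucc :: (B ++ L))) by
      rw [s2, neg_neg]] at d2
  exact ⟨_, _, _, _, _, _, _, _, _, _, d1, d2, d3⟩

theorem lieW_foldl {s₁ s₂ s₃ : BTree n} (h : (lieW s₁ + lieW s₂ + lieW s₃ : NCP n K) = 0)
    (Us : List (BTree n)) : (lieW (Us.foldl (· * ·) s₁) + lieW (Us.foldl (· * ·) s₂) + lieW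
    (Us.foldl (· * ·) s₃) : NCP n K) = 0 := by
  induction Us generalizing s₁ s₂ s₃ with
  | nil => exact h
  | cons t Us ih => exact ih (by rw [lieW_mul, lieW_mul, lieW_mul, ← add_lie, ← add_lie, h, zero_lie])

/-- A splitting of a 4-valent vertex in a tree hanging off the loop. -/
theorem Quad.isLoop_of_tree (hw : Quad Γ w p q a b) (hl : ∀ i, ¬ (Γ i).IsDiag) (hp : IsEnd w vp)
    (ep : split Γ (inr w) S₀ p.castSucc = s(inr vp, xp)) (ha : IsEnd w va)
    (ea : split Γ (inr w) S₀ a.castSucc = s(inr va, xa))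
    (h1 : Branch (split Γ (inr w) S₀) xa a.castSucc A s) (hb : IsEnd w vb)
    (eb : split Γ (inr w) S₀ b.castSucc = s(inr vb, xb))
    (h2 : Branch (split Γ (inr w) S₀) xb b.castSucc B t) (hq : IsEnd w vq)
    (eq : split Γ (inr w) S₀ q.castSucc = s(inr vq, xq))
    (h3 : Branch (split Γ (inr w) S₀) xq q.castSucc Q r)
    (h4 : Spine (split Γ (inr w) S₀) xp p.castSucc (inr u) f L Us)
    (h5 : Tri (split Γ (inr w) S₀) u i f g) (h6 : split Γ (inr w) S₀ g = s(inr u, z))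
    (h7 : Spine (split Γ (inr w) S₀) z g (inr u) i M Ts) (hL : (i :: (Fin.last e ::
    (a.castSucc :: (A ++ b.castSucc :: B) ++ q.castSucc :: Q) ++ (L ++ f :: M))).Perm
    (finRange (e + 1))) : ∃ x' y, IsLoop (split Γ (inr w) {a, b}) i x' y
    (Us.foldl (· * ·) (s * t * r) :: Ts) (listSign (i :: (Fin.last e ::
    (a.castSucc :: (A ++ b.castSucc :: B) ++ q.castSucc :: Q) ++ (L ++ f :: M)))) :=
    by
  have hn := hL.nodup_iff.2 (nodup_finRange _)
  have hd := hw.1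
  have hn' := hn
  simp only [nodup_cons, List.mem_cons, List.mem_append, not_mem_nil, or_false, not_or,
    cons_append, append_assoc] at hn' hd
  set S : Finset (Fin e) := {a, b}
  have hM : g ∈ M := by
    rcases h7.eq_nil_or with ⟨-, -, -, h⟩ | ⟨L', rfl⟩
    · exact absurd h h5.2.1.symm
    · simp
  have hu : ¬ IsEnd w u := fun hc => by
    rcases (h5.2.2.2 _).1 (hc.mem_last S₀) with h | h | h
    all_goals grind
  have hu' : ∀ v, (inr u : Vtx n (m + 1)) = inr v → ¬ IsEnd w v := fun v hv =>
    inr.inj hv ▸ hu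
  have e0 := fun v hv => IsEnd.mem_last (Γ := Γ) (w := w) (v := v) hv S₀
  have e1 := fun v => mem_split_iff (Γ := Γ) (w := w) (v := v) S₀ S
  have t5 : Tri (split Γ (inr w) S) u i f g :=
    ⟨h5.1, h5.2.1, h5.2.2.1, fun h => by rw [← e1 u hu, h5.2.2.2]⟩
  have hj : ∀ j v, ¬ IsEnd w v → split Γ (inr w) S₀ j = s(inr v, inr u) →
      split Γ (inr w) S j = s(inr v, inr u) := fun j v hv hh =>
    split_edge S₀ S j _ _ (fun _ h => inr.inj h ▸ hv) hu' hh
  -- away from the ends of the new edge the two splittings agree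
  obtain ⟨c1, c2⟩ := h7.congr e0 e1 (split_edge S₀ S) (by
    simp only [List.mem_append, List.mem_singleton]; tauto) (hj i) (by rintro rfl; simp at hM)
  have ep' := split_end hl hp ep
  have c3 : Spine (split Γ (inr w) S) xp p.castSucc (inr u) f L Us := by
    rcases eq_or_ne L [] with rfl | hL'
    · obtain ⟨-, rfl, rfl, rfl⟩ | ⟨_, h⟩ := h4.eq_nil_or
      · exact Spine.nil _ _
      · cases h
    · exact (h4.congr e0 e1 (split_edge S₀ S) (by
        simp only [List.mem_append, List.mem_singleton]; tauto) (hj f) hL').2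
  have hb' := Branch.node (Γ := split Γ (inr w) S) hw.tri_old split_last
    (by rw [(split_end hl hq eq).2, if_neg (by simp [S]; tauto)])
    (Branch.node hw.tri_new (by rw [(split_end hl ha ea).2, if_pos (by simp [S])])
      (by rw [(split_end hl hb eb).2, if_pos (by simp [S])])
      (h1.of_isEnd (S := S) (by simp only [List.mem_cons]; tauto))
      (h2.of_isEnd (by simp only [List.mem_cons]; tauto)))
    (h3.of_isEnd (by simp only [List.mem_cons]; tauto))
  obtain ⟨y', B', d1, d2, d3⟩ := c3.branch (x' := inr w.castSucc)
    (by rw [ep'.2 S, if_neg (by simp [S]; tauto), Sym2.eq_swap]) hb'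
  obtain ⟨d4, d5⟩ := d3 [i] M (by simpa using hn)
  have c4 := Spine.cons t5 d1 d2 (split_edge S₀ S g _ _ hu' c1 h6) c2
  obtain ⟨x', d6⟩ := c4.isLoop ((d4.symm.cons i).trans hL)
  refine ⟨inr u, x', ?_⟩
  simp only [cons_append, nil_append] at d5 ⊢
  rwa [d5]

end

section

variable {S₀ : Finset (Fin e)}
variable {v v' : Fin (m + 1)} {h k g c d i₁ i₂ i₃ : Fin (e + 1)}

theorem IsEnd.of_mem (hh : h = Fin.last e) (hv : inr v ∈ split Γ (inr w) S₀ h) : IsEnd w v := by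
  rw [hh, mem_split_last, up_inr, newV_def] at hv
  exact hv.imp inr.inj inr.inj

/-- The edges at the two new vertices of a splitting, one of which is `v`, name the edges at the
4-valent vertex which is split. -/
theorem Quad.exists_near (hw : Quad Γ w p q a b) (hl : ∀ i, ¬ (Γ i).IsDiag)
    (h1 : Tri (split Γ (inr w) S₀) v k (Fin.last e) g)
    (h2 : Tri (split Γ (inr w) S₀) v' (Fin.last e) c d)
    (hne : split Γ (inr w) S₀ (Fin.last e) = s(inr v, inr v')) : ∃ p' q' a' b', Quad Γ w p' q' a'
    b' ∧ k = p'.castSucc ∧ g = q'.castSucc ∧ c = a'.castSucc ∧ d = b'.castSucc ∧ IsEnd w v ∧ IsEnd w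
    v' := by
  have hv := IsEnd.of_mem rfl ((h1.2.2.2 _).2 (Or.inr (Or.inl rfl)))
  have hv' := IsEnd.of_mem rfl ((h2.2.2.2 _).2 (Or.inl rfl))
  have hvv : v ≠ v' := by
    rintro rfl
    exact split_loopless hl _ (by rw [hne]; exact Sym2.mk_isDiag_iff.2 rfl)
  have key : ∀ {v : Fin (m + 1)} {h : Fin e}, IsEnd w v →
      inr v ∈ split Γ (inr w) S₀ h.castSucc → h ∈ [p, q, a, b] := by
    rintro v h (rfl | rfl) hh
    · exact (hw.2 h).1 (mem_split_self.1 hh).1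
    · exact (hw.2 h).1 (mem_split_newV.1 hh).1
  have key2 : ∀ {h h' : Fin (e + 1)}, inr v ∈ split Γ (inr w) S₀ h →
      inr v' ∈ split Γ (inr w) S₀ h' → h ≠ Fin.last e → h ≠ h' := by
    rintro h _ m1 m2 hh rfl
    obtain ⟨h, rfl⟩ := Fin.exists_castSucc_eq.2 hh
    obtain ⟨z, hz⟩ := m1
    rw [hz, Sym2.mem_iff] at m2
    rcases m2 with m2 | m2
    · exact hvv (inr.inj m2).symm
    · exact (split_end hl hv hz).1 _ m2.symm hv'
  obtain ⟨p', rfl⟩ := Fin.exists_castSucc_eq.2 h1.1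
  obtain ⟨q', rfl⟩ := Fin.exists_castSucc_eq.2 h1.2.2.1.symm
  obtain ⟨a', rfl⟩ := Fin.exists_castSucc_eq.2 h2.1.symm
  obtain ⟨b', rfl⟩ := Fin.exists_castSucc_eq.2 h2.2.1.symm
  have mp := (h1.2.2.2 _).2 (Or.inl rfl)
  have mq := (h1.2.2.2 _).2 (Or.inr (Or.inr rfl))
  have ma := (h2.2.2.2 _).2 (Or.inr (Or.inl rfl))
  have mb := (h2.2.2.2 _).2 (Or.inr (Or.inr rfl))
  have n1 : p' ≠ q' := fun h => h1.2.1 (h ▸ rfl)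
  have n2 : a' ≠ b' := fun h => h2.2.2.1 (h ▸ rfl)
  have n3 : p' ≠ a' := fun h => key2 mp ma h1.1 (h ▸ rfl)
  have n4 : p' ≠ b' := fun h => key2 mp mb h1.1 (h ▸ rfl)
  have n5 : q' ≠ a' := fun h => key2 mq ma h1.2.2.1.symm (h ▸ rfl)
  have n6 : q' ≠ b' := fun h => key2 mq mb h1.2.2.1.symm (h ▸ rfl)
  have hp : [p, q, a, b].Perm [p', q', a', b'] := by
    refine (List.Subperm.perm_of_length_le (List.Nodup.subperm ?_ ?_) (by simp)).symm
    · simp [n1, n2, n3, n4, n5, n6]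
    · intro h hh
      grind
  exact ⟨p', q', a', b', hw.perm hp, rfl, rfl, rfl, rfl, hv, hv'⟩

theorem Quad.loopPiece_sum_of_loop [CharZero K] {x₁ x₂ x₃ y₁ y₂ y₃ : Vtx n (m + 1)}
    {S₁ S₂ S₃ : Finset (Fin e)} (hT₁ : IsTrivalent (split Γ (inr w) S₁))
    (hT₂ : IsTrivalent (split Γ (inr w) S₂)) (hT₃ : IsTrivalent (split Γ (inr w) S₃))
    (he : e + 1 = 2 * (m + 1)) (h₁ : IsLoop (split Γ (inr w) S₁) i₁ x₁ y₁ (s * t :: Ts) ε)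
    (h₂ : IsLoop (split Γ (inr w) S₂) i₂ x₂ y₂ (s :: t :: Ts) (-ε))
    (h₃ : IsLoop (split Γ (inr w) S₃) i₃ x₃ y₃ (t :: s :: Ts) ε) : loopPiece n (m + 1) (e + 1) K
    (cl K (split Γ (inr w) S₁) + cl K (split Γ (inr w) S₂) + cl K (split Γ (inr w) S₃)) = 0 := by
  rw [map_add, map_add, h₁.loopPiece_eq hT₁ he, h₂.loopPiece_eq hT₂ he, h₃.loopPiece_eq hT₃ he]
  simp only [prodW_cons, lieW_mul, bracket_def, ← map_smul, ← map_add]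
  refine (congrArg loopVal ?_).trans (map_zero _)
  push_cast
  rw [sub_mul, mul_assoc, mul_assoc]
  module

/-- The cyclic words of the three splittings of a 4-valent vertex add up to zero. -/
theorem Quad.loopPiece_sum [CharZero K] (hw : Quad Γ w p q a b) (hl : ∀ i, ¬ (Γ i).IsDiag)
    (ht : ∀ v, v ≠ w → valence Γ (inr v) = 3) (h1 : loops Γ = 1) (he : e + 1 = 2 * (m + 1)) :
    loopPiece n (m + 1) (e + 1) K (cl K (split Γ (inr w) {a, b}) + cl K (split Γ (inr w) {b, q}) +
    cl K (split Γ (inr w) {q, a})) = 0 := by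
  refine hw.sum_induction (P := fun x => loopPiece n (m + 1) (e + 1) K x = 0) (map_zero _)
    fun {q a b} hw hI => ?_
  have hT : ∀ {p q a b}, Quad Γ w p q a b → IsTrivalent (split Γ (inr w) {a, b}) :=
    fun hw => ⟨split_loopless hl, valence_split_quad hw ht⟩
  -- the three classes add up to the differential of `Γ`, so the edges may be renamed
  have hren : ∀ {p' q' a' b'}, Quad Γ w p' q' a' b' →
      loopPiece n (m + 1) (e + 1) K (cl K (split Γ (inr w) {a', b'}) +
        cl K (split Γ (inr w) {b', q'}) + cl K (split Γ (inr w) {q', a'})) = 0 →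
      loopPiece n (m + 1) (e + 1) K (cl K (split Γ (inr w) {a, b}) +
        cl K (split Γ (inr w) {b, q}) + cl K (split Γ (inr w) {q, a})) = 0 := by
    intro p' q' a' b' hw' h
    rw [← mk_splitSum K (by omega) hw]
    rwa [← mk_splitSum K (by omega) hw'] at h
  obtain ⟨_, _, _, _, _, hL⟩ := hI.exists_isLoop (by rw [loops_split_inr, h1]) he
  obtain ⟨v, i, f, g, y, z, A, s, L, Us, hv, hf, hb, hg, hs, hp, hk⟩ := hL.exists_step (Fin.last e)
  have hnew : ∀ {x y : Vtx n (m + 1)}, split Γ (inr w) {a, b} (Fin.last e) = s(x, y) →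
      ∃ v, y = inr v := by
    intro x y h
    have : y ∈ split Γ (inr w) {a, b} (Fin.last e) := by rw [h]; simp
    rw [mem_split_last, up_inr, newV_def] at this
    exact this.elim (fun h => ⟨_, h⟩) fun h => ⟨_, h⟩
  rcases hk with rfl | hk | rfl
  · -- the new edge joins the loop to a tree
    obtain ⟨v', rfl⟩ := hnew hf
    obtain ⟨c, d, yc, yd, A₁, A₂, s₁, s₂, hv', hc, hd, b1, b2, rfl, rfl⟩ := hb.inr_inv
    obtain ⟨p', q', a', b', hw', rfl, rfl, rfl, rfl, e1, e2⟩ := hw.exists_near hl hv hv' hf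
    obtain ⟨_, _, _, _, _, _, _, _, _, ε, l1, l2, l3⟩ := hw'.isLoop_of_loop hl e2 hc b1 e2 hd b2 e1
      hg hs e1 (by simpa using hp)
    exact hren hw' (Quad.loopPiece_sum_of_loop (hT hw') (hT hw'.rot) (hT hw'.rot.rot) he l1 l2 l3)
  · -- the new edge belongs to a tree hanging off the loop
    obtain ⟨u, u', B, t, L', Us', k1, k2, k3, k4, k5⟩ := hb.exists_up hf hk
    cases k3 with
    | nil => exact absurd rfl k5
    | @cons v₁ _ f₁ g₁ _ y₁ z₁ _ Q L₁ r Us₁ hv₁ hf₁ hb₁ hg₁ hs₁ =>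
    obtain ⟨v', rfl⟩ := hnew k1
    obtain ⟨c, d, yc, yd, A₁, A₂, s₁, s₂, hv', hc, hd, b1, b2, rfl, rfl⟩ := k2.inr_inv
    obtain ⟨p', q', a', b', hw', rfl, rfl, rfl, rfl, e1, e2⟩ :=
      hw.exists_near hl hv₁.rot.rot hv' k1
    have hp' : (i :: (Fin.last e :: (a'.castSucc :: (A₁ ++ b'.castSucc :: A₂) ++
        q'.castSucc :: Q) ++ (L₁ ++ f :: L))).Perm (finRange (e + 1)) := by
      refine List.Perm.trans ?_ hp
      rw [perm_iff_count]
      grind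
    have hp2 : (i :: (Fin.last e :: (b'.castSucc :: (A₂ ++ q'.castSucc :: Q) ++
        a'.castSucc :: A₁) ++ (L₁ ++ f :: L))).Perm (finRange (e + 1)) := by
      refine List.Perm.trans ?_ hp'
      rw [perm_iff_count]
      grind
    have hp3 : (i :: (Fin.last e :: (q'.castSucc :: (Q ++ a'.castSucc :: A₁) ++
        b'.castSucc :: A₂) ++ (L₁ ++ f :: L))).Perm (finRange (e + 1)) := by
      refine List.Perm.trans ?_ hp'
      rw [perm_iff_count]
      grind
    -- rotating the three subtrees moves an odd block past an even one
    have hsign : ∀ {h₁ h₂ h₃ : Fin (e + 1)} {B₁ B₂ B₃ : List (Fin (e + 1))}, Even B₂.length →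
        Even B₃.length → (i :: (Fin.last e :: (h₁ :: (B₁ ++ h₂ :: B₂) ++
        h₃ :: B₃) ++ (L₁ ++ f :: L))).Perm (finRange (e + 1)) →
        listSign (i :: (Fin.last e :: (h₁ :: (B₁ ++ h₂ :: B₂) ++ h₃ :: B₃) ++ (L₁ ++ f :: L))) =
        listSign (i :: (Fin.last e :: (h₂ :: (B₂ ++ h₃ :: B₃) ++ h₁ :: B₁) ++ (L₁ ++ f :: L))) := by
      intro h₁ h₂ h₃ B₁ B₂ B₃ E₂ E₃ h
      have := listSign_swap_even [i, Fin.last e] (h₁ :: B₁) (h₂ :: B₂ ++ h₃ :: B₃) (L₁ ++ f :: L)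
        (by simpa using h.nodup_iff.2 (nodup_finRange _)) (by
          refine Even.mul_left ?_ _
          simp only [List.length_append, List.length_cons]
          grind)
      simpa using this
    obtain ⟨_, _, l1⟩ := hw'.isLoop_of_tree hl e1 hg₁ e2 hc b1 e2 hd b2 e1 hf₁ hb₁ hs₁ hv hg hs hp'
    obtain ⟨_, _, l2⟩ := hw'.rot.isLoop_of_tree hl e1 hg₁ e2 hd b2 e1 hf₁ hb₁ e2 hc b1
      hs₁ hv hg hs hp2
    obtain ⟨_, _, l3⟩ := hw'.rot.rot.isLoop_of_tree hl e1 hg₁ e1 hf₁ hb₁ e2 hc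
      b1 e2 hd b2 hs₁ hv hg hs hp3
    rw [← hsign hb₁.even b1.even hp2, ← hsign b2.even hb₁.even hp'] at l3
    rw [← hsign b2.even hb₁.even hp'] at l2
    refine hren hw' ?_
    rw [map_add, map_add, l1.loopPiece_eq (hT hw') he, l2.loopPiece_eq (hT hw'.rot) he,
      l3.loopPiece_eq (hT hw'.rot.rot) he]
    -- the Jacobi identity, multiplied by the words of the trees on the way to the loop
    have hj := lieW_foldl (K := K) (s₁ := s₁ * s₂ * r) (s₂ := s₂ * r * s₁) (s₃ := r * s₁ * s₂) (by
        simp only [lieW_mul, bracket_def]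
        noncomm_ring) Us₁
    rw [← smul_add, ← smul_add, ← map_add, ← map_add, prodW_cons, prodW_cons, prodW_cons,
      ← add_mul, ← add_mul, hj, zero_mul, map_zero, smul_zero]
  · -- the new edge belongs to the loop
    obtain ⟨v', rfl⟩ := hnew hg
    cases hs with
    | nil => exact absurd rfl hv.2.1
    | @cons _ _ f' g' _ y' z' _ A' L' t Us' hv' hf' hb' hg' hs' =>
    obtain ⟨p', q', a', b', hw', rfl, rfl, rfl, rfl, e1, e2⟩ := hw.exists_near hl hv.swap hv' hg
    have hw2 : Quad Γ w p' b' q' a' := hw'.rot.rot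
    obtain ⟨_, _, _, _, _, _, _, _, _, ε, l1, l2, l3⟩ := hw2.isLoop_of_loop hl e1 hf hb e2 hf' hb' e2
      hg' hs' e1 (by
        refine List.Perm.trans ?_ hp
        rw [perm_iff_count]
        intro h
        simp only [count_cons, count_append]
        omega)
    exact hren hw2 (Quad.loopPiece_sum_of_loop (hT hw2) (hT hw2.rot) (hT hw2.rot.rot) he l1 l2 l3)

end

section

/-! ### Loops with legs -/

variable {k : ℕ}
variable {r : ℕ} {w : Fin k → Fin n}

theorem hairLoop_odd (hr : r < k) (h : 2 * r + 1 < 2 * k) :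
    hairLoop w ⟨2 * r + 1, h⟩ = s(inr ⟨r, hr⟩, inr ⟨(r + 1) % k, Nat.mod_lt _ (by omega)⟩) := by
  have h1 : (2 * r + 1) % 2 ≠ 0 := by omega
  have h2 : (2 * r + 1) / 2 = r := by omega
  simp only [hairLoop, h1, if_false, h2]

theorem hairLoop_even (hr : r < k) (h : 2 * r < 2 * k) :
    hairLoop w ⟨2 * r, h⟩ = s(inr ⟨r, hr⟩, inl (w ⟨r, hr⟩)) := by
  have h1 : (2 * r) % 2 = 0 := by omega
  have h2 : (2 * r) / 2 = r := by omega
  simp only [hairLoop, h1, if_true, h2]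

theorem mem_hairLoop (hr : r < k) (h : Fin (2 * k)) : inr ⟨r, hr⟩ ∈ hairLoop w h ↔ (h : ℕ) =
    (2 * r + 2 * k - 1) % (2 * k) ∨ (h : ℕ) = 2 * r ∨ (h : ℕ) = 2 * r + 1 := by
  have e1 : (2 * r + 2 * k - 1) % (2 * k) = if r = 0 then 2 * k - 1 else 2 * r - 1 := by
    split_ifs with h0
    · subst h0
      rw [Nat.mod_eq_of_lt] <;> omega
    · rw [show 2 * r + 2 * k - 1 = (2 * r - 1) + 2 * k by omega, Nat.add_mod_right,
        Nat.mod_eq_of_lt (by omega)]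
  obtain ⟨h, hh⟩ := h
  rw [e1]
  obtain ⟨a, rfl | rfl⟩ := Nat.even_or_odd' h
  · rw [hairLoop_even (by omega), Sym2.mem_iff]
    simp only [inr.injEq, Fin.mk.injEq, reduceCtorEq, or_false]
    split_ifs <;> omega
  · rw [hairLoop_odd (by omega), Sym2.mem_iff]
    simp only [inr.injEq, Fin.mk.injEq]
    rcases eq_or_ne (a + 1) k with h0 | h0
    · rw [h0, Nat.mod_self]
      split_ifs <;> omega
    · rw [Nat.mod_eq_of_lt (by omega)]
      split_ifs <;> omega

theorem tri_hairLoop (hk : 2 ≤ k) (hr : r < k) : Tri (hairLoop w) ⟨r, hr⟩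
    ⟨(2 * r + 2 * k - 1) % (2 * k), Nat.mod_lt _ (by omega)⟩ ⟨2 * r, by omega⟩
    ⟨2 * r + 1, by omega⟩ := by
  have h0 : (2 * r + 2 * k - 1) % (2 * k) ≠ 2 * r ∧ (2 * r + 2 * k - 1) % (2 * k) ≠ 2 * r + 1 := by
    rcases r with _ | r
    · rw [Nat.mod_eq_of_lt (by omega)]
      omega
    · rw [show 2 * (r + 1) + 2 * k - 1 = 2 * r + 1 + 2 * k by omega, Nat.add_mod_right,
        Nat.mod_eq_of_lt (by omega)]
      omega
  refine ⟨fun h => h0.1 (congrArg Fin.val h), fun h => h0.2 (congrArg Fin.val h),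
    fun h => by simp at h, fun h => ?_⟩
  rw [mem_hairLoop, Fin.ext_iff, Fin.ext_iff, Fin.ext_iff]

/-- The loop with legs `w`, read from its last edge. -/
theorem isLoop_hairLoop (hk : 2 ≤ k) : ∃ i x x',
    IsLoop (hairLoop w) i x x' ((ofFn w).map FreeMagma.of) (-1) := by
  have : NeZero k := ⟨by omega⟩
  have : NeZero (2 * k) := ⟨by omega⟩
  let E : ℕ → Fin (2 * k) := Fin.ofNat (2 * k)
  let V : ℕ → Fin k := Fin.ofNat k
  -- the edges met on the walk from the vertex `t` over `d` vertices; indices are taken cyclically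
  let L : ℕ → ℕ → List (Fin (2 * k)) := fun t d =>
    (List.range' t d).flatMap fun r => [E (2 * r + 2 * k - 1), E (2 * r)]
  have hmod : ∀ a b, a = b + 2 * k → E a = E b := by
    rintro _ b rfl
    exact Fin.ext (Nat.add_mod_right ..)
  have hE : ∀ a (h : a < 2 * k), E a = ⟨a, h⟩ := fun a h => Fin.ext (Nat.mod_eq_of_lt h)
  have hV : ∀ a (h : a < k), V a = ⟨a, h⟩ := fun a h => Fin.ext (Nat.mod_eq_of_lt h)
  have hsp : ∀ d t, t + d = k → Spine (hairLoop w) (inr (V t)) (E (2 * t + 2 * k - 1))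
      (inr (V k)) (E (2 * k + 2 * k - 1)) (L t d)
      ((List.range' t d).map fun r => FreeMagma.of (w (V r))) := by
    intro d
    induction d with
    | zero =>
      rintro t rfl
      exact Spine.nil _ _
    | succ d ih =>
      intro t ht
      have h1 := ih (t + 1) (by omega)
      rw [hmod (2 * (t + 1) + 2 * k - 1) (2 * t + 1) (by omega)] at h1
      have hv : Tri (hairLoop w) (V t) (E (2 * t + 2 * k - 1)) (E (2 * t)) (E (2 * t + 1)) := by
        rw [hV t (by omega), hE (2 * t) (by omega), hE (2 * t + 1) (by omega)]
        exact tri_hairLoop hk _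
      refine Spine.cons (L := L (t + 1) d) hv (y := inl (w (V t))) ?_ (Branch.leaf _ _) ?_ h1
      · rw [hE _ (by omega), hV _ (by omega), hairLoop_even (by omega)]
      · rw [hE _ (by omega), hV _ (by omega), hairLoop_odd (by omega)]
        rfl
  have hL : ∀ d t, L t d ++ [E (2 * (t + d) + 2 * k - 1)] = E (2 * t + 2 * k - 1) ::
      (List.range' t d).flatMap fun r => [E (2 * r), E (2 * r + 1)] := by
    intro d
    induction d with
    | zero => intro t; rfl
    | succ d ih =>
      intro t
      have h1 := ih (t + 1)
      rw [hmod (2 * (t + 1) + 2 * k - 1) (2 * t + 1) (by omega),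
        show t + 1 + d = t + (d + 1) by omega] at h1
      simp only [L, List.range'_succ, List.flatMap_cons, cons_append, nil_append] at h1 ⊢
      rw [h1]
  have hfin : ((List.range' 0 k).flatMap fun r => [E (2 * r), E (2 * r + 1)]) =
      finRange (2 * k) := by
    refine List.map_injective_iff.2 Fin.val_injective ?_
    have key : ∀ d, d ≤ k → ((List.range d).flatMap fun r => [E (2 * r), E (2 * r + 1)]).map Fin.val =
        List.range (2 * d) := by
      intro d
      induction d with
      | zero => intro _; rfl
      | succ d ih =>
        intro hd
        rw [List.range_succ, List.flatMap_append, List.map_append, ih (by omega),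
          show 2 * (d + 1) = 2 * d + 1 + 1 by ring, List.range_succ, List.range_succ,
          List.flatMap_singleton, hE (2 * d) (by omega), hE (2 * d + 1) (by omega)]
        simp
    rw [← List.range_eq_range', key k le_rfl, List.map_coe_finRange_eq_range]
  have hk0 := hL k 0
  rw [hfin, zero_add, hmod (2 * k + 2 * k - 1) (2 * 0 + 2 * k - 1) (by omega)] at hk0
  have h1 := hsp k 0 (zero_add k)
  rw [hmod (2 * k + 2 * k - 1) (2 * 0 + 2 * k - 1) (by omega),
    show V k = V 0 from Fin.ext (by simp [V])] at h1
  have h2 : (List.range' 0 k).map (fun r => FreeMagma.of (w (V r))) =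
      (ofFn w).map FreeMagma.of := by
    refine List.ext_getElem (by simp) fun r h3 h4 => ?_
    simp only [List.getElem_map, List.getElem_range', List.getElem_ofFn, zero_add, one_mul]
    rw [hV]
  generalize hi : E (2 * 0 + 2 * k - 1) = i at h1 hk0
  have hne : L 0 k ≠ [] := by
    grind
  obtain ⟨M, hM⟩ : ∃ M, L 0 k = i :: M := by
    rcases hc : L 0 k with _ | ⟨b, M⟩
    all_goals grind
  rw [hM] at hk0 h1
  have hMf : M ++ [i] = finRange (2 * k) := (List.cons.inj hk0).2
  have hp : (i :: M).Perm (finRange (2 * k)) := by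
    grind
  -- the walk starts with the last edge, which has to pass an odd number of others
  have hs : listSign (i :: M) = -1 := by
    have := listSign_swap_odd [] [i] M [] (by simpa using hp.nodup_iff.2 (nodup_finRange _))
      (by simp) (by
        have := congrArg List.length hMf
        simp at this
        rw [Nat.odd_iff]
        omega)
    simp only [append_nil, nil_append, cons_append] at this
    rw [this, hMf, listSign_finRange]
  obtain ⟨x', h3⟩ := h1.isLoop hp
  rw [hs, h2] at h3
  exact ⟨_, _, _, h3⟩

theorem prodW_map_of (l : List (Fin n)) : prodW K (l.map FreeMagma.of) = wd l := by
  induction l with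
  | nil => rfl
  | cons a l ih => rw [List.map_cons, prodW_cons, ih, lieW_of, ← wd_append, List.singleton_append]

theorem loopPiece_hairLoop (hI : IsICG (hairLoop w)) (hk : k ≠ 0) : loops (hairLoop w) = 1 ∧
    loopPiece n k (2 * k) K (cl K (hairLoop w)) = (-1 : K) ^ k • cyc (toAss (wd (ofFn w).reverse)) -
    cyc (toAss (wd (ofFn w))) := by
  have h2 : 2 ≤ k := by
    by_contra hc
    obtain rfl : k = 1 := by omega
    refine hI.loopless ⟨2 * 0 + 1, by omega⟩ ?_
    rw [hairLoop_odd (by omega)]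
    simp
  obtain ⟨i, x, x', h⟩ := isLoop_hairLoop (w := w) h2
  have h1 : loops (hairLoop w) = 1 :=
    (loops_of_valence hI.loopless fun v => (tri_hairLoop h2 v.2).valence_eq).trans (by omega)
  refine ⟨h1, ?_⟩
  have := loopPiece_cl (K := K) ⟨hairLoop w, hI⟩
  rw [this, if_pos ⟨h1, rfl⟩, h.loopWord_eq, loopVal_apply, prodW_map_of, ← prodW_map_of,
    anti_prodW, ← List.map_reverse, prodW_map_of, prodW_map_of, List.length_map, List.length_ofFn, map_smul,
    map_smul]
  push_cast
  module

end

section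

/-! ### Graphs with one loop are determined by their cyclic words -/

variable {i' j' : Fin e}

/-- A walk is determined by the trees hanging off it, up to the names of the vertices and edges. -/
theorem Spine.unique (h : Spine Γ x i y j L Ts) (h' : Spine Γ' x' i' y' j' L' Ts) : ∃ V V' : List
    (Fin m), L.length = 2 * V.length ∧ V'.length = V.length ∧ L'.length = L.length ∧
    (Ts ≠ [] → ∀ v, x = inr v → v ∈ V) ∧ (Ts ≠ [] → ∀ v, x' = inr v → v ∈ V') ∧
    (∀ f ∈ L, f ≠ i → ∀ v, inr v ∈ Γ f → v ∈ V) ∧ (∀ f ∈ L', f ≠ i' → ∀ v, inr v ∈ Γ' f → v ∈ V') ∧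
    ∀ τ : Fin m → Fin m, V' = V.map τ → (Ts ≠ [] → x' = Sum.map id τ x) ∧ (y' = Sum.map id τ y →
    x' = Sum.map id τ x ∧ (L' ++ [j']).tail.map Γ' = (L ++ [j]).tail.map fun f => (Γ f).map
    (Sum.map id τ)) := by
  induction h generalizing x' i' L' with
  | nil x i =>
    cases h' with
    | nil => exact ⟨[], [], rfl, rfl, rfl, by simp, by simp, by simp, by simp, fun τ _ =>
        ⟨by simp, fun h => ⟨h, rfl⟩⟩⟩
  | @cons v i f g j y z w A L s Ts hv hf hb hg hs ih =>
    cases h' with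
    | @cons v' _ f' g' _ p' z' _ A' L' _ _ hv' hf' hb' hg' hs' =>
    obtain ⟨V, V', a1, a2, a3, a4, a5, a6, a7⟩ := hb.unique hb'
    obtain ⟨U, U', c1, c2, c0, c3, c4, c5, c6, c7⟩ := ih hs'
    have l1 := hb.length_eq
    have l2 := hb'.length_eq
    have key : ∀ {Γ : EdgeSeq n m e} {v : Fin m} {f : Fin e} {x : Vtx n m} {V : List (Fin m)},
        Γ f = s(inr v, x) → (∀ w, x = inr w → w ∈ V) → ∀ w, inr w ∈ Γ f → w = v ∨ w ∈ V := by
      intro Γ v f x V hf hx w hw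
      rw [hf, Sym2.mem_iff] at hw
      rcases hw with hw | hw
      · exact Or.inl (inr.inj hw)
      · exact Or.inr (hx w hw.symm)
    have hne : ∀ {Γ : EdgeSeq n m e} {z w : Vtx n m} {g j : Fin e} {L : List (Fin e)},
        Spine Γ z g w j L Ts → g ∈ L → Ts ≠ [] := by
      rintro Γ z w g j L h hg rfl
      cases h
      simp at hg
    refine ⟨v :: (V ++ U), v' :: (V' ++ U'), ?_, by simp [a2, c2], ?_, ?_, ?_, ?_, ?_, ?_⟩
    · grind
    · grind
    · grind
    · grind
    · intro c hc hci w hw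
      simp only [List.mem_cons, List.mem_append] at hc ⊢
      grind
    · intro c hc hci w hw
      simp only [List.mem_cons, List.mem_append] at hc ⊢
      grind
    · intro τ hτ
      rw [List.map_cons, List.map_append] at hτ
      injection hτ with h3 h4
      obtain ⟨h5, h6⟩ := List.append_inj h4 (by simp [a2])
      obtain ⟨d1, d2⟩ := a7 τ h5
      refine ⟨fun _ => by rw [h3]; rfl, fun hy => ⟨by rw [h3]; rfl, ?_⟩⟩
      obtain ⟨d3, d4⟩ := (c7 τ h6).2 hy
      have hg1 : ∀ {Γ : EdgeSeq n m e} {z w : Vtx n m} {g j : Fin e} {L : List (Fin e)},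
          Spine Γ z g w j L Ts → L ++ [j] = g :: (L ++ [j]).tail := by
        intro Γ z w g j L h
        rcases h.eq_nil_or with ⟨rfl, -, -, rfl⟩ | ⟨L', rfl⟩ <;> rfl
      simp only [cons_append, List.tail_cons, append_assoc, List.map_cons,
        List.map_append, d2, hf, hf', Sym2.map_mk, h3, d1, Sum.map_inr]
      have e1 : (L' ++ [j']).map Γ' = (L ++ [j]).map fun f => (Γ f).map (Sum.map id τ) := by
        rw [hg1 hs, hg1 hs', List.map_cons, List.map_cons, d4, hg, hg', Sym2.map_mk, h3, d3,
          Sum.map_inr]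
      grind

theorem IsLoop.unique (hΓ : IsTrivalent Γ) (hΓ' : IsTrivalent Γ') (he : e = 2 * m)
    (h : IsLoop Γ i x u Ts ε) (h' : IsLoop Γ' i' x' u' Ts ε') : (ε : K) • cl K Γ = (ε' : K) • cl K
    Γ' := by
  obtain ⟨-, L, h1, hL, rfl⟩ := h
  obtain ⟨-, L', h1', hL', rfl⟩ := h'
  obtain ⟨V, V', a1, a2, -, -, -, a3, a4, a5⟩ := h1.unique h1'
  have hlen := hL.length_eq
  rw [List.length_finRange] at hlen
  have hT : Ts ≠ [] := by
    rintro rfl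
    cases h1
    exact absurd (hL.mem_iff.2 (mem_finRange i)) (by simp)
  have key : ∀ {Γ : EdgeSeq n m e} {i : Fin e} {L : List (Fin e)} {V : List (Fin m)},
      IsTrivalent Γ → V.length = m → L.Perm (finRange e) →
      (∀ f ∈ L, f ≠ i → ∀ v, inr v ∈ Γ f → v ∈ V) → V.Perm (finRange m) := by
    intro Γ i L V hΓ hV hL h
    refine perm_finRange_of_length hV fun v => ?_
    obtain ⟨f, hf, hfi⟩ := Finset.exists_mem_ne
      (s := univ.filter fun f => inr v ∈ Γ f) (by have := hΓ.2 v; unfold valence at this; omega) i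
    exact h f (hL.mem_iff.2 (mem_finRange f)) hfi v (by simpa using hf)
  obtain ⟨σ, τ, hr, hs⟩ := exists_relabel (Γ := Γ) (Γ' := Γ') hL hL'
    (key hΓ (by omega) hL a3) (key hΓ' (by omega) hL' a4) (by
    intro τ hτ
    obtain ⟨b1, b2⟩ := a5 τ hτ
    have b3 := (b2 (b1 hT)).2
    rcases h1.eq_nil_or with ⟨-, h, -⟩ | ⟨M, rfl⟩
    · exact absurd h hT
    rcases h1'.eq_nil_or with ⟨-, h, -⟩ | ⟨M', rfl⟩
    · exact absurd h hT
    simp only [cons_append, List.tail_cons, List.map_append, List.map_cons, List.map_nil] at b3 ⊢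
    obtain ⟨b4, b5⟩ := List.append_inj' b3 rfl
    rw [b4, (List.cons.inj b5).1])
  rw [cl_relabel K hr, smul_smul, hs]
  congr 1
  push_cast
  ring

theorem Spine.split (h : Spine Γ x i y j L (Ts ++ Us)) : ∃ z k L₁ L₂, L = L₁ ++ L₂ ∧
    Spine Γ x i z k L₁ Ts ∧ Spine Γ z k y j L₂ Us := by
  induction Ts generalizing x i L with
  | nil => exact ⟨x, i, [], L, rfl, Spine.nil _ _, h⟩
  | cons s Ts ih =>
    cases h with
    | cons hv hf hb hg hs =>
      obtain ⟨z, k, L₁, L₂, rfl, h1, h2⟩ := ih hs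
      exact ⟨z, k, _, L₂, by simp, Spine.cons hv hf hb hg h1, h2⟩

theorem IsLoop.rotate (h : IsLoop Γ i x u (Ts ++ Us) ε) : ∃ j y z, IsLoop Γ j y z (Us ++ Ts) ε := by
  obtain ⟨-, L, h1, hL, rfl⟩ := h
  obtain ⟨z, k, L₁, L₂, rfl, h2, h3⟩ := h1.split
  have hL' := List.perm_append_comm.trans hL
  obtain ⟨z', h4⟩ := (h3.append h2).isLoop hL'
  have := listSign_swap_even [] L₁ L₂ [] (by simpa using hL.nodup_iff.2 (nodup_finRange _))
    (h2.even.mul_right _)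
  simp only [nil_append, append_nil] at this
  exact ⟨k, z, z', this ▸ h4⟩

theorem IsLoop.length_eq (h : IsLoop Γ i x u Ts ε) : e = 2 * (Ts.map FreeMagma.length).sum := by
  obtain ⟨-, L, h1, hL, -⟩ := h
  have key : ∀ {x y i j L Ts}, Spine Γ x i y j L Ts →
      L.length = 2 * (Ts.map FreeMagma.length).sum := by
    intro x y i j L Ts h
    induction h with
    | nil => rfl
    | cons hv hf hb hg hs ih =>
      have := hb.length_eq
      grind
  rw [← key h1, hL.length_eq, List.length_finRange]

/-- In a graph with one loop, a tree `s * t` hanging off the loop can be replaced by the commutator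
of the trees `s` and `t`, modulo coboundaries. -/
theorem IsLoop.exists_expand [CharZero K] (hΓ : IsTrivalent Γ) (he : e = 2 * m)
    (h : IsLoop Γ i x u (s * t :: Ts) ε) : ∃ (Γ₁ Γ₂ : EdgeSeq n m e) (i₁ i₂ : Fin e)
    (x₁ x₂ u₁ u₂ : Vtx n m) (ε₁ ε₂ : ℤ), IsTrivalent Γ₁ ∧ IsTrivalent Γ₂ ∧ IsLoop Γ₁ i₁ x₁ u₁
    (s :: t :: Ts) ε₁ ∧ IsLoop Γ₂ i₂ x₂ u₂ (t :: s :: Ts) ε₂ ∧ (ε : K) • cl K Γ -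
    ((ε₁ : K) • cl K Γ₁ - (ε₂ : K) • cl K Γ₂) ∈ bdPiece n m e K 1 := by
  obtain ⟨-, L, h1, hL, -⟩ := id h
  cases h1 with
  | @cons v _ f g _ y z _ A L _ _ hv hf hb hg hs =>
  obtain ⟨v', rfl⟩ : ∃ v', y = inr v' := by
    cases hb
    exact ⟨_, rfl⟩
  obtain ⟨c, d, yc, yd, A₁, A₂, s₁, s₂, hv', hc, hd, b1, b2, rfl, hst⟩ := hb.inr_inv
  obtain ⟨rfl, rfl⟩ := mul_inj_magma hst
  have hn := hL.nodup_iff.2 (nodup_finRange _)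
  obtain ⟨L, rfl⟩ : ∃ L', L = g :: L' := by
    rcases hs.eq_nil_or with ⟨-, -, -, h⟩ | h
    · exact absurd h.symm hv.2.1
    · exact h
  have hn' : [i, g, c, d].Nodup := by
    grind
  rcases m with _ | m
  · exact v.elim0
  obtain ⟨e, rfl⟩ : ∃ e', e = e' + 1 := ⟨2 * m + 1, by omega⟩
  obtain ⟨σ, τ, Γ₀, w, p', q', a', b', hr, hQ, hl, ht, e1, e2, e3, e4, e5, e6, e7⟩ :=
    exists_contract hΓ hv hv' hn'
  have r1 := hr.edge hc
  have r2 := hr.edge hd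
  have r3 := hr.edge hg
  have r4 := hr.branch b1
  have r5 := hr.branch b2
  have r6 := hr.spine hs
  have hvx : ∀ v, vtxEquiv n τ (inr v) = inr (τ v) := fun _ => rfl
  simp only [e2, e3, e4, e5, e6, e7, hvx] at r1 r2 r3 r4 r5 r6
  have hp := perm_map_finRange hL σ⁻¹
  simp only [List.map_cons, List.map_append, e1, e2, e3, e4, e5, cons_append] at hp r6
  have i1 : IsEnd w w.castSucc := Or.inl rfl
  have i2 : IsEnd w (Fin.last m) := Or.inr rfl
  obtain ⟨_, _, _, _, _, _, _, _, _, ε₁, l1, l2, l3⟩ := hQ.isLoop_of_loop hl i2 r1 r4 i2 r2 r5 i1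
    r3 r6 i1 (by simpa using hp)
  have hT : ∀ {p q a b}, Quad Γ₀ w p q a b → IsTrivalent (KV.split Γ₀ (inr w) {a, b}) :=
    fun hw => ⟨split_loopless hl, valence_split_quad hw ht⟩
  have hlp : loops Γ₀ = 1 := by
    rw [← loops_split_inr (w := w) (S := {a', b'}), loops_of_valence (hT hQ).1 (hT hQ).2]
    omega
  refine ⟨_, _, _, _, _, _, _, _, -ε₁, ε₁, hT hQ.rot, hT hQ.rot.rot, l2, l3, ?_⟩
  rw [h.unique (K := K) hΓ (hT hQ) he l1]
  convert smul_mem _ (ε₁ : K) (hQ.sum_mem_bdPiece (K := K) hl ht hlp (by omega)) using 1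
  push_cast
  module

end

section

variable (n m e) (K) in
/-- The class, modulo coboundaries, of a loop with legs `u`. -/
def loopClass (u : List (Fin n)) : Piece n m e K ⧸ bdPiece n m e K 1 := by
  classical exact
    if h : ∃ p : EdgeSeq n m e × ℤ, IsTrivalent p.1 ∧
        ∃ i x x', IsLoop p.1 i x x' (u.map FreeMagma.of) p.2 then
      (bdPiece n m e K 1).mkQ ((h.choose.2 : K) • cl K h.choose.1)
    else 0

theorem IsLoop.loopClass_eq (hΓ : IsTrivalent Γ) (he : e = 2 * m) {u : List (Fin n)}
    (h : IsLoop Γ i x x' (u.map FreeMagma.of) ε) :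
    loopClass n m e K u = (bdPiece n m e K 1).mkQ ((ε : K) • cl K Γ) := by
  have h1 : ∃ p : EdgeSeq n m e × ℤ, IsTrivalent p.1 ∧
      ∃ i x x', IsLoop p.1 i x x' (u.map FreeMagma.of) p.2 := ⟨(Γ, ε), hΓ, i, x, x', h⟩
  rw [loopClass, dif_pos h1]
  obtain ⟨h2, _, _, _, h3⟩ := h1.choose_spec
  rw [h3.unique (K := K) h2 hΓ he h]

theorem loopClass_append_comm (he : e = 2 * m) (u v : List (Fin n)) :
    loopClass n m e K (u ++ v) = loopClass n m e K (v ++ u) := by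
  have key : ∀ {u v : List (Fin n)} {Γ : EdgeSeq n m e} {i x x' ε},
      IsLoop Γ i x x' ((u ++ v).map FreeMagma.of) ε →
      ∃ i x x', IsLoop Γ i x x' ((v ++ u).map FreeMagma.of) ε := by
    intro u v Γ i x x' ε h
    rw [List.map_append] at h ⊢
    exact h.rotate
  by_cases h : ∃ p : EdgeSeq n m e × ℤ, IsTrivalent p.1 ∧
      ∃ i x x', IsLoop p.1 i x x' ((u ++ v).map FreeMagma.of) p.2
  · obtain ⟨p, h1, _, _, _, h2⟩ := h
    obtain ⟨_, _, _, h3⟩ := key h2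
    rw [h2.loopClass_eq h1 he, h3.loopClass_eq h1 he]
  · rw [loopClass, loopClass, dif_neg h, dif_neg]
    rintro ⟨p, h1, _, _, _, h2⟩
    exact h ⟨p, h1, key h2⟩

theorem loopClass_rotate (he : e = 2 * m) (u : List (Fin n)) (r : ℕ) :
    loopClass n m e K (u.rotate r) = loopClass n m e K u := by
  rw [List.rotate_eq_drop_append_take_mod, loopClass_append_comm he, List.take_append_drop]

variable (n m e) (K) in
/-- The linear map which sends each word of length `m` to the class of the loop with these legs. -/
def ofWords : Ass n K →ₗ[K] Piece n m e K ⧸ bdPiece n m e K 1 :=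
  ∑ u : Fin m → Fin n, (LinearMap.proj (ofFn u)).smulRight (loopClass n m e K (ofFn u))

theorem ofWords_apply (a : Ass n K) : ofWords n m e K a =
    ∑ u : Fin m → Fin n, a (ofFn u) • loopClass n m e K (ofFn u) := by
  simp [ofWords]

theorem ofWords_cyc (he : e = 2 * m) (a : Ass n K) :
    ofWords n m e K (cyc a) = (m : K) • ofWords n m e K a := by
  have h1 : ∀ u : Fin m → Fin n, cyc a (ofFn u) • loopClass n m e K (ofFn u) =
      ∑ r ∈ range m, a ((ofFn u).rotate r) • loopClass n m e K ((ofFn u).rotate r) := by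
    intro u
    simp only [loopClass_rotate he, ← Finset.sum_smul]
    congr 1
    change ∑ r ∈ range (ofFn u).length, _ = _
    rw [List.length_ofFn]
  rw [ofWords_apply, Finset.sum_congr rfl fun u _ => h1 u, Finset.sum_comm, ofWords_apply,
    Nat.cast_smul_eq_nsmul, ← Finset.card_range m, ← Finset.sum_const, Finset.card_range]
  refine Finset.sum_congr rfl fun r hr => ?_
  have : NeZero m := ⟨by have := Finset.mem_range.1 hr; omega⟩
  refine Eq.trans ?_ (Equiv.sum_comp (Equiv.arrowCongr (Equiv.addRight (Fin.ofNat m r)).symm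
    (Equiv.refl _)) fun u => a (ofFn u) • loopClass n m e K (ofFn u))
  refine Finset.sum_congr rfl fun u _ => ?_
  have h2 : (ofFn u).rotate r = ofFn (Equiv.arrowCongr
      (Equiv.addRight (Fin.ofNat m r)).symm (Equiv.refl (Fin n)) u) := by
    refine List.ext_getElem (by simp) fun k h3 h4 => ?_
    simp [List.getElem_rotate, Fin.add_def]
  rw [h2]

theorem ofWords_mul_comm [CharZero K] (he : e = 2 * m) (hm : m ≠ 0) (p q : NCP n K) :
    ofWords n m e K (toAss (p * q)) = ofWords n m e K (toAss (q * p)) := by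
  have h := ofWords_cyc (K := K) he (toAss (p * q))
  rw [toAss_mul, cyc_mul_comm, ofWords_cyc he, ← toAss_mul, ← toAss_mul] at h
  exact (smul_right_injective _ (Nat.cast_ne_zero.2 hm) h).symm

/-- Modulo coboundaries a graph with one loop is recovered from its word. -/
theorem IsLoop.ofWords_eq [CharZero K] (hΓ : IsTrivalent Γ) (he : e = 2 * m)
    (h : IsLoop Γ i x x' Ts ε) : ofWords n m e K (toAss (prodW K Ts)) = (bdPiece n m e K 1).mkQ
    ((ε : K) • cl K Γ) := by
  induction hd : m - Ts.length using Nat.strong_induction_on generalizing Γ i x x' Ts ε with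
  | _ d ih =>
  by_cases hT : ∀ s ∈ Ts, ∃ k, s = FreeMagma.of k
  · -- all trees are leaves
    obtain ⟨u, rfl⟩ : ∃ u : List (Fin n), Ts = u.map FreeMagma.of := by
      clear h hd
      induction Ts with
      | nil => exact ⟨[], rfl⟩
      | cons s Ts ih =>
        obtain ⟨k, rfl⟩ := hT s (by simp)
        obtain ⟨u, rfl⟩ := ih fun s hs => hT s (by simp [hs])
        exact ⟨k :: u, rfl⟩
    have hl : u.length = m := by
      have := h.length_eq
      rw [List.map_map, show FreeMagma.length ∘ FreeMagma.of = fun _ : Fin n => 1 from rfl,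
        List.map_const', List.sum_replicate, smul_eq_mul, mul_one] at this
      omega
    subst hl
    rw [prodW_map_of, ofWords_apply, Finset.sum_eq_single u.get]
    · rw [toAss_wd, List.ofFn_get, if_pos rfl, one_smul, h.loopClass_eq hΓ he]
    · intro v _ hv
      rw [toAss_wd, if_neg, zero_smul]
      intro hc
      refine hv (List.ofFn_injective ?_)
      rw [hc, List.ofFn_get]
    · simp
  -- expand a tree `s * t` into its two parts: the loops so obtained have one more tree
  · push Not at hT
    obtain ⟨p, hp, hp'⟩ := hT
    obtain ⟨s, t, rfl⟩ : ∃ s t, p = s * t := by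
      cases p with
      | of k => exact absurd rfl (hp' k)
      | mul s t => exact ⟨s, t, rfl⟩
    obtain ⟨Vs, Ws, rfl⟩ := List.append_of_mem hp
    obtain ⟨j, y, y', h1⟩ := h.rotate
    obtain ⟨Γ₁, Γ₂, i₁, i₂, x₁, x₂, u₁, u₂, ε₁, ε₂, hT₁, hT₂, l1, l2, h2⟩ :=
      h1.exists_expand (K := K) hΓ he
    have hlen := h.length_eq
    have key : ∀ {Us : List (BTree n)}, Us.length ≤ (Us.map FreeMagma.length).sum :=
      fun {Us} => by
        simpa using List.length_le_sum_of_one_le (Us.map FreeMagma.length) (by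
          simp only [List.mem_map]
          rintro _ ⟨s, -, rfl⟩
          exact s.length_pos)
    have d1 := l1.length_eq
    have d2 := key (Us := s :: t :: (Ws ++ Vs))
    change e = 2 * (List.map FreeMagma.length (s :: t :: (Ws ++ Vs))).sum at d1
    change IsLoop Γ₁ i₁ x₁ u₁ (s :: t :: (Ws ++ Vs)) ε₁ at l1
    change IsLoop Γ₂ i₂ x₂ u₂ (t :: s :: (Ws ++ Vs)) ε₂ at l2
    simp only [List.length_cons, List.length_append] at d2 hd
    have e1 := ih _ (by simp only [List.length_cons, List.length_append]; omega) hT₁ l1 rfl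
    have e2 := ih _ (by simp only [List.length_cons, List.length_append]; omega) hT₂ l2 rfl
    rw [prodW_append, ofWords_mul_comm he (by omega), ← prodW_append]
    have h3 : (bdPiece n m e K 1).mkQ ((ε : K) • cl K Γ) = _ := (Submodule.Quotient.eq _).2 h2
    rw [h3, ← Submodule.mkQ_apply, map_sub, ← e1, ← e2]
    simp only [cons_append, prodW_cons, lieW_mul, bracket_def, sub_mul, mul_assoc, map_sub]

theorem ofWords_loopPiece [CharZero K] (he : e = 2 * m) {Γ : Gph n m e} (hl : loops Γ.1 = 1) :
    ofWords n m e K (loopPiece n m e K (cl K Γ.1)) = (2 * m : K) • (bdPiece n m e K 1).mkQ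
    (cl K Γ.1) := by
  obtain ⟨i, x, x', Ts, ε, h⟩ := Γ.2.exists_isLoop hl he
  have hT : IsTrivalent Γ.1 := ⟨Γ.2.loopless, Γ.2.valence_eq_three (by omega)⟩
  have hε : (ε : K) * ε = 1 := by
    obtain ⟨-, L, -, -, rfl⟩ := h
    exact_mod_cast congrArg (Int.cast (R := K)) (listSign_mul_self L)
  have hs : ((-1 : K) ^ Ts.length) * (-1) ^ Ts.length = 1 := by
    rw [← pow_add, Even.neg_one_pow ⟨_, rfl⟩]
  rw [h.loopPiece_eq hT he, map_smul, loopVal_apply, map_sub, ofWords_cyc he, ofWords_cyc he,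
    anti_prodW, map_smul, map_smul, h.ofWords_eq hT he, h.reverse.ofWords_eq hT he]
  push_cast
  simp only [map_smul, smul_smul, ← sub_smul]
  congr 1
  linear_combination (m : K) * (1 + (-1) ^ Ts.length * (-1) ^ Ts.length) * hε + (m : K) * hs

/-- A combination of graphs with one loop all of whose cyclic words cancel is a coboundary. -/
theorem mem_bdPiece_of_loopPiece [CharZero K] (he : e = 2 * m) {z : Piece n m e K} (hz : z ∈ span K
    {y | ∃ Γ : Gph n m e, loops Γ.1 = 1 ∧ y = (Rel n m e K).mkQ (Finsupp.single Γ 1)})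
    (h : loopPiece n m e K z = 0) : z ∈ bdPiece n m e K 1 := by
  rcases eq_or_ne m 0 with rfl | hm
  · refine (Submodule.span_le (p := bdPiece n 0 e K 1)).2 ?_ hz
    rintro _ ⟨Γ, hΓ, rfl⟩
    obtain ⟨i, -⟩ := Γ.2.exists_isLoop hΓ he
    exact absurd i.2 (by omega)
  · have h1 : ofWords n m e K (loopPiece n m e K z) = (2 * m : K) • (bdPiece n m e K 1).mkQ z := by
      clear h
      induction hz using span_induction with
      | mem x hx =>
        obtain ⟨Γ, hΓ, rfl⟩ := hx
        rw [← cl_of]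
        exact ofWords_loopPiece he hΓ
      | zero => simp
      | add x y _ _ hx hy => rw [map_add, map_add, map_add, hx, hy, smul_add]
      | smul c x _ hx => rw [map_smul, map_smul, map_smul, hx, smul_comm]
    rw [h, map_zero] at h1
    refine (Submodule.Quotient.mk_eq_zero _).1 ((smul_eq_zero.1 h1.symm).resolve_left ?_)
    exact mul_ne_zero two_ne_zero (Nat.cast_ne_zero.2 hm)

end

section

/-! ### Closing up trees, and the divergence -/

variable {j : Fin n}

/-- The value of `∂_j` on the word of a branch is a sum over the paths from the root to the leaves
labelled `j`: such a path contributes the product of the words of the trees which branch off. -/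
theorem Branch.sum_spine (h : Branch Γ x i A s) {M : Type*} [AddCommGroup M] [Module K M]
    (φ : NCP n K →ₗ[K] M) (F : Fin e → M) (P : List (Fin e)) (hn : (P ++ i :: A).Nodup) (hF : ∀ g L
    Us, Spine Γ x i (inl j) g L Us → (L ++ [g]).Perm (i :: A) → F g =
    (listSign (P ++ (L ++ [g])) : K) • φ (prodW K Us)) : (if x = inl j then F i else 0) +
    ((A.filter (inl j ∈ Γ ·)).map F).sum = (listSign (P ++ i :: A) : K) • φ (pdP j (lieW s)) := by
  induction h generalizing M P with
  | leaf k i =>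
    simp only [inl.injEq, List.filter_nil, List.map_nil, List.sum_nil, add_zero, lieW_of]
    have h1 : (wd [k] : NCP n K) = wd ([] ++ [k]) := rfl
    rw [h1, pdP_concat]
    split_ifs with hk
    · subst hk
      rw [hF _ _ _ (Spine.nil _ _) (List.Perm.refl _)]
      rfl
    · simp
  | @node v i f g x y A B s t hv hf hg h1 h2 ih1 ih2 =>
    have key : ∀ {f : Fin e} {x : Vtx n m} {C : List (Fin e)}, Γ f = s(inr v, x) →
        (((f :: C).filter (inl j ∈ Γ ·)).map F).sum =
          (if x = inl j then F f else 0) + ((C.filter (inl j ∈ Γ ·)).map F).sum := by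
      intro f x C hf
      rw [List.filter_cons]
      have : inl j ∈ Γ f ↔ x = inl j := by
        grind
      by_cases hx : x = inl j <;> simp [this, hx]
    have perm : ∀ P : List (Fin e), (P ++ i :: f :: (A ++ g :: B)).Perm
        (P ++ i :: g :: (B ++ f :: A)) := by
      intro P
      rw [perm_iff_count]; intro a; simp only [count_cons, count_append]; omega
    have e1 := ih1 (φ ∘ₗ LinearMap.mulLeft K (lieW t)) F (P ++ i :: g :: B) (by
        rw [append_assoc]
        exact (perm P).nodup_iff.1 hn) fun k L Us hs hp => by
      rw [hF k _ _ (Spine.cons hv.swap hg h2 hf hs) (by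
        have := (hp.append_left (i :: g :: B)).trans (perm []).symm
        simpa using this), prodW_cons]
      simp
    have e2 := ih2 (φ ∘ₗ LinearMap.mulLeft K (lieW s)) F (P ++ i :: f :: A) (by
        rw [append_assoc]
        exact hn) fun k L Us hs hp => by
      rw [hF k _ _ (Spine.cons hv hf h1 hg hs) (by
        simpa using hp.append_left (i :: f :: A)), prodW_cons]
      simp
    -- the minus sign of the bracket: both blocks are odd
    have e3 := listSign_swap_odd (P ++ [i]) (f :: A) (g :: B) [] (by simpa using hn)
      (by simpa using h1.even.add_one) (by simpa using h2.even.add_one)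
    simp only [append_nil, append_assoc, cons_append, nil_append] at e1 e2 e3
    rw [if_neg (by simp), zero_add, ← cons_append, List.filter_append, List.map_append,
      List.sum_append, key hf, key hg, cons_append, e1, e2, e3, lieW_mul, bracket_def, map_sub, pdP_mul, pdP_mul,
      aug_lieW, aug_lieW]
    simp only [zero_smul, add_zero, map_sub, LinearMap.comp_apply, LinearMap.mulLeft_apply]
    push_cast
    module

variable (K) in
/-- The word of the path in a tree which starts at the external vertex `j` through the edge `f` and
returns to `j` through the edge `g`, as a sum over rotations. -/
def walkVal (Γ : EdgeSeq n m e) (j : Fin n) (f g : Fin e) : Ass n K := by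
  classical exact
    if h : ∃ p : Vtx n m × List (Fin e) × List (BTree n), Γ f = s(inl j, p.1) ∧
        Spine Γ p.1 f (inl j) g p.2.1 p.2.2 ∧ p.2.1 ≠ [] ∧
        (p.2.1 ++ [g]).Perm (finRange e) then
      (listSign (h.choose.2.1 ++ [g]) : K) • cyc (toAss (wd [j] * prodW K h.choose.2.2))
    else 0

theorem Spine.walkVal_eq (h : Spine Γ x f (inl j) g L Ts) (hf : Γ f = s(inl j, x)) (hL : L ≠ [])
    (hp : (L ++ [g]).Perm (finRange e)) : walkVal K Γ j f g = (listSign (L ++ [g]) : K) • cyc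
    (toAss (wd [j] * prodW K Ts)) := by
  have h1 : ∃ p : Vtx n m × List (Fin e) × List (BTree n), Γ f = s(inl j, p.1) ∧
        Spine Γ p.1 f (inl j) g p.2.1 p.2.2 ∧ p.2.1 ≠ [] ∧
        (p.2.1 ++ [g]).Perm (finRange e) := ⟨(x, L, Ts), hf, h, hL, hp⟩
  rw [walkVal, dif_pos h1]
  obtain ⟨c1, c2, c3, c4⟩ := h1.choose_spec
  generalize h1.choose = p at *
  obtain ⟨x', L', Us⟩ := p
  obtain rfl := Sym2.other_eq hf c1
  have hg : ∀ {L : List (Fin e)}, (L ++ [g]).Perm (finRange e) → g ∉ L.tail := by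
    intro L hp hg
    have := hp.nodup_iff.2 (nodup_finRange _)
    simp only [List.nodup_append, List.mem_singleton] at this
    exact this.2.2 _ (List.mem_of_mem_tail hg) _ rfl rfl
  obtain ⟨δ, d1, -, d3⟩ := c2.det (K := K) h (hg c4) (hg hp) (by simp [c3, hL])
  have d4 := d3 [] [g] (c4.nodup_iff.2 (nodup_finRange _))
  simp only [nil_append] at d4
  have hδ : (δ : K) * δ = 1 := by
    have h1 := listSign_mul_self (L ++ [g])
    have h2 := listSign_mul_self (L' ++ [g])
    rw [d4] at h2
    exact_mod_cast congrArg (Int.cast (R := K))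
      (show δ * δ = 1 by linear_combination h2 - δ * δ * h1)
  simp only [d1, d4, mul_smul_comm, map_smul, smul_smul]
  congr 1
  push_cast
  linear_combination (listSign (L ++ [g]) : K) * hδ

theorem Spine.split_leg (h : Spine Γ x i y g L Ts) (hy : y = inl j)
    (hL : L ≠ []) (hn : ∀ f ∈ L.tail, f ∉ S) (hg : g ∈ S) :
    Spine (KV.split Γ (inl j) S) (up x) i.castSucc newV g.castSucc (L.map Fin.castSucc) Ts := by
  induction h with
  | nil => exact absurd rfl hL
  | @cons v i f g' k y z w A L s Ts hv hf hb hg' hs ih =>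
    simp only [List.tail_cons, List.mem_cons, List.mem_append] at hn
    have hu : ∀ w i f g, (inl j : Vtx n m) = inr w → ¬ Tri Γ w i f g := by simp
    simp only [List.map_cons, List.map_append]
    refine Spine.cons (hv.split (by simp)) (split_of_notMem' (hn f (by tauto)) hf)
      (hb.split hu fun a ha => hn a (by tauto)) (z := if L = [] then newV else up z) ?_ ?_
    · rcases hs.eq_nil_or with ⟨rfl, -, rfl, rfl⟩ | ⟨L', rfl⟩
      · rw [if_pos rfl, split_of_mem hg (by rw [hg', hy, Sym2.eq_swap]) (by simp), Sym2.eq_swap]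
        rfl
      · rw [if_neg (by simp), split_of_notMem' (hn g' (by simp)) hg']
        rfl
    · rcases eq_or_ne L [] with rfl | hL'
      · rw [if_pos rfl]
        obtain ⟨-, rfl, rfl, rfl⟩ | ⟨_, h⟩ := hs.eq_nil_or
        · exact Spine.nil _ _
        · cases h
      · rw [if_neg hL']
        exact ih hy hL' (fun a ha => hn a (by have := List.mem_of_mem_tail ha; tauto)) hg

/-- Joining the two ends of a path at an external vertex `j` to a new vertex gives a graph with one
loop, which also has a leg `j`. -/
theorem Spine.isLoop_split (h : Spine Γ x f (inl j) g L Ts) (hf : Γ f = s(inl j, x))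
    (hl : ∀ i, ¬ (Γ i).IsDiag) (hL : L ≠ []) (hp : (L ++ [g]).Perm (finRange e)) : ∃ y z, IsLoop
    (KV.split Γ (inl j) {f, g}) g.castSucc y z (FreeMagma.of j :: Ts) (listSign (L ++ [g])) := by
  have hxj : x ≠ inl j := by
    rintro rfl
    exact hl f (by rw [hf]; simp)
  obtain ⟨L', rfl⟩ : ∃ L', L = f :: L' := by
    rcases h.eq_nil_or with ⟨h, -⟩ | h
    exacts [absurd h hL, h]
  have hn := hp.nodup_iff.2 (nodup_finRange _)
  simp only [cons_append, nodup_cons, List.mem_append, List.mem_singleton, not_or,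
    List.nodup_append] at hn
  have hgm : inl j ∈ Γ g := by
    obtain ⟨u, -, h1, -⟩ := h.reverse hf
    rw [h1]
    simp
  have hS : ∀ a ∈ ({f, g} : Finset (Fin e)), inl j ∈ Γ a := by
    grind
  have hv : Tri (KV.split Γ (inl j) {f, g}) (Fin.last m) g.castSucc (Fin.last e) f.castSucc := by
    refine ⟨(Fin.castSucc_ne_last g), fun h => hn.1.2 (Fin.castSucc_injective _ h).symm,
      (Fin.castSucc_ne_last f).symm, fun k => ?_⟩
    induction k using Fin.lastCases with
    | last => simp [mem_split_last, newV_def]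
    | cast k =>
      rw [← newV_def, mem_split_newV]
      grind
  have h1 := h.split_leg (S := {f, g}) rfl hL (by
    simp only [List.tail_cons, mem_insert, mem_singleton, not_or]
    exact fun a ha => ⟨fun hc => hn.1.1 (hc ▸ ha), hn.2.2.2 a ha g rfl⟩) (by simp)
  have h2 := Spine.cons hv (split_last.trans Sym2.eq_swap) (Branch.leaf j _)
    (split_of_mem (by simp) hf hxj) h1
  have hlast : ∀ l : List (Fin e), listSign (l.map Fin.castSucc ++ [Fin.last e]) = listSign l := by
    intro l
    induction l with
    | nil => rfl
    | cons a l ih =>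
      simp only [List.map_cons, cons_append, listSign, ih]
      simp [List.countP_append, List.countP_map, Function.comp_def, Fin.le_last]
  have hp' : (g.castSucc :: Fin.last e :: ([] ++ (f :: L').map Fin.castSucc)).Perm
      (finRange (e + 1)) := by
    rw [List.finRange_succ_last]
    refine List.Perm.trans ?_ ((hp.map Fin.castSucc).append_right [Fin.last e])
    rw [perm_iff_count]
    grind
  have hs := listSign_swap_even [] [g.castSucc, Fin.last e] ((f :: L').map Fin.castSucc) [] (by
    simpa using hp'.nodup_iff.2 (nodup_finRange _)) (Even.mul_right (by simp) _)
  have hs' := hlast ((f :: L') ++ [g])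
  obtain ⟨z, h3⟩ := Spine.isLoop h2 hp'
  refine ⟨inr (Fin.last m), z, ?_⟩
  convert h3 using 1
  rw [← hs']
  simpa using hs.symm

end

section

variable {j : Fin n}

theorem IsICG.exists_root (h : IsICG Γ) (h0 : loops Γ = 0) (he : e = 2 * m + 1) (hf : inl j ∈ Γ f) :
    ∃ x A s, Γ f = s(inl j, x) ∧ Branch Γ x f A s ∧ (f :: A).Perm (finRange e) ∧ leafVal K Γ j f =
    (listSign (f :: A) : K) • toAss (lieW s) := by
  have key : ∀ {x s z ε}, Full Γ f x (inl j) s z ε → ∃ x A s, Γ f = s(inl j, x) ∧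
      Branch Γ x f A s ∧ (f :: A).Perm (finRange e) ∧
      leafVal K Γ j f = (listSign (f :: A) : K) • toAss (lieW s) := by
    rintro x s z ε ⟨A, M, h1, h2, h3, h4, -⟩
    have h5 := leafVal_eq (K := K) h1 h2 h3 h4
    rw [h3.inl_inv.1, append_nil] at h4 h5
    exact ⟨x, A, s, h1.trans Sym2.eq_swap, h2, h4, h5⟩
  obtain ⟨x, x', s, z, ε, hF⟩ := h.exists_full h0 he f
  have h1 := hF.choose_spec.choose_spec.1
  rw [h1, Sym2.mem_iff] at hf
  rcases hf with rfl | rfl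
  · exact key hF.symm
  · exact key hF

/-- Splitting an external vertex of a tree along two of its edges. -/
theorem IsICG.loopPiece_split_pair [CharZero K] (h : IsICG Γ) (h0 : loops Γ = 0)
    (he : e = 2 * m + 1) (hf : inl j ∈ Γ f) (hg : inl j ∈ Γ g) (hfg : f ≠ g)
    (hT : IsTrivalent (split Γ (inl j) {f, g})) : loopPiece n (m + 1) (e + 1) K
    (cl K (split Γ (inl j) {f, g})) = walkVal K Γ j f g + walkVal K Γ j g f := by
  obtain ⟨x, A, s, h1, h2, h3, -⟩ := h.exists_root (K := K) h0 he hf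
  have hgA : g ∈ A := by
    grind
  obtain ⟨u, u', B, t, L, Us, c1, c2, c3, c4, c5⟩ := h2.exists_up h1 hgA
  obtain rfl : u' = inl j := by
    cases c3 with
    | nil => exact absurd rfl c5
    | cons =>
      grind
  rw [c2.inl_inv.1, nil_append] at c4
  have hp : (L ++ [f]).Perm (finRange e) :=
    (List.perm_append_comm.trans (c4.cons f)).trans h3
  have c1' := c1.trans Sym2.eq_swap
  obtain ⟨u₂, L', d1, d2, d3, d4⟩ := c3.reverse c1'
  obtain rfl := Sym2.other_eq h1 (d1.trans Sym2.eq_swap)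
  have d5 := d4 [] [] (hp.nodup_iff.2 (nodup_finRange _))
  have hL' : L' ≠ [] := by
    grind
  obtain ⟨y, z, hloop⟩ := c3.isLoop_split c1' h.loopless c5 hp
  rw [Finset.pair_comm] at hloop
  rw [hloop.loopPiece_eq hT (by omega), c3.walkVal_eq c1' c5 hp, d2.walkVal_eq h1 hL' (d3.trans hp),
    prodW_cons, lieW_of, loopVal_apply, anti_mul, anti_prodW, ← lieW_of, anti_lieW, lieW_of]
  simp only [nil_append] at d5
  rw [d5]
  have hc : cyc (toAss (prodW K Us.reverse * wd [j])) = cyc (toAss (wd [j] * prodW K Us.reverse)) := by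
    rw [toAss_mul, cyc_mul_comm, ← toAss_mul]
  simp only [smul_mul_assoc, mul_neg, map_smul, map_neg, hc]
  push_cast
  have hs : ((-1 : K) ^ Us.length) * (-1) ^ Us.length = 1 := by
    rw [← pow_add, Even.neg_one_pow ⟨_, rfl⟩]
  simp only [sub_neg_eq_add, smul_add, smul_smul]
  rw [add_comm]
  congr 2
  linear_combination (listSign (L' ++ [g]) : K) * hs

theorem sum_powersetCard_two {ι M : Type*} [DecidableEq ι] [AddCommMonoid M] (E : Finset ι)
    (V : Finset ι → M) (W : ι → ι → M) (h : ∀ f ∈ E, ∀ g ∈ E, f ≠ g → V {f, g} = W f g + W g f) : ∑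
    S ∈ E.powersetCard 2, V S = ∑ f ∈ E, ∑ g ∈ E.erase f, W f g := by
  have h1 : ∑ f ∈ E, ∑ g ∈ E.erase f, W f g = ∑ p ∈ E.offDiag, W p.1 p.2 := by
    rw [Finset.sum_sigma']
    refine Finset.sum_bij' (fun p _ => (p.1, p.2)) (fun p _ => ⟨p.1, p.2⟩) ?_ ?_ ?_ ?_ ?_ <;>
      simp +contextual [eq_comm]
  have h0 := Finset.sum_fiberwise_of_maps_to (s := E.offDiag) (t := E.powersetCard 2)
    (g := fun p : ι × ι => {p.1, p.2}) (fun p hp => ?_) fun p => W p.1 p.2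
  · rw [h1, ← h0]
    refine Finset.sum_congr rfl fun S hS => ?_
    obtain ⟨hS1, hS2⟩ := mem_powersetCard.1 hS
    obtain ⟨f, g, hfg, rfl⟩ := card_eq_two.1 hS2
    have hf := hS1 (mem_insert_self f _)
    have hg := hS1 (mem_insert_of_mem (mem_singleton_self g))
    have h2 : E.offDiag.filter (fun p => ({p.1, p.2} : Finset ι) = {f, g}) = {(f, g), (g, f)} := by
      grind
    rw [h f hf g hg hfg, h2, Finset.sum_pair (by simp [hfg])]
  · rw [mem_offDiag] at hp
    refine mem_powersetCard.2 ⟨?_, card_pair hp.2.2⟩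
    simp [insert_subset_iff, hp.1, hp.2.1]

theorem IsICG.sum_walkVal (h : IsICG Γ) (h0 : loops Γ = 0) (he : e = 2 * m + 1) (hf : inl j ∈ Γ f) :
    ∑ g ∈ (univ.filter fun g => inl j ∈ Γ g).erase f, walkVal K Γ j f g = cyc
    (Ass.mul (Ass.X j) (Ass.pd j (leafVal K Γ j f))) := by
  obtain ⟨x, A, s, h1, h2, h3, h4⟩ := h.exists_root (K := K) h0 he hf
  have hx : x ≠ inl j := by
    rintro rfl
    exact h.loopless f (by rw [h1]; simp)
  have hn := h3.nodup_iff.2 (nodup_finRange _)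
  have key := h2.sum_spine (j := j) (K := K) (cyc ∘ₗ toAss ∘ₗ LinearMap.mulLeft K (wd [j]))
    (walkVal K Γ j f) [] (by simpa using hn) fun g L Us hs hp => by
      rw [hs.walkVal_eq h1 ?_ (hp.trans h3)]
      · rfl
      · rintro rfl
        cases hs
        exact hx rfl
  rw [if_neg hx, zero_add] at key
  have h5 : ∑ g ∈ (univ.filter fun g => inl j ∈ Γ g).erase f, walkVal K Γ j f g =
      ((A.filter (inl j ∈ Γ ·)).map (walkVal K Γ j f)).sum := by
    rw [← List.sum_toFinset _ ((List.nodup_cons.1 hn).2.filter _)]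
    refine Finset.sum_congr ?_ fun _ _ => rfl
    ext g
    have h6 := h3.mem_iff (a := g)
    have h7 := (List.nodup_cons.1 hn).1
    simp only [List.mem_cons, mem_finRange, iff_true] at h6
    simp only [mem_erase, mem_filter, mem_univ, true_and, List.mem_toFinset, List.mem_filter,
      decide_eq_true_eq]
    constructor
    · rintro ⟨a1, a2⟩
      exact ⟨h6.resolve_left a1, a2⟩
    · rintro ⟨a1, a2⟩
      exact ⟨fun hc => h7 (hc ▸ a1), a2⟩
  rw [h5, key, h4, ← map_smul toAss, ← toAss_pdP, ← toAss_X (K := K), ← toAss_mul, map_smul (pdP j),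
    mul_smul_comm, map_smul, map_smul]
  rfl

/-- The cyclic word of the part of the differential of a tree which creates a loop is the divergence
of the derivation attached to the tree. -/
theorem loopPiece_splitSum [CharZero K] (Γ : Gph n m e) (h0 : loops Γ.1 = 0) (he : e = 2 * m + 1) :
    loopPiece n (m + 1) (e + 1) K
    ((Rel n (m + 1) (e + 1) K).mkQ (splitSum K (fun Δ => loops Δ = loops Γ.1 + 1) Γ.1)) = cyc
    (∑ j, Ass.mul (Ass.X j) (Ass.pd j (treeWord K Γ.1 j))) := by
  have hv := Γ.2.valence_eq_three (by omega)
  have hT : ∀ {j} {S : Finset (Fin e)}, (∀ i ∈ S, inl j ∈ Γ.1 i) → S.card = 2 →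
      IsTrivalent (split Γ.1 (inl j) S) := by
    intro j S hS hc
    refine ⟨split_loopless Γ.2.loopless, fun v => ?_⟩
    induction v using Fin.lastCases with
    | last => rw [← newV_def, valence_split_newV hS, hc]
    | cast v => rw [← up_inr, valence_split_of_ne (by simp), hv]
  -- splitting an internal vertex creates no loop
  have hin : ∀ v S, (Rel n (m + 1) (e + 1) K).mkQ (splitTerm K
      (fun Δ => loops Δ = loops Γ.1 + 1) Γ.1 (inr v) S) = 0 := by
    intro v S
    rw [mk_splitTerm, if_neg]
    rw [loops_split_inr]
    omega
  -- only the splittings along two edges of an external vertex contribute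
  have hex : ∀ j S, loopPiece n (m + 1) (e + 1) K ((Rel n (m + 1) (e + 1) K).mkQ (splitTerm K
      (fun Δ => loops Δ = loops Γ.1 + 1) Γ.1 (inl j) S)) =
      if S ∈ (univ.filter fun g => inl j ∈ Γ.1 g).powersetCard 2 then
        loopPiece n (m + 1) (e + 1) K (cl K (split Γ.1 (inl j) S)) else 0 := by
    intro j S
    have hsub : S ⊆ univ.filter (fun g => inl j ∈ Γ.1 g) ↔ ∀ i ∈ S, inl j ∈ Γ.1 i := by
      simp [subset_iff]
    rw [mk_splitTerm]
    simp only [mem_powersetCard, hsub]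
    by_cases hS : ∀ i ∈ S, inl j ∈ Γ.1 i
    · by_cases hc : S.card = 2
      · have := hT hS hc
        rw [if_pos ⟨hS, by rw [loops_of_valence this.1 this.2]; omega⟩, if_pos ⟨hS, hc⟩]
      · rw [if_neg (c := (∀ i ∈ S, inl j ∈ Γ.1 i) ∧ S.card = 2) fun h => hc h.2]
        split_ifs with h1
        · rw [cl_of_not, map_zero]
          intro hI
          have h2 := hI.valence_eq_three (by omega) (Fin.last m)
          rw [← newV_def, valence_split_newV hS] at h2
          omega
        · rw [map_zero]
    · rw [if_neg fun h => hS h.1, if_neg fun h => hS h.1, map_zero]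
  rw [splitSum]
  simp only [map_add, map_smul, map_sum, hin, hex, sum_const_zero, smul_zero, add_zero]
  refine Finset.sum_congr rfl fun j _ => ?_
  rw [Finset.sum_ite_mem, univ_inter, sum_powersetCard_two _ _ (walkVal K Γ.1 j)]
  · have h1 : ∀ a b : Ass n K, Ass.pd j (a + b) = Ass.pd j a + Ass.pd j b := fun _ _ => rfl
    have h2 : ∑ f ∈ univ.filter (fun g => inl j ∈ Γ.1 g), leafVal K Γ.1 j f =
        treeWord K Γ.1 j := by
      rw [treeWord_eq_sum]
      refine Finset.sum_subset (subset_univ _) fun f _ hf => leafVal_of_notMem ?_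
      simpa using hf
    rw [← h2]
    have h3 : ∀ E : Finset (Fin e), Ass.mul (Ass.X j) (Ass.pd j (∑ f ∈ E, leafVal K Γ.1 j f)) =
        ∑ f ∈ E, Ass.mul (Ass.X j) (Ass.pd j (leafVal K Γ.1 j f)) := fun E => by
      have := map_sum ((assPlus n K).subtype ∘ₗ xpd K j) (leafVal K Γ.1 j) E
      exact this
    rw [h3, map_sum]
    exact Finset.sum_congr rfl fun f hf => Γ.2.sum_walkVal h0 he (by simpa using hf)
  · intro f hf g hg hfg
    simp only [mem_filter, mem_univ, true_and] at hf hg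
    exact Γ.2.loopPiece_split_pair h0 he hf hg hfg (hT (by
      simp only [mem_insert, mem_singleton]
      rintro i (rfl | rfl) <;> assumption) (card_pair hfg))

end

section

/-! ### One-loop graphs as cyclic words -/

variable {w : List (Fin n)} {x : ICG n K}

theorem isHomog_prodW (Ts : List (BTree n)) :
    IsHomog (Ts.map FreeMagma.length).sum (prodW K Ts) := by
  induction Ts with
  | nil => exact isHomog_wd []
  | cons s Ts ih =>
    rw [prodW_cons, List.map_cons, List.sum_cons]
    exact (isHomog_lieW s).mul ih

theorem cyc_eq_zero_of_isHomog {d : ℕ} {p : NCP n K} (hp : IsHomog d p)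
    (hw : w.length ≠ d) : cyc (toAss p) w = 0 := by
  change ∑ r ∈ range w.length, toAss p (w.rotate r) = 0
  exact sum_eq_zero fun r _ => hp _ (by rwa [List.length_rotate])

/-- A property of series which is closed under linear combinations holds for the image of
`loopPiece` if it holds for loops with trees hanging off them. -/
theorem loopPiece_induction {P : Ass n K → Prop} (h0 : P 0) (ha : ∀ a b, P a → P b → P (a + b))
    (hs : ∀ (c : K) a, P a → P (c • a))
    (h : ∀ Ts : List (BTree n), (Ts.map FreeMagma.length).sum = m → P (loopVal (prodW K Ts)))
    (y : Piece n m e K) : P (loopPiece n m e K y) := by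
  obtain ⟨y, rfl⟩ := mkQ_surjective _ y
  induction y using Finsupp.induction_linear with
  | zero => simpa using h0
  | add f g hf hg =>
    grind
  | single Γ c =>
    rw [← mul_one c, ← smul_eq_mul, ← Finsupp.smul_single, map_smul, map_smul]
    refine hs _ _ ?_
    rw [← cl_of, loopPiece_cl]
    split_ifs with hΓ
    · obtain ⟨_, _, _, Ts, ε, hL⟩ := Γ.2.exists_isLoop hΓ.1 hΓ.2
      rw [hL.loopWord_eq]
      exact hs _ _ (h Ts (by have := hL.length_eq; omega))
    · exact h0

theorem loopPiece_rotate (y : Piece n m e K) (w : List (Fin n)) (r : ℕ) :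
    loopPiece n m e K y (w.rotate r) = loopPiece n m e K y w :=
  loopPiece_induction (P := fun a => a (w.rotate r) = a w) rfl
    (fun a b ha hb => by rw [Pi.add_apply, Pi.add_apply, ha, hb])
    (fun c a ha => by rw [Pi.smul_apply, Pi.smul_apply, ha])
    (fun Ts _ => cyc_rotate _ w r) y

theorem loopPiece_isHomog (y : Piece n m e K) (hw : w.length ≠ m) : loopPiece n m e K y w = 0 :=
  loopPiece_induction (P := fun a => a w = 0) rfl
    (fun a b ha hb => by rw [Pi.add_apply, ha, hb, add_zero])
    (fun c a ha => by rw [Pi.smul_apply, ha, smul_zero])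
    (fun Ts h => by
      have h' : (Ts.reverse.map FreeMagma.length).sum = m := by
        rw [List.map_reverse, List.sum_reverse, h]
      rw [loopVal_apply, anti_prodW, map_smul, map_smul, Pi.sub_apply, Pi.smul_apply,
        cyc_eq_zero_of_isHomog (isHomog_prodW Ts) (by rwa [h]),
        cyc_eq_zero_of_isHomog (isHomog_prodW Ts.reverse) (by rwa [h']),
        smul_zero, sub_zero]) y

theorem loopPiece_nil (y : Piece n m e K) : loopPiece n m e K y [] = 0 :=
  loopPiece_induction (P := fun a => a [] = 0) rfl
    (fun a b ha hb => by rw [Pi.add_apply, ha, hb, add_zero])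
    (fun c a ha => by rw [Pi.smul_apply, ha, smul_zero])
    (fun _ _ => rfl) y

variable (n K) in
/-- The series of cyclic words of a series of graphs with one loop. -/
def loopSeries : ICG n K →ₗ[K] Ass n K where
  toFun x w := loopPiece n w.length (2 * w.length) K (x _ _) w
  map_add' x y := by
    funext w
    simp
  map_smul' c x := by
    funext w
    simp

theorem loopSeries_apply (x : ICG n K) (hm : w.length = m) (he : e = 2 * m) :
    loopSeries n K x w = loopPiece n m e K (x m e) w := by
  subst hm he
  rfl

theorem loopSeries_eq_zero_of_mem_B₁ [CharZero K] (hx : x ∈ B₁ n K 1 0) : loopSeries n K x = 0 := by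
  obtain ⟨y, hy, rfl⟩ := hx
  have key : ∀ m e, loopPiece n m e K (dLoop n K 0 y m e) = 0 := by
    intro m e
    rcases m with _ | m
    · exact map_zero _
    rcases e with _ | e
    · exact map_zero _
    change loopPiece n (m + 1) (e + 1) K (dPiece n m e K _ (y m e)) = 0
    by_cases he : e = 2 * m + 1
    · have h1 := hy.1 m e
      generalize y m e = z at h1
      induction h1 using span_induction with
      | zero => simp
      | add a b _ _ ha hb => rw [map_add, map_add, ha, hb, add_zero]
      | smul c a _ ha => rw [map_smul, map_smul, ha, smul_zero]
      | mem a ha =>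
        obtain ⟨Γ, h0, rfl⟩ := ha
        change loopPiece n (m + 1) (e + 1) K ((Rel n (m + 1) (e + 1) K).mkQ
          (dFree n m e K _ (Finsupp.single Γ 1))) = 0
        obtain ⟨w, hw4, hw3⟩ := Γ.2.exists_four (by omega)
        obtain ⟨p, q, a, b, hw⟩ := exists_quad hw4
        rw [dFree_single, mk_splitSum K (by omega) hw]
        exact hw.loopPiece_sum Γ.2.loopless hw3 h0 (by omega)
    · rw [hy.2 m e (by push_cast; omega), map_zero, map_zero]
  funext w
  exact congrFun (key _ _) w

theorem mem_B₁_of_loopSeries_eq_zero [CharZero K] (hx : x ∈ Z₁ n K 1 0)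
    (h : loopSeries n K x = 0) : x ∈ B₁ n K 1 0 := by
  rw [mem_B₁_iff]
  intro m e
  by_cases he : e = 2 * m
  · refine mem_bdPiece_of_loopPiece he (hx.1.1 m e) ?_
    funext w
    by_cases hw : w.length = m
    · rw [← loopSeries_apply x hw he, h]
    · exact loopPiece_isHomog _ hw
  · rw [hx.1.2 m e (by push_cast; omega)]
    exact zero_mem _

variable (n K) in
/-- The map which sends the class of a series of graphs with one loop to its series of cyclic words.
The division by the length compensates that `loopPiece` sums over all rotations of a word. -/
def loopMap [CharZero K] : E₁ n K 1 0 →ₗ[K] Tr n K :=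
  ((B₁ n K 1 0).submoduleOf (Z₁ n K 1 0)).liftQ
    (tr n K ∘ₗ avg n K ∘ₗ loopSeries n K ∘ₗ (Z₁ n K 1 0).subtype) fun x hx => by
      rw [LinearMap.mem_ker]
      change tr n K (avg n K (loopSeries n K x)) = 0
      have : loopSeries n K x = 0 := loopSeries_eq_zero_of_mem_B₁ hx
      rw [this, map_zero, map_zero]

theorem loopMap_cls₁ [CharZero K] (x : Z₁ n K 1 0) :
    loopMap n K (cls₁ n K 1 0 x) = tr n K (avg n K (loopSeries n K x)) := rfl

theorem loopMap_injective [CharZero K] : Injective (loopMap n K) := by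
  rw [← LinearMap.ker_eq_bot, LinearMap.ker_eq_bot']
  intro y hy
  obtain ⟨x, rfl⟩ := mkQ_surjective _ y
  refine (Submodule.Quotient.mk_eq_zero _).2 (mem_B₁_of_loopSeries_eq_zero x.2 ?_)
  exact eq_zero_of_tr_avg (fun w r => by
    rw [loopSeries_apply _ (List.length_rotate ..) rfl, loopPiece_rotate]
    rfl) (loopPiece_nil _) hy

/-- The value of `loopMap` on the loop with legs, with the sign of the walk around it. -/
theorem isCyclicWordMap_loopMap [CharZero K] : IsCyclicWordMap K (loopMap n K) := by
  intro k w hw hI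
  have hk : k ≠ 0 := by
    rintro rfl
    simp at hw
  obtain ⟨h1, h2⟩ := loopPiece_hairLoop (K := K) hI hk
  have hs : toICG n K (single K ⟨hairLoop w, hI⟩) k (2 * k) = cl K (hairLoop w) := by
    have := cl_of K ⟨hairLoop w, hI⟩
    rw [this]
    change (Rel n _ _ K).mkQ ((single K ⟨hairLoop w, hI⟩ : FormalSum n K) k (2 * k)) = _
    rw [single, Pi.single_eq_same, Pi.single_eq_same]
  have hz : ∀ m e, (m = k ∧ e = 2 * k) ∨ toICG n K (single K ⟨hairLoop w, hI⟩) m e = 0 := by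
    intro m e
    change _ ∨ (Rel n _ _ K).mkQ ((single K ⟨hairLoop w, hI⟩ : FormalSum n K) m e) = _
    by_cases hm : m = k
    · subst hm
      by_cases he : e = 2 * m
      · exact Or.inl ⟨rfl, he⟩
      · rw [single, Pi.single_eq_same, Pi.single_eq_of_ne he, map_zero]
        exact Or.inr rfl
    · rw [single, Pi.single_eq_of_ne hm]
      exact Or.inr (map_zero _)
  have hZ : toICG n K (single K ⟨hairLoop w, hI⟩) ∈ Z₁ n K 1 0 := by
    refine mem_Z₁_of_mem (fun m e => ?_) fun m e h => ?_
    · rcases hz m e with ⟨rfl, rfl⟩ | h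
      · rw [hs]
        exact subset_span ⟨⟨_, hI⟩, h1, cl_of K ⟨hairLoop w, hI⟩⟩
      · rw [h]
        exact zero_mem _
    grind
  refine ⟨hZ, ?_⟩
  -- the monomial of `l`, as a series without constant term
  let W : (l : List (Fin n)) → l ≠ [] → assPlus n K := fun l hl =>
    ⟨fun u => if u = l then 1 else 0, if_neg hl.symm⟩
  have hW : ∀ l hl, (W l hl : Ass n K) = toAss (wd l : NCP n K) :=
    fun l _ => funext fun u => (toAss_wd l u).symm
  have hw' : (ofFn w).reverse ≠ [] := by simpa using hw
  have h3 : loopSeries n K (toICG n K (single K ⟨hairLoop w, hI⟩)) =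
      cyc (((-1 : K) ^ k • W _ hw' - W _ hw : assPlus n K) : Ass n K) := by
    rw [Submodule.coe_sub, Submodule.coe_smul, map_sub, map_smul, hW _ hw', hW _ hw, ← h2]
    funext u
    by_cases hu : u.length = k
    · rw [loopSeries_apply _ hu rfl, hs]
    · rw [loopPiece_isHomog _ hu]
      rw [loopSeries_apply _ rfl rfl, (hz _ _).resolve_left fun h => hu h.1, map_zero,
        Pi.zero_apply]
  rw [loopMap_cls₁]
  change tr n K (avg n K (loopSeries n K (toICG n K (single K ⟨hairLoop w, hI⟩)))) = _
  rw [h3, tr_avg_cyc, map_sub, map_smul]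
  rfl

end

section

/-! ### The loop filtration and the divergence -/

section Filtration

variable {R R₁ R₂ : ℕ → ℕ → Prop} {x z : ICG n K} {P Q : ℕ → Prop} {p : ℕ}

theorem dRestr_mem_degPart {q : ℤ} (hx : x ∈ degPart n K q) :
    dRestr n K R x ∈ degPart n K (q + 1) := by
  intro m e h
  rcases m with _ | m
  · rfl
  rcases e with _ | e
  · rfl
  change dPiece n m e K R (x m e) = 0
  rw [hx m e (by push_cast at h; omega), map_zero]

theorem dRestr_mem_loopSpan (hx : x ∈ loopSpan n K P) (h : ∀ a b, P a → a ≤ b → R a b → Q b) :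
    dRestr n K R x ∈ loopSpan n K Q := by
  intro m e
  rcases m with _ | m
  · exact zero_mem _
  rcases e with _ | e
  · exact zero_mem _
  change dPiece n m e K R (x m e) ∈ _
  have h1 := hx m e
  generalize x m e = y at h1
  induction h1 using span_induction with
  | zero => rw [map_zero]; exact zero_mem _
  | add a b _ _ ha hb => rw [map_add]; exact add_mem ha hb
  | smul c a _ ha => rw [map_smul]; exact smul_mem _ _ ha
  | mem a ha =>
    obtain ⟨Γ, hΓ, rfl⟩ := ha
    change (Rel n (m + 1) (e + 1) K).mkQ (dFree n m e K _ (Finsupp.single Γ 1)) ∈ _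
    have h2 : ∀ v S, (Rel n (m + 1) (e + 1) K).mkQ
        (splitTerm K (fun Δ => R (loops Γ.1) (loops Δ)) Γ.1 v S) ∈
        span K {y | ∃ Γ : Gph n (m + 1) (e + 1), Q (loops Γ.1) ∧
          y = (Rel n (m + 1) (e + 1) K).mkQ (Finsupp.single Γ 1)} := by
      intro v S
      unfold splitTerm
      split_ifs with hc
      · exact subset_span ⟨⟨_, hc.1⟩, h _ _ hΓ (loops_le_split hc.1 hc.2.1) hc.2.2, rfl⟩
      · rw [map_zero]
        exact zero_mem _
    rw [dFree_single, splitSum, map_add, map_smul, map_sum, map_sum]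
    simp only [map_sum]
    exact add_mem (sum_mem fun _ _ => sum_mem fun _ _ => h2 _ _)
      (smul_mem _ _ (sum_mem fun _ _ => sum_mem fun _ _ => h2 _ _))

/-- The differentials restricted by the number of loops before and after a splitting are additive in
the restriction; only pairs `a ≤ b` matter. -/
theorem dRestr_add (h : ∀ a b, a ≤ b → (R a b ↔ R₁ a b ∨ R₂ a b)) (h' : ∀ a b, R₁ a b → ¬ R₂ a b)
    (x : ICG n K) : dRestr n K R x = dRestr n K R₁ x + dRestr n K R₂ x := by
  funext m e
  rcases m with _ | m
  · exact (add_zero (0 : Piece n 0 e K)).symm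
  rcases e with _ | e
  · exact (add_zero (0 : Piece n (m + 1) 0 K)).symm
  change dPiece n m e K R (x m e) = dPiece n m e K R₁ (x m e) + dPiece n m e K R₂ (x m e)
  obtain ⟨y, hy⟩ := mkQ_surjective _ (x m e)
  rw [← hy]
  suffices h1 : dFree n m e K R = dFree n m e K R₁ + dFree n m e K R₂ from
    congrArg (Rel n (m + 1) (e + 1) K).mkQ (LinearMap.congr_fun h1 y)
  refine Finsupp.lhom_ext' fun Γ => LinearMap.ext_ring ?_
  have h2 : ∀ v S, splitTerm K (fun Δ => R (loops Γ.1) (loops Δ)) Γ.1 v S =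
      splitTerm K (fun Δ => R₁ (loops Γ.1) (loops Δ)) Γ.1 v S +
      splitTerm K (fun Δ => R₂ (loops Γ.1) (loops Δ)) Γ.1 v S := by
    intro v S
    unfold splitTerm
    by_cases hc : IsICG (split Γ.1 v S) ∧ ∀ i ∈ S, v ∈ Γ.1 i
    -- splitting never decreases the number of loops
    · have h3 := h _ _ (loops_le_split hc.1 hc.2)
      have h4 := h' (loops Γ.1) (loops (split Γ.1 v S))
      by_cases h5 : R₁ (loops Γ.1) (loops (split Γ.1 v S))
      · rw [dif_pos ⟨hc.1, hc.2, h3.2 (Or.inl h5)⟩, dif_pos ⟨hc.1, hc.2, h5⟩,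
          dif_neg fun h => h4 h5 h.2.2, add_zero]
      · by_cases h6 : R₂ (loops Γ.1) (loops (split Γ.1 v S))
        · rw [dif_pos ⟨hc.1, hc.2, h3.2 (Or.inr h6)⟩, dif_neg fun h => h5 h.2.2,
            dif_pos ⟨hc.1, hc.2, h6⟩, zero_add]
        · rw [dif_neg fun h => (h3.1 h.2.2).elim h5 h6, dif_neg fun h => h5 h.2.2,
            dif_neg fun h => h6 h.2.2, add_zero]
    · rw [dif_neg fun h => hc ⟨h.1, h.2.1⟩, dif_neg fun h => hc ⟨h.1, h.2.1⟩,
        dif_neg fun h => hc ⟨h.1, h.2.1⟩, add_zero]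
  change dFree n m e K R (Finsupp.single Γ 1) =
    dFree n m e K R₁ (Finsupp.single Γ 1) + dFree n m e K R₂ (Finsupp.single Γ 1)
  simp only [dFree_single, splitSum, h2, sum_add_distrib, smul_add]
  abel

/-- Modulo two internal loops the differential of a series is `d₀ + d₁`. -/
theorem d_sub_mem_Fil (x : ICG n K) : d n K x - (dLoop n K 0 x + dLoop n K 1 x) ∈ Fil n K 2 := by
  rw [dRestr_add (R₁ := fun a b => b = a + 0) (R₂ := fun a b => a + 1 ≤ b)
    (by intros; simp; omega) (by intros; omega),
    dRestr_add (R := fun a b => a + 1 ≤ b) (R₁ := fun a b => b = a + 1) (R₂ := fun a b => a + 2 ≤ b)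
    (by intros; omega) (by intros; omega)]
  have h1 : x ∈ loopSpan n K fun _ => True := by
    intro m e
    obtain ⟨y, hy⟩ := mkQ_surjective _ (x m e)
    rw [← hy, ← Finsupp.sum_single y, Finsupp.sum, map_sum]
    refine sum_mem fun Γ _ => ?_
    rw [← mul_one (y Γ), ← smul_eq_mul, ← Finsupp.smul_single, map_smul]
    exact smul_mem _ _ (subset_span ⟨Γ, trivial, rfl⟩)
  convert dRestr_mem_loopSpan (R := fun a b => a + 2 ≤ b) (Q := (2 ≤ ·)) h1
    (by intros; omega) using 1
  abel

theorem loopPart_eq_self (hx : x ∈ Gr n K p) : loopPart n K p x = x := by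
  funext m e
  have h : span K {y | ∃ Γ : Gph n m e, loops Γ.1 = p ∧
      y = (Rel n m e K).mkQ (Finsupp.single Γ 1)} ≤
      LinearMap.eqLocus (partPiece n m e K p) LinearMap.id := by
    rw [Submodule.span_le]
    rintro _ ⟨Γ, hΓ, rfl⟩
    change (Rel n m e K).mkQ (partFree n m e K p (Finsupp.single Γ 1)) = _
    rw [partFree_single, if_pos hΓ]
    rfl
  exact h (hx m e)

theorem loopPart_eq_zero (hP : ¬ P p) (hx : x ∈ loopSpan n K P) : loopPart n K p x = 0 := by
  funext m e
  have h : span K {y | ∃ Γ : Gph n m e, P (loops Γ.1) ∧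
      y = (Rel n m e K).mkQ (Finsupp.single Γ 1)} ≤ LinearMap.ker (partPiece n m e K p) := by
    rw [Submodule.span_le]
    rintro _ ⟨Γ, hΓ, rfl⟩
    change (Rel n m e K).mkQ (partFree n m e K p (Finsupp.single Γ 1)) = 0
    rw [partFree_single, if_neg (by rintro rfl; exact hP hΓ), map_zero]
  exact h (hx m e)

theorem sub_loopPart_mem_Fil (x : ICG n K) :
    x - (loopPart n K 0 x + loopPart n K 1 x) ∈ Fil n K 2 := by
  intro m e
  obtain ⟨y, hy⟩ := mkQ_surjective _ (x m e)
  change x m e - (partPiece n m e K 0 (x m e) + partPiece n m e K 1 (x m e)) ∈ _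
  rw [← hy]
  change (Rel n m e K).mkQ (y - (partFree n m e K 0 y + partFree n m e K 1 y)) ∈ _
  clear hy
  induction y using Finsupp.induction_linear with
  | zero => simp
  | add f g hf hg =>
    convert add_mem hf hg using 1
    simp only [map_add, map_sub]
    abel
  | single Γ c =>
    rw [← mul_one c, ← smul_eq_mul, ← Finsupp.smul_single]
    simp only [map_smul, ← smul_add, ← smul_sub, partFree_single]
    refine smul_mem _ _ ?_
    split_ifs with h1 h2 h2
    · omega
    · simp
    · simp
    · exact subset_span ⟨Γ, by omega, by simp⟩

/-- A series whose differential has no graphs with fewer than two loops: its tree part `x₀` and its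
one-loop part `x₁` satisfy `d₁ x₀ + d₀ x₁ = 0`. -/
theorem dLoop_loopPart (hx : x ∈ Zr n K 2) :
    dLoop n K 1 (loopPart n K 0 x) + dLoop n K 0 (loopPart n K 1 x) = 0 := by
  set x₀ := loopPart n K 0 x with h₀
  set x₁ := loopPart n K 1 x with h₁
  have g₀ : x₀ ∈ Gr n K 0 := loopPart_mem_Gr K 0 x
  have g₁ : x₁ ∈ Gr n K 1 := loopPart_mem_Gr K 1 x
  have hz : dLoop n K 0 x₀ = 0 := (loopPart_mem_Z₁ K one_le_two hx).2
  have m1 : dLoop n K 1 x₀ + dLoop n K 0 x₁ ∈ Gr n K 1 :=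
    add_mem (dRestr_mem_loopSpan g₀ (by intros; omega))
      (dRestr_mem_loopSpan g₁ (by intros; omega))
  have m2 : dLoop n K 1 x₀ + dLoop n K 0 x₁ ∈ Fil n K 2 := by
    have e1 : d n K x ∈ Fil n K 2 := hx.2
    have e2 := d_sub_mem_Fil x₀
    have e3 := d_sub_mem_Fil x₁
    have e4 : d n K (x - (x₀ + x₁)) ∈ Fil n K 2 :=
      dRestr_mem_loopSpan (sub_loopPart_mem_Fil x) (by intros; omega)
    have e5 : dLoop n K 1 x₁ ∈ Fil n K 2 :=
      dRestr_mem_loopSpan g₁ (by intros; omega)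
    rw [hz] at e2
    convert sub_mem (sub_mem (sub_mem (sub_mem e1 e4) e2) e3) e5 using 1
    rw [map_sub, map_add]
    abel
  rw [← loopPart_eq_self m1]
  exact loopPart_eq_zero (by simp) m2

end Filtration

section Div

variable {z : ICG n K}

theorem dLoop_mem_Z₁ (hz : z ∈ Z₁ n K 0 0) : dLoop n K 1 z ∈ Z₁ n K 1 0 :=
  mem_Z₁_of_mem (dRestr_mem_loopSpan hz.1.1 (by intros; omega)) (by
    simpa using dRestr_mem_degPart (R := fun a b => b = a + 1) hz.1.2)

variable (n K) in
/-- `(a_1, …, a_n) ↦ ∑ k, x_k (∂_k a_k)`, the divergence before the projection to cyclic words. -/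
def divPlus : (Fin n → Ass n K) →ₗ[K] assPlus n K := ∑ k : Fin n, xpd K k ∘ₗ LinearMap.proj k

theorem coe_divPlus (a : Fin n → Ass n K) :
    (divPlus n K a : Ass n K) = ∑ k, Ass.mul (Ass.X k) (Ass.pd k (a k)) := by
  simp [divPlus, xpd]

theorem tr_divPlus (a : Fin n → Ass n K) : tr n K (divPlus n K a) = div n K a := by
  simp [divPlus, div]

theorem divPlus_apply (a : Fin n → Ass n K) (j : Fin n) (w : List (Fin n)) :
    (divPlus n K a : Ass n K) (j :: w) = a j (w ++ [j]) := by
  rw [coe_divPlus, Finset.sum_apply]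
  simp [X_mul_cons, Ass.pd]

variable [CharZero K]

/-- The component of the differential which creates a loop is the divergence. -/
theorem loopSeries_dLoop (hz : z ∈ Z₁ n K 0 0) :
    loopSeries n K (dLoop n K 1 z) = cyc (divPlus n K (psi n K z) : Ass n K) := by
  funext w
  rcases hw : w.length with _ | m
  · obtain rfl := List.length_eq_zero_iff.1 hw
    exact loopPiece_nil (dLoop n K 1 z 0 0)
  rw [loopSeries_apply (e := 2 * m + 1 + 1) _ hw (by ring)]
  have h1 : cyc (divPlus n K (psi n K z) : Ass n K) w =
      cyc (divPlus n K (treePiece n m (2 * m + 1) K (z m (2 * m + 1))) : Ass n K) w := by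
    change ∑ r ∈ range w.length, _ = ∑ r ∈ range w.length, _
    refine sum_congr rfl fun r _ => ?_
    have hl : (w.rotate r).length = m + 1 := by rw [List.length_rotate, hw]
    generalize w.rotate r = v at hl
    rcases v with _ | ⟨j, u⟩
    · simp at hl
    · rw [divPlus_apply, divPlus_apply, psi_apply (m := m) z j (by simpa using hl) rfl]
  rw [h1]
  refine congrFun ?_ w
  change loopPiece n (m + 1) (2 * m + 1 + 1) K (dPiece n m (2 * m + 1) K _ (z m (2 * m + 1))) = _
  have h2 := hz.1.1 m (2 * m + 1)
  generalize z m (2 * m + 1) = y at h2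
  induction h2 using span_induction with
  | zero => simp
  | add a b _ _ ha hb => simp only [map_add, ha, hb, Submodule.coe_add]
  | smul c a _ ha => simp only [map_smul, ha, Submodule.coe_smul]
  | mem a ha =>
    obtain ⟨Γ, h0, rfl⟩ := ha
    change loopPiece n (m + 1) _ K ((Rel n (m + 1) _ K).mkQ
      (dFree n m _ K _ (Finsupp.single Γ 1))) = _
    rw [dFree_single, loopPiece_splitSum Γ h0 rfl, ← cl_of, treePiece_cl, if_pos ⟨h0, rfl⟩,
      coe_divPlus]

theorem loopMap_dLoop (z : Z₁ n K 0 0) :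
    loopMap n K (cls₁ n K 1 0 ⟨_, dLoop_mem_Z₁ z.2⟩) = div n K (Psi n K (cls₁ n K 0 0 z)) := by
  rw [loopMap_cls₁, coe_Psi, ← tr_divPlus, loopSeries_dLoop z.2, tr_avg_cyc]

/-- A class of trees survives to the second page exactly when its divergence vanishes: in degree zero
the only obstruction is `d₁ z`, modulo the coboundaries `d₀ y` of graphs with one loop. -/
theorem cls₁_mem_krvGraph_iff (z : Z₁ n K 0 0) : cls₁ n K 0 0 z ∈ krvGraph n K 1 ↔
    div n K (Psi n K (cls₁ n K 0 0 z)) = 0 := by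
  constructor
  · rintro ⟨y, hy⟩
    obtain ⟨x, rfl⟩ := mkQ_surjective _ y
    have h1 : cls₁ n K 0 0 ⟨loopPart n K 0 x, loopPart_mem_Z₁ K one_le_two x.2⟩ =
      cls₁ n K 0 0 z := hy
    rw [← h1, ← loopMap_dLoop]
    -- `d₁ x₀ = - d₀ x₁` is a coboundary
    refine (congrArg (loopMap n K) ?_).trans (map_zero _)
    refine (Submodule.Quotient.mk_eq_zero _).2
      ⟨-loopPart n K 1 x, ⟨neg_mem (loopPart_mem_Gr K 1 _), neg_mem ?_⟩, ?_⟩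
    · exact loopPart_mem_degPart K 1 (by simpa using x.2.1)
    · rw [map_neg]
      exact (eq_neg_of_add_eq_zero_left (dLoop_loopPart x.2)).symm
  · intro h
    rw [← loopMap_dLoop] at h
    have h1 := loopMap_injective (h.trans (map_zero _).symm)
    obtain ⟨y, ⟨hy1, hy2⟩, hy3⟩ := (Submodule.Quotient.mk_eq_zero _).1 h1
    change dLoop n K 0 y = dLoop n K 1 z at hy3
    have hz : dLoop n K 0 z = 0 := z.2.2
    -- if `d₁ z = d₀ y`, then `d (z - y)` has no part with at most one loop
    have hx : (z : ICG n K) - y ∈ Zr n K 2 := by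
      refine ⟨sub_mem (by simpa using z.2.1.2) (by simpa using hy2), ?_⟩
      change d n K (z - y) ∈ Fil n K 2
      have e1 := d_sub_mem_Fil (z : ICG n K)
      have e2 := d_sub_mem_Fil y
      have e3 : dLoop n K 1 y ∈ Fil n K 2 := dRestr_mem_loopSpan hy1 (by intros; omega)
      rw [hz] at e1
      rw [hy3] at e2
      convert sub_mem (sub_mem e1 e2) e3 using 1
      rw [map_sub]
      abel
    refine ⟨Submodule.Quotient.mk ⟨_, hx⟩, ?_⟩
    change cls₁ n K 0 0 ⟨loopPart n K 0 ((z : ICG n K) - y), _⟩ = _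
    congr 1
    ext1
    change loopPart n K 0 ((z : ICG n K) - y) = z
    rw [map_sub, loopPart_eq_self z.2.1.1, loopPart_eq_zero (by simp) hy1, sub_zero]

theorem map_krvGraph : (krvGraph n K 1).map (Psi n K : E₁ n K 0 0 →ₗ[K] sder n K) = krv n K := by
  ext u
  obtain ⟨y, rfl⟩ := (Psi n K).surjective u
  obtain ⟨z, rfl⟩ := mkQ_surjective _ y
  refine Iff.trans ?_ (cls₁_mem_krvGraph_iff z)
  constructor
  · rintro ⟨y, hy, h⟩
    rwa [← (Psi n K).injective h]
  · exact fun h => ⟨_, h, rfl⟩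

end Div

end

end KV

theorem mainTheorem5 (K : Type*) [Field K] [CharZero K] (n : ℕ) (hn : 1 ≤ n) :
    ∃ Ψ : KV.E₁ n K 0 0 ≃ₗ[K] KV.sder n K,
      (∀ (c : KV.FormalSum n K), KV.IsTreeSeries c →
        ∃ h : KV.toICG n K c ∈ KV.Z₁ n K 0 0,
          (Ψ (KV.cls₁ n K 0 0 ⟨KV.toICG n K c, h⟩) : Fin n → KV.Ass n K) = KV.treeTuple c) ∧
      (∀ c c' : KV.FormalSum n K, KV.IsTreeSeries c → KV.IsTreeSeries c' →
        ∀ (h : KV.toICG n K c ∈ KV.Z₁ n K 0 0) (h' : KV.toICG n K c' ∈ KV.Z₁ n K 0 0),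
        ∃ h'' : KV.toICG n K (KV.ihara K c c') ∈ KV.Z₁ n K 0 0,
          (Ψ (KV.cls₁ n K 0 0 ⟨_, h''⟩) : Fin n → KV.Ass n K) =
            KV.Ass.tderBracket (Ψ (KV.cls₁ n K 0 0 ⟨_, h⟩)) (Ψ (KV.cls₁ n K 0 0 ⟨_, h'⟩))) ∧
      (∃ j : KV.E₁ n K 1 0 →ₗ[K] KV.Tr n K, Function.Injective j ∧
        KV.IsCyclicWordMap K j ∧
        ∀ z : KV.Z₁ n K 0 0, ∃ h : KV.dLoop n K 1 z ∈ KV.Z₁ n K 1 0,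
          j (KV.cls₁ n K 1 0 ⟨_, h⟩) = KV.div n K (Ψ (KV.cls₁ n K 0 0 z))) ∧
      (KV.krvGraph n K 1).map (Ψ : KV.E₁ n K 0 0 →ₗ[K] KV.sder n K) = KV.krv n K := by
  refine ⟨KV.Psi n K, fun c hc => ⟨KV.toICG_mem_Z₁ hc, KV.psi_toICG hc⟩, fun c c' hc hc' h h' =>
    ⟨KV.toICG_mem_Z₁ (KV.isTreeSeries_ihara hc hc'), ?_⟩,
    ⟨KV.loopMap n K, KV.loopMap_injective, KV.isCyclicWordMap_loopMap,
      fun z => ⟨KV.dLoop_mem_Z₁ z.2, KV.loopMap_dLoop z⟩⟩, KV.map_krvGraph⟩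
  rw [KV.coe_Psi, KV.coe_Psi, KV.coe_Psi]
  exact KV.psi_ihara hc hc'
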